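/- **Setting.** All Hilbert spaces are complex, $[X]$ denotes the closed linear span (in norm) of a set $X$, and products of sets of operators are taken elementwise. A *$C^*$-base* $\mathfrak b=(\mathfrak K,\mathfrak B,\mathfrak B^\dagger)$ is a Hilbert space $\mathfrak K$ with two nondegenerate, commuting $C^*$-algebras $\mathfrak B,\mathfrak B^\dagger\subseteq\mathcal L(\mathfrak K)$; put $\mathfrak b^\dagger=(\mathfrak K,\mathfrak B^\dagger,\mathfrak B)$. A *$C^*$-$\mathfrak b$-module* $H_\alpha$ is a Hilbert space $H$ with a closed subspace $\alpha\subseteq\mathcal L(\mathfrak K,H)$ such that $[\alpha\mathfrak K]=H$, $[\alpha\mathfrak B]=\alpha$, $[\alpha^*\alpha]=\mathfrak B$; it carries the representation $\rho_\alpha:\mathfrak B^\dagger\to\mathcal L(H)$, $\rho_\alpha(x)\xi\zeta=\xi x\zeta$ ($\xi\in\alpha$, $\zeta\in\mathfrak K$). For a $C^*$-$\mathfrak b$-module $H_\alpha$ and a $C^*$-$\mathfrak b^\dagger$-module $L_\gamma$, the *relative tensor product* $H_\alpha\otimes{}_\gamma L$ is the Hilbert space densely spanned by elements $\xi\otimes\zeta\otimes\eta$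 ($\xi\in\alpha,\zeta\in\mathfrak K,\eta\in\gamma$) with $\langle\xi\otimes\zeta\otimes\eta,\xi'\otimes\zeta'\otimes\eta'\rangle=\langle\zeta,\xi^*\xi'\eta^*\eta'\zeta'\rangle$. Let $|\xi\rangle_1:L\to H_\alpha\otimes{}_\gamma L$, $\eta\zeta\mapsto\xi\otimes\zeta\otimes\eta$, and $|\eta\rangle_2:H\to H_\alpha\otimes{}_\gamma L$, $\xi\zeta\mapsto\xi\otimes\zeta\otimes\eta$, with adjoints $\langle\xi|_1,\langle\eta|_2$, and let $|\alpha\rangle_1=\{|\xi\rangle_1:\xi\in\alpha\}$, $|\gamma\rangle_2=\{|\eta\rangle_2:\eta\in\gamma\}$, and so on. For an operator $S$ on $H$ such that $S$ and $S^*$ commute with $\rho_\alpha(\mathfrak B^\dagger)$, $S\otimes\mathrm{Id}$ is defined by $(S\otimes \mathrm{Id})|\eta\rangle_2=|\eta\rangle_2S$; $\mathrm{Id}\otimes S$ is defined similarly through $|\xi\rangle_1$. For further module structures $\alpha_1\subseteq\mathcal L(\mathfrak K,H)$ with $[\rho_\alpha(\mathfrak B^\dagger)\alpha_1]=\alpha_1$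 and $\gamma_1\subseteq\mathcal L(\mathfrak K,L)$ with $[\rho_\gamma(\mathfrak B)\gamma_1]=\gamma_1$, put $\alpha_1\triangleleft\gamma=[|\gamma\rangle_2\alpha_1]$ and $\alpha\triangleright\gamma_1=[|\alpha\rangle_1\gamma_1]$; these are module structures on $H_\alpha\otimes{}_\gamma L$. Let $(H,\widehat\beta,\alpha,\beta)$ be a $C^*$-$(\mathfrak b^\dagger,\mathfrak b,\mathfrak b^\dagger)$-module: $H_{\widehat\beta}$ and $H_\beta$ are $C^*$-$\mathfrak b^\dagger$-modules, $H_\alpha$ is a $C^*$-$\mathfrak b$-module, and for any two distinct ones $\gamma,\delta$ of these three structures, $\delta$ is the closed linear span of the products of operators in the image of $\rho_\gamma$ with elements of $\delta$. Let $V: H_{\widehat\beta}\otimes{}_\alpha H\to H_\alpha\otimes{}_\beta H$ be a *$C^*$-pseudo-multiplicative unitary*, that is, a unitary such that $$V(\alpha\triangleleft\alpha)=\alpha\triangleright\alpha,\quad V(\widehat\beta\triangleright\beta)=\widehat\beta\triangleleft\beta,\quad V(\widehat\beta\triangleright\widehat\beta)=\alpha\triangleright\widehat\beta,\quad V(\beta\triangleleft\alpha)=\beta\triangleleft\beta$$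 and such that the pentagon equation $V_{23}V_{12}=V_{12}V_{13}V_{23}$ holds on $H_{\widehat\beta}\otimes{}_\alpha H_{\widehat\beta}\otimes{}_\alpha H$, where $V_{12},V_{23}$ denote $V$ applied to two adjacent factors, $V_{13}=\Sigma_{23}V_{12}\Sigma_{23}$, $\Sigma_{23}$ exchanges the last two factors, and the canonical associativity isomorphisms are suppressed. For module structures $\gamma,\delta$ on a Hilbert space $X$ over $\mathfrak b$ or $\mathfrak b^\dagger$, let $\gamma^\infty$ be the space of sequences $\eta=(\eta_k)_{k\in\mathbb N}$ in $\gamma$ for which $\sum_k\eta_k^*\eta_k$ converges in norm, with $\|\eta\|=\|\sum_k\eta_k^*\eta_k\|^{1/2}$. For a $C^*$-algebra $A\subseteq\mathcal L(X)$, $\eta\in\gamma^\infty$, $\eta'\in\delta^\infty$, let $\omega_{\eta,\eta'}:A\to\mathcal L(\mathfrak K)$, $T\mapsto\sum_k\eta_k^*T\eta_k'$, and let $\Omega_{\gamma,\delta}(A)=\{\omega_{\eta,\eta'}:\eta\in\gamma^\infty,\ \eta'\in\delta^\infty\}$, normed by $\|\omega\|=\inf\{\|\eta\|\|\eta'\|:\omega=\omega_{\eta,\eta'}\}$.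 Put $$\tilde\Omega_{\beta,\alpha}=\Omega_{\beta,\alpha}(\rho_{\widehat\beta}(\mathfrak B)'),\qquad \tilde\Omega_{\alpha,\widehat\beta}=\Omega_{\alpha,\widehat\beta}(\rho_\beta(\mathfrak B)'),$$ $$\Delta_V(z)=V(z\otimes\mathrm{Id})V^*\ \ (z\in\rho_{\widehat\beta}(\mathfrak B)'),\qquad \widehat\Delta_V(y)=V^*(\mathrm{Id}\otimes y)V\ \ (y\in\rho_\beta(\mathfrak B)'),$$ $$\widehat A_V=[\langle\beta|_2V|\alpha\rangle_2]\subseteq\mathcal L(H),\qquad A_V=[\langle\alpha|_1V|\widehat\beta\rangle_1]\subseteq\mathcal L(H).$$ Write $\widehat\otimes$ for the completed projective tensor product. **Theorem.** 1. There exist linear contractions, both written $\omega\otimes\omega'\mapsto\omega\boxtimes\omega'$, $$\tilde\Omega_{\beta,\alpha}\widehat\otimes\tilde\Omega_{\beta,\alpha}\to\Omega_{(\beta\triangleleft\beta),(\alpha\triangleright\alpha)}\big((\rho_{\widehat\beta}(\mathfrak B)\otimes\rho_{\widehat\beta}(\mathfrak B))'\big),\qquad \tilde\Omega_{\alpha,\widehat\beta}\widehat\otimes\tilde\Omega_{\alpha,\widehat\beta}\to\Omega_{(\alpha\triangleleft\alpha),(\widehat\beta\triangleright\widehat\beta)}\big((\rho_\beta(\mathfrak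 B)\otimes\rho_\beta(\mathfrak B))'\big),$$ the commutants being taken on $H_\alpha\otimes{}_\beta H$ and on $H_{\widehat\beta}\otimes{}_\alpha H$, respectively, such that for all $\xi,\xi'\in\beta^\infty$, $\eta,\eta'\in\alpha^\infty$, $\zeta,\zeta'\in\widehat\beta^\infty$ and each bijection $i:\mathbb N\times\mathbb N\to\mathbb N$ we have $\omega_{\xi,\eta}\boxtimes\omega_{\xi',\eta'}=\omega_{\theta,\theta'}$ and $\omega_{\eta,\zeta}\boxtimes\omega_{\eta',\zeta'}=\omega_{\kappa,\kappa'}$, where the sequences $\theta\in(\beta\triangleleft\beta)^\infty$, $\theta'\in(\alpha\triangleright\alpha)^\infty$, $\kappa\in(\alpha\triangleleft\alpha)^\infty$, $\kappa'\in(\widehat\beta\triangleright\widehat\beta)^\infty$ are given by $$\theta_{i(m,n)}=|\xi'_n\rangle_2\xi_m,\quad\theta'_{i(m,n)}=|\eta_m\rangle_1\eta'_n,\quad\kappa_{i(m,n)}=|\eta'_n\rangle_2\eta_m,\quad\kappa'_{i(m,n)}=|\zeta_m\rangle_1\zeta'_n.$$ 2. $\Delta_V$ and $\widehat\Delta_V$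 take values in $(\rho_{\widehat\beta}(\mathfrak B)\otimes\rho_{\widehat\beta}(\mathfrak B))'$ and $(\rho_\beta(\mathfrak B)\otimes\rho_\beta(\mathfrak B))'$, respectively, and $\tilde\Omega_{\beta,\alpha}$ and $\tilde\Omega_{\alpha,\widehat\beta}$ are Banach algebras (complete, with an associative bilinear multiplication satisfying $\|\omega*\omega'\|\le\|\omega\|\|\omega'\|$) with respect to the multiplications $\omega*\omega'=(\omega\boxtimes\omega')\circ\Delta_V$ and $\omega*\omega'=(\omega\boxtimes\omega')\circ\widehat\Delta_V$, respectively. 3. There exist contractive algebra homomorphisms $\widehat\pi_V:\tilde\Omega_{\beta,\alpha}\to\widehat A_V$ and $\pi_V:\tilde\Omega_{\alpha,\widehat\beta}\to A_V$ such that for all $\xi\in\beta^\infty$, $\eta\in\alpha^\infty$, $\zeta\in\widehat\beta^\infty$, $$\widehat\pi_V(\omega_{\xi,\eta})=\sum_n\langle\xi_n|_2V|\eta_n\rangle_2,\qquad\pi_V(\omega_{\eta,\zeta})=\sum_n\langle\eta_n|_1V|\zeta_n\rangle_1,$$ with convergence in norm. Their images, the Fourier algebra $\widehat A^0_V=\widehat\pi_V(\tilde\Omega_{\beta,\alpha})$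 and the dual Fourier algebra $A^0_V=\pi_V(\tilde\Omega_{\alpha,\widehat\beta})$, are subalgebras of $\mathcal L(H)$ that are norm dense in $\widehat A_V$ and $A_V$, respectively. -/

import Mathlib

open scoped InnerProduct InnerProductSpace
set_option linter.unusedSectionVars false

noncomputable section
namespace CPMU
universe u v w

section Frames
variable {X : Type*} {Y : Type*} {Z : Type*} {ι : Type*}
  [NormedAddCommGroup X] [InnerProductSpace ℂ X] [CompleteSpace X]
  [NormedAddCommGroup Y] [InnerProductSpace ℂ Y] [CompleteSpace Y]
  [NormedAddCommGroup Z] [InnerProductSpace ℂ Z] [CompleteSpace Z]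

/-- The closed linear span `[S]`. -/
def cspan {E : Type*} [NormedAddCommGroup E] [NormedSpace ℂ E] (S : Set E) : Submodule ℂ E :=
  (Submodule.span ℂ S).topologicalClosure

/-- The family of operators `k` has jointly dense range, `[⋃ᵢ k i X] = Y`. -/
def Total (k : ι → X →L[ℂ] Y) : Prop := cspan {y : Y | ∃ i x, k i x = y} = ⊤

/-- `(xᵢ)ᵢ ↦ ∑ᵢ k i xᵢ`. -/
def sumMap (k : ι → X →L[ℂ] Y) : (ι →₀ X) →ₗ[ℂ] Y :=
  Finsupp.lsum ℂ fun i => (k i : X →ₗ[ℂ] Y)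

/-- The bounded operator `T` with `T ∘ k i = l i` for all `i`; it is unique if `k` is total, and
it exists under the hypotheses of `frameMap_comp`. -/
def frameMap (k : ι → X →L[ℂ] Y) (l : ι → X →L[ℂ] Z) : Y →L[ℂ] Z :=
  (sumMap l).extendOfNorm (sumMap k)

theorem sumMap_single (k : ι → X →L[ℂ] Y) (i : ι) (x : X) :
    sumMap k (Finsupp.single i x) = k i x := by
  simp [sumMap]

theorem sumMap_apply (k : ι → X →L[ℂ] Y) (f : ι →₀ X) :
    sumMap k f = f.sum fun i x => k i x := by
  simp [sumMap, Finsupp.lsum_apply]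

theorem denseRange_sumMap {k : ι → X →L[ℂ] Y} (hk : Total k) : DenseRange (sumMap k) := by
  have h1 : Submodule.span ℂ {y : Y | ∃ i x, k i x = y} ≤ LinearMap.range (sumMap k) := by
    rw [Submodule.span_le]
    rintro y ⟨i, x, rfl⟩
    exact ⟨_, sumMap_single k i x⟩
  have h2 : Dense ((Submodule.span ℂ {y : Y | ∃ i x, k i x = y} : Submodule ℂ Y) : Set Y) := by
    rw [Submodule.dense_iff_topologicalClosure_eq_top]
    exact hk
  exact h2.mono h1

theorem inner_sumMap (k : ι → X →L[ℂ] Y) (f : ι →₀ X) :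
    ⟪sumMap k f, sumMap k f⟫_ℂ
      = ∑ i ∈ f.support, ∑ j ∈ f.support, ⟪f i, ((k i)† ∘L k j) (f j)⟫_ℂ := by
  simp only [sumMap_apply, Finsupp.sum, sum_inner, inner_sum,
    ContinuousLinearMap.comp_apply, ContinuousLinearMap.adjoint_inner_right]
  exact Finset.sum_comm

theorem norm_sumMap_le {k : ι → X →L[ℂ] Y} {l : ι → X →L[ℂ] Z} {P : X →L[ℂ] X} (hP : 0 ≤ P)
    (hc : ∀ i j, Commute P ((k i)† ∘L k j))
    (hl : ∀ i j, (l i)† ∘L l j = (k i)† ∘L k j ∘L P) (f : ι →₀ X) :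
    ‖sumMap l f‖ ≤ √‖P‖ * ‖sumMap k f‖ := by
  set Q : X →L[ℂ] X := algebraMap ℝ (X →L[ℂ] X) ‖P‖ - P with hQ
  have hQ0 : 0 ≤ Q := sub_nonneg.2 (IsSelfAdjoint.of_nonneg hP).le_algebraMap_norm_self
  set c := CFC.sqrt Q with hcdef
  have hcc : c * c = Q := CFC.sqrt_mul_sqrt_self Q hQ0
  have hcs : star c = c := (IsSelfAdjoint.of_nonneg (CFC.sqrt_nonneg Q)).star_eq
  have hcomm : ∀ i j, Commute c ((k i)† ∘L k j) := by
    intro i j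
    have : Commute Q ((k i)† ∘L k j) := by
      rw [hQ]
      exact Commute.sub_left (Algebra.commutes _ _) (hc i j)
    exact this.cfcₙ_nnreal _
  have key : ⟪sumMap l f, sumMap l f⟫_ℂ + ⟪sumMap (fun i => k i ∘L c) f, sumMap (fun i => k i ∘L c) f⟫_ℂ
      = (‖P‖ : ℂ) * ⟪sumMap k f, sumMap k f⟫_ℂ := by
    simp only [inner_sumMap]
    rw [← Finset.sum_add_distrib, Finset.mul_sum]
    refine Finset.sum_congr rfl fun i _ => ?_
    rw [← Finset.sum_add_distrib, Finset.mul_sum]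
    refine Finset.sum_congr rfl fun j _ => ?_
    have e : (k i ∘L c)† ∘L (k j ∘L c) = ((k i)† ∘L k j) ∘L Q := by
      rw [ContinuousLinearMap.adjoint_comp, ← ContinuousLinearMap.star_eq_adjoint c, hcs]
      calc _ = c * ((k i)† ∘L k j) * c := rfl
        _ = ((k i)† ∘L k j) * (c * c) := by rw [(hcomm i j).eq, mul_assoc]
        _ = _ := by rw [hcc]; rfl
    rw [hl, e, ← inner_add_right, ← inner_smul_right]
    congr 1
    simp [hQ, Algebra.algebraMap_eq_smul_one]
  simp only [inner_self_eq_norm_sq_to_K] at key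
  have key' : ‖sumMap l f‖ ^ 2 + ‖sumMap (fun i => k i ∘L c) f‖ ^ 2
      = ‖P‖ * ‖sumMap k f‖ ^ 2 := by
    apply Complex.ofReal_injective
    push_cast
    exact key
  refine abs_le_of_sq_le_sq' ?_ (by positivity) |>.2
  rw [mul_pow, Real.sq_sqrt (norm_nonneg _)]
  nlinarith [sq_nonneg ‖sumMap (fun i => k i ∘L c) f‖]

theorem frameMap_comp {k : ι → X →L[ℂ] Y} {l : ι → X →L[ℂ] Z} (hk : Total k)
    (P : X →L[ℂ] X) (hP : 0 ≤ P) (hc : ∀ i j, Commute P ((k i)† ∘L k j))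
    (hl : ∀ i j, (l i)† ∘L l j = (k i)† ∘L k j ∘L P) (i : ι) :
    frameMap k l ∘L k i = l i := by
  ext x
  have := (sumMap l).extendOfNorm_eq (denseRange_sumMap hk)
    ⟨_, norm_sumMap_le hP hc hl⟩ (Finsupp.single i x)
  rw [sumMap_single, sumMap_single] at this
  exact this

theorem norm_frameMap_le {k : ι → X →L[ℂ] Y} {l : ι → X →L[ℂ] Z} (hk : Total k)
    (P : X →L[ℂ] X) (hP : 0 ≤ P) (hc : ∀ i j, Commute P ((k i)† ∘L k j))
    (hl : ∀ i j, (l i)† ∘L l j = (k i)† ∘L k j ∘L P) : ‖frameMap k l‖ ≤ √‖P‖ :=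
  ContinuousLinearMap.opNorm_le_bound _ (Real.sqrt_nonneg _)
    ((sumMap l).norm_extendOfNorm_apply_le (denseRange_sumMap hk) _ (norm_sumMap_le hP hc hl))

theorem mem_cspan {E : Type*} [NormedAddCommGroup E] [NormedSpace ℂ E] {S : Set E} {x : E}
    (h : x ∈ S) : x ∈ cspan S :=
  Submodule.le_topologicalClosure _ (Submodule.subset_span h)

theorem map_mem_of_mem_cspan {E E' : Type*} [NormedAddCommGroup E] [NormedSpace ℂ E]
    [NormedAddCommGroup E'] [NormedSpace ℂ E'] {S : Set E} (T : E →L[ℂ] E') {M : Submodule ℂ E'}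
    (hM : IsClosed (M : Set E')) (h : ∀ s ∈ S, T s ∈ M) {x : E} (hx : x ∈ cspan S) : T x ∈ M := by
  have h1 : Submodule.span ℂ S ≤ M.comap (T : E →ₗ[ℂ] E') := Submodule.span_le.2 h
  have h2 : IsClosed ((M.comap (T : E →ₗ[ℂ] E') : Submodule ℂ E) : Set E) :=
    hM.preimage T.continuous
  exact Submodule.topologicalClosure_minimal _ h1 h2 hx

theorem isClosed_cspan {E : Type*} [NormedAddCommGroup E] [NormedSpace ℂ E] (S : Set E) :
    IsClosed (cspan S : Set E) := Submodule.isClosed_topologicalClosure _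

theorem Total.ext {k : ι → X →L[ℂ] Y} (hk : Total k) {T T' : Y →L[ℂ] Z}
    (h : ∀ i, T ∘L k i = T' ∘L k i) : T = T' := by
  ext y
  have hy : y ∈ cspan {y : Y | ∃ i x, k i x = y} := by rw [hk]; trivial
  have := map_mem_of_mem_cspan (T - T') (M := ⊥) isClosed_singleton (by
    rintro _ ⟨i, x, rfl⟩
    simpa [sub_eq_zero] using DFunLike.congr_fun (h i) x) hy
  simpa [sub_eq_zero] using this

theorem Total.ext_adjoint {k : ι → X →L[ℂ] Y} (hk : Total k) {T T' : Y →L[ℂ] Y}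
    (h : ∀ i j, (k i)† ∘L T ∘L k j = (k i)† ∘L T' ∘L k j) : T = T' := by
  refine hk.ext fun j => ?_
  apply ContinuousLinearMap.adjoint.injective
  refine hk.ext fun i => ?_
  apply ContinuousLinearMap.adjoint.injective
  have := h i j
  simpa [ContinuousLinearMap.adjoint_comp] using this
end Frames


section Schur
variable {K : Type u} [NormedAddCommGroup K] [InnerProductSpace ℂ K] [CompleteSpace K]

theorem proj_comp_adjoint {s : Type*} [Fintype s] [DecidableEq s] (x y : s) :
    PiLp.proj (𝕜 := ℂ) 2 (fun _ : s => K) x ∘L (PiLp.proj (𝕜 := ℂ) 2 (fun _ : s => K) y)†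
      = if x = y then 1 else 0 := by
  have h : ∀ a : K, ((PiLp.proj (𝕜 := ℂ) 2 (fun _ : s => K) y)†) a = WithLp.toLp 2 (Pi.single y a) := by
    intro a
    refine ext_inner_right ℂ fun v => ?_
    rw [ContinuousLinearMap.adjoint_inner_left, PiLp.inner_apply]
    rw [Finset.sum_eq_single y]
    · simp
    · intro z _ hz
      simp [Pi.single_eq_of_ne hz]
    · simp
  ext a
  simp only [ContinuousLinearMap.comp_apply, h]
  by_cases hxy : x = y
  · subst hxy; simp
  · simp [hxy]

theorem exists_sqrt_gram_aux {G H : Type*} [NormedAddCommGroup G] [InnerProductSpace ℂ G]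
    [CompleteSpace G] [NormedAddCommGroup H] [InnerProductSpace ℂ H]
    [CompleteSpace H] {s : Type*} [Fintype s] [DecidableEq s] (ξ : s → K →L[ℂ] H)
    (p : s → G →L[ℂ] K) (hp : ∀ x y, p x ∘L (p y)† = if x = y then 1 else 0)
    (hsum : ∑ x, (p x)† ∘L p x = 1) :
    ∃ S : s → s → K →L[ℂ] K, (∀ x y, (S x y)† = S y x) ∧
      (∀ x y, ∑ z, S x z ∘L S z y = (ξ x)† ∘L ξ y) ∧
      ∀ c : K →L[ℂ] K, (∀ x y, Commute c ((ξ x)† ∘L ξ y)) → ∀ x y, Commute c (S x y) := by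
  let U : G →L[ℂ] H := ∑ x, ξ x ∘L p x
  let X : G →L[ℂ] G := U† ∘L U
  have hX0 : 0 ≤ X := (ContinuousLinearMap.nonneg_iff_isPositive _).2 (ContinuousLinearMap.isPositive_adjoint_comp_self U)
  let S := CFC.sqrt X
  have hSS : S * S = X := CFC.sqrt_mul_sqrt_self X hX0
  have hSs : S† = S := (IsSelfAdjoint.of_nonneg (CFC.sqrt_nonneg X)).star_eq
  have hUp : ∀ x, U ∘L (p x)† = ξ x := by
    intro x
    simp only [U, ContinuousLinearMap.finsetSum_comp, ContinuousLinearMap.comp_assoc, hp]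
    rw [Finset.sum_eq_single x] <;> simp +contextual
    rfl
  refine ⟨fun x y => p x ∘L S ∘L (p y)†, ?_, ?_, ?_⟩
  · intro x y
    simp [ContinuousLinearMap.adjoint_comp, hSs, ContinuousLinearMap.comp_assoc]
  · intro x y
    have e : ∀ z, (p x ∘L S ∘L (p z)†) ∘L (p z ∘L S ∘L (p y)†)
        = (p x ∘L S) ∘L ((p z)† ∘L p z) ∘L (S ∘L (p y)†) := fun z => rfl
    simp only [e]
    rw [← ContinuousLinearMap.comp_finsetSum, ← ContinuousLinearMap.finsetSum_comp, hsum]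
    calc _ = p x ∘L (S * S) ∘L (p y)† := rfl
      _ = (U ∘L (p x)†)† ∘L (U ∘L (p y)†) := by
        rw [hSS, ContinuousLinearMap.adjoint_comp, ContinuousLinearMap.adjoint_adjoint]; rfl
      _ = _ := by rw [hUp, hUp]
  · intro c hc x y
    let D : G →L[ℂ] G := ∑ z, (p z)† ∘L c ∘L p z
    have hpD : ∀ x, p x ∘L D = c ∘L p x := by
      intro x
      simp only [D, ContinuousLinearMap.comp_finsetSum, ← ContinuousLinearMap.comp_assoc, hp]
      rw [Finset.sum_eq_single x]
      · simp; rfl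
      · intro z _ hz; simp [hz.symm]
      · simp
    have hDp : ∀ x, D ∘L (p x)† = (p x)† ∘L c := by
      intro x
      simp only [D, ContinuousLinearMap.finsetSum_comp, ContinuousLinearMap.comp_assoc, hp]
      rw [Finset.sum_eq_single x]
      · simp; rfl
      · intro z _ hz; simp [hz]
      · simp
    have hext : ∀ A A' : G →L[ℂ] G,
        (∀ x y, p x ∘L A ∘L (p y)† = p x ∘L A' ∘L (p y)†) → A = A' := by
      intro A A' h
      have e : ∀ A : G →L[ℂ] G,
          A = ∑ x, ∑ y, (p x)† ∘L (p x ∘L A ∘L (p y)†) ∘L p y := by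
        intro A
        have h1 : A = (∑ x, (p x)† ∘L p x) ∘L A ∘L (∑ y, (p y)† ∘L p y) := by rw [hsum]; rfl
        conv_lhs => rw [h1]
        simp only [ContinuousLinearMap.finsetSum_comp, ContinuousLinearMap.comp_finsetSum,
          ContinuousLinearMap.comp_assoc]
        exact Finset.sum_comm
      rw [e A, e A']
      simp only [h]
    have hX : ∀ x y, p x ∘L X ∘L (p y)† = (ξ x)† ∘L ξ y := by
      intro x y
      rw [← hUp, ← hUp, ContinuousLinearMap.adjoint_comp, ContinuousLinearMap.adjoint_adjoint]
      rfl
    have hDX : Commute D X := by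
      apply hext
      intro x y
      calc p x ∘L (D * X) ∘L (p y)† = (p x ∘L D) ∘L X ∘L (p y)† := rfl
        _ = c * (p x ∘L X ∘L (p y)†) := by rw [hpD]; rfl
        _ = (p x ∘L X ∘L (p y)†) * c := by rw [hX, (hc x y).eq]
        _ = p x ∘L X ∘L (D ∘L (p y)†) := by rw [hDp]; rfl
        _ = _ := rfl
    have hSD : Commute (CFC.sqrt X) D := by
      unfold CFC.sqrt
      exact hDX.symm.cfcₙ_nnreal NNReal.sqrt
    have hDS : Commute D S := hSD.symm
    calc c * (p x ∘L S ∘L (p y)†) = (c ∘L p x) ∘L S ∘L (p y)† := rfl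
      _ = p x ∘L (D * S) ∘L (p y)† := by rw [← hpD]; rfl
      _ = p x ∘L S ∘L (D ∘L (p y)†) := by rw [hDS.eq]; rfl
      _ = _ := by rw [hDp]; rfl

/-- A Gram matrix of operators has a self-adjoint square root, whose entries commute with every
operator commuting with the entries of the Gram matrix. -/
theorem exists_sqrt_gram {H : Type*} [NormedAddCommGroup H] [InnerProductSpace ℂ H]
    [CompleteSpace H] {s : Type*} [Fintype s] [DecidableEq s] (ξ : s → K →L[ℂ] H) :
    ∃ S : s → s → K →L[ℂ] K, (∀ x y, (S x y)† = S y x) ∧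
      (∀ x y, ∑ z, S x z ∘L S z y = (ξ x)† ∘L ξ y) ∧
      ∀ c : K →L[ℂ] K, (∀ x y, Commute c ((ξ x)† ∘L ξ y)) → ∀ x y, Commute c (S x y) := by
  refine exists_sqrt_gram_aux ξ (fun x => PiLp.proj 2 (fun _ : s => K) x)
    (fun x y => proj_comp_adjoint x y) ?_
  ext1 v
  refine ext_inner_right ℂ fun w => ?_
  simp [sum_inner, ContinuousLinearMap.adjoint_inner_left, PiLp.inner_apply]
end Schur

/-- A `C*`-base `(𝔎, 𝔅, 𝔅†)`: two commuting nondegenerate `C*`-algebras on a Hilbert space. -/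
structure CBase (K : Type u) [NormedAddCommGroup K] [InnerProductSpace ℂ K] [CompleteSpace K] where
  B : NonUnitalStarSubalgebra ℂ (K →L[ℂ] K)
  Bd : NonUnitalStarSubalgebra ℂ (K →L[ℂ] K)
  isClosed_B : IsClosed (B : Set (K →L[ℂ] K))
  isClosed_Bd : IsClosed (Bd : Set (K →L[ℂ] K))
  nondegenerate_B : Total fun b : B => (b : K →L[ℂ] K)
  nondegenerate_Bd : Total fun b : Bd => (b : K →L[ℂ] K)
  commute : ∀ b ∈ B, ∀ c ∈ Bd, Commute b c

section Modules
variable {K : Type u} [NormedAddCommGroup K] [InnerProductSpace ℂ K] [CompleteSpace K]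
variable {H : Type v} [NormedAddCommGroup H] [InnerProductSpace ℂ H] [CompleteSpace H]
variable {L : Type w} [NormedAddCommGroup L] [InnerProductSpace ℂ L] [CompleteSpace L]

/-- The opposite base `𝔟† = (𝔎, 𝔅†, 𝔅)`. -/
@[reducible] def CBase.dagger (b : CBase K) : CBase K where
  B := b.Bd
  Bd := b.B
  isClosed_B := b.isClosed_Bd
  isClosed_Bd := b.isClosed_B
  nondegenerate_B := b.nondegenerate_Bd
  nondegenerate_Bd := b.nondegenerate_B
  commute := fun x hx y hy => (b.commute y hy x hx).symm

/-- The structure of a `C*`-`𝔟`-module on the Hilbert space `H`: a closed subspace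
`α ⊆ ℒ(𝔎, H)` with `[α𝔎] = H`, `[α𝔅] = α` and `[α*α] = 𝔅`. -/
structure CMod (b : CBase K) (H : Type v) [NormedAddCommGroup H] [InnerProductSpace ℂ H]
    [CompleteSpace H] where
  space : Submodule ℂ (K →L[ℂ] H)
  isClosed : IsClosed (space : Set (K →L[ℂ] H))
  total : Total fun ξ : space => (ξ : K →L[ℂ] H)
  mul_base : cspan {η | ∃ ξ ∈ space, ∃ x ∈ b.B, η = ξ ∘L x} = space
  inner_base : cspan {x | ∃ ξ ∈ space, ∃ ξ' ∈ space, x = ξ† ∘L ξ'} = b.B.toSubmodule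

variable {b c : CBase K}

theorem CMod.adjoint_comp_mem (E : CMod b H) (ξ ξ' : E.space) :
    (ξ : K →L[ℂ] H)† ∘L (ξ' : K →L[ℂ] H) ∈ b.B := by
  have h : (ξ : K →L[ℂ] H)† ∘L (ξ' : K →L[ℂ] H) ∈ b.B.toSubmodule := by
    rw [← E.inner_base]
    exact Submodule.le_topologicalClosure _ (Submodule.subset_span ⟨ξ, ξ.2, ξ', ξ'.2, rfl⟩)
  exact h

theorem CMod.comp_mem (E : CMod b H) (ξ : E.space) (x : b.B) :
    (ξ : K →L[ℂ] H) ∘L (x : K →L[ℂ] K) ∈ E.space := by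
  have h : (ξ : K →L[ℂ] H) ∘L (x : K →L[ℂ] K) ∈
      cspan {η | ∃ ξ ∈ E.space, ∃ x ∈ b.B, η = ξ ∘L x} :=
    Submodule.le_topologicalClosure _ (Submodule.subset_span ⟨ξ, ξ.2, x, x.2, rfl⟩)
  rwa [E.mul_base] at h

/-- The representation `ρ_α : 𝔅† → ℒ(H)`, given by `ρ_α(b†) ξ ζ = ξ b† ζ`. -/
def CMod.rho (E : CMod b H) (x : b.Bd) : H →L[ℂ] H :=
  frameMap (fun ξ : E.space => (ξ : K →L[ℂ] H)) fun ξ => (ξ : K →L[ℂ] H) ∘L (x : K →L[ℂ] K)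

theorem star_mul_nonneg (x : K →L[ℂ] H) : 0 ≤ x† ∘L x :=
  (ContinuousLinearMap.nonneg_iff_isPositive _).2 (ContinuousLinearMap.isPositive_adjoint_comp_self x)

theorem CMod.rho_comp (E : CMod b H) (x : b.Bd) (ξ : E.space) :
    E.rho x ∘L (ξ : K →L[ℂ] H) = (ξ : K →L[ℂ] H) ∘L (x : K →L[ℂ] K) := by
  have hs : (x : K →L[ℂ] K)† ∈ b.Bd := star_mem x.2
  refine frameMap_comp (k := fun ξ : E.space => (ξ : K →L[ℂ] H)) E.total
    ((x : K →L[ℂ] K)† ∘L (x : K →L[ℂ] K)) (star_mul_nonneg _) (fun i j => ?_) (fun i j => ?_) ξ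
  · exact (b.commute _ (E.adjoint_comp_mem i j) _ (mul_mem hs x.2)).symm
  · have := (b.commute _ (E.adjoint_comp_mem i j) _ hs).eq
    calc _ = (x : K →L[ℂ] K)† * ((i : K →L[ℂ] H)† ∘L (j : K →L[ℂ] H)) * (x : K →L[ℂ] K) := by
          rw [ContinuousLinearMap.adjoint_comp]; rfl
      _ = _ := by rw [← this]; rfl

/-- The condition `[ρ_E(𝔅†)E₁] = E₁`. -/
def Compat (E : CMod b H) (E₁ : CMod c H) : Prop :=
  cspan {η | ∃ x : b.Bd, ∃ ξ ∈ E₁.space, η = E.rho x ∘L ξ} = E₁.space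

/-- The kernel `((ξ,η),(ξ',η')) ↦ ξ*ξ'η*η'` defining the relative tensor product. -/
def rtpKernel (E : CMod b H) (F : CMod b.dagger L) :
    Matrix (E.space × F.space) (E.space × F.space) (K →L[ℂ] K) :=
  Matrix.of fun x y => ((x.1 : K →L[ℂ] H)† ∘L (y.1 : K →L[ℂ] H)) ∘L
    ((x.2 : K →L[ℂ] L)† ∘L (y.2 : K →L[ℂ] L))

theorem rtpKernel_commute (E : CMod b H) (F : CMod b.dagger L) (ξ ξ' : E.space) (η η' : F.space) :
    Commute ((ξ : K →L[ℂ] H)† ∘L (ξ' : K →L[ℂ] H)) ((η : K →L[ℂ] L)† ∘L (η' : K →L[ℂ] L)) :=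
  b.commute _ (E.adjoint_comp_mem ξ ξ') _ (F.adjoint_comp_mem η η')

theorem rtpKernel_posSemidef (E : CMod b H) (F : CMod b.dagger L) :
    (rtpKernel E F).PosSemidef := by
  classical
  have tfae := (RKHS.posSemidef_tfae (𝕜 := ℂ) (K := rtpKernel E F)).out 0 2
  refine tfae.2 (And.intro ?_ fun vv => ?_)
  · ext1 x y
    have := (rtpKernel_commute E F x.1 y.1 x.2 y.2).eq
    rw [Matrix.conjTranspose_apply, ContinuousLinearMap.star_eq_adjoint]
    simp only [rtpKernel, Matrix.of_apply, ContinuousLinearMap.adjoint_comp,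
      ContinuousLinearMap.adjoint_adjoint]
    exact this.symm
  · obtain ⟨S, hS, hSS, hSc⟩ := exists_sqrt_gram
      (fun x : vv.support => (x.1.1 : K →L[ℂ] H))
    have key : (vv.sum fun x w => vv.sum fun x' w' => ⟪rtpKernel E F x' x w, w'⟫_ℂ)
        = ∑ z : vv.support, ⟪∑ x : vv.support, (x.1.2 : K →L[ℂ] L) (S z x (vv x)),
            ∑ x : vv.support, (x.1.2 : K →L[ℂ] L) (S z x (vv x))⟫_ℂ := by
      have pair : ∀ x x' : vv.support, ⟪rtpKernel E F x' x (vv x), vv x'⟫_ℂ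
          = ∑ z : vv.support, ⟪(x.1.2 : K →L[ℂ] L) (S z x (vv x)),
              (x'.1.2 : K →L[ℂ] L) (S z x' (vv x'))⟫_ℂ := by
        intro x x'
        have e : rtpKernel E F x' x
            = ∑ z, (S x' z ∘L S z x) ∘L
                ((x'.1.2 : K →L[ℂ] L)† ∘L (x.1.2 : K →L[ℂ] L)) := by
          rw [← ContinuousLinearMap.finsetSum_comp, hSS]
          rfl
        rw [e, sum_apply, sum_inner]
        refine Finset.sum_congr rfl fun z _ => ?_
        have hc : Commute ((x'.1.2 : K →L[ℂ] L)† ∘L (x.1.2 : K →L[ℂ] L)) (S z x) :=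
          hSc _ (fun y y' => (rtpKernel_commute E F y.1.1 y'.1.1 x'.1.2 x.1.2).symm) z x
        have e2 : (S x' z ∘L S z x) ∘L ((x'.1.2 : K →L[ℂ] L)† ∘L (x.1.2 : K →L[ℂ] L))
            = (S z x')† ∘L (x'.1.2 : K →L[ℂ] L)† ∘L (x.1.2 : K →L[ℂ] L) ∘L S z x := by
          rw [hS]
          calc _ = S x' z ∘L (S z x * ((x'.1.2 : K →L[ℂ] L)† ∘L (x.1.2 : K →L[ℂ] L))) := rfl
            _ = _ := by rw [← hc.eq]; rfl
        rw [e2]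
        simp only [ContinuousLinearMap.comp_apply, ContinuousLinearMap.adjoint_inner_left]
      simp only [sum_inner, inner_sum, Finsupp.sum]
      simp only [← Finset.sum_coe_sort vv.support, pair]
      refine Finset.sum_comm.trans ?_
      exact (Finset.sum_congr rfl fun _ _ => Finset.sum_comm).trans Finset.sum_comm
    rw [key, map_sum]
    exact Finset.sum_nonneg fun z _ => inner_self_nonneg

instance (E : CMod b H) (F : CMod b.dagger L) : Fact (rtpKernel E F).PosSemidef :=
  ⟨rtpKernel_posSemidef E F⟩

/-- The relative tensor product `H ⊗ L` of a `C*`-`𝔟`-module `H_E` and a `C*`-`𝔟†`-module `L_F`: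
the Hilbert space spanned by elements `ξ ⊗ ζ ⊗ η` (`ξ ∈ E`, `ζ ∈ 𝔎`, `η ∈ F`) with inner product
`⟪ξ ⊗ ζ ⊗ η, ξ' ⊗ ζ' ⊗ η'⟫ = ⟪ζ, ξ*ξ'η*η'ζ'⟫`. -/
def RTP (E : CMod b H) (F : CMod b.dagger L) : Type (max u v w) := RKHS.OfKernel (rtpKernel E F)

instance (E : CMod b H) (F : CMod b.dagger L) : NormedAddCommGroup (RTP E F) :=
  inferInstanceAs (NormedAddCommGroup (RKHS.OfKernel (rtpKernel E F)))

instance (E : CMod b H) (F : CMod b.dagger L) : InnerProductSpace ℂ (RTP E F) :=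
  inferInstanceAs (InnerProductSpace ℂ (RKHS.OfKernel (rtpKernel E F)))

instance (E : CMod b H) (F : CMod b.dagger L) : CompleteSpace (RTP E F) :=
  inferInstanceAs (CompleteSpace (RKHS.OfKernel (rtpKernel E F)))

instance (E : CMod b H) (F : CMod b.dagger L) : RKHS ℂ (RTP E F) (E.space × F.space) K :=
  inferInstanceAs (RKHS ℂ (RKHS.OfKernel (rtpKernel E F)) (E.space × F.space) K)

/-- The operator `ζ ↦ ξ ⊗ ζ ⊗ η`. -/
def ten (E : CMod b H) (F : CMod b.dagger L) (i : E.space × F.space) : K →L[ℂ] RTP E F :=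
  RKHS.kerFun (RTP E F) i

theorem ten_adjoint_comp (E : CMod b H) (F : CMod b.dagger L) (i j : E.space × F.space) :
    (ten E F i)† ∘L ten E F j = ((i.1 : K →L[ℂ] H)† ∘L (j.1 : K →L[ℂ] H)) ∘L
      ((i.2 : K →L[ℂ] L)† ∘L (j.2 : K →L[ℂ] L)) := by
  have h : RKHS.kernel (RTP E F) = rtpKernel E F := RKHS.OfKernel.kernel_ofKernel
  exact congrFun (congrFun h i) j

theorem ten_total (E : CMod b H) (F : CMod b.dagger L) : Total (ten E F) := 
  RKHS.kerFun_dense (RTP E F)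

end Modules

section Kets
variable {K : Type u} [NormedAddCommGroup K] [InnerProductSpace ℂ K] [CompleteSpace K]
variable {H : Type v} [NormedAddCommGroup H] [InnerProductSpace ℂ H] [CompleteSpace H]
variable {L : Type w} [NormedAddCommGroup L] [InnerProductSpace ℂ L] [CompleteSpace L]
variable {Y : Type*} [NormedAddCommGroup Y] [InnerProductSpace ℂ Y] [CompleteSpace Y]
variable {b c : CBase K}

theorem CMod.norm_rho_le (E : CMod b H) (x : b.Bd) : ‖E.rho x‖ ≤ ‖x‖ := by
  have hs : (x : K →L[ℂ] K)† ∈ b.Bd := star_mem x.2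
  have := norm_frameMap_le (k := fun ξ : E.space => (ξ : K →L[ℂ] H))
    (l := fun ξ : E.space => (ξ : K →L[ℂ] H) ∘L (x : K →L[ℂ] K)) E.total
    ((x : K →L[ℂ] K)† ∘L (x : K →L[ℂ] K)) (star_mul_nonneg _)
    (fun i j => (b.commute _ (E.adjoint_comp_mem i j) _ (mul_mem hs x.2)).symm) (fun i j => by
      have := (b.commute _ (E.adjoint_comp_mem i j) _ hs).eq
      calc _ = (x : K →L[ℂ] K)† * ((i : K →L[ℂ] H)† ∘L (j : K →L[ℂ] H)) * (x : K →L[ℂ] K) := by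
            rw [ContinuousLinearMap.adjoint_comp]; rfl
        _ = _ := by rw [← this]; rfl)
  rw [ContinuousLinearMap.norm_adjoint_comp_self, Real.sqrt_mul_self (norm_nonneg _)] at this
  exact this

theorem CMod.rho_add (E : CMod b H) (x y : b.Bd) : E.rho (x + y) = E.rho x + E.rho y :=
  E.total.ext fun ξ => by
    rw [ContinuousLinearMap.add_comp, E.rho_comp, E.rho_comp, E.rho_comp]
    simp [ContinuousLinearMap.comp_add]

theorem CMod.rho_smul (E : CMod b H) (r : ℂ) (x : b.Bd) : E.rho (r • x) = r • E.rho x :=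
  E.total.ext fun ξ => by
    rw [ContinuousLinearMap.smul_comp, E.rho_comp, E.rho_comp]
    simp

/-- `ρ_E` as a bounded linear map. -/
def CMod.rhoL (E : CMod b H) : b.Bd →L[ℂ] (H →L[ℂ] H) :=
  LinearMap.mkContinuous ⟨⟨E.rho, E.rho_add⟩, E.rho_smul⟩ 1 fun x => by
    simpa using E.norm_rho_le x

/-- Operators mapping `E` into `E'` intertwine the representations `ρ_E` and `ρ_E'`. -/
theorem CMod.intertwine (E : CMod b H) (E' : CMod b L) (T : H →L[ℂ] L)
    (hT : ∀ ξ ∈ E.space, T ∘L ξ ∈ E'.space) (x : b.Bd) : T ∘L E.rho x = E'.rho x ∘L T :=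
  E.total.ext fun ξ => by
    have := E'.rho_comp x ⟨_, hT ξ ξ.2⟩
    rw [ContinuousLinearMap.comp_assoc, E.rho_comp, ContinuousLinearMap.comp_assoc]
    exact this.symm

theorem Compat.mem {E : CMod b H} {E₁ : CMod c H} (h : Compat E E₁) (x : b.Bd)
    {ξ : K →L[ℂ] H} (hξ : ξ ∈ E₁.space) : E.rho x ∘L ξ ∈ E₁.space := by
  have : E.rho x ∘L ξ ∈ cspan {η | ∃ x : b.Bd, ∃ ξ ∈ E₁.space, η = E.rho x ∘L ξ} :=
    mem_cspan ⟨x, ξ, hξ, rfl⟩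
  rwa [h] at this

theorem Compat.comm {E : CMod b H} {E₁ : CMod c H} (h : Compat E E₁) (x : b.Bd) (y : c.Bd) :
    E.rho x ∘L E₁.rho y = E₁.rho y ∘L E.rho x :=
  E₁.intertwine E₁ (E.rho x) (fun _ hξ => h.mem x hξ) y

/-- The operator `|η⟩₂ : H → H ⊗ L`, `ξζ ↦ ξ ⊗ ζ ⊗ η`. -/
def ket2 (E : CMod b H) (F : CMod b.dagger L) (η : F.space) : H →L[ℂ] RTP E F :=
  frameMap (fun ξ : E.space => (ξ : K →L[ℂ] H)) fun ξ => ten E F (ξ, η)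

/-- The operator `|ξ⟩₁ : L → H ⊗ L`, `ηζ ↦ ξ ⊗ ζ ⊗ η`. -/
def ket1 (E : CMod b H) (F : CMod b.dagger L) (ξ : E.space) : L →L[ℂ] RTP E F :=
  frameMap (fun η : F.space => (η : K →L[ℂ] L)) fun η => ten E F (ξ, η)

theorem ket2_comp (E : CMod b H) (F : CMod b.dagger L) (η : F.space) (ξ : E.space) :
    ket2 E F η ∘L (ξ : K →L[ℂ] H) = ten E F (ξ, η) := by
  refine frameMap_comp (k := fun ξ : E.space => (ξ : K →L[ℂ] H)) (l := fun ξ => ten E F (ξ, η))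
    E.total ((η : K →L[ℂ] L)† ∘L (η : K →L[ℂ] L)) (star_mul_nonneg _) ?_ ?_ ξ
  · intro i j
    exact (rtpKernel_commute E F i j η η).symm
  · intro i j
    exact ten_adjoint_comp E F (i, η) (j, η)

theorem ket1_comp (E : CMod b H) (F : CMod b.dagger L) (ξ : E.space) (η : F.space) :
    ket1 E F ξ ∘L (η : K →L[ℂ] L) = ten E F (ξ, η) := by
  refine frameMap_comp (k := fun η : F.space => (η : K →L[ℂ] L)) (l := fun η => ten E F (ξ, η))
    F.total ((ξ : K →L[ℂ] H)† ∘L (ξ : K →L[ℂ] H)) (star_mul_nonneg _) ?_ ?_ η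
  · intro i j
    exact rtpKernel_commute E F ξ ξ i j
  · intro i j
    exact (ten_adjoint_comp E F (ξ, i) (ξ, j)).trans (rtpKernel_commute E F ξ ξ i j).eq

theorem ket2_adjoint_comp (E : CMod b H) (F : CMod b.dagger L) (η η' : F.space) :
    (ket2 E F η)† ∘L ket2 E F η'
      = E.rho ⟨(η : K →L[ℂ] L)† ∘L (η' : K →L[ℂ] L), F.adjoint_comp_mem η η'⟩ :=
  E.total.ext_adjoint fun ξ ξ' => by
    rw [E.rho_comp]
    calc _ = (ket2 E F η ∘L (ξ : K →L[ℂ] H))† ∘L (ket2 E F η' ∘L (ξ' : K →L[ℂ] H)) := by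
          rw [ContinuousLinearMap.adjoint_comp]; rfl
      _ = _ := by rw [ket2_comp, ket2_comp, ten_adjoint_comp]; rfl

theorem ket1_adjoint_comp (E : CMod b H) (F : CMod b.dagger L) (ξ ξ' : E.space) :
    (ket1 E F ξ)† ∘L ket1 E F ξ'
      = F.rho ⟨(ξ : K →L[ℂ] H)† ∘L (ξ' : K →L[ℂ] H), E.adjoint_comp_mem ξ ξ'⟩ :=
  F.total.ext_adjoint fun η η' => by
    rw [F.rho_comp]
    calc _ = (ket1 E F ξ ∘L (η : K →L[ℂ] L))† ∘L (ket1 E F ξ' ∘L (η' : K →L[ℂ] L)) := by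
          rw [ContinuousLinearMap.adjoint_comp]; rfl
      _ = _ := by
        rw [ket1_comp, ket1_comp, ten_adjoint_comp]
        exact (rtpKernel_commute E F _ _ _ _).eq

theorem ket2_total (E : CMod b H) (F : CMod b.dagger L) : Total (ket2 E F) := by
  refine top_le_iff.1 ?_
  rw [← show cspan _ = ⊤ from ten_total E F]
  rintro x hx
  refine map_mem_of_mem_cspan (ContinuousLinearMap.id ℂ _) (isClosed_cspan _) ?_ hx
  rintro _ ⟨⟨ξ, η⟩, ζ, rfl⟩
  exact mem_cspan ⟨η, (ξ : K →L[ℂ] H) ζ, by rw [← ket2_comp]; rfl⟩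

theorem ket1_total (E : CMod b H) (F : CMod b.dagger L) : Total (ket1 E F) := by
  refine top_le_iff.1 ?_
  rw [← show cspan _ = ⊤ from ten_total E F]
  rintro x hx
  refine map_mem_of_mem_cspan (ContinuousLinearMap.id ℂ _) (isClosed_cspan _) ?_ hx
  rintro _ ⟨⟨ξ, η⟩, ζ, rfl⟩
  exact mem_cspan ⟨ξ, (η : K →L[ℂ] L) ζ, by rw [← ket1_comp]; rfl⟩

/-- The module structure `[{k i}E₁]` on `Y`, where `{k i}` is a total family of operators `H → Y`
with `[{(k i)* k j}E₁] = E₁`. -/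
def CMod.push {ι : Type*} (E₁ : CMod c H) (k : ι → H →L[ℂ] Y) (hk : Total k)
    (h : cspan {θ | ∃ i j, ∃ ξ ∈ E₁.space, θ = ((k i)† ∘L k j) ∘L ξ} = E₁.space) : CMod c Y where
  space := cspan {θ | ∃ i, ∃ ξ ∈ E₁.space, θ = k i ∘L ξ}
  isClosed := isClosed_cspan _
  total := by
    have h1 : ∀ i x, k i x ∈ cspan {y : Y | ∃ (θ : cspan {θ | ∃ i, ∃ ξ ∈ E₁.space, θ = k i ∘L ξ})
        (ζ : K), (θ : K →L[ℂ] Y) ζ = y} := by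
      intro i x
      have hx : x ∈ cspan {y : H | ∃ (ξ : E₁.space) (ζ : K), (ξ : K →L[ℂ] H) ζ = y} := by
        rw [show cspan _ = ⊤ from E₁.total]; trivial
      refine map_mem_of_mem_cspan (k i) (isClosed_cspan _) ?_ hx
      rintro _ ⟨ξ, ζ, rfl⟩
      exact mem_cspan ⟨⟨_, mem_cspan ⟨i, ξ, ξ.2, rfl⟩⟩, ζ, rfl⟩
    refine top_le_iff.1 ?_
    rw [← show cspan _ = ⊤ from hk]
    intro x hx
    refine map_mem_of_mem_cspan (ContinuousLinearMap.id ℂ _) (isClosed_cspan _) ?_ hx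
    rintro _ ⟨i, x, rfl⟩
    exact h1 i x
  mul_base := by
    apply le_antisymm
    · intro θ hθ
      refine map_mem_of_mem_cspan (ContinuousLinearMap.id ℂ _) (isClosed_cspan _) ?_ hθ
      rintro _ ⟨θ, hθ, x, hx, rfl⟩
      refine map_mem_of_mem_cspan ((ContinuousLinearMap.compL ℂ K K Y).flip x)
        (isClosed_cspan _) ?_ hθ
      rintro _ ⟨i, ξ, hξ, rfl⟩
      exact mem_cspan ⟨i, ξ ∘L x, E₁.comp_mem ⟨ξ, hξ⟩ ⟨x, hx⟩, rfl⟩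
    · intro θ hθ
      refine map_mem_of_mem_cspan (ContinuousLinearMap.id ℂ _) (isClosed_cspan _) ?_ hθ
      rintro _ ⟨i, ξ, hξ, rfl⟩
      rw [← E₁.mul_base] at hξ
      refine map_mem_of_mem_cspan (ContinuousLinearMap.compL ℂ K H Y (k i)) (isClosed_cspan _) ?_ hξ
      rintro _ ⟨ξ, hξ, x, hx, rfl⟩
      exact mem_cspan ⟨k i ∘L ξ, mem_cspan ⟨i, ξ, hξ, rfl⟩, x, hx, rfl⟩
  inner_base := by
    have hcl : IsClosed (c.B.toSubmodule : Set (K →L[ℂ] K)) := c.isClosed_B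
    apply le_antisymm
    · have h1 : ∀ i, ∀ ξ ∈ E₁.space, ∀ θ ∈ cspan {θ | ∃ i, ∃ ξ ∈ E₁.space, θ = k i ∘L ξ},
          (k i ∘L ξ)† ∘L θ ∈ c.B := by
        intro i ξ hξ θ hθ
        refine map_mem_of_mem_cspan (ContinuousLinearMap.compL ℂ K Y K ((k i ∘L ξ)†)) hcl ?_ hθ
        rintro _ ⟨j, ξ', hξ', rfl⟩
        have hm : ((k i)† ∘L k j) ∘L ξ' ∈ E₁.space := by
          have : ((k i)† ∘L k j) ∘L ξ' ∈
            cspan {θ | ∃ i j, ∃ ξ ∈ E₁.space, θ = ((k i)† ∘L k j) ∘L ξ} :=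
            mem_cspan ⟨i, j, ξ', hξ', rfl⟩
          rwa [h] at this
        have := E₁.adjoint_comp_mem ⟨ξ, hξ⟩ ⟨_, hm⟩
        simp only [ContinuousLinearMap.compL_apply, ContinuousLinearMap.adjoint_comp]
        exact this
      intro x hx
      refine map_mem_of_mem_cspan (ContinuousLinearMap.id ℂ _) hcl ?_ hx
      rintro _ ⟨θ, hθ, θ', hθ', rfl⟩
      have h2 : θ'† ∘L θ ∈ c.B.toSubmodule := by
        refine map_mem_of_mem_cspan (ContinuousLinearMap.compL ℂ K Y K (θ'†)) hcl ?_ hθ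
        rintro _ ⟨i, ξ, hξ, rfl⟩
        have : ((k i ∘L ξ)† ∘L θ')† ∈ c.B := star_mem (h1 i ξ hξ θ' hθ')
        rw [ContinuousLinearMap.adjoint_comp, ContinuousLinearMap.adjoint_adjoint] at this
        exact this
      have h3 : (θ'† ∘L θ)† ∈ c.B := star_mem (show θ'† ∘L θ ∈ c.B from h2)
      rw [ContinuousLinearMap.adjoint_comp, ContinuousLinearMap.adjoint_adjoint] at h3
      exact h3
    · intro x hx
      rw [← E₁.inner_base] at hx
      refine map_mem_of_mem_cspan (ContinuousLinearMap.id ℂ _) (isClosed_cspan _) ?_ hx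
      rintro _ ⟨ξ, hξ, ξ', hξ', rfl⟩
      rw [← h] at hξ'
      refine map_mem_of_mem_cspan (ContinuousLinearMap.compL ℂ K H K (ξ†)) (isClosed_cspan _) ?_ hξ'
      rintro _ ⟨i, j, ξ'', hξ'', rfl⟩
      refine mem_cspan ⟨k i ∘L ξ, mem_cspan ⟨i, ξ, hξ, rfl⟩, k j ∘L ξ'',
        mem_cspan ⟨j, ξ'', hξ'', rfl⟩, ?_⟩
      rw [ContinuousLinearMap.adjoint_comp]
      rfl

theorem CMod.push_rho {ι : Type*} (E₁ : CMod c H) (k : ι → H →L[ℂ] Y) (hk : Total k)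
    (h : cspan {θ | ∃ i j, ∃ ξ ∈ E₁.space, θ = ((k i)† ∘L k j) ∘L ξ} = E₁.space) (i : ι)
    (x : c.Bd) : (E₁.push k hk h).rho x ∘L k i = k i ∘L E₁.rho x :=
  (E₁.intertwine (E₁.push k hk h) (k i) (fun ξ hξ => mem_cspan ⟨i, ξ, hξ, rfl⟩) x).symm

theorem Compat.cspan_eq {E : CMod b H} {E₁ : CMod c H} (h : Compat E E₁) (F : CMod b.dagger L) :
    cspan {θ | ∃ η η' : F.space, ∃ ξ ∈ E₁.space, θ =
      E.rho ⟨(η : K →L[ℂ] L)† ∘L (η' : K →L[ℂ] L), F.adjoint_comp_mem η η'⟩ ∘L ξ}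
      = E₁.space := by
  apply le_antisymm
  · intro θ hθ
    refine map_mem_of_mem_cspan (ContinuousLinearMap.id ℂ _) E₁.isClosed ?_ hθ
    rintro _ ⟨η, η', ξ, hξ, rfl⟩
    exact h.mem _ hξ
  · intro θ hθ
    rw [← show cspan _ = _ from h] at hθ
    refine map_mem_of_mem_cspan (ContinuousLinearMap.id ℂ _) (isClosed_cspan _) ?_ hθ
    rintro _ ⟨⟨x, hxB⟩, ξ, hξ, rfl⟩
    set M := cspan {θ | ∃ η η' : F.space, ∃ ξ ∈ E₁.space, θ =
      E.rho ⟨(η : K →L[ℂ] L)† ∘L (η' : K →L[ℂ] L), F.adjoint_comp_mem η η'⟩ ∘L ξ} with hM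
    have hx : x ∈ cspan {x | ∃ ξ ∈ F.space, ∃ ξ' ∈ F.space, x = ξ† ∘L ξ'} := by
      rw [F.inner_base]; exact hxB
    have hspan : ∀ y ∈ Submodule.span ℂ {x | ∃ ξ ∈ F.space, ∃ ξ' ∈ F.space, x = ξ† ∘L ξ'},
        ∃ hy : y ∈ b.Bd, E.rho ⟨y, hy⟩ ∘L ξ ∈ M := by
      intro y hy
      induction hy using Submodule.span_induction with
      | mem y hy =>
        obtain ⟨η, hη, η', hη', rfl⟩ := hy
        exact ⟨F.adjoint_comp_mem ⟨η, hη⟩ ⟨η', hη'⟩,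
          mem_cspan ⟨⟨η, hη⟩, ⟨η', hη'⟩, ξ, hξ, rfl⟩⟩
      | zero =>
        refine ⟨zero_mem _, ?_⟩
        have : E.rho ⟨0, zero_mem _⟩ = 0 := map_zero E.rhoL
        rw [this, ContinuousLinearMap.zero_comp]
        exact zero_mem _
      | add y z _ _ ihy ihz =>
        obtain ⟨hy, ihy⟩ := ihy
        obtain ⟨hz, ihz⟩ := ihz
        refine ⟨add_mem hy hz, ?_⟩
        have : E.rho ⟨y + z, add_mem hy hz⟩ = _ := E.rho_add ⟨y, hy⟩ ⟨z, hz⟩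
        rw [this, ContinuousLinearMap.add_comp]
        exact add_mem ihy ihz
      | smul r y _ ihy =>
        obtain ⟨hy, ihy⟩ := ihy
        refine ⟨SMulMemClass.smul_mem r hy, ?_⟩
        have : E.rho ⟨r • y, SMulMemClass.smul_mem r hy⟩ = _ := E.rho_smul r ⟨y, hy⟩
        rw [this, ContinuousLinearMap.smul_comp]
        exact M.smul_mem r ihy
    have hx' : x ∈ closure ((Submodule.span ℂ {x | ∃ ξ ∈ F.space, ∃ ξ' ∈ F.space,
        x = ξ† ∘L ξ'} : Submodule ℂ (K →L[ℂ] K)) : Set (K →L[ℂ] K)) := hx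
    obtain ⟨y, hy, hlim⟩ := mem_closure_iff_seq_limit.1 hx'
    choose hyB hyM using fun n => hspan (y n) (hy n)
    have hlim' : Filter.Tendsto (fun n => (⟨y n, hyB n⟩ : b.Bd)) Filter.atTop (nhds ⟨x, hxB⟩) :=
      tendsto_subtype_rng.2 hlim
    have hlim2 := ((((ContinuousLinearMap.compL ℂ K H H).flip ξ).comp E.rhoL).continuous.tendsto
      ⟨x, hxB⟩).comp hlim'
    exact (isClosed_cspan _).mem_of_tendsto hlim2 (Filter.Eventually.of_forall hyM)

/-- The module structure `E₁ ◁ F = [|F⟩₂ E₁]` on `H ⊗ L`. -/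
def triL (E : CMod b H) (F : CMod b.dagger L) (E₁ : CMod c H) (h : Compat E E₁) :
    CMod c (RTP E F) :=
  E₁.push (ket2 E F) (ket2_total E F) (by
    simp only [ket2_adjoint_comp]
    exact h.cspan_eq F)

/-- The module structure `E ▷ F₁ = [|E⟩₁ F₁]` on `H ⊗ L`. -/
def triR (E : CMod b H) (F : CMod b.dagger L) (F₁ : CMod c L) (h : Compat F F₁) :
    CMod c (RTP E F) :=
  F₁.push (ket1 E F) (ket1_total E F) (by
    simp only [ket1_adjoint_comp]
    exact h.cspan_eq (b := b.dagger) E)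

end Kets

section Maps
variable {K : Type u} [NormedAddCommGroup K] [InnerProductSpace ℂ K] [CompleteSpace K]
variable {H : Type*} [NormedAddCommGroup H] [InnerProductSpace ℂ H] [CompleteSpace H]
variable {H' : Type*} [NormedAddCommGroup H'] [InnerProductSpace ℂ H'] [CompleteSpace H']
variable {L : Type*} [NormedAddCommGroup L] [InnerProductSpace ℂ L] [CompleteSpace L]
variable {M : Type*} [NormedAddCommGroup M] [InnerProductSpace ℂ M] [CompleteSpace M]
variable {b c : CBase K}

/-- The operator `T ⊗ Id`, determined by `(T ⊗ Id)(x ⊗ η) = Tx ⊗ η`. -/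
def tensL (E : CMod b H) (E' : CMod b H') (F : CMod b.dagger L) (T : H →L[ℂ] H') :
    RTP E F →L[ℂ] RTP E' F :=
  frameMap (ket2 E F) fun η => ket2 E' F η ∘L T

/-- The operator `Id ⊗ T`, determined by `(Id ⊗ T)(ξ ⊗ x) = ξ ⊗ Tx`. -/
def tensR (E : CMod b L) (F : CMod b.dagger H) (F' : CMod b.dagger H') (T : H →L[ℂ] H') :
    RTP E F →L[ℂ] RTP E F' :=
  frameMap (ket1 E F) fun ξ => ket1 E F' ξ ∘L T

theorem tensL_comp (E : CMod b H) (E' : CMod b H') (F : CMod b.dagger L) (T : H →L[ℂ] H')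
    (hT : ∀ x, T ∘L E.rho x = E'.rho x ∘L T) (hT' : ∀ x, T† ∘L E'.rho x = E.rho x ∘L T†)
    (η : F.space) : tensL E E' F T ∘L ket2 E F η = ket2 E' F η ∘L T := by
  refine frameMap_comp (k := ket2 E F) (l := fun η => ket2 E' F η ∘L T) (ket2_total E F)
    (T† ∘L T) (star_mul_nonneg T) ?_ ?_ η
  · intro i j
    rw [ket2_adjoint_comp]
    set x : b.Bd := ⟨(i : K →L[ℂ] L)† ∘L (j : K →L[ℂ] L), F.adjoint_comp_mem i j⟩
    calc T† ∘L (T ∘L E.rho x) = (T† ∘L E'.rho x) ∘L T := by rw [hT]; rfl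
      _ = E.rho x ∘L T† ∘L T := by rw [hT']; rfl
  · intro i j
    rw [ContinuousLinearMap.adjoint_comp]
    set x : b.Bd := ⟨(i : K →L[ℂ] L)† ∘L (j : K →L[ℂ] L), F.adjoint_comp_mem i j⟩
    calc (T† ∘L (ket2 E' F i)†) ∘L (ket2 E' F j ∘L T)
        = T† ∘L ((ket2 E' F i)† ∘L ket2 E' F j) ∘L T := rfl
      _ = (T† ∘L E'.rho x) ∘L T := by rw [ket2_adjoint_comp]; rfl
      _ = E.rho x ∘L T† ∘L T := by rw [hT']; rfl
      _ = _ := by rw [← ket2_adjoint_comp]; rfl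

theorem tensR_comp (E : CMod b L) (F : CMod b.dagger H) (F' : CMod b.dagger H') (T : H →L[ℂ] H')
    (hT : ∀ x, T ∘L F.rho x = F'.rho x ∘L T) (hT' : ∀ x, T† ∘L F'.rho x = F.rho x ∘L T†)
    (ξ : E.space) : tensR E F F' T ∘L ket1 E F ξ = ket1 E F' ξ ∘L T := by
  refine frameMap_comp (k := ket1 E F) (l := fun ξ => ket1 E F' ξ ∘L T) (ket1_total E F)
    (T† ∘L T) (star_mul_nonneg T) ?_ ?_ ξ
  · intro i j
    rw [ket1_adjoint_comp]
    set x : b.B := ⟨(i : K →L[ℂ] L)† ∘L (j : K →L[ℂ] L), E.adjoint_comp_mem i j⟩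
    calc T† ∘L (T ∘L F.rho x) = (T† ∘L F'.rho x) ∘L T := by rw [hT]; rfl
      _ = F.rho x ∘L T† ∘L T := by rw [hT']; rfl
  · intro i j
    rw [ContinuousLinearMap.adjoint_comp]
    set x : b.B := ⟨(i : K →L[ℂ] L)† ∘L (j : K →L[ℂ] L), E.adjoint_comp_mem i j⟩
    calc (T† ∘L (ket1 E F' i)†) ∘L (ket1 E F' j ∘L T)
        = T† ∘L ((ket1 E F' i)† ∘L ket1 E F' j) ∘L T := rfl
      _ = (T† ∘L F'.rho x) ∘L T := by rw [ket1_adjoint_comp]; rfl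
      _ = F.rho x ∘L T† ∘L T := by rw [hT']; rfl
      _ = _ := by rw [← ket1_adjoint_comp]; rfl

theorem frameMap_comp_of_eq {X Y Z : Type*} {ι : Type*}
    [NormedAddCommGroup X] [InnerProductSpace ℂ X] [CompleteSpace X]
    [NormedAddCommGroup Y] [InnerProductSpace ℂ Y] [CompleteSpace Y]
    [NormedAddCommGroup Z] [InnerProductSpace ℂ Z] [CompleteSpace Z]
    {k : ι → X →L[ℂ] Y} {l : ι → X →L[ℂ] Z} (hk : Total k)
    (hl : ∀ i j, (l i)† ∘L l j = (k i)† ∘L k j) (i : ι) : frameMap k l ∘L k i = l i :=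
  frameMap_comp hk 1 ((ContinuousLinearMap.nonneg_iff_isPositive _).2
    ContinuousLinearMap.isPositive_one) (fun _ _ => Commute.one_left _) (fun i j => hl i j) i

theorem Total.comp {X Y Z : Type*} {ι κ : Type*}
    [NormedAddCommGroup X] [InnerProductSpace ℂ X] [CompleteSpace X]
    [NormedAddCommGroup Y] [InnerProductSpace ℂ Y] [CompleteSpace Y]
    [NormedAddCommGroup Z] [InnerProductSpace ℂ Z] [CompleteSpace Z]
    {k : ι → X →L[ℂ] Y} {l : κ → Y →L[ℂ] Z} (hk : Total k) (hl : Total l) :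
    Total fun i : ι × κ => l i.2 ∘L k i.1 := by
  refine top_le_iff.1 ?_
  rw [← show cspan _ = ⊤ from hl]
  intro z hz
  refine map_mem_of_mem_cspan (ContinuousLinearMap.id ℂ _) (isClosed_cspan _) ?_ hz
  rintro _ ⟨j, y, rfl⟩
  have hy : y ∈ cspan {y : Y | ∃ i x, k i x = y} := by
    rw [show cspan _ = ⊤ from hk]; trivial
  refine map_mem_of_mem_cspan (l j) (isClosed_cspan _) ?_ hy
  rintro _ ⟨i, x, rfl⟩
  exact mem_cspan ⟨(i, j), x, rfl⟩

/-- The flip `ξ ⊗ ζ ⊗ η ↦ η ⊗ ζ ⊗ ξ`. -/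
def flip (E : CMod b H) (F : CMod b.dagger L) : RTP E F →L[ℂ] RTP (b := b.dagger) F E :=
  frameMap (ten E F) fun i => ten (b := b.dagger) F E (i.2, i.1)

theorem flip_comp (E : CMod b H) (F : CMod b.dagger L) (i : E.space × F.space) :
    flip E F ∘L ten E F i = ten (b := b.dagger) F E (i.2, i.1) := by
  refine frameMap_comp_of_eq (ten_total E F) (fun i j => ?_) i
  rw [ten_adjoint_comp, ten_adjoint_comp]
  exact (rtpKernel_commute E F i.1 j.1 i.2 j.2).symm.eq

section Assoc
variable (E : CMod b H) (F : CMod b.dagger L) (F₁ : CMod c L) (G : CMod c.dagger M)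
  (h : Compat F F₁) (h' : Compat F₁ F)

theorem assoc_aux (i j : E.space × G.space) :
    (ket1 E (triL F₁ G F h') i.1 ∘L ket2 F₁ G i.2)† ∘L
        (ket1 E (triL F₁ G F h') j.1 ∘L ket2 F₁ G j.2)
      = (ket2 (triR E F F₁ h) G i.2 ∘L ket1 E F i.1)† ∘L
        (ket2 (triR E F F₁ h) G j.2 ∘L ket1 E F j.1) := by
  set x : b.B := ⟨_, E.adjoint_comp_mem i.1 j.1⟩
  set y : c.Bd := ⟨_, G.adjoint_comp_mem i.2 j.2⟩
  have hl : (triL F₁ G F h').rho x ∘L ket2 F₁ G j.2 = ket2 F₁ G j.2 ∘L F.rho x :=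
    CMod.push_rho F (ket2 F₁ G) _ _ j.2 x
  have hr : (triR E F F₁ h).rho y ∘L ket1 E F j.1 = ket1 E F j.1 ∘L F₁.rho y :=
    CMod.push_rho F₁ (ket1 E F) _ _ j.1 y
  rw [ContinuousLinearMap.adjoint_comp, ContinuousLinearMap.adjoint_comp]
  calc _ = (ket2 F₁ G i.2)† ∘L ((ket1 E (triL F₁ G F h') i.1)† ∘L ket1 E (triL F₁ G F h') j.1)
          ∘L ket2 F₁ G j.2 := rfl
    _ = ((ket2 F₁ G i.2)† ∘L ket2 F₁ G j.2) ∘L F.rho x := by rw [ket1_adjoint_comp, hl]; rfl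
    _ = F.rho x ∘L F₁.rho y := by rw [ket2_adjoint_comp]; exact (h.comm x y).symm
    _ = ((ket1 E F i.1)† ∘L ket1 E F j.1) ∘L F₁.rho y := by rw [ket1_adjoint_comp]
    _ = (ket1 E F i.1)† ∘L ((triR E F F₁ h).rho y) ∘L ket1 E F j.1 := by rw [hr]; rfl
    _ = _ := by rw [← ket2_adjoint_comp]; rfl

/-- The identification `(H ⊗ L) ⊗ M → H ⊗ (L ⊗ M)`, `(ξ ⊗ x) ⊗ η ↦ ξ ⊗ (x ⊗ η)`. -/
def assoc : RTP (triR E F F₁ h) G →L[ℂ] RTP E (triL F₁ G F h') :=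
  frameMap (fun i : E.space × G.space => ket2 (triR E F F₁ h) G i.2 ∘L ket1 E F i.1)
    fun i => ket1 E (triL F₁ G F h') i.1 ∘L ket2 F₁ G i.2

/-- The identification `H ⊗ (L ⊗ M) → (H ⊗ L) ⊗ M`, `ξ ⊗ (x ⊗ η) ↦ (ξ ⊗ x) ⊗ η`. -/
def assocSymm : RTP E (triL F₁ G F h') →L[ℂ] RTP (triR E F F₁ h) G :=
  frameMap (fun i : E.space × G.space => ket1 E (triL F₁ G F h') i.1 ∘L ket2 F₁ G i.2)
    fun i => ket2 (triR E F F₁ h) G i.2 ∘L ket1 E F i.1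

theorem assoc_comp (i : E.space × G.space) :
    assoc E F F₁ G h h' ∘L (ket2 (triR E F F₁ h) G i.2 ∘L ket1 E F i.1)
      = ket1 E (triL F₁ G F h') i.1 ∘L ket2 F₁ G i.2 :=
  frameMap_comp_of_eq
    (k := fun i : E.space × G.space => ket2 (triR E F F₁ h) G i.2 ∘L ket1 E F i.1)
    (l := fun i => ket1 E (triL F₁ G F h') i.1 ∘L ket2 F₁ G i.2)
    ((ket1_total E F).comp (ket2_total _ G)) (assoc_aux E F F₁ G h h') i

theorem total_swap {X Y ι κ : Type*}
    [NormedAddCommGroup X] [InnerProductSpace ℂ X] [CompleteSpace X]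
    [NormedAddCommGroup Y] [InnerProductSpace ℂ Y] [CompleteSpace Y]
    {k : ι × κ → X →L[ℂ] Y} (hk : Total fun i : κ × ι => k (i.2, i.1)) : Total k := by
  refine top_le_iff.1 ?_
  rw [← show cspan _ = ⊤ from hk]
  intro z hz
  refine map_mem_of_mem_cspan (ContinuousLinearMap.id ℂ _) (isClosed_cspan _) ?_ hz
  rintro _ ⟨i, x, rfl⟩
  exact mem_cspan ⟨(i.2, i.1), x, rfl⟩

theorem assocSymm_comp (i : E.space × G.space) :
    assocSymm E F F₁ G h h' ∘L (ket1 E (triL F₁ G F h') i.1 ∘L ket2 F₁ G i.2)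
      = ket2 (triR E F F₁ h) G i.2 ∘L ket1 E F i.1 :=
  frameMap_comp_of_eq
    (k := fun i : E.space × G.space => ket1 E (triL F₁ G F h') i.1 ∘L ket2 F₁ G i.2)
    (l := fun i => ket2 (triR E F F₁ h) G i.2 ∘L ket1 E F i.1)
    (total_swap ((ket2_total F₁ G).comp (ket1_total E _)))
    (fun i j => (assoc_aux E F F₁ G h h' i j).symm) i

end Assoc

section Swap
variable (E : CMod b H) (F : CMod b.dagger L) (E₁ : CMod c H) (G : CMod c.dagger M)
  (h : Compat E E₁) (h' : Compat E₁ E)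

/-- The isomorphism `Σ₂₃ : (H ⊗ L) ⊗ M → (H ⊗ M) ⊗ L`, `(x ⊗ η) ⊗ ω ↦ (x ⊗ ω) ⊗ η`. -/
def swap23 : RTP (triL E F E₁ h) G →L[ℂ] RTP (triL E₁ G E h') F :=
  frameMap (fun i : F.space × G.space => ket2 (triL E F E₁ h) G i.2 ∘L ket2 E F i.1)
    fun i => ket2 (triL E₁ G E h') F i.1 ∘L ket2 E₁ G i.2

theorem swap23_comp (i : F.space × G.space) :
    swap23 E F E₁ G h h' ∘L (ket2 (triL E F E₁ h) G i.2 ∘L ket2 E F i.1)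
      = ket2 (triL E₁ G E h') F i.1 ∘L ket2 E₁ G i.2 := by
  refine frameMap_comp_of_eq
    (k := fun i : F.space × G.space => ket2 (triL E F E₁ h) G i.2 ∘L ket2 E F i.1)
    (l := fun i => ket2 (triL E₁ G E h') F i.1 ∘L ket2 E₁ G i.2)
    ((ket2_total E F).comp (ket2_total _ G)) (fun i j => ?_) i
  set x : b.Bd := ⟨_, F.adjoint_comp_mem i.1 j.1⟩
  set y : c.Bd := ⟨_, G.adjoint_comp_mem i.2 j.2⟩
  have hl : (triL E₁ G E h').rho x ∘L ket2 E₁ G j.2 = ket2 E₁ G j.2 ∘L E.rho x :=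
    CMod.push_rho E (ket2 E₁ G) _ _ j.2 x
  have hr : (triL E F E₁ h).rho y ∘L ket2 E F j.1 = ket2 E F j.1 ∘L E₁.rho y :=
    CMod.push_rho E₁ (ket2 E F) _ _ j.1 y
  rw [ContinuousLinearMap.adjoint_comp, ContinuousLinearMap.adjoint_comp]
  calc _ = (ket2 E₁ G i.2)† ∘L ((ket2 (triL E₁ G E h') F i.1)† ∘L ket2 (triL E₁ G E h') F j.1)
          ∘L ket2 E₁ G j.2 := rfl
    _ = ((ket2 E₁ G i.2)† ∘L ket2 E₁ G j.2) ∘L E.rho x := by rw [ket2_adjoint_comp, hl]; rfl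
    _ = E.rho x ∘L E₁.rho y := by rw [ket2_adjoint_comp]; exact (h.comm x y).symm
    _ = ((ket2 E F i.1)† ∘L ket2 E F j.1) ∘L E₁.rho y := by rw [ket2_adjoint_comp]
    _ = (ket2 E F i.1)† ∘L ((triL E F E₁ h).rho y) ∘L ket2 E F j.1 := by rw [hr]; rfl
    _ = _ := by rw [← ket2_adjoint_comp]; rfl

end Swap
end Maps

section Omega
variable {K : Type u} [NormedAddCommGroup K] [InnerProductSpace ℂ K] [CompleteSpace K]
variable {H : Type v} [NormedAddCommGroup H] [InnerProductSpace ℂ H] [CompleteSpace H]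

/-- The space `E^∞` of all sequences `η` in `E ⊆ ℒ(𝔎, H)` for which `∑ₖ ηₖ*ηₖ` converges in norm. -/
structure SeqInf (E : Submodule ℂ (K →L[ℂ] H)) where
  seq : ℕ → K →L[ℂ] H
  mem : ∀ k, seq k ∈ E
  summable_sq : Summable fun k => (seq k)† ∘L seq k

/-- The `k`-th entry of a sequence in `E^∞`, as an element of `E`. -/
def SeqInf.el {E : Submodule ℂ (K →L[ℂ] H)} (η : SeqInf E) (k : ℕ) : E := ⟨η.seq k, η.mem k⟩

/-- `‖η‖ = ‖∑ₖ ηₖ*ηₖ‖^{1/2}`. -/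
instance (E : Submodule ℂ (K →L[ℂ] H)) : Norm (SeqInf E) :=
  ⟨fun η => √‖∑' k, (η.seq k)† ∘L η.seq k‖⟩

variable {E F : Submodule ℂ (K →L[ℂ] H)}

theorem SeqInf.norm_nonneg (η : SeqInf E) : 0 ≤ ‖η‖ := Real.sqrt_nonneg _

theorem SeqInf.norm_sq (η : SeqInf E) : ‖η‖ ^ 2 = ‖∑' k, (η.seq k)† ∘L η.seq k‖ :=
  Real.sq_sqrt (_root_.norm_nonneg _)

theorem inner_adjoint_comp_self (x : K →L[ℂ] H) (v : K) :
    RCLike.re ⟪v, (x† ∘L x) v⟫_ℂ = ‖x v‖ ^ 2 := by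
  rw [ContinuousLinearMap.comp_apply, ContinuousLinearMap.adjoint_inner_right,
    inner_self_eq_norm_sq]

theorem re_inner_le (S : K →L[ℂ] K) (v : K) : RCLike.re ⟪v, S v⟫_ℂ ≤ ‖S‖ * ‖v‖ ^ 2 := by
  calc RCLike.re ⟪v, S v⟫_ℂ ≤ ‖v‖ * ‖S v‖ := re_inner_le_norm _ _
    _ ≤ ‖v‖ * (‖S‖ * ‖v‖) := by gcongr; exact S.le_opNorm v
    _ = _ := by ring

theorem SeqInf.sum_le (η : SeqInf E) (s : Finset ℕ) (v : K) :
    ∑ k ∈ s, ‖η.seq k v‖ ^ 2 ≤ ‖η‖ ^ 2 * ‖v‖ ^ 2 := by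
  have h1 : HasSum (fun k => ‖η.seq k v‖ ^ 2)
      (RCLike.re ⟪v, (∑' k, (η.seq k)† ∘L η.seq k) v⟫_ℂ) := by
    have := η.summable_sq.hasSum.mapL ((RCLike.reCLM (K := ℂ)).comp
      (((innerSL ℂ v).comp (ContinuousLinearMap.apply ℂ K v)).restrictScalars ℝ))
    have e : (fun k => ‖η.seq k v‖ ^ 2) = fun k => ((RCLike.reCLM (K := ℂ)).comp
      (((innerSL ℂ v).comp (ContinuousLinearMap.apply ℂ K v)).restrictScalars ℝ))
        ((η.seq k)† ∘L η.seq k) := by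
      funext k
      exact (inner_adjoint_comp_self (η.seq k) v).symm
    rw [e]
    exact this
  calc _ ≤ _ := sum_le_hasSum s (fun _ _ => by positivity) h1
    _ ≤ _ := by rw [η.norm_sq]; exact re_inner_le _ _

theorem norm_sum_le_of_bounds {ι : Type*} (x y : ι → K →L[ℂ] H) (T : H →L[ℂ] H) (s : Finset ι)
    {a b : ℝ} (ha : 0 ≤ a) (hb : 0 ≤ b) (hx : ∀ v, ∑ k ∈ s, ‖x k v‖ ^ 2 ≤ a ^ 2 * ‖v‖ ^ 2)
    (hy : ∀ v, ∑ k ∈ s, ‖y k v‖ ^ 2 ≤ b ^ 2 * ‖v‖ ^ 2) :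
    ‖∑ k ∈ s, (x k)† ∘L T ∘L y k‖ ≤ a * b * ‖T‖ := by
  refine ContinuousLinearMap.opNorm_le_bound _ (by positivity) fun v => ?_
  set w := (∑ k ∈ s, (x k)† ∘L T ∘L y k) v with hw
  have h1 : ‖w‖ ^ 2 ≤ ‖T‖ * ((a * ‖w‖) * (b * ‖v‖)) := by
    calc ‖w‖ ^ 2 = RCLike.re ⟪w, (∑ k ∈ s, (x k)† ∘L T ∘L y k) v⟫_ℂ := by
          rw [← hw, inner_self_eq_norm_sq]
      _ = ∑ k ∈ s, RCLike.re ⟪x k w, T (y k v)⟫_ℂ := by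
          rw [sum_apply, inner_sum, map_sum]
          simp only [ContinuousLinearMap.comp_apply, ContinuousLinearMap.adjoint_inner_right]
      _ ≤ ∑ k ∈ s, ‖T‖ * (‖x k w‖ * ‖y k v‖) := by
          refine Finset.sum_le_sum fun k _ => (re_inner_le_norm _ _).trans ?_
          calc _ ≤ ‖x k w‖ * (‖T‖ * ‖y k v‖) := by gcongr; exact T.le_opNorm _
            _ = _ := by ring
      _ = ‖T‖ * ∑ k ∈ s, ‖x k w‖ * ‖y k v‖ := by rw [Finset.mul_sum]
      _ ≤ ‖T‖ * ((a * ‖w‖) * (b * ‖v‖)) := by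
          gcongr
          refine abs_le_of_sq_le_sq' ?_ (by positivity) |>.2
          calc _ ≤ (∑ k ∈ s, ‖x k w‖ ^ 2) * (∑ k ∈ s, ‖y k v‖ ^ 2) :=
                Finset.sum_mul_sq_le_sq_mul_sq _ _ _
            _ ≤ (a ^ 2 * ‖w‖ ^ 2) * (b ^ 2 * ‖v‖ ^ 2) := by
                gcongr
                · exact hx w
                · exact hy v
            _ = _ := by ring
  rcases (norm_nonneg w).eq_or_lt with h0 | h0
  · rw [← h0]; positivity
  · refine le_of_mul_le_mul_right ?_ h0
    calc ‖w‖ * ‖w‖ = ‖w‖ ^ 2 := by ring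
      _ ≤ _ := h1
      _ = _ := by ring

theorem SeqInf.summable (η : SeqInf E) (η' : SeqInf F) (T : H →L[ℂ] H) :
    Summable fun k => (η.seq k)† ∘L T ∘L η'.seq k := by
  rw [summable_iff_vanishing_norm]
  intro ε hε
  obtain ⟨δ, hδ, hδε⟩ : ∃ δ : ℝ, 0 < δ ∧ ‖η‖ * δ * ‖T‖ < ε := by
    refine ⟨ε / (‖η‖ * ‖T‖ + 1), ?_, ?_⟩
    · have := η.norm_nonneg; positivity
    · have := η.norm_nonneg
      have h2 : 0 < ‖η‖ * ‖T‖ + 1 := by positivity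
      calc _ = ε * ((‖η‖ * ‖T‖) / (‖η‖ * ‖T‖ + 1)) := by ring
        _ < ε * 1 := by
          gcongr
          rw [div_lt_one h2]; linarith
        _ = ε := mul_one _
  obtain ⟨s, hs⟩ := summable_iff_vanishing_norm.1 η'.summable_sq (δ ^ 2) (by positivity)
  refine ⟨s, fun t ht => lt_of_le_of_lt ?_ hδε⟩
  refine norm_sum_le_of_bounds _ _ T t η.norm_nonneg hδ.le (η.sum_le t) fun v => ?_
  calc ∑ k ∈ t, ‖η'.seq k v‖ ^ 2 = RCLike.re ⟪v, (∑ k ∈ t, (η'.seq k)† ∘L η'.seq k) v⟫_ℂ := by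
        rw [sum_apply, inner_sum, map_sum]
        simp only [inner_adjoint_comp_self]
    _ ≤ _ := re_inner_le _ _
    _ ≤ _ := by gcongr; exact (hs t ht).le

theorem SeqInf.norm_tsum_le (η : SeqInf E) (η' : SeqInf F) (T : H →L[ℂ] H) :
    ‖∑' k, (η.seq k)† ∘L T ∘L η'.seq k‖ ≤ ‖η‖ * ‖η'‖ * ‖T‖ := by
  refine le_of_tendsto (η.summable η' T).hasSum.norm (Filter.Eventually.of_forall fun s => ?_)
  exact norm_sum_le_of_bounds _ _ T s η.norm_nonneg η'.norm_nonneg (η.sum_le s) (η'.sum_le s)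

/-- The map `ω_{η,η'} : A → ℒ(𝔎)`, `T ↦ ∑ₖ ηₖ* T η'ₖ`. -/
def omegaMap (A : Submodule ℂ (H →L[ℂ] H)) (η : SeqInf E) (η' : SeqInf F) :
    A →L[ℂ] (K →L[ℂ] K) :=
  LinearMap.mkContinuous
    { toFun := fun T => ∑' k, (η.seq k)† ∘L (T : H →L[ℂ] H) ∘L η'.seq k
      map_add' := fun T T' => by
        rw [← (η.summable η' T).tsum_add (η.summable η' T')]
        simp [ContinuousLinearMap.comp_add, ContinuousLinearMap.add_comp]
      map_smul' := fun r T => by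
        rw [RingHom.id_apply, ← (η.summable η' T).tsum_const_smul]
        simp }
    (‖η‖ * ‖η'‖) fun T => η.norm_tsum_le η' T

theorem omegaMap_apply (A : Submodule ℂ (H →L[ℂ] H)) (η : SeqInf E) (η' : SeqInf F) (T : A) :
    omegaMap A η η' T = ∑' k, (η.seq k)† ∘L (T : H →L[ℂ] H) ∘L η'.seq k := rfl

theorem norm_omegaMap_le (A : Submodule ℂ (H →L[ℂ] H)) (η : SeqInf E) (η' : SeqInf F) :
    ‖omegaMap A η η'‖ ≤ ‖η‖ * ‖η'‖ :=
  LinearMap.mkContinuous_norm_le _ (mul_nonneg η.norm_nonneg η'.norm_nonneg) _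

theorem adjoint_smul_comp (r t : ℂ) (x y : K →L[ℂ] H) (T : H →L[ℂ] H) :
    (r • x)† ∘L T ∘L (t • y) = (star r * t) • (x† ∘L T ∘L y) := by
  rw [map_smulₛₗ, ContinuousLinearMap.comp_smul, ContinuousLinearMap.comp_smul,
    ContinuousLinearMap.smul_comp, smul_smul, mul_comm]
  rfl

/-- Scalar multiples in `E^∞`. -/
def SeqInf.scale (r : ℂ) (η : SeqInf E) : SeqInf E :=
  ⟨fun k => r • η.seq k, fun k => E.smul_mem r (η.mem k),
    (η.summable_sq.const_smul (star r * r)).congr fun k =>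
      (adjoint_smul_comp r r (η.seq k) (η.seq k) (ContinuousLinearMap.id ℂ H)).symm⟩

theorem SeqInf.norm_scale (r : ℂ) (η : SeqInf E) : ‖η.scale r‖ = ‖r‖ * ‖η‖ := by
  have h : ∑' k, ((η.scale r).seq k)† ∘L (η.scale r).seq k
      = (star r * r) • ∑' k, (η.seq k)† ∘L η.seq k := by
    rw [← η.summable_sq.tsum_const_smul]
    exact tsum_congr fun k =>
      adjoint_smul_comp r r (η.seq k) (η.seq k) (ContinuousLinearMap.id ℂ H)
  refine (pow_left_inj₀ (SeqInf.norm_nonneg _) (mul_nonneg (_root_.norm_nonneg _) η.norm_nonneg)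
    two_ne_zero).1 ?_
  rw [SeqInf.norm_sq, h, norm_smul, mul_pow, η.norm_sq]
  simp [sq]

theorem hasSum_interleave {G : Type*} [AddCommMonoid G] [TopologicalSpace G] [ContinuousAdd G]
    {f : ℕ ⊕ ℕ → G} {s t : G} (hx : HasSum (f ∘ Sum.inl) s) (hy : HasSum (f ∘ Sum.inr) t)
    (e : ℕ ≃ ℕ ⊕ ℕ) : HasSum (f ∘ e) (s + t) :=
  e.hasSum_iff.2 (HasSum.sum hx hy)

/-- The sequence obtained by interleaving two sequences. -/
def SeqInf.interleave (η ζ : SeqInf E) : SeqInf E :=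
  ⟨fun k => Sum.elim η.seq ζ.seq (Equiv.natSumNatEquivNat.symm k), fun k => by
      rcases Equiv.natSumNatEquivNat.symm k with i | i
      · exact η.mem i
      · exact ζ.mem i,
    (hasSum_interleave (f := fun z => (Sum.elim η.seq ζ.seq z)† ∘L Sum.elim η.seq ζ.seq z)
      η.summable_sq.hasSum ζ.summable_sq.hasSum Equiv.natSumNatEquivNat.symm).summable⟩

theorem SeqInf.norm_interleave_sq_le (η ζ : SeqInf E) :
    ‖η.interleave ζ‖ ^ 2 ≤ ‖η‖ ^ 2 + ‖ζ‖ ^ 2 := by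
  rw [SeqInf.norm_sq, SeqInf.norm_sq, SeqInf.norm_sq]
  have : ∑' k, ((η.interleave ζ).seq k)† ∘L (η.interleave ζ).seq k
      = ∑' k, (η.seq k)† ∘L η.seq k + ∑' k, (ζ.seq k)† ∘L ζ.seq k :=
    (hasSum_interleave (f := fun z => (Sum.elim η.seq ζ.seq z)† ∘L Sum.elim η.seq ζ.seq z)
      η.summable_sq.hasSum ζ.summable_sq.hasSum Equiv.natSumNatEquivNat.symm).tsum_eq
  rw [this]
  exact norm_add_le _ _

theorem omegaMap_interleave (A : Submodule ℂ (H →L[ℂ] H)) (η ζ : SeqInf E) (η' ζ' : SeqInf F) :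
    omegaMap A (η.interleave ζ) (η'.interleave ζ') = omegaMap A η η' + omegaMap A ζ ζ' := by
  ext1 T
  have h : HasSum ((fun z : ℕ ⊕ ℕ => (Sum.elim η.seq ζ.seq z)† ∘L (T : H →L[ℂ] H) ∘L
      Sum.elim η'.seq ζ'.seq z) ∘ Equiv.natSumNatEquivNat.symm)
      (omegaMap A η η' T + omegaMap A ζ ζ' T) :=
    hasSum_interleave (f := fun z => (Sum.elim η.seq ζ.seq z)† ∘L (T : H →L[ℂ] H) ∘L
      Sum.elim η'.seq ζ'.seq z) (η.summable η' T).hasSum (ζ.summable ζ' T).hasSum _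
  exact h.tsum_eq

theorem omegaMap_scale (A : Submodule ℂ (H →L[ℂ] H)) (r : ℂ) (η : SeqInf E) (η' : SeqInf F) :
    omegaMap A η (η'.scale r) = r • omegaMap A η η' := by
  ext1 T
  change omegaMap A η (η'.scale r) T = r • omegaMap A η η' T
  rw [omegaMap_apply, omegaMap_apply, ← (η.summable η' T).tsum_const_smul]
  refine tsum_congr fun k => ?_
  have := adjoint_smul_comp 1 r (η.seq k) (η'.seq k) T
  rwa [one_smul, star_one, one_mul] at this

theorem omegaMap_scale_scale (A : Submodule ℂ (H →L[ℂ] H)) (t : ℝ) (ht : t ≠ 0) (η : SeqInf E)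
    (η' : SeqInf F) :
    omegaMap A (η.scale (t : ℂ)) (η'.scale ((t⁻¹ : ℝ) : ℂ)) = omegaMap A η η' := by
  ext1 T
  rw [omegaMap_apply, omegaMap_apply]
  refine tsum_congr fun k => (adjoint_smul_comp _ _ (η.seq k) (η'.seq k) T).trans ?_
  have : star (t : ℂ) * ((t⁻¹ : ℝ) : ℂ) = 1 := by
    rw [← starRingEnd_apply, Complex.conj_ofReal, ← Complex.ofReal_mul, mul_inv_cancel₀ ht,
      Complex.ofReal_one]
  rw [this, one_smul]

theorem adjoint_zero_comp (T : H →L[ℂ] H) :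
    (0 : K →L[ℂ] H)† ∘L T ∘L (0 : K →L[ℂ] H) = 0 := by
  rw [map_zero, ContinuousLinearMap.zero_comp]

/-- The zero sequence. -/
def SeqInf.zero (E : Submodule ℂ (K →L[ℂ] H)) : SeqInf E :=
  ⟨fun _ => 0, fun _ => E.zero_mem,
    summable_zero.congr fun _ => (adjoint_zero_comp (ContinuousLinearMap.id ℂ H)).symm⟩

theorem omegaMap_zero (A : Submodule ℂ (H →L[ℂ] H)) :
    omegaMap A (SeqInf.zero E) (SeqInf.zero F) = 0 := by
  ext1 T
  exact (tsum_congr fun k => adjoint_zero_comp (T : H →L[ℂ] H)).trans tsum_zero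

theorem SeqInf.norm_zero : ‖SeqInf.zero E‖ = 0 := by
  have h : ∑' k, ((SeqInf.zero E).seq k)† ∘L (SeqInf.zero E).seq k = 0 :=
    (tsum_congr fun k => adjoint_zero_comp (ContinuousLinearMap.id ℂ H)).trans tsum_zero
  have h2 := (SeqInf.zero E).norm_sq
  rw [h, _root_.norm_zero] at h2
  exact pow_eq_zero_iff two_ne_zero |>.1 h2

/-- `Ω_{E,F}(A)` as a subspace of the space of bounded linear maps `A → ℒ(𝔎)`. -/
def omegaSubmodule (A : Submodule ℂ (H →L[ℂ] H)) (E F : Submodule ℂ (K →L[ℂ] H)) :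
    Submodule ℂ (A →L[ℂ] (K →L[ℂ] K)) where
  carrier := {φ | ∃ (η : SeqInf E) (η' : SeqInf F), φ = omegaMap A η η'}
  add_mem' := by
    rintro _ _ ⟨η, η', rfl⟩ ⟨ζ, ζ', rfl⟩
    exact ⟨η.interleave ζ, η'.interleave ζ', (omegaMap_interleave A η ζ η' ζ').symm⟩
  zero_mem' := ⟨SeqInf.zero E, SeqInf.zero F, (omegaMap_zero A).symm⟩
  smul_mem' := by
    rintro r _ ⟨η, η', rfl⟩
    exact ⟨η, η'.scale r, (omegaMap_scale A r η η').symm⟩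

/-- The space `Ω_{E,F}(A) = {ω_{η,η'} | η ∈ E^∞, η' ∈ F^∞}`. -/
def Omega (A : Submodule ℂ (H →L[ℂ] H)) (E F : Submodule ℂ (K →L[ℂ] H)) : Type (max u v) :=
  omegaSubmodule A E F

variable {A : Submodule ℂ (H →L[ℂ] H)}

instance : AddCommGroup (omegaSubmodule A E F) :=
  Submodule.addCommGroup (R := ℂ) (M := A →L[ℂ] (K →L[ℂ] K)) (omegaSubmodule A E F)

instance : AddCommGroup (Omega A E F) := inferInstanceAs (AddCommGroup (omegaSubmodule A E F))

instance : Module ℂ (Omega A E F) := inferInstanceAs (Module ℂ (omegaSubmodule A E F))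

/-- The bounded linear map `A → ℒ(𝔎)` underlying an element of `Ω_{E,F}(A)`. -/
def Omega.toCLM : Omega A E F →ₗ[ℂ] (A →L[ℂ] (K →L[ℂ] K)) := (omegaSubmodule A E F).subtype

/-- The element `ω_{η,η'}` of `Ω_{E,F}(A)`. -/
def omega (A : Submodule ℂ (H →L[ℂ] H)) (η : SeqInf E) (η' : SeqInf F) : Omega A E F :=
  ⟨omegaMap A η η', η, η', rfl⟩

/-- `‖ω‖ = inf {‖η‖‖η'‖ | ω = ω_{η,η'}}`. -/
def Omega.norm (φ : Omega A E F) : ℝ :=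
  sInf {r | ∃ (η : SeqInf E) (η' : SeqInf F), φ = omega A η η' ∧ r = ‖η‖ * ‖η'‖}

theorem Omega.bddBelow (φ : Omega A E F) :
    BddBelow {r | ∃ (η : SeqInf E) (η' : SeqInf F), φ = omega A η η' ∧ r = ‖η‖ * ‖η'‖} :=
  ⟨0, by rintro _ ⟨η, η', _, rfl⟩; exact mul_nonneg η.norm_nonneg η'.norm_nonneg⟩

theorem Omega.nonempty (φ : Omega A E F) :
    {r | ∃ (η : SeqInf E) (η' : SeqInf F), φ = omega A η η' ∧ r = ‖η‖ * ‖η'‖}.Nonempty := by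
  obtain ⟨φ, η, η', rfl⟩ := φ
  exact ⟨_, η, η', rfl, rfl⟩

theorem Omega.norm_le_of_eq {φ : Omega A E F} {η : SeqInf E} {η' : SeqInf F}
    (h : φ = omega A η η') : φ.norm ≤ ‖η‖ * ‖η'‖ := csInf_le φ.bddBelow ⟨η, η', h, rfl⟩

theorem Omega.norm_nonneg (φ : Omega A E F) : 0 ≤ φ.norm :=
  le_csInf φ.nonempty (by rintro _ ⟨η, η', _, rfl⟩; exact mul_nonneg η.norm_nonneg η'.norm_nonneg)

theorem Omega.norm_toCLM_le (φ : Omega A E F) : ‖φ.toCLM‖ ≤ φ.norm :=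
  le_csInf φ.nonempty (by rintro _ ⟨η, η', rfl, rfl⟩; exact norm_omegaMap_le A η η')

theorem Omega.exists_balanced (φ : Omega A E F) {r : ℝ} (h : φ.norm < r) :
    ∃ (η : SeqInf E) (η' : SeqInf F), φ = omega A η η' ∧ ‖η‖ ^ 2 ≤ r ∧ ‖η'‖ ^ 2 ≤ r := by
  obtain ⟨_, ⟨η, η', rfl, rfl⟩, hlt⟩ := exists_lt_of_csInf_lt φ.nonempty h
  have hr : 0 < r := lt_of_le_of_lt (Omega.norm_nonneg _) h
  have ha := η.norm_nonneg
  have hb := η'.norm_nonneg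
  obtain ⟨t, ht, h1, h2⟩ : ∃ t : ℝ, 0 < t ∧ t ^ 2 * ‖η‖ ^ 2 ≤ r ∧ ‖η'‖ ^ 2 ≤ r * t ^ 2 := by
    rcases ha.eq_or_lt with h0 | h0
    · refine ⟨√(‖η'‖ ^ 2 / r + 1), by positivity, ?_, ?_⟩
      · rw [← h0]; simpa using hr.le
      · rw [Real.sq_sqrt (by positivity)]
        field_simp
        linarith
    · refine ⟨√r / ‖η‖, by positivity, ?_, ?_⟩
      · rw [div_pow, Real.sq_sqrt hr.le]
        field_simp
        exact le_refl _
      · rw [div_pow, Real.sq_sqrt hr.le, mul_div_assoc', le_div_iff₀ (by positivity)]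
        nlinarith [mul_nonneg ha hb]
  refine ⟨η.scale t, η'.scale (t⁻¹ : ℝ), ?_, ?_, ?_⟩
  · exact Subtype.ext (omegaMap_scale_scale A t ht.ne' η η').symm
  · rw [SeqInf.norm_scale, mul_pow]
    simpa using h1
  · rw [SeqInf.norm_scale, mul_pow]
    simp only [Complex.norm_real, norm_inv, Real.norm_eq_abs, sq_abs, inv_pow]
    rw [inv_mul_le_iff₀ (by positivity)]
    linarith

/-- The norm of `Ω_{E,F}(A)`. -/
def Omega.addGroupNorm (A : Submodule ℂ (H →L[ℂ] H)) (E F : Submodule ℂ (K →L[ℂ] H)) :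
    AddGroupNorm (Omega A E F) where
  toFun := Omega.norm
  map_zero' := by
    refine le_antisymm ?_ (Omega.norm_nonneg _)
    have h : (0 : Omega A E F) = omega A (SeqInf.zero E) (SeqInf.zero F) := by
      exact Subtype.ext (omegaMap_zero A).symm
    refine (Omega.norm_le_of_eq h).trans (le_of_eq ?_)
    rw [SeqInf.norm_zero, zero_mul]
  add_le' := fun φ ψ => by
    refine le_of_forall_pos_le_add fun ε hε => ?_
    obtain ⟨η, η', rfl, h1, h2⟩ := φ.exists_balanced (r := φ.norm + ε / 2) (by linarith)
    obtain ⟨ζ, ζ', rfl, h3, h4⟩ := ψ.exists_balanced (r := ψ.norm + ε / 2) (by linarith)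
    have h : omega A η η' + omega A ζ ζ' = omega A (η.interleave ζ) (η'.interleave ζ') :=
      Subtype.ext (omegaMap_interleave A η ζ η' ζ').symm
    refine (Omega.norm_le_of_eq h).trans ?_
    have h5 := SeqInf.norm_interleave_sq_le η ζ
    have h6 := SeqInf.norm_interleave_sq_le η' ζ'
    nlinarith [sq_nonneg (‖η.interleave ζ‖ - ‖η'.interleave ζ'‖)]
  neg' := fun φ => by
    have key : ∀ φ : Omega A E F, (-φ).norm ≤ φ.norm := by
      intro φ
      refine le_csInf φ.nonempty ?_
      rintro _ ⟨η, η', rfl, rfl⟩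
      have h : -omega A η η' = omega A η (η'.scale (-1)) := by
        refine Subtype.ext ?_
        exact (neg_one_smul ℂ (omegaMap A η η')).symm.trans (omegaMap_scale A (-1) η η').symm
      refine (Omega.norm_le_of_eq h).trans (le_of_eq ?_)
      rw [SeqInf.norm_scale]
      simp
    refine le_antisymm (key φ) ?_
    simpa using key (-φ)
  eq_zero_of_map_eq_zero' := fun φ h => by
    have h1 : ‖φ.toCLM‖ ≤ 0 := φ.norm_toCLM_le.trans h.le
    have h2 : φ.toCLM = 0 := (norm_le_zero_iff (E := A →L[ℂ] (K →L[ℂ] K))).1 h1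
    exact Subtype.ext h2

instance : NormedAddCommGroup (Omega A E F) :=
  (Omega.addGroupNorm A E F).toNormedAddCommGroup

instance : NormedSpace ℂ (Omega A E F) where
  norm_smul_le := fun r φ => by
    show (r • φ).norm ≤ ‖r‖ * φ.norm
    refine le_of_forall_pos_le_add fun ε hε => ?_
    obtain ⟨_, ⟨η, η', hφ, rfl⟩, hlt⟩ := exists_lt_of_csInf_lt φ.nonempty
      (lt_add_of_pos_right φ.norm (show 0 < ε / (‖r‖ + 1) by positivity))
    have h : r • φ = omega A η (η'.scale r) := by
      rw [hφ]
      exact Subtype.ext (omegaMap_scale A r η η').symm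
    refine (Omega.norm_le_of_eq h).trans ?_
    rw [SeqInf.norm_scale]
    have h3 : ‖r‖ * (ε / (‖r‖ + 1)) ≤ ε := by
      rw [mul_div_assoc', div_le_iff₀ (by positivity)]
      nlinarith [_root_.norm_nonneg r]
    nlinarith [_root_.norm_nonneg r, mul_le_mul_of_nonneg_left hlt.le (_root_.norm_nonneg r)]

end Omega

section ProjectiveTensor
open scoped TensorProduct

/-- The projective tensor square `E ⊗̂ E` of a normed space `E`, the completion of the algebraic
tensor square with respect to the projective norm. -/
abbrev ProjTensorSq (E : Type w) [NormedAddCommGroup E] [NormedSpace ℂ E] : Type w :=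
  UniformSpace.Completion (⨂[ℂ] _ : Fin 2, E)

/-- The elementary tensor `x ⊗ y` in `E ⊗̂ E`. -/
def projTmul {E : Type w} [NormedAddCommGroup E] [NormedSpace ℂ E] (x y : E) : ProjTensorSq E :=
  ((PiTensorProduct.tprod ℂ ![x, y] : ⨂[ℂ] _ : Fin 2, E) : UniformSpace.Completion _)

/-- The bilinear map `m` turns `E` into a Banach algebra: `E` is complete, `m` is associative and
`‖m x y‖ ≤ ‖x‖‖y‖`. -/
structure IsBanachAlgebra (E : Type w) [NormedAddCommGroup E] [NormedSpace ℂ E]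
    (m : E →ₗ[ℂ] E →ₗ[ℂ] E) : Prop where
  complete : CompleteSpace E
  assoc : ∀ x y z, m (m x y) z = m x (m y z)
  norm_le : ∀ x y, ‖m x y‖ ≤ ‖x‖ * ‖y‖

end ProjectiveTensor

section Triples
variable {K : Type u} [NormedAddCommGroup K] [InnerProductSpace ℂ K] [CompleteSpace K]

/-- The structure `(β̂, α, β)` of a `C*`-`(𝔟†,𝔟,𝔟†)`-module on the Hilbert space `H`. -/
structure CTriple (b : CBase K) (H : Type v) [NormedAddCommGroup H] [InnerProductSpace ℂ H]
    [CompleteSpace H] where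
  βh : CMod b.dagger H
  α : CMod b H
  β : CMod b.dagger H
  βhα : Compat βh α
  αβh : Compat α βh
  βhβ : Compat βh β
  ββh : Compat β βh
  αβ : Compat α β
  βα : Compat β α

/-- `T E = E'`, where `T E = {T θ | θ ∈ E}`. -/
def MapsOnto {Y Z : Type*} [NormedAddCommGroup Y] [InnerProductSpace ℂ Y] [CompleteSpace Y]
    [NormedAddCommGroup Z] [InnerProductSpace ℂ Z] [CompleteSpace Z] {c : CBase K}
    (T : Y →L[ℂ] Z) (E : CMod c Y) (E' : CMod c Z) : Prop :=
  {θ | ∃ θ₀ ∈ E.space, θ = T ∘L θ₀} = (E'.space : Set (K →L[ℂ] Z))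

variable {H : Type v} [NormedAddCommGroup H] [InnerProductSpace ℂ H] [CompleteSpace H]
variable {b : CBase K}

namespace CTriple
variable (t : CTriple b H)

/-- `H ⊗ H` formed with respect to `β̂` and `α`, the domain of `V`. -/
abbrev Source : Type (max u v) := RTP t.βh t.α

/-- `H ⊗ H` formed with respect to `α` and `β`, the range of `V`. -/
abbrev Range : Type (max u v) := RTP t.α t.β

/-- `α ◁ α` on the source. -/
abbrev sLα : CMod b t.Source := triL t.βh t.α t.α t.βhα
/-- `β ◁ α` on the source. -/
abbrev sLβ : CMod b.dagger t.Source := triL t.βh t.α t.β t.βhβ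
/-- `β̂ ▷ β` on the source. -/
abbrev sRβ : CMod b.dagger t.Source := triR t.βh t.α t.β t.αβ
/-- `β̂ ▷ β̂` on the source. -/
abbrev sRβh : CMod b.dagger t.Source := triR t.βh t.α t.βh t.αβh
/-- `α ▷ α` on the range. -/
abbrev rRα : CMod b t.Range := triR t.α t.β t.α t.βα
/-- `α ▷ β̂` on the range. -/
abbrev rRβh : CMod b.dagger t.Range := triR t.α t.β t.βh t.ββh
/-- `β̂ ◁ β` on the range. -/
abbrev rLβh : CMod b.dagger t.Range := triL t.α t.β t.βh t.αβh
/-- `β ◁ β` on the range. -/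
abbrev rLβ : CMod b.dagger t.Range := triL t.α t.β t.β t.αβ

/-- The composition `V₂₃ V₁₂` along the left-hand side of the pentagon diagram. -/
def pentagonLeft (V : t.Source →L[ℂ] t.Range) : RTP t.sRβh t.α →L[ℂ] RTP t.α t.rLβ :=
  tensR t.α t.sLβ t.rLβ V ∘L
    assoc t.α t.β t.βh t.α t.ββh t.βhβ ∘L
    tensL t.sRβh t.rRβh t.α V

/-- The composition `V₁₂ V₁₃ V₂₃` along the right-hand side of the pentagon diagram, where
`V₁₃ = Σ₂₃ V₁₂ Σ₂₃`. -/
def pentagonRight (V : t.Source →L[ℂ] t.Range) : RTP t.sRβh t.α →L[ℂ] RTP t.α t.rLβ :=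
  assoc t.α t.β t.α t.β t.βα t.αβ ∘L
    tensL t.sLα t.rRα t.β V ∘L
    swap23 t.α t.β t.βh t.α t.αβh t.βhα ∘L
    tensL t.sRβ t.rLβh t.α V ∘L
    assocSymm t.βh t.α t.β t.α t.αβ t.βα ∘L
    tensR t.βh t.rRα (triL t.β t.α t.α t.βα) (flip t.α t.β) ∘L
    tensR t.βh t.sLα t.rRα V ∘L
    assoc t.βh t.α t.βh t.α t.αβh t.βhα

end CTriple

/-- A `C*`-pseudo-multiplicative unitary: a `C*`-`(𝔟†,𝔟,𝔟†)`-module `(H, β̂, α, β)` with a unitary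
`V` satisfying the intertwining relations and the pentagon equation. -/
structure PMU (b : CBase K) (H : Type v) [NormedAddCommGroup H] [InnerProductSpace ℂ H]
    [CompleteSpace H] extends CTriple b H where
  V : toCTriple.Source ≃ₗᵢ[ℂ] toCTriple.Range
  map_α : MapsOnto (V.toContinuousLinearEquiv : _ →L[ℂ] _) toCTriple.sLα toCTriple.rRα
  map_βhβ : MapsOnto (V.toContinuousLinearEquiv : _ →L[ℂ] _) toCTriple.sRβ toCTriple.rLβh
  map_βh : MapsOnto (V.toContinuousLinearEquiv : _ →L[ℂ] _) toCTriple.sRβh toCTriple.rRβh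
  map_β : MapsOnto (V.toContinuousLinearEquiv : _ →L[ℂ] _) toCTriple.sLβ toCTriple.rLβ
  pentagon : toCTriple.pentagonLeft (V.toContinuousLinearEquiv : _ →L[ℂ] _) =
    toCTriple.pentagonRight (V.toContinuousLinearEquiv : _ →L[ℂ] _)

/-- The commutant `ρ_E(𝔅†)'`. -/
def CMod.commutant (E : CMod b H) : Submodule ℂ (H →L[ℂ] H) :=
  (Subalgebra.centralizer ℂ (Set.range E.rho)).toSubmodule

namespace PMU
variable (V : PMU b H)

/-- `V` as a bounded operator. -/
def op : V.Source →L[ℂ] V.Range := V.V.toContinuousLinearEquiv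

/-- The commutant of `ρ_β̂(𝔅) ⊗ ρ_β̂(𝔅)` on the range of `V`. -/
def rangeCommutant : Submodule ℂ (V.Range →L[ℂ] V.Range) :=
  (Subalgebra.centralizer ℂ {T | ∃ x y : b.B,
    T = tensL V.α V.α V.β (V.βh.rho x) ∘L tensR V.α V.β V.β (V.βh.rho y)}).toSubmodule

/-- The commutant of `ρ_β(𝔅) ⊗ ρ_β(𝔅)` on the source of `V`. -/
def sourceCommutant : Submodule ℂ (V.Source →L[ℂ] V.Source) :=
  (Subalgebra.centralizer ℂ {T | ∃ x y : b.B,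
    T = tensL V.βh V.βh V.α (V.β.rho x) ∘L tensR V.βh V.α V.α (V.β.rho y)}).toSubmodule

/-- `Δ_V(z) = V(z ⊗ Id)V*`. -/
def delta (z : H →L[ℂ] H) : V.Range →L[ℂ] V.Range :=
  V.op ∘L tensL V.βh V.βh V.α z ∘L V.op†

/-- `Δ̂_V(y) = V*(Id ⊗ y)V`. -/
def deltaHat (y : H →L[ℂ] H) : V.Source →L[ℂ] V.Source :=
  V.op† ∘L tensR V.α V.β V.β y ∘L V.op

/-- The operator `⟨ξ|₂ V |η⟩₂`, `ξ ∈ β`, `η ∈ α`. -/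
def sliceHat (ξ : V.β.space) (η : V.α.space) : H →L[ℂ] H :=
  (ket2 V.α V.β ξ)† ∘L V.op ∘L ket2 V.βh V.α η

/-- The operator `⟨η|₁ V |ζ⟩₁`, `η ∈ α`, `ζ ∈ β̂`. -/
def slice (η : V.α.space) (ζ : V.βh.space) : H →L[ℂ] H :=
  (ket1 V.α V.β η)† ∘L V.op ∘L ket1 V.βh V.α ζ

/-- `Â_V = [⟨β|₂ V |α⟩₂]`. -/
def legHat : Submodule ℂ (H →L[ℂ] H) := cspan {T | ∃ ξ η, T = V.sliceHat ξ η}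

/-- `A_V = [⟨α|₁ V |β̂⟩₁]`. -/
def leg : Submodule ℂ (H →L[ℂ] H) := cspan {T | ∃ η ζ, T = V.slice η ζ}

/-- `Ω̃_{β,α} = Ω_{β,α}(ρ_β̂(𝔅)')`. -/
abbrev OmegaHat : Type (max u v) := Omega V.βh.commutant V.β.space V.α.space

/-- `Ω̃_{α,β̂} = Ω_{α,β̂}(ρ_β(𝔅)')`. -/
abbrev OmegaDual : Type (max u v) := Omega V.β.commutant V.α.space V.βh.space

/-- The Fourier algebra `Â⁰_V`: all sums `∑ₙ ⟨ξₙ|₂ V |ηₙ⟩₂` with `ξ ∈ β^∞`, `η ∈ α^∞`. -/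
def fourier : Set (H →L[ℂ] H) :=
  {T | ∃ (ξ : SeqInf V.β.space) (η : SeqInf V.α.space), HasSum (fun n => V.sliceHat (ξ.el n) (η.el n)) T}

/-- The dual Fourier algebra `A⁰_V`: all sums `∑ₙ ⟨ηₙ|₁ V |ζₙ⟩₁` with `η ∈ α^∞`, `ζ ∈ β̂^∞`. -/
def dualFourier : Set (H →L[ℂ] H) :=
  {T | ∃ (η : SeqInf V.α.space) (ζ : SeqInf V.βh.space), HasSum (fun n => V.slice (η.el n) (ζ.el n)) T}

end PMU
end Triples

end CPMU
end

/-! The whole theorem rests on slicing. On `H ⊗ H` one has `|η⟩₁ τ = |τ⟩₂ η`, both being the map `ζ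
↦ η ⊗ ζ ⊗ τ`. The value of `ω_{ξ,η} ⊠ ω_{ξ',η'}` at `T` is the double sum `∑ ξₘ* ⟨ξ'ₙ|₂ T |ηₘ⟩₁
η'ₙ`. Summing over `m` alone gives an operator whose product with any `τ` is `ω_{ξ,η}(⟨ξ'ₙ|₂ T
|τ⟩₂)`, by the exchange relation. Since the `τ` have jointly dense range, this inner sum depends
only, and linearly, on the functional `ω_{ξ,η}` and not on its representation; the sum over `n` is
treated symmetrically. This makes `⊠` well defined, bilinear and contractive
(`SliceData.sumLeft_comp`, `SliceData.comp_sumRight`, `SliceData.norm_boxFun_le`).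

The functional `φ ∘ Δ_V` must again be of the form `ω_{ξ,η}`. The relations for `V` place `V*θₙ` and
`V*θ'ₙ` in closed spans `[|α⟩₂ β]` and `[|α⟩₂ α]`, and `z ⊗ Id` passes through `|α⟩₂` as `z`. For
finite sums `∑ |kₐ⟩₂ fₐ` the Gram matrix `⟨kₐ|₂|k_b⟩₂` has entries in `ρ_β̂(𝔅)`, which commute with
`z` and preserve `β` and `α`. Its square root `S` inherits both properties, and `∑ₐ Sₘₐ fₐ` is a
finite family in the module with the same functional and no larger norm
(`exists_fin_of_mem_pushSpan`). Approximation and the completeness of `Ω` extend this to the closed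
spans (`exists_omega_push`). Completeness itself comes from concatenating the representing sequences
of a series.

Every functional is a norm convergent series of rank-one functionals `T ↦ ξ*Tη`, so algebraic
identities need only be checked on these. Associativity follows from coassociativity: by the
pentagon equation, conjugating `z ⊗ Id ⊗ Id` by `V₂₃V₁₂` agrees with conjugating it by `V₁₂V₁₃`,
because `V₂₃` commutes with `z ⊗ Id ⊗ Id`. A single operator on three legs therefore has both
iterated coproducts as its slices (`PMU.exists_delta_delta`).

For the representation, `σ*⟨ξ|₂V|η⟩₂ζ = ξ*⟨σ|₁V|ζ⟩₁η`: the matrix entries of `π̂(ω)` are the values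
of `ω` on the slices `⟨σ|₁V|ζ⟩₁`, which lie in the domain of `ω`. Multiplicativity is the pentagon
equation again, in the form `Δ_V(⟨σ|₁V|ζ⟩₁) = ⟨σ|₁V₁₂V₁₃|ζ⟩₁` (`PMU.delta_slice_apply`). The dual
half has the same structure with the roles of the legs exchanged, so both are instances of
`FourierData.main`. -/

noncomputable section
namespace CPMU
universe u v w

/-! ### Families of operators with bounded or uniformly small square sums. -/

section SquareSums
variable {X Y Z : Type*} {ι κ : Type*}
  [NormedAddCommGroup X] [InnerProductSpace ℂ X] [CompleteSpace X]
  [NormedAddCommGroup Y] [InnerProductSpace ℂ Y] [CompleteSpace Y]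
  [NormedAddCommGroup Z] [InnerProductSpace ℂ Z] [CompleteSpace Z]

/-- `∑ₖ ‖x k v‖² ≤ a² ‖v‖²` for all `v`. -/
def RowBound (x : ι → X →L[ℂ] Y) (a : ℝ) : Prop :=
  ∀ (s : Finset ι) (v : X), ∑ k ∈ s, ‖x k v‖ ^ 2 ≤ a ^ 2 * ‖v‖ ^ 2

/-- The tails of `∑ₖ ‖x k v‖²` are small, uniformly for `v` in the unit ball. -/
def SqSmall (x : ι → X →L[ℂ] Y) : Prop :=
  ∀ ε : ℝ, 0 < ε → ∃ s : Finset ι, ∀ t : Finset ι, Disjoint t s → ∀ v : X,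
    ∑ k ∈ t, ‖x k v‖ ^ 2 ≤ ε ^ 2 * ‖v‖ ^ 2

theorem re_inner_sum_adjoint_comp (x : ι → X →L[ℂ] Y) (s : Finset ι) (v : X) :
    RCLike.re ⟪v, (∑ k ∈ s, (x k)† ∘L x k) v⟫_ℂ = ∑ k ∈ s, ‖x k v‖ ^ 2 := by
  rw [sum_apply, inner_sum, map_sum]
  simp only [ContinuousLinearMap.comp_apply, ContinuousLinearMap.adjoint_inner_right,
    inner_self_eq_norm_sq]

theorem re_inner_le' (S : X →L[ℂ] X) (v : X) : RCLike.re ⟪v, S v⟫_ℂ ≤ ‖S‖ * ‖v‖ ^ 2 := by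
  calc RCLike.re ⟪v, S v⟫_ℂ ≤ ‖v‖ * ‖S v‖ := re_inner_le_norm _ _
    _ ≤ ‖v‖ * (‖S‖ * ‖v‖) := by gcongr; exact S.le_opNorm v
    _ = _ := by ring

theorem sum_norm_sq_le (x : ι → X →L[ℂ] Y) (s : Finset ι) (v : X) :
    ∑ k ∈ s, ‖x k v‖ ^ 2 ≤ ‖∑ k ∈ s, (x k)† ∘L x k‖ * ‖v‖ ^ 2 := by
  rw [← re_inner_sum_adjoint_comp]
  exact re_inner_le' _ _

/-- Pairing the value `w` at `v` with itself leaves `∑ ‖xₖ w‖ ‖yₖ v‖`, which the Cauchy–Schwarz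
inequality bounds by `a‖w‖ · b‖v‖`; dividing by `‖w‖` gives the claim. Domains of `x` and `y` may
differ, as needed for mixed sums such as `SliceData.sumLeft`. -/
theorem norm_sum_adjoint_comp_le {W : Type*} [NormedAddCommGroup W] [InnerProductSpace ℂ W]
    [CompleteSpace W] (x : ι → X →L[ℂ] Y) (y : ι → W →L[ℂ] Z) (T : Z →L[ℂ] Y) (s : Finset ι)
    {a b : ℝ} (ha : 0 ≤ a) (hb : 0 ≤ b) (hx : ∀ v, ∑ k ∈ s, ‖x k v‖ ^ 2 ≤ a ^ 2 * ‖v‖ ^ 2)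
    (hy : ∀ v, ∑ k ∈ s, ‖y k v‖ ^ 2 ≤ b ^ 2 * ‖v‖ ^ 2) :
    ‖∑ k ∈ s, (x k)† ∘L T ∘L y k‖ ≤ a * b * ‖T‖ := by
  refine ContinuousLinearMap.opNorm_le_bound _ (by positivity) fun v => ?_
  set w := (∑ k ∈ s, (x k)† ∘L T ∘L y k) v with hw
  have h1 : ‖w‖ ^ 2 ≤ ‖T‖ * ((a * ‖w‖) * (b * ‖v‖)) := by
    calc ‖w‖ ^ 2 = RCLike.re ⟪w, (∑ k ∈ s, (x k)† ∘L T ∘L y k) v⟫_ℂ := by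
          rw [← hw, inner_self_eq_norm_sq]
      _ = ∑ k ∈ s, RCLike.re ⟪x k w, T (y k v)⟫_ℂ := by
          rw [sum_apply, inner_sum, map_sum]
          simp only [ContinuousLinearMap.comp_apply, ContinuousLinearMap.adjoint_inner_right]
      _ ≤ ∑ k ∈ s, ‖T‖ * (‖x k w‖ * ‖y k v‖) := by
          refine Finset.sum_le_sum fun k _ => (re_inner_le_norm _ _).trans ?_
          calc _ ≤ ‖x k w‖ * (‖T‖ * ‖y k v‖) := by gcongr; exact T.le_opNorm _
            _ = _ := by ring
      _ = ‖T‖ * ∑ k ∈ s, ‖x k w‖ * ‖y k v‖ := by rw [Finset.mul_sum]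
      _ ≤ ‖T‖ * ((a * ‖w‖) * (b * ‖v‖)) := by
          gcongr
          refine abs_le_of_sq_le_sq' ?_ (by positivity) |>.2
          calc _ ≤ (∑ k ∈ s, ‖x k w‖ ^ 2) * (∑ k ∈ s, ‖y k v‖ ^ 2) :=
                Finset.sum_mul_sq_le_sq_mul_sq _ _ _
            _ ≤ (a ^ 2 * ‖w‖ ^ 2) * (b ^ 2 * ‖v‖ ^ 2) := by
                gcongr
                · exact hx w
                · exact hy v
            _ = _ := by ring
  rcases (norm_nonneg w).eq_or_lt with h0 | h0
  · rw [← h0]; positivity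
  · refine le_of_mul_le_mul_right ?_ h0
    calc ‖w‖ * ‖w‖ = ‖w‖ ^ 2 := by ring
      _ ≤ _ := h1
      _ = _ := by ring

theorem exists_pos_mul_lt {a : ℝ} (ha : 0 ≤ a) {ε : ℝ} (hε : 0 < ε) : ∃ δ : ℝ, 0 < δ ∧ a * δ < ε := by
  refine ⟨ε / (a + 1), by positivity, ?_⟩
  rw [mul_div_assoc', div_lt_iff₀ (by positivity)]
  nlinarith

/-- Small tails are needed of one family only: the other contributes the constant `a`. Uniformity of
the tails over the unit ball is what yields convergence in norm rather than strongly. -/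
theorem summable_adjoint_comp {W : Type*} [NormedAddCommGroup W] [InnerProductSpace ℂ W]
    [CompleteSpace W] {x : ι → X →L[ℂ] Y} {y : ι → W →L[ℂ] Z} (T : Z →L[ℂ] Y) {a : ℝ}
    (ha : 0 ≤ a) (hx : RowBound x a) (hy : SqSmall y) :
    Summable fun k => (x k)† ∘L T ∘L y k := by
  rw [summable_iff_vanishing_norm]
  intro ε hε
  obtain ⟨δ, hδ, hδε⟩ := exists_pos_mul_lt (a := a * ‖T‖) (by positivity) hε
  obtain ⟨s, hs⟩ := hy δ hδ
  refine ⟨s, fun t ht => lt_of_le_of_lt ?_ hδε⟩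
  refine (norm_sum_adjoint_comp_le x y T t ha hδ.le (hx t) (hs t ht)).trans (le_of_eq ?_)
  ring

theorem norm_tsum_adjoint_comp_le {W : Type*} [NormedAddCommGroup W] [InnerProductSpace ℂ W]
    [CompleteSpace W] {x : ι → X →L[ℂ] Y} {y : ι → W →L[ℂ] Z} (T : Z →L[ℂ] Y) {a b : ℝ}
    (ha : 0 ≤ a) (hb : 0 ≤ b) (hx : RowBound x a) (hy : RowBound y b) (hy' : SqSmall y) :
    ‖∑' k, (x k)† ∘L T ∘L y k‖ ≤ a * b * ‖T‖ := by
  refine le_of_tendsto (summable_adjoint_comp T ha hx hy').hasSum.norm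
    (Filter.Eventually.of_forall fun s => ?_)
  exact norm_sum_adjoint_comp_le x y T s ha hb (hx s) (hy s)

/-- Converse of `SqSmall.of_summable`. Norm convergence of `∑ xₖ*xₖ` is thus interchangeable with a
tail condition on vectors, which is easier to verify for double families. -/
theorem SqSmall.summable_sq {x : ι → X →L[ℂ] Y} (hx : SqSmall x) :
    Summable fun k => (x k)† ∘L x k := by
  rw [summable_iff_vanishing_norm]
  intro ε hε
  -- The resulting estimate is not strict, so `ε / 2` leaves the room needed for `< ε`.
  obtain ⟨s, hs⟩ := hx (√(ε / 2)) (by positivity)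
  refine ⟨s, fun t ht => ?_⟩
  have := norm_sum_adjoint_comp_le x x (ContinuousLinearMap.id ℂ Y) t (Real.sqrt_nonneg _)
    (Real.sqrt_nonneg _) (hs t ht) (hs t ht)
  rw [Real.mul_self_sqrt (by positivity)] at this
  have h1 : ‖ContinuousLinearMap.id ℂ Y‖ ≤ 1 := ContinuousLinearMap.norm_id_le
  calc _ ≤ ε / 2 * ‖ContinuousLinearMap.id ℂ Y‖ := this
    _ ≤ ε / 2 * 1 := by gcongr
    _ < ε := by linarith

theorem SqSmall.of_summable {x : ι → X →L[ℂ] Y} (hx : Summable fun k => (x k)† ∘L x k) :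
    SqSmall x := by
  intro ε hε
  obtain ⟨s, hs⟩ := summable_iff_vanishing_norm.1 hx (ε ^ 2) (by positivity)
  refine ⟨s, fun t ht v => (sum_norm_sq_le x t v).trans ?_⟩
  gcongr
  exact (hs t ht).le

theorem RowBound.comp_equiv {x : ι → X →L[ℂ] Y} {a : ℝ} (hx : RowBound x a) (e : κ ≃ ι) :
    RowBound (x ∘ e) a := fun s v => by
  have := hx (s.map e.toEmbedding) v
  rwa [Finset.sum_map] at this

theorem SqSmall.comp_equiv {x : ι → X →L[ℂ] Y} (hx : SqSmall x) (e : κ ≃ ι) :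
    SqSmall (x ∘ e) := fun ε hε => by
  obtain ⟨s, hs⟩ := hx ε hε
  refine ⟨s.map e.symm.toEmbedding, fun t ht v => ?_⟩
  have := hs (t.map e.toEmbedding) ?_ v
  · rwa [Finset.sum_map] at this
  · rw [Finset.disjoint_left] at ht ⊢
    intro a ha has
    rw [Finset.mem_map_equiv] at ha
    exact ht ha (by rw [Finset.mem_map_equiv]; simpa using has)

/-- A finite set of index pairs is enlarged to the product of its two projections; the sum over the
second index is then bounded by `k` at the vector `x m v`, and the sum over the first index by `x`.
-/
theorem RowBound.comp_prod {x : ι → X →L[ℂ] Y} {k : κ → Y →L[ℂ] Z} {a b : ℝ}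
    (hk : RowBound k b) (hx : RowBound x a) :
    RowBound (fun p : ι × κ => k p.2 ∘L x p.1) (b * a) := by
  classical
  intro s v
  calc ∑ p ∈ s, ‖(k p.2 ∘L x p.1) v‖ ^ 2
      ≤ ∑ p ∈ s.image Prod.fst ×ˢ s.image Prod.snd, ‖k p.2 (x p.1 v)‖ ^ 2 :=
        Finset.sum_le_sum_of_subset_of_nonneg Finset.subset_product (fun _ _ _ => by positivity)
    _ = ∑ m ∈ s.image Prod.fst, ∑ n ∈ s.image Prod.snd, ‖k n (x m v)‖ ^ 2 :=
        Finset.sum_product _ _ _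
    _ ≤ ∑ m ∈ s.image Prod.fst, b ^ 2 * ‖x m v‖ ^ 2 :=
        Finset.sum_le_sum fun m _ => hk _ _
    _ ≤ b ^ 2 * (a ^ 2 * ‖v‖ ^ 2) := by
        rw [← Finset.mul_sum]
        gcongr
        exact hx _ _
    _ = _ := by ring

/-- A pair outside `s₁ ×ˢ s₂` has its first index outside `s₁` or its second outside `s₂`. In either
case one factor contributes a small tail and the other its bound. -/
theorem SqSmall.comp_prod {x : ι → X →L[ℂ] Y} {k : κ → Y →L[ℂ] Z} {a b : ℝ} (ha : 0 ≤ a)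
    (hb : 0 ≤ b) (hk : RowBound k b) (hx : RowBound x a) (hk' : SqSmall k) (hx' : SqSmall x) :
    SqSmall (fun p : ι × κ => k p.2 ∘L x p.1) := by
  classical
  intro ε hε
  -- The two parts will contribute `δ²a²` and `b²δ²`, together at most `((a + b)δ)²`.
  obtain ⟨δ, hδ, hδε⟩ := exists_pos_mul_lt (a := a + b) (by positivity) hε
  obtain ⟨s₁, h₁⟩ := hx' δ hδ
  obtain ⟨s₂, h₂⟩ := hk' δ hδ
  refine ⟨s₁ ×ˢ s₂, fun t ht v => ?_⟩
  have hsplit := Finset.sum_filter_add_sum_filter_not t (fun p => p.1 ∈ s₁)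
    (fun p => ‖(k p.2 ∘L x p.1) v‖ ^ 2)
  rw [← hsplit]
  have e1 : ∑ p ∈ t with p.1 ∈ s₁, ‖(k p.2 ∘L x p.1) v‖ ^ 2 ≤ δ ^ 2 * (a ^ 2 * ‖v‖ ^ 2) := by
    set r := t.filter (fun p => p.1 ∈ s₁)
    calc _ ≤ ∑ p ∈ r.image Prod.fst ×ˢ r.image Prod.snd, ‖k p.2 (x p.1 v)‖ ^ 2 :=
          Finset.sum_le_sum_of_subset_of_nonneg Finset.subset_product (fun _ _ _ => by positivity)
      _ = ∑ m ∈ r.image Prod.fst, ∑ n ∈ r.image Prod.snd, ‖k n (x m v)‖ ^ 2 :=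
          Finset.sum_product _ _ _
      _ ≤ ∑ m ∈ r.image Prod.fst, δ ^ 2 * ‖x m v‖ ^ 2 := by
          refine Finset.sum_le_sum fun m _ => h₂ _ ?_ _
          rw [Finset.disjoint_left]
          intro n hn hn2
          obtain ⟨p, hp, rfl⟩ := Finset.mem_image.1 hn
          have hp' := Finset.mem_filter.1 hp
          exact Finset.disjoint_left.1 ht hp'.1 (Finset.mem_product.2 ⟨hp'.2, hn2⟩)
      _ ≤ _ := by
          rw [← Finset.mul_sum]
          gcongr
          exact hx _ _
  have e2 : ∑ p ∈ t with ¬ p.1 ∈ s₁, ‖(k p.2 ∘L x p.1) v‖ ^ 2 ≤ b ^ 2 * (δ ^ 2 * ‖v‖ ^ 2) := by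
    set r := t.filter (fun p => ¬ p.1 ∈ s₁)
    calc _ ≤ ∑ p ∈ r.image Prod.fst ×ˢ r.image Prod.snd, ‖k p.2 (x p.1 v)‖ ^ 2 :=
          Finset.sum_le_sum_of_subset_of_nonneg Finset.subset_product (fun _ _ _ => by positivity)
      _ = ∑ m ∈ r.image Prod.fst, ∑ n ∈ r.image Prod.snd, ‖k n (x m v)‖ ^ 2 :=
          Finset.sum_product _ _ _
      _ ≤ ∑ m ∈ r.image Prod.fst, b ^ 2 * ‖x m v‖ ^ 2 :=
          Finset.sum_le_sum fun m _ => hk _ _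
      _ ≤ _ := by
          rw [← Finset.mul_sum]
          gcongr
          refine h₁ _ ?_ _
          rw [Finset.disjoint_left]
          intro m hm hm2
          obtain ⟨p, hp, rfl⟩ := Finset.mem_image.1 hm
          exact (Finset.mem_filter.1 hp).2 hm2
  have hle : δ ^ 2 * a ^ 2 + b ^ 2 * δ ^ 2 ≤ ε ^ 2 := by
    have : ((a + b) * δ) ^ 2 ≤ ε ^ 2 := by gcongr
    nlinarith [mul_nonneg (mul_nonneg ha hb) (sq_nonneg δ)]
  nlinarith [mul_le_mul_of_nonneg_right hle (sq_nonneg ‖v‖)]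

end SquareSums

/-! ### The norm of `E^∞` through square sums. -/

section SeqInf
variable {K : Type u} [NormedAddCommGroup K] [InnerProductSpace ℂ K] [CompleteSpace K]
variable {H : Type v} [NormedAddCommGroup H] [InnerProductSpace ℂ H] [CompleteSpace H]
variable {E F : Submodule ℂ (K →L[ℂ] H)}

theorem SeqInf.rowBound (η : SeqInf E) : RowBound η.seq ‖η‖ := fun s v => η.sum_le s v

theorem SeqInf.sqSmall (η : SeqInf E) : SqSmall η.seq := SqSmall.of_summable η.summable_sq

/-- With `SeqInf.rowBound` this characterises `‖η‖` as the least row bound, so norm estimates in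
`E^∞` become estimates of finite sums of squares. -/
theorem SeqInf.norm_le_of_rowBound (η : SeqInf E) {a : ℝ} (ha : 0 ≤ a) (h : RowBound η.seq a) :
    ‖η‖ ≤ a := by
  have h1 := norm_tsum_adjoint_comp_le (ContinuousLinearMap.id ℂ H) ha ha h h η.sqSmall
  have h2 : ‖ContinuousLinearMap.id ℂ H‖ ≤ 1 := ContinuousLinearMap.norm_id_le
  refine abs_le_of_sq_le_sq' ?_ ha |>.2
  rw [η.norm_sq]
  calc _ ≤ a * a * ‖ContinuousLinearMap.id ℂ H‖ := h1
    _ ≤ a * a * 1 := by gcongr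
    _ = _ := by ring

/-- The element of `E^∞` given by a square-summable family indexed by a countable set. -/
def SeqInf.ofFamily {ι : Type*} (x : ι → K →L[ℂ] H) (hx : ∀ i, x i ∈ E) (h : SqSmall x)
    (e : ℕ ≃ ι) : SeqInf E :=
  ⟨x ∘ e, fun k => hx (e k), (h.comp_equiv e).summable_sq⟩

theorem SeqInf.norm_ofFamily_le {ι : Type*} (x : ι → K →L[ℂ] H) (hx : ∀ i, x i ∈ E)
    (h : SqSmall x) (e : ℕ ≃ ι) {a : ℝ} (ha : 0 ≤ a) (hb : RowBound x a) :
    ‖SeqInf.ofFamily x hx h e‖ ≤ a :=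
  SeqInf.norm_le_of_rowBound _ ha (hb.comp_equiv e)

/-- Unconditional summation makes the enumeration `e` invisible on the right; this is why an
arbitrary bijection `ℕ × ℕ → ℕ` may be used in the theorem. -/
theorem omegaMap_ofFamily (A : Submodule ℂ (H →L[ℂ] H)) {ι : Type*} (x y : ι → K →L[ℂ] H)
    (hx : ∀ i, x i ∈ E) (hy : ∀ i, y i ∈ F) (h : SqSmall x) (h' : SqSmall y) (e : ℕ ≃ ι) (T : A) :
    omegaMap A (SeqInf.ofFamily x hx h e) (SeqInf.ofFamily y hy h' e) T
      = ∑' i, (x i)† ∘L (T : H →L[ℂ] H) ∘L y i := by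
  rw [omegaMap_apply]
  exact e.tsum_eq (fun i => (x i)† ∘L (T : H →L[ℂ] H) ∘L y i)

end SeqInf

/-! ### Completeness of `Ω` and expansion into rank-one functionals. -/

section OmegaComplete
variable {K : Type u} [NormedAddCommGroup K] [InnerProductSpace ℂ K] [CompleteSpace K]
variable {H : Type v} [NormedAddCommGroup H] [InnerProductSpace ℂ H] [CompleteSpace H]
variable {E F : Submodule ℂ (K →L[ℂ] H)} {A : Submodule ℂ (H →L[ℂ] H)}

/-- All sequences outside a finite set `s₁` together have small total mass because `r` is summable.
Each of the finitely many sequences in `s₁` has small tails of its own. -/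
theorem sqSmall_concat (η : ℕ → SeqInf E) {r : ℕ → ℝ} (hr : Summable r)
    (h : ∀ n, ‖η n‖ ^ 2 ≤ r n) : SqSmall fun p : ℕ × ℕ => (η p.1).seq p.2 := by
  intro ε hε
  obtain ⟨s₁, h₁⟩ := summable_iff_vanishing_norm.1 hr (ε ^ 2 / 2) (by positivity)
  -- Half of the allowance `ε²` is shared equally by the sequences with index in `s₁`; the other
  -- half is for the remaining ones.
  obtain ⟨δ, hδ, hδε⟩ : ∃ δ : ℝ, 0 < δ ∧ (s₁.card : ℝ) * δ ^ 2 ≤ ε ^ 2 / 2 := by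
    obtain ⟨d, hd, hd'⟩ := exists_pos_mul_lt (a := (s₁.card : ℝ)) (by positivity)
      (show 0 < ε ^ 2 / 2 by positivity)
    exact ⟨√d, by positivity, by rw [Real.sq_sqrt hd.le]; exact hd'.le⟩
  choose s hs using fun n => (η n).sqSmall δ hδ
  -- One common set of excluded second indices serves every `m ∈ s₁`, so the excluded set is a
  -- product.
  refine ⟨s₁ ×ˢ s₁.biUnion s, fun t ht v => ?_⟩
  rw [← Finset.sum_filter_add_sum_filter_not t (fun p => p.1 ∈ s₁)]
  have e1 : ∑ p ∈ t with p.1 ∈ s₁, ‖(η p.1).seq p.2 v‖ ^ 2 ≤ ε ^ 2 / 2 * ‖v‖ ^ 2 := by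
    set q := t.filter (fun p => p.1 ∈ s₁)
    calc _ ≤ ∑ p ∈ s₁ ×ˢ (q.image Prod.snd \ s₁.biUnion s), ‖(η p.1).seq p.2 v‖ ^ 2 := by
          refine Finset.sum_le_sum_of_subset_of_nonneg (fun p hp => ?_)
            (fun _ _ _ => by positivity)
          have hp' := Finset.mem_filter.1 hp
          refine Finset.mem_product.2 ⟨hp'.2, Finset.mem_sdiff.2
            ⟨Finset.mem_image_of_mem _ hp, fun h2 => ?_⟩⟩
          exact Finset.disjoint_left.1 ht hp'.1 (Finset.mem_product.2 ⟨hp'.2, h2⟩)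
      _ = ∑ m ∈ s₁, ∑ n ∈ q.image Prod.snd \ s₁.biUnion s, ‖(η m).seq n v‖ ^ 2 :=
          Finset.sum_product _ _ _
      _ ≤ ∑ m ∈ s₁, δ ^ 2 * ‖v‖ ^ 2 := by
          refine Finset.sum_le_sum fun m hm => hs m _ ?_ v
          rw [Finset.disjoint_left]
          intro n hn hn'
          exact (Finset.mem_sdiff.1 hn).2 (Finset.mem_biUnion.2 ⟨m, hm, hn'⟩)
      _ = (s₁.card : ℝ) * δ ^ 2 * ‖v‖ ^ 2 := by rw [Finset.sum_const, nsmul_eq_mul]; ring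
      _ ≤ _ := by gcongr
  have e2 : ∑ p ∈ t with ¬ p.1 ∈ s₁, ‖(η p.1).seq p.2 v‖ ^ 2 ≤ ε ^ 2 / 2 * ‖v‖ ^ 2 := by
    set q := t.filter (fun p => ¬ p.1 ∈ s₁)
    calc _ ≤ ∑ p ∈ q.image Prod.fst ×ˢ q.image Prod.snd, ‖(η p.1).seq p.2 v‖ ^ 2 :=
          Finset.sum_le_sum_of_subset_of_nonneg Finset.subset_product (fun _ _ _ => by positivity)
      _ = ∑ m ∈ q.image Prod.fst, ∑ n ∈ q.image Prod.snd, ‖(η m).seq n v‖ ^ 2 :=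
          Finset.sum_product _ _ _
      _ ≤ ∑ m ∈ q.image Prod.fst, r m * ‖v‖ ^ 2 := by
          refine Finset.sum_le_sum fun m _ => ((η m).sum_le _ v).trans ?_
          gcongr
          exact h m
      _ = (∑ m ∈ q.image Prod.fst, r m) * ‖v‖ ^ 2 := by rw [Finset.sum_mul]
      _ ≤ _ := by
          gcongr
          refine (Real.le_norm_self _).trans (h₁ _ ?_).le
          rw [Finset.disjoint_left]
          intro m hm hm2
          obtain ⟨p, hp, rfl⟩ := Finset.mem_image.1 hm
          exact (Finset.mem_filter.1 hp).2 hm2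
  nlinarith

theorem rowBound_concat (η : ℕ → SeqInf E) {r : ℕ → ℝ} (hr : Summable r)
    (h : ∀ n, ‖η n‖ ^ 2 ≤ r n) :
    RowBound (fun p : ℕ × ℕ => (η p.1).seq p.2) (√(∑' n, r n)) := by
  have hr0 : ∀ n, 0 ≤ r n := fun n => (sq_nonneg _).trans (h n)
  intro s v
  calc _ ≤ ∑ p ∈ s.image Prod.fst ×ˢ s.image Prod.snd, ‖(η p.1).seq p.2 v‖ ^ 2 :=
        Finset.sum_le_sum_of_subset_of_nonneg Finset.subset_product (fun _ _ _ => by positivity)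
    _ = ∑ m ∈ s.image Prod.fst, ∑ n ∈ s.image Prod.snd, ‖(η m).seq n v‖ ^ 2 :=
        Finset.sum_product _ _ _
    _ ≤ ∑ m ∈ s.image Prod.fst, r m * ‖v‖ ^ 2 := by
        refine Finset.sum_le_sum fun m _ => ((η m).sum_le _ v).trans ?_
        gcongr
        exact h m
    _ = (∑ m ∈ s.image Prod.fst, r m) * ‖v‖ ^ 2 := by rw [Finset.sum_mul]
    _ ≤ _ := by
        rw [Real.sq_sqrt (tsum_nonneg hr0)]
        gcongr
        exact hr.sum_le_tsum _ fun n _ => hr0 n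

/-- The concatenation of a sequence of elements of `E^∞` with summable squares of norms. -/
def SeqInf.concat (η : ℕ → SeqInf E) {r : ℕ → ℝ} (hr : Summable r)
    (h : ∀ n, ‖η n‖ ^ 2 ≤ r n) : SeqInf E :=
  SeqInf.ofFamily _ (fun p : ℕ × ℕ => (η p.1).mem p.2) (sqSmall_concat η hr h) Nat.pairEquiv.symm

theorem SeqInf.norm_concat_le (η : ℕ → SeqInf E) {r : ℕ → ℝ} (hr : Summable r)
    (h : ∀ n, ‖η n‖ ^ 2 ≤ r n) : ‖SeqInf.concat η hr h‖ ≤ √(∑' n, r n) :=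
  SeqInf.norm_ofFamily_le _ _ _ _ (Real.sqrt_nonneg _) (rowBound_concat η hr h)

theorem hasSum_omegaMap_concat (η : ℕ → SeqInf E) (η' : ℕ → SeqInf F) {r : ℕ → ℝ}
    (hr : Summable r) (h : ∀ n, ‖η n‖ ^ 2 ≤ r n) (h' : ∀ n, ‖η' n‖ ^ 2 ≤ r n) (T : A) :
    HasSum (fun n => omegaMap A (η n) (η' n) T)
      (omegaMap A (SeqInf.concat η hr h) (SeqInf.concat η' hr h') T) := by
  have hs := (summable_adjoint_comp (T : H →L[ℂ] H) (Real.sqrt_nonneg _) (rowBound_concat η hr h)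
    (sqSmall_concat η' hr h'))
  have := hs.hasSum.prod_fiberwise fun n => ((η n).summable (η' n) (T : H →L[ℂ] H)).hasSum
  have e : omegaMap A (SeqInf.concat η hr h) (SeqInf.concat η' hr h') T = _ :=
    omegaMap_ofFamily A _ _ _ _ _ _ _ T
  rw [e]
  exact this

theorem Omega.norm_def (φ : Omega A E F) : ‖φ‖ = φ.norm := rfl

theorem Omega.ext {φ ψ : Omega A E F} (h : ∀ T, φ.toCLM T = ψ.toCLM T) : φ = ψ :=
  Subtype.ext (ContinuousLinearMap.ext h)

theorem omega_toCLM (η : SeqInf E) (η' : SeqInf F) (T : A) :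
    (omega A η η').toCLM T = ∑' k, (η.seq k)† ∘L (T : H →L[ℂ] H) ∘L η'.seq k := rfl

theorem norm_omega_le (η : SeqInf E) (η' : SeqInf F) : ‖omega A η η'‖ ≤ ‖η‖ * ‖η'‖ :=
  Omega.norm_le_of_eq rfl

/-- Evaluation at `T`. -/
def Omega.evalL (T : A) : Omega A E F →L[ℂ] (K →L[ℂ] K) :=
  LinearMap.mkContinuous
    { toFun := fun φ => φ.toCLM T
      map_add' := fun φ ψ => by rw [map_add]; rfl
      map_smul' := fun r φ => by rw [map_smul]; rfl } ‖T‖ fun φ => by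
    rw [mul_comm]
    exact (ContinuousLinearMap.le_opNorm φ.toCLM T).trans
      (mul_le_mul_of_nonneg_right φ.norm_toCLM_le (_root_.norm_nonneg _))

theorem Omega.evalL_apply (T : A) (φ : Omega A E F) : Omega.evalL T φ = φ.toCLM T := rfl

/-- For an absolutely convergent series, the concatenated representing sequences represent the sum.
The remainder after `N` terms is represented by the concatenation from index `N` on, so its norm is
at most the tail of `r`. -/
instance : CompleteSpace (Omega A E F) := by
  refine NormedAddCommGroup.completeSpace_of_summable_imp_tendsto fun φ hφ => ?_
  -- The norm is an infimum that need not be attained; the summable excess `(1/2)ⁿ` guarantees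
  -- representations. They are balanced, so that the square of each factor is at most `r n`.
  set r : ℕ → ℝ := fun n => ‖φ n‖ + (1 / 2) ^ n with hrdef
  have hr : Summable r := hφ.add summable_geometric_two
  choose η η' heq h h' using fun n => (φ n).exists_balanced (r := r n)
    (by rw [← Omega.norm_def, hrdef]; simp)
  refine ⟨omega A (SeqInf.concat η hr h) (SeqInf.concat η' hr h'), ?_⟩
  rw [tendsto_iff_norm_sub_tendsto_zero]
  refine squeeze_zero (fun _ => norm_nonneg _) (fun N => ?_) (tendsto_sum_nat_add r)
  have hrN : Summable fun n => r (n + N) := (summable_nat_add_iff N).2 hr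
  have key : omega A (SeqInf.concat η hr h) (SeqInf.concat η' hr h') - ∑ n ∈ Finset.range N, φ n
      = omega A (SeqInf.concat (fun n => η (n + N)) hrN fun n => h (n + N))
        (SeqInf.concat (fun n => η' (n + N)) hrN fun n => h' (n + N)) := by
    refine Omega.ext fun T => ?_
    have h1 := hasSum_omegaMap_concat (A := A) η η' hr h h' T
    have h2 := hasSum_omegaMap_concat (A := A) (fun n => η (n + N)) (fun n => η' (n + N)) hrN
      (fun n => h (n + N)) (fun n => h' (n + N)) T
    have h3 := h1.summable.sum_add_tsum_nat_add N
    rw [h1.tsum_eq, h2.tsum_eq] at h3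
    have h4 : ∀ n, Omega.evalL T (φ n) = omegaMap A (η n) (η' n) T := fun n => by
      rw [heq n]
      rfl
    rw [← Omega.evalL_apply, map_sub, map_sum]
    simp only [h4]
    exact (eq_sub_of_add_eq' h3).symm
  rw [norm_sub_rev, key]
  refine (norm_omega_le _ _).trans ?_
  have ha := SeqInf.norm_concat_le (fun n => η (n + N)) hrN fun n => h (n + N)
  have hb := SeqInf.norm_concat_le (fun n => η' (n + N)) hrN fun n => h' (n + N)
  have h0 : 0 ≤ ∑' n, r (n + N) := tsum_nonneg fun n => (sq_nonneg _).trans (h (n + N))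
  calc _ ≤ √(∑' n, r (n + N)) * √(∑' n, r (n + N)) :=
        mul_le_mul ha hb (SeqInf.norm_nonneg _) (Real.sqrt_nonneg _)
    _ = _ := Real.mul_self_sqrt h0

/-- The sequence `(ξ, 0, 0, …)`. -/
def SeqInf.single (ξ : E) : SeqInf E :=
  ⟨fun k => if k = 0 then (ξ : K →L[ℂ] H) else 0, fun k => by split_ifs <;> simp,
    summable_of_ne_finset_zero (s := {0}) fun k hk => by
      simp only [Finset.mem_singleton] at hk
      simp [hk]⟩

theorem SeqInf.single_seq_of_ne (ξ : E) {k : ℕ} (hk : k ≠ 0) : (SeqInf.single ξ).seq k = 0 :=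
  if_neg hk

theorem omega_single (ξ : E) (η : F) (T : A) :
    (omega A (SeqInf.single ξ) (SeqInf.single η)).toCLM T
      = (ξ : K →L[ℂ] H)† ∘L (T : H →L[ℂ] H) ∘L (η : K →L[ℂ] H) := by
  rw [omega_toCLM, tsum_eq_single 0]
  · rfl
  · intro k hk
    rw [SeqInf.single_seq_of_ne _ hk, map_zero, ContinuousLinearMap.zero_comp]

/-- The sequence obtained by replacing the entries with index in `s` by `0`. -/
def SeqInf.mask (η : SeqInf E) (s : Finset ℕ) : SeqInf E :=
  ⟨fun k => if k ∈ s then 0 else η.seq k, fun k => by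
      split_ifs
      exacts [E.zero_mem, η.mem k],
    (SqSmall.summable_sq fun ε hε => by
      obtain ⟨s', hs'⟩ := η.sqSmall ε hε
      refine ⟨s', fun t ht v => le_trans (Finset.sum_le_sum fun k _ => ?_) (hs' t ht v)⟩
      split_ifs
      · simp
      · exact le_rfl)⟩

theorem SeqInf.norm_mask_le (η : SeqInf E) (s : Finset ℕ) : ‖η.mask s‖ ≤ ‖η‖ := by
  refine SeqInf.norm_le_of_rowBound _ η.norm_nonneg fun t v =>
    le_trans (Finset.sum_le_sum fun k _ => ?_) (η.sum_le t v)
  change ‖(if k ∈ s then 0 else η.seq k) v‖ ^ 2 ≤ _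
  split_ifs
  · simp
  · exact le_rfl

theorem SeqInf.exists_norm_mask_le (η : SeqInf E) {ε : ℝ} (hε : 0 < ε) :
    ∃ s₀ : Finset ℕ, ∀ s, s₀ ⊆ s → ‖η.mask s‖ ≤ ε := by
  obtain ⟨s₀, h₀⟩ := η.sqSmall ε hε
  refine ⟨s₀, fun s hs => SeqInf.norm_le_of_rowBound _ hε.le fun t v => ?_⟩
  have e : ∑ k ∈ t, ‖(η.mask s).seq k v‖ ^ 2 = ∑ k ∈ t \ s, ‖η.seq k v‖ ^ 2 := by
    rw [← Finset.sum_sdiff (Finset.inter_subset_left : t ∩ s ⊆ t), Finset.sdiff_inter_self_left]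
    have h2 : ∑ k ∈ t ∩ s, ‖(η.mask s).seq k v‖ ^ 2 = 0 := Finset.sum_eq_zero fun k hk => by
      have : (η.mask s).seq k = 0 := if_pos (Finset.mem_inter.1 hk).2
      rw [this]
      simp
    rw [h2, add_zero]
    refine Finset.sum_congr rfl fun k hk => ?_
    have : (η.mask s).seq k = η.seq k := if_neg (Finset.mem_sdiff.1 hk).2
    rw [this]
  rw [e]
  exact h₀ _ (Finset.disjoint_left.2 fun k hk hk' => (Finset.mem_sdiff.1 hk).2 (hs hk')) v

/-- The remainder of the rank-one expansion is again displayed as an `ω` of two sequences, which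
lets its norm in `Ω` be estimated and not just its values. -/
theorem omega_sub_sum_single (η : SeqInf E) (η' : SeqInf F) (s : Finset ℕ) :
    omega A η η' - ∑ n ∈ s, omega A (SeqInf.single (η.el n)) (SeqInf.single (η'.el n))
      = omega A (η.mask s) (η'.mask s) := by
  refine Omega.ext fun T => ?_
  rw [← Omega.evalL_apply, map_sub, map_sum]
  simp only [Omega.evalL_apply, omega_single]
  rw [sub_eq_iff_eq_add]
  have h1 := (η.summable η' (T : H →L[ℂ] H)).hasSum
  have h2 := ((η.mask s).summable (η'.mask s) (T : H →L[ℂ] H)).hasSum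
  have h3 : HasSum (fun n => if n ∈ s then (η.seq n)† ∘L (T : H →L[ℂ] H) ∘L η'.seq n else 0)
      (∑ n ∈ s, (η.seq n)† ∘L (T : H →L[ℂ] H) ∘L η'.seq n) := by
    have := hasSum_sum_of_ne_finset_zero (s := s) (L := SummationFilter.unconditional ℕ)
      (f := fun n => if n ∈ s then (η.seq n)† ∘L (T : H →L[ℂ] H) ∘L η'.seq n else 0)
      (fun n hn => if_neg hn)
    rwa [Finset.sum_congr rfl fun n hn => if_pos hn] at this
  have h4 := h2.add h3
  refine h1.unique ?_
  rw [show (fun k => (η.seq k)† ∘L (T : H →L[ℂ] H) ∘L η'.seq k) = _ from funext fun n => ?_]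
  · exact h4
  · by_cases hn : n ∈ s <;> simp [SeqInf.mask, hn]

/-- Convergence holds in the norm of `Ω`: a remainder has norm at most `‖η‖` times the norm of a
masked `η'`, and the latter tends to zero. Hence bounded maps on `Ω` are determined by rank-one
functionals, as used in `Omega.clm_ext`. -/
theorem hasSum_omega_single (η : SeqInf E) (η' : SeqInf F) :
    HasSum (fun n => omega A (SeqInf.single (η.el n)) (SeqInf.single (η'.el n))) (omega A η η') := by
  rw [HasSum, SummationFilter.unconditional_filter, Metric.tendsto_atTop]
  intro ε hε
  obtain ⟨δ, hδ, hδε⟩ := exists_pos_mul_lt η.norm_nonneg hε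
  obtain ⟨s₀, h₀⟩ := η'.exists_norm_mask_le hδ
  refine ⟨s₀, fun s hs => ?_⟩
  rw [dist_eq_norm, norm_sub_rev, omega_sub_sum_single]
  refine lt_of_le_of_lt ((norm_omega_le _ _).trans ?_) hδε
  exact mul_le_mul (η.norm_mask_le s) (h₀ s hs) (SeqInf.norm_nonneg _) η.norm_nonneg

theorem Omega.exists_eq (φ : Omega A E F) : ∃ η η', φ = omega A η η' := by
  obtain ⟨_, η, η', rfl⟩ := φ
  exact ⟨η, η', rfl⟩

/-- Bounded linear maps on `Ω_{E,F}(A)` that agree on the functionals `T ↦ ξ*Tη` are equal. -/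
theorem Omega.clm_ext {Y : Type*} [NormedAddCommGroup Y] [NormedSpace ℂ Y]
    {f g : Omega A E F →L[ℂ] Y}
    (h : ∀ (ξ : E) (η : F), f (omega A (SeqInf.single ξ) (SeqInf.single η))
      = g (omega A (SeqInf.single ξ) (SeqInf.single η))) : f = g := by
  ext φ
  obtain ⟨η, η', rfl⟩ := φ.exists_eq
  have h1 := (hasSum_omega_single (A := A) η η').mapL f
  have h2 := (hasSum_omega_single (A := A) η η').mapL g
  simp only [h] at h1
  exact h1.unique h2

end OmegaComplete

/-! ### Square roots of Gram matrices inside `C*`-algebras. -/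

section GramRoot
variable {X Y G : Type*}
  [NormedAddCommGroup X] [InnerProductSpace ℂ X] [CompleteSpace X]
  [NormedAddCommGroup Y] [InnerProductSpace ℂ Y] [CompleteSpace Y]
  [NormedAddCommGroup G] [InnerProductSpace ℂ G] [CompleteSpace G]

/-- The operators all of whose matrix entries lie in `C`. -/
def matrixSubalgebra {s : Type*} [Fintype s] (p : s → G →L[ℂ] X)
    (hsum : ∑ x, (p x)† ∘L p x = 1) (C : NonUnitalStarSubalgebra ℂ (X →L[ℂ] X)) :
    NonUnitalStarSubalgebra ℂ (G →L[ℂ] G) where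
  carrier := {T | ∀ x y, p x ∘L T ∘L (p y)† ∈ C}
  add_mem' := fun {a b} ha hb x y => by
    rw [ContinuousLinearMap.add_comp, ContinuousLinearMap.comp_add]
    exact add_mem (ha x y) (hb x y)
  zero_mem' := fun x y => by
    rw [ContinuousLinearMap.zero_comp, ContinuousLinearMap.comp_zero]
    exact zero_mem C
  smul_mem' := fun r a ha x y => by
    rw [ContinuousLinearMap.smul_comp, ContinuousLinearMap.comp_smul]
    exact SMulMemClass.smul_mem r (ha x y)
  mul_mem' := fun {a b} ha hb x y => by
    -- Matrix multiplication: the resolution of the identity `hsum` is inserted between `a` and `b`.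
    have e : p x ∘L (a * b) ∘L (p y)†
        = ∑ z, (p x ∘L a ∘L (p z)†) ∘L (p z ∘L b ∘L (p y)†) := by
      have e1 : ∀ z, (p x ∘L a ∘L (p z)†) ∘L (p z ∘L b ∘L (p y)†)
          = (p x ∘L a) ∘L ((p z)† ∘L p z) ∘L (b ∘L (p y)†) := fun z => rfl
      simp only [e1]
      rw [← ContinuousLinearMap.comp_finsetSum, ← ContinuousLinearMap.finsetSum_comp, hsum]
      rfl
    rw [e]
    exact sum_mem fun z _ => mul_mem (ha x z) (hb z y)
  star_mem' := fun {a} ha x y => by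
    have := star_mem (ha y x)
    rw [ContinuousLinearMap.star_eq_adjoint, ContinuousLinearMap.adjoint_comp,
      ContinuousLinearMap.adjoint_comp, ContinuousLinearMap.adjoint_adjoint] at this
    exact this

theorem isClosed_matrixSubalgebra {s : Type*} [Fintype s] (p : s → G →L[ℂ] X)
    (hsum : ∑ x, (p x)† ∘L p x = 1) (C : NonUnitalStarSubalgebra ℂ (X →L[ℂ] X))
    (hC : IsClosed (C : Set (X →L[ℂ] X))) :
    IsClosed (matrixSubalgebra p hsum C : Set (G →L[ℂ] G)) := by
  have : (matrixSubalgebra p hsum C : Set (G →L[ℂ] G))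
      = ⋂ x, ⋂ y, (fun T : G →L[ℂ] G => p x ∘L T ∘L (p y)†) ⁻¹' (C : Set (X →L[ℂ] X)) := by
    ext T
    simp only [Set.mem_iInter]
    rfl
  rw [this]
  refine isClosed_iInter fun x => isClosed_iInter fun y => hC.preimage ?_
  exact (ContinuousLinearMap.compL ℂ X G X (p x)).continuous.comp
    ((ContinuousLinearMap.compL ℂ X G G).flip ((p y)†)).continuous

/-- The maps `p x` are the coordinates of an amplification `G` of `X`, on which the Gram matrix
becomes the single positive operator `M = U*U`. Operators with entries in `C` form a closed
`*`-subalgebra, which contains `M` and therefore its square root. -/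
theorem exists_sqrt_gram_mem_aux {s : Type*} [Fintype s] [DecidableEq s] (k : s → X →L[ℂ] Y)
    (p : s → G →L[ℂ] X) (hp : ∀ x y, p x ∘L (p y)† = if x = y then 1 else 0)
    (hsum : ∑ x, (p x)† ∘L p x = 1) :
    ∃ S : s → s → X →L[ℂ] X, (∀ x y, (S x y)† = S y x) ∧
      (∀ x y, ∑ z, S x z ∘L S z y = (k x)† ∘L k y) ∧
      ∀ C : NonUnitalStarSubalgebra ℂ (X →L[ℂ] X), IsClosed (C : Set (X →L[ℂ] X)) →
        (∀ x y, (k x)† ∘L k y ∈ C) → ∀ x y, S x y ∈ C := by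
  let U : G →L[ℂ] Y := ∑ x, k x ∘L p x
  let M : G →L[ℂ] G := U† ∘L U
  have hM0 : 0 ≤ M := (ContinuousLinearMap.nonneg_iff_isPositive _).2
    (ContinuousLinearMap.isPositive_adjoint_comp_self U)
  let S := CFC.sqrt M
  have hSS : S * S = M := CFC.sqrt_mul_sqrt_self M hM0
  have hSs : S† = S := (IsSelfAdjoint.of_nonneg (CFC.sqrt_nonneg M)).star_eq
  have hUp : ∀ x, U ∘L (p x)† = k x := by
    intro x
    simp only [U, ContinuousLinearMap.finsetSum_comp, ContinuousLinearMap.comp_assoc, hp]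
    rw [Finset.sum_eq_single x] <;> simp +contextual
    rfl
  have hM : ∀ x y, p x ∘L M ∘L (p y)† = (k x)† ∘L k y := by
    intro x y
    rw [← hUp, ← hUp, ContinuousLinearMap.adjoint_comp, ContinuousLinearMap.adjoint_adjoint]
    rfl
  refine ⟨fun x y => p x ∘L S ∘L (p y)†, ?_, ?_, ?_⟩
  · intro x y
    simp [ContinuousLinearMap.adjoint_comp, hSs, ContinuousLinearMap.comp_assoc]
  · intro x y
    have e : ∀ z, (p x ∘L S ∘L (p z)†) ∘L (p z ∘L S ∘L (p y)†)
        = (p x ∘L S) ∘L ((p z)† ∘L p z) ∘L (S ∘L (p y)†) := fun z => rfl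
    simp only [e]
    rw [← ContinuousLinearMap.comp_finsetSum, ← ContinuousLinearMap.finsetSum_comp, hsum]
    calc _ = p x ∘L (S * S) ∘L (p y)† := rfl
      _ = _ := by rw [hSS, hM]
  · intro C hC hk
    have h1 : M ∈ matrixSubalgebra p hsum C := fun x y => by rw [hM]; exact hk x y
    have : IsClosed (matrixSubalgebra p hsum C : Set (G →L[ℂ] G)) :=
      isClosed_matrixSubalgebra p hsum C hC
    have h2 : S ∈ matrixSubalgebra p hsum C := by
      change CFC.sqrt M ∈ _
      -- Written as a non-unital functional calculus of `M`, the root stays in the closed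
      -- `*`-subalgebra. No unit is required, since the square root vanishes at zero.
      rw [CFC.sqrt_eq_real_sqrt M hM0]
      exact cfcₙ_mem _ h1
    exact h2

/-- A Gram matrix of operators has a self-adjoint square root, whose entries lie in every
`C*`-algebra that contains the entries of the Gram matrix. -/
theorem exists_sqrt_gram_mem {s : Type*} [Fintype s] [DecidableEq s] (k : s → X →L[ℂ] Y) :
    ∃ S : s → s → X →L[ℂ] X, (∀ x y, (S x y)† = S y x) ∧
      (∀ x y, ∑ z, S x z ∘L S z y = (k x)† ∘L k y) ∧
      ∀ C : NonUnitalStarSubalgebra ℂ (X →L[ℂ] X), IsClosed (C : Set (X →L[ℂ] X)) →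
        (∀ x y, (k x)† ∘L k y ∈ C) → ∀ x y, S x y ∈ C := by
  refine exists_sqrt_gram_mem_aux k (fun x => PiLp.proj 2 (fun _ : s => X) x)
    (fun x y => proj_comp_adjoint x y) ?_
  ext1 v
  refine ext_inner_right ℂ fun w => ?_
  simp [sum_inner, ContinuousLinearMap.adjoint_inner_left, PiLp.inner_apply]

/-- The operators `T` with `T E ⊆ E` and `T* E ⊆ E`. -/
def stabilizer {K : Type*} [NormedAddCommGroup K] [InnerProductSpace ℂ K]
    (E : Submodule ℂ (K →L[ℂ] X)) : NonUnitalStarSubalgebra ℂ (X →L[ℂ] X) where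
  carrier := {T | ∀ ξ ∈ E, T ∘L ξ ∈ E ∧ T† ∘L ξ ∈ E}
  add_mem' := fun {a b} ha hb ξ hξ => by
    rw [map_add, ContinuousLinearMap.add_comp, ContinuousLinearMap.add_comp]
    exact ⟨add_mem (ha ξ hξ).1 (hb ξ hξ).1, add_mem (ha ξ hξ).2 (hb ξ hξ).2⟩
  zero_mem' := fun ξ hξ => by
    rw [map_zero, ContinuousLinearMap.zero_comp]
    exact ⟨zero_mem _, zero_mem _⟩
  smul_mem' := fun r a ha ξ hξ => by
    rw [map_smulₛₗ, ContinuousLinearMap.smul_comp, ContinuousLinearMap.smul_comp]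
    exact ⟨E.smul_mem _ (ha ξ hξ).1, E.smul_mem _ (ha ξ hξ).2⟩
  mul_mem' := fun {a b} ha hb ξ hξ => by
    refine ⟨(ha _ (hb ξ hξ).1).1, ?_⟩
    have : (a * b)† = b† ∘L a† := ContinuousLinearMap.adjoint_comp a b
    rw [this]
    exact (hb _ (ha ξ hξ).2).2
  star_mem' := fun {a} ha ξ hξ => by
    rw [ContinuousLinearMap.star_eq_adjoint, ContinuousLinearMap.adjoint_adjoint]
    exact (ha ξ hξ).symm

theorem isClosed_stabilizer {K : Type*} [NormedAddCommGroup K] [InnerProductSpace ℂ K]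
    {E : Submodule ℂ (K →L[ℂ] X)} (hE : IsClosed (E : Set (K →L[ℂ] X))) :
    IsClosed (stabilizer E : Set (X →L[ℂ] X)) := by
  have : (stabilizer E : Set (X →L[ℂ] X)) = ⋂ ξ : E,
      ((fun T : X →L[ℂ] X => T ∘L (ξ : K →L[ℂ] X)) ⁻¹' (E : Set (K →L[ℂ] X)) ∩
        (fun T : X →L[ℂ] X => T† ∘L (ξ : K →L[ℂ] X)) ⁻¹' (E : Set (K →L[ℂ] X))) := by
    ext T
    simp only [Set.mem_iInter, Subtype.forall]
    rfl
  rw [this]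
  have hc : ∀ ξ : E, Continuous fun T : X →L[ℂ] X => T ∘L (ξ : K →L[ℂ] X) := fun ξ =>
    ((ContinuousLinearMap.compL ℂ K X X).flip (ξ : K →L[ℂ] X)).continuous
  refine isClosed_iInter fun ξ => (hE.preimage (hc ξ)).inter (hE.preimage ?_)
  exact (hc ξ).comp (ContinuousLinearMap.adjoint (𝕜 := ℂ) (E := X) (F := X)).continuous

/-- The operators commuting with `z` and `z*` form a closed `*`-algebra, to which `hS` applies.
Commutation of the Gram entries with `z*` is not assumed: it follows by taking adjoints, because the
adjoint of an entry is the entry with indices exchanged. -/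
theorem commute_of_gram {s : Type*} {k : s → X →L[ℂ] Y} {z : X →L[ℂ] X} {S : X →L[ℂ] X}
    (hz : ∀ i j, z ∘L ((k i)† ∘L k j) = ((k i)† ∘L k j) ∘L z)
    (hS : ∀ C : NonUnitalStarSubalgebra ℂ (X →L[ℂ] X), IsClosed (C : Set (X →L[ℂ] X)) →
        (∀ x y, (k x)† ∘L k y ∈ C) → S ∈ C) : z ∘L S = S ∘L z := by
  have h := hS (NonUnitalStarSubalgebra.centralizer ℂ {z}) ?_ fun i j => ?_
  · rw [NonUnitalStarSubalgebra.mem_centralizer_iff] at h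
    exact (h z rfl).1
  · rw [NonUnitalStarSubalgebra.coe_centralizer]
    exact Set.isClosed_centralizer _
  · rw [NonUnitalStarSubalgebra.mem_centralizer_iff]
    intro g hg
    obtain rfl : g = z := hg
    refine ⟨hz i j, ?_⟩
    have := congrArg ContinuousLinearMap.adjoint (hz j i)
    have hk : ((k j)† ∘L k i)† = (k i)† ∘L k j := by
      rw [ContinuousLinearMap.adjoint_comp, ContinuousLinearMap.adjoint_adjoint]
    rw [ContinuousLinearMap.adjoint_comp g, ContinuousLinearMap.adjoint_comp _ g, hk] at this
    rw [ContinuousLinearMap.star_eq_adjoint]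
    exact this.symm

end GramRoot

/-! ### Replacing finite sums of products `k i ξ` by finite families in the module. -/

section Push
variable {K : Type u} [NormedAddCommGroup K] [InnerProductSpace ℂ K] [CompleteSpace K]
variable {H : Type v} [NormedAddCommGroup H] [InnerProductSpace ℂ H] [CompleteSpace H]
variable {Y : Type w} [NormedAddCommGroup Y] [InnerProductSpace ℂ Y] [CompleteSpace Y]
variable {ι : Type*}

/-- The algebraic span of `{k i ξ | ξ ∈ D}`. -/
def pushSpan (k : ι → H →L[ℂ] Y) (D : Submodule ℂ (K →L[ℂ] H)) : Submodule ℂ (K →L[ℂ] Y) :=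
  Submodule.span ℂ {θ | ∃ i, ∃ ξ ∈ D, θ = k i ∘L ξ}

theorem exists_finsupp_of_mem_pushSpan {k : ι → H →L[ℂ] Y} {D : Submodule ℂ (K →L[ℂ] H)}
    {x : K →L[ℂ] Y} (hx : x ∈ pushSpan k D) :
    ∃ f : ι →₀ D, x = f.sum fun i ξ => k i ∘L (ξ : K →L[ℂ] H) := by
  have hle : pushSpan k D ≤ LinearMap.range (Finsupp.lsum ℂ fun i : ι =>
      (ContinuousLinearMap.compL ℂ K H Y (k i)).toLinearMap ∘ₗ D.subtype) := by
    refine Submodule.span_le.2 ?_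
    rintro _ ⟨i, ξ, hξ, rfl⟩
    refine ⟨Finsupp.single i ⟨ξ, hξ⟩, ?_⟩
    simp
  obtain ⟨f, rfl⟩ := hle hx
  exact ⟨f, by rw [Finsupp.lsum_apply]; rfl⟩

theorem finsupp_sum_eq_coe_sort {k : ι → H →L[ℂ] Y} {D : Submodule ℂ (K →L[ℂ] H)} (f : ι →₀ D)
    {s : Finset ι} (h : f.support ⊆ s) :
    (f.sum fun i ξ => k i ∘L (ξ : K →L[ℂ] H)) = ∑ a : s, k a ∘L (f a : K →L[ℂ] H) := by
  rw [Finsupp.sum_of_support_subset f h _ fun i _ => by simp]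
  exact (Finset.sum_coe_sort s fun i => k i ∘L (f i : K →L[ℂ] H)).symm

/-- Pairs of elements of the spans of `k i D` and `k i D'` can be replaced by finite families in
`D` and `D'` without changing the associated functionals. -/
theorem exists_fin_of_mem_pushSpan {k : ι → H →L[ℂ] Y} {D D' : Submodule ℂ (K →L[ℂ] H)}
    (hD : IsClosed (D : Set (K →L[ℂ] H))) (hD' : IsClosed (D' : Set (K →L[ℂ] H)))
    (hkD : ∀ i j, ∀ ξ ∈ D, ((k i)† ∘L k j) ∘L ξ ∈ D)
    (hkD' : ∀ i j, ∀ ξ ∈ D', ((k i)† ∘L k j) ∘L ξ ∈ D')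
    {x y : K →L[ℂ] Y} (hx : x ∈ pushSpan k D) (hy : y ∈ pushSpan k D') :
    ∃ (N : ℕ) (c d : ℕ → K →L[ℂ] H), (∀ n, c n ∈ D) ∧ (∀ n, d n ∈ D') ∧
      (∀ n, N ≤ n → c n = 0) ∧ (∀ n, N ≤ n → d n = 0) ∧
      (∀ (t : Finset ℕ) (v : K), ∑ n ∈ t, ‖c n v‖ ^ 2 ≤ ‖x v‖ ^ 2) ∧
      (∀ (t : Finset ℕ) (v : K), ∑ n ∈ t, ‖d n v‖ ^ 2 ≤ ‖y v‖ ^ 2) ∧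
      ∀ (z : H →L[ℂ] H) (Z : Y →L[ℂ] Y),
        (∀ i j, z ∘L ((k i)† ∘L k j) = ((k i)† ∘L k j) ∘L z) → (∀ i, Z ∘L k i = k i ∘L z) →
        ∑ n ∈ Finset.range N, (c n)† ∘L z ∘L d n = x† ∘L Z ∘L y := by
  classical
  obtain ⟨f, hf⟩ := exists_finsupp_of_mem_pushSpan hx
  obtain ⟨g, hg⟩ := exists_finsupp_of_mem_pushSpan hy
  -- A common index set, so that `x` and `y` are treated with the same Gram matrix.
  set s := f.support ∪ g.support
  rw [finsupp_sum_eq_coe_sort f (Finset.subset_union_left : _ ⊆ s)] at hf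
  rw [finsupp_sum_eq_coe_sort g (Finset.subset_union_right : _ ⊆ s)] at hg
  -- As `∑ₘ S b m S m a = (k b)* k a`, the family `∑ₐ S m a fₐ` has the same inner products as the
  -- single operator `∑ₐ k a fₐ`, but takes values in `H`.
  obtain ⟨S, hSs, hSS, hSC⟩ := exists_sqrt_gram_mem fun a : s => k a
  -- Gram entries and their adjoints preserve `D`; these operators form a closed `*`-algebra, so the
  -- entries of the root preserve `D` too.
  have hSD : ∀ a b, ∀ ξ ∈ D, S a b ∘L ξ ∈ D := by
    intro a b ξ hξ
    refine (hSC (stabilizer D) (isClosed_stabilizer hD) (fun a b ξ hξ => ⟨hkD _ _ ξ hξ, ?_⟩) a b ξ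
      hξ).1
    rw [ContinuousLinearMap.adjoint_comp, ContinuousLinearMap.adjoint_adjoint]
    exact hkD _ _ ξ hξ
  have hSD' : ∀ a b, ∀ ξ ∈ D', S a b ∘L ξ ∈ D' := by
    intro a b ξ hξ
    refine (hSC (stabilizer D') (isClosed_stabilizer hD') (fun a b ξ hξ => ⟨hkD' _ _ ξ hξ, ?_⟩) a b
      ξ hξ).1
    rw [ContinuousLinearMap.adjoint_comp, ContinuousLinearMap.adjoint_adjoint]
    exact hkD' _ _ ξ hξ
  let c : s → K →L[ℂ] H := fun m => ∑ a : s, S m a ∘L (f a : K →L[ℂ] H)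
  let d : s → K →L[ℂ] H := fun m => ∑ a : s, S m a ∘L (g a : K →L[ℂ] H)
  -- Moving `z` past the entries of `S` collects the product of two roots into the Gram matrix, and
  -- `k a z = Z k a` then absorbs `z` into `Z`.
  have key : ∀ (p q : s → K →L[ℂ] H) (z : H →L[ℂ] H) (Z : Y →L[ℂ] Y),
      (∀ i j, z ∘L ((k i)† ∘L k j) = ((k i)† ∘L k j) ∘L z) → (∀ i, Z ∘L k i = k i ∘L z) →
      ∑ m : s, (∑ a : s, S m a ∘L p a)† ∘L z ∘L (∑ a : s, S m a ∘L q a)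
        = (∑ a : s, k a ∘L p a)† ∘L Z ∘L ∑ a : s, k a ∘L q a := by
    intro p q z Z hz hZ
    have hzS : ∀ m a, z ∘L S m a = S m a ∘L z := fun m a =>
      commute_of_gram (k := fun a : s => k a) (fun i j => hz i j) fun C hC h => hSC C hC h m a
    simp only [map_sum, ContinuousLinearMap.comp_finsetSum, ContinuousLinearMap.finsetSum_comp,
      ContinuousLinearMap.adjoint_comp, hSs]
    rw [Finset.sum_comm]
    refine Finset.sum_congr rfl fun a _ => ?_
    rw [Finset.sum_comm]
    refine Finset.sum_congr rfl fun b _ => ?_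
    calc ∑ m : s, ((p b)† ∘L S b m) ∘L z ∘L S m a ∘L q a
        = ∑ m : s, (p b)† ∘L (S b m ∘L S m a) ∘L (z ∘L q a) := by
          refine Finset.sum_congr rfl fun m _ => ?_
          have := hzS m a
          calc _ = ((p b)† ∘L S b m) ∘L (z ∘L S m a) ∘L q a := rfl
            _ = _ := by rw [this]; rfl
      _ = (p b)† ∘L ((k b)† ∘L k a) ∘L (z ∘L q a) := by
          rw [← hSS, ContinuousLinearMap.finsetSum_comp, ContinuousLinearMap.comp_finsetSum]
      _ = ((p b)† ∘L (k b)†) ∘L (k a ∘L z) ∘L q a := rfl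
      _ = _ := by rw [← hZ]; rfl
  -- The case `z = Id`, `Z = Id` of `key` shows that square sums are preserved, so the norms do not
  -- grow.
  have hsq : ∀ (p : s → K →L[ℂ] H) (v : K),
      ∑ m : s, ‖(∑ a : s, S m a ∘L p a) v‖ ^ 2 = ‖(∑ a : s, k a ∘L p a) v‖ ^ 2 := by
    intro p v
    have := key p p (ContinuousLinearMap.id ℂ H) (ContinuousLinearMap.id ℂ Y)
      (fun _ _ => rfl) (fun _ => rfl)
    simp only [ContinuousLinearMap.id_comp] at this
    rw [← re_inner_sum_adjoint_comp, this, ContinuousLinearMap.comp_apply,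
      ContinuousLinearMap.adjoint_inner_right, inner_self_eq_norm_sq]
  let e := s.equivFin
  -- The finite family is enumerated and padded with zeros from index `s.card` on.
  let ext : (s → K →L[ℂ] H) → ℕ → K →L[ℂ] H := fun p n =>
    if h : n < s.card then p (e.symm ⟨n, h⟩) else 0
  have hext0 : ∀ p n, s.card ≤ n → ext p n = 0 := fun p n h => dif_neg (by omega)
  have hextsq : ∀ p (t : Finset ℕ) (v : K), ∑ n ∈ t, ‖ext p n v‖ ^ 2 ≤ ∑ m : s, ‖p m v‖ ^ 2 := by
    intro p t v
    calc ∑ n ∈ t, ‖ext p n v‖ ^ 2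
        = ∑ n ∈ t with n < s.card, ‖ext p n v‖ ^ 2 := by
          refine (Finset.sum_filter_of_ne fun n _ hn => ?_).symm
          by_contra h
          rw [hext0 p n (by omega)] at hn
          simp at hn
      _ ≤ ∑ n ∈ Finset.range s.card, ‖ext p n v‖ ^ 2 :=
          Finset.sum_le_sum_of_subset_of_nonneg
            (fun n hn => Finset.mem_range.2 (Finset.mem_filter.1 hn).2)
            (fun _ _ _ => by positivity)
      _ = ∑ n : Fin s.card, ‖p (e.symm n) v‖ ^ 2 := by
          rw [Finset.sum_range]
          refine Finset.sum_congr rfl fun n _ => ?_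
          have : ext p n = p (e.symm n) := dif_pos n.2
          rw [this]
      _ = _ := e.symm.sum_comp fun m => ‖p m v‖ ^ 2
  refine ⟨s.card, ext c, ext d, fun n => ?_, fun n => ?_, hext0 c, hext0 d, fun t v => ?_,
    fun t v => ?_, fun z Z hz hZ => ?_⟩
  · simp only [ext]
    split_ifs
    · exact sum_mem fun a _ => hSD _ _ _ (f a).2
    · exact zero_mem _
  · simp only [ext]
    split_ifs
    · exact sum_mem fun a _ => hSD' _ _ _ (g a).2
    · exact zero_mem _
  · refine (hextsq c t v).trans (le_of_eq ?_)
    rw [hf]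
    exact hsq (fun a => f a) v
  · refine (hextsq d t v).trans (le_of_eq ?_)
    rw [hg]
    exact hsq (fun a => g a) v
  · rw [hf, hg, ← key (fun a => f a) (fun a => g a) z Z hz hZ, Finset.sum_range]
    have : ∀ n : Fin s.card, (ext c n)† ∘L z ∘L ext d n
        = (c (e.symm n))† ∘L z ∘L d (e.symm n) := by
      intro n
      have h1 : ext c n = c (e.symm n) := dif_pos n.2
      have h2 : ext d n = d (e.symm n) := dif_pos n.2
      rw [h1, h2]
    simp only [this]
    exact e.symm.sum_comp fun m => (c m)† ∘L z ∘L d m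

theorem rowBound_of_fin {x : ℕ → K →L[ℂ] Y} {c : ℕ → ℕ → K →L[ℂ] H}
    (h : ∀ k (t : Finset ℕ) (v : K), ∑ n ∈ t, ‖c k n v‖ ^ 2 ≤ ‖x k v‖ ^ 2) {a : ℝ}
    (hx : RowBound x a) : RowBound (fun p : ℕ × ℕ => c p.1 p.2) a := by
  intro s v
  calc _ ≤ ∑ p ∈ s.image Prod.fst ×ˢ s.image Prod.snd, ‖c p.1 p.2 v‖ ^ 2 :=
        Finset.sum_le_sum_of_subset_of_nonneg Finset.subset_product (fun _ _ _ => by positivity)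
    _ = ∑ m ∈ s.image Prod.fst, ∑ n ∈ s.image Prod.snd, ‖c m n v‖ ^ 2 :=
        Finset.sum_product _ _ _
    _ ≤ ∑ m ∈ s.image Prod.fst, ‖x m v‖ ^ 2 := Finset.sum_le_sum fun m _ => h m _ v
    _ ≤ _ := hx _ v

/-- Every row vanishes beyond `N k`. Removing all possibly nonzero entries of the rows in `s`
removes only finitely many, and what remains is bounded by the tail of `x` outside `s`. -/
theorem sqSmall_of_fin {x : ℕ → K →L[ℂ] Y} {c : ℕ → ℕ → K →L[ℂ] H} {N : ℕ → ℕ}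
    (h : ∀ k (t : Finset ℕ) (v : K), ∑ n ∈ t, ‖c k n v‖ ^ 2 ≤ ‖x k v‖ ^ 2)
    (h0 : ∀ k n, N k ≤ n → c k n = 0) (hx : SqSmall x) :
    SqSmall (fun p : ℕ × ℕ => c p.1 p.2) := by
  intro ε hε
  obtain ⟨s, hs⟩ := hx ε hε
  refine ⟨s ×ˢ s.biUnion fun k => Finset.range (N k), fun t ht v => ?_⟩
  calc ∑ p ∈ t, ‖c p.1 p.2 v‖ ^ 2 = ∑ p ∈ t with p.1 ∉ s, ‖c p.1 p.2 v‖ ^ 2 := by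
        refine (Finset.sum_filter_of_ne fun p hp hne => ?_).symm
        intro h1
        refine hne ?_
        have : N p.1 ≤ p.2 := by
          by_contra hlt
          exact Finset.disjoint_left.1 ht hp (Finset.mem_product.2 ⟨h1, Finset.mem_biUnion.2
            ⟨p.1, h1, Finset.mem_range.2 (not_le.1 hlt)⟩⟩)
        rw [h0 _ _ this]
        simp
    _ ≤ ∑ p ∈ (t.filter (·.1 ∉ s)).image Prod.fst ×ˢ (t.filter (·.1 ∉ s)).image Prod.snd,
          ‖c p.1 p.2 v‖ ^ 2 :=
        Finset.sum_le_sum_of_subset_of_nonneg Finset.subset_product (fun _ _ _ => by positivity)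
    _ = ∑ m ∈ (t.filter (·.1 ∉ s)).image Prod.fst,
          ∑ n ∈ (t.filter (·.1 ∉ s)).image Prod.snd, ‖c m n v‖ ^ 2 := Finset.sum_product _ _ _
    _ ≤ ∑ m ∈ (t.filter (·.1 ∉ s)).image Prod.fst, ‖x m v‖ ^ 2 :=
        Finset.sum_le_sum fun m _ => h m _ v
    _ ≤ _ := by
        refine hs _ ?_ v
        rw [Finset.disjoint_left]
        intro m hm
        obtain ⟨p, hp, rfl⟩ := Finset.mem_image.1 hm
        exact (Finset.mem_filter.1 hp).2

/-- Entrywise use of `exists_fin_of_mem_pushSpan`. The order of quantifiers matters: one pair of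
sequences serves all `z` simultaneously and hence represents a functional. -/
theorem exists_seqInf_of_pushSpan {k : ι → H →L[ℂ] Y} {D D' : Submodule ℂ (K →L[ℂ] H)}
    (hD : IsClosed (D : Set (K →L[ℂ] H))) (hD' : IsClosed (D' : Set (K →L[ℂ] H)))
    (hkD : ∀ i j, ∀ ξ ∈ D, ((k i)† ∘L k j) ∘L ξ ∈ D)
    (hkD' : ∀ i j, ∀ ξ ∈ D', ((k i)† ∘L k j) ∘L ξ ∈ D')
    (x : SeqInf (pushSpan k D)) (y : SeqInf (pushSpan k D')) :
    ∃ (c : SeqInf D) (d : SeqInf D'), ‖c‖ ≤ ‖x‖ ∧ ‖d‖ ≤ ‖y‖ ∧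
      ∀ (z : H →L[ℂ] H) (Z : Y →L[ℂ] Y),
        (∀ i j, z ∘L ((k i)† ∘L k j) = ((k i)† ∘L k j) ∘L z) → (∀ i, Z ∘L k i = k i ∘L z) →
        ∑' n, (c.seq n)† ∘L z ∘L d.seq n = ∑' n, (x.seq n)† ∘L Z ∘L y.seq n := by
  choose N c d hc hd hc0 hd0 hcx hdy hz using fun n =>
    exists_fin_of_mem_pushSpan hD hD' hkD hkD' (x.mem n) (y.mem n)
  have hcr := rowBound_of_fin hcx x.rowBound
  have hdr := rowBound_of_fin hdy y.rowBound
  have hcs := sqSmall_of_fin hcx hc0 x.sqSmall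
  have hds := sqSmall_of_fin hdy hd0 y.sqSmall
  refine ⟨SeqInf.ofFamily _ (fun p : ℕ × ℕ => hc p.1 p.2) hcs Nat.pairEquiv.symm,
    SeqInf.ofFamily _ (fun p : ℕ × ℕ => hd p.1 p.2) hds Nat.pairEquiv.symm,
    SeqInf.norm_ofFamily_le _ _ _ _ x.norm_nonneg hcr,
    SeqInf.norm_ofFamily_le _ _ _ _ y.norm_nonneg hdr, fun z Z hzk hZ => ?_⟩
  have hsum := summable_adjoint_comp z x.norm_nonneg hcr hds
  have h1 := hsum.hasSum.prod_fiberwise fun m => hasSum_sum_of_ne_finset_zero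
    (L := SummationFilter.unconditional ℕ) (s := Finset.range (N m))
    (f := fun n => (c m n)† ∘L z ∘L d m n) (fun n hn => by
      rw [Finset.mem_range, not_lt] at hn
      rw [hc0 m n hn, map_zero, ContinuousLinearMap.zero_comp])
  simp only [fun m => hz m z Z hzk hZ] at h1
  rw [h1.tsum_eq]
  exact Nat.pairEquiv.symm.tsum_eq (fun p : ℕ × ℕ => (c p.1 p.2)† ∘L z ∘L d p.1 p.2)

end Push

/-! ### Differences and perturbations of families with bounded square sums. -/

section RowAlgebra
variable {X Y Z : Type*} {ι κ : Type*}
  [NormedAddCommGroup X] [InnerProductSpace ℂ X] [CompleteSpace X]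
  [NormedAddCommGroup Y] [InnerProductSpace ℂ Y] [CompleteSpace Y]

/-- Minkowski's inequality, with the cross term estimated by Cauchy–Schwarz. -/
theorem RowBound.sub {x y : ι → X →L[ℂ] Y} {a b : ℝ} (ha : 0 ≤ a) (hb : 0 ≤ b)
    (hx : RowBound x a) (hy : RowBound y b) : RowBound (fun k => x k - y k) (a + b) := by
  intro s v
  have h1 := hx s v
  have h2 := hy s v
  have h3 : ∑ k ∈ s, ‖x k v‖ * ‖y k v‖ ≤ a * b * ‖v‖ ^ 2 := by
    refine abs_le_of_sq_le_sq' ?_ (by positivity) |>.2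
    calc _ ≤ (∑ k ∈ s, ‖x k v‖ ^ 2) * (∑ k ∈ s, ‖y k v‖ ^ 2) :=
          Finset.sum_mul_sq_le_sq_mul_sq _ _ _
      _ ≤ (a ^ 2 * ‖v‖ ^ 2) * (b ^ 2 * ‖v‖ ^ 2) := by gcongr
      _ = _ := by ring
  calc ∑ k ∈ s, ‖(x k - y k) v‖ ^ 2
      ≤ ∑ k ∈ s, (‖x k v‖ ^ 2 + 2 * (‖x k v‖ * ‖y k v‖) + ‖y k v‖ ^ 2) := by
        refine Finset.sum_le_sum fun k _ => ?_
        have : ‖(x k - y k) v‖ ≤ ‖x k v‖ + ‖y k v‖ := norm_sub_le _ _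
        calc _ ≤ (‖x k v‖ + ‖y k v‖) ^ 2 := by gcongr
          _ = _ := by ring
    _ = ∑ k ∈ s, ‖x k v‖ ^ 2 + 2 * ∑ k ∈ s, ‖x k v‖ * ‖y k v‖ + ∑ k ∈ s, ‖y k v‖ ^ 2 := by
        rw [Finset.sum_add_distrib, Finset.sum_add_distrib, Finset.mul_sum]
    _ ≤ _ := by nlinarith

theorem SqSmall.sub {x y : ι → X →L[ℂ] Y} (hx : SqSmall x) (hy : SqSmall y) :
    SqSmall fun k => x k - y k := by
  classical
  intro ε hε
  obtain ⟨s, hs⟩ := hx (ε / 2) (by positivity)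
  obtain ⟨s', hs'⟩ := hy (ε / 2) (by positivity)
  refine ⟨s ∪ s', fun t ht v => ?_⟩
  rw [Finset.disjoint_union_right] at ht
  have h1 := hs t ht.1 v
  have h2 := hs' t ht.2 v
  calc ∑ k ∈ t, ‖(x k - y k) v‖ ^ 2 ≤ ∑ k ∈ t, (2 * ‖x k v‖ ^ 2 + 2 * ‖y k v‖ ^ 2) := by
        refine Finset.sum_le_sum fun k _ => ?_
        have : ‖(x k - y k) v‖ ≤ ‖x k v‖ + ‖y k v‖ := norm_sub_le _ _
        calc _ ≤ (‖x k v‖ + ‖y k v‖) ^ 2 := by gcongr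
          _ ≤ _ := by nlinarith [sq_nonneg (‖x k v‖ - ‖y k v‖)]
    _ = 2 * ∑ k ∈ t, ‖x k v‖ ^ 2 + 2 * ∑ k ∈ t, ‖y k v‖ ^ 2 := by
        rw [Finset.sum_add_distrib, Finset.mul_sum, Finset.mul_sum]
    _ ≤ _ := by nlinarith

theorem sum_norm_sq_apply_le (x : ι → X →L[ℂ] Y) (s : Finset ι) (v : X) :
    ∑ k ∈ s, ‖x k v‖ ^ 2 ≤ (∑ k ∈ s, ‖x k‖ ^ 2) * ‖v‖ ^ 2 := by
  rw [Finset.sum_mul]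
  refine Finset.sum_le_sum fun k _ => ?_
  rw [← mul_pow]
  gcongr
  exact (x k).le_opNorm v

theorem SqSmall.of_summable_norm_sq {x : ι → X →L[ℂ] Y} (h : Summable fun k => ‖x k‖ ^ 2) :
    SqSmall x := by
  intro ε hε
  obtain ⟨s, hs⟩ := summable_iff_vanishing_norm.1 h (ε ^ 2) (by positivity)
  refine ⟨s, fun t ht v => (sum_norm_sq_apply_le x t v).trans ?_⟩
  gcongr
  exact (Real.le_norm_self _).trans (hs t ht).le

theorem SqSmall.congr {x y : ι → X →L[ℂ] Y} (hx : SqSmall x) (h : ∀ k, x k = y k) : SqSmall y := by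
  rwa [← funext h]

theorem RowBound.congr {x y : ι → X →L[ℂ] Y} {a : ℝ} (hx : RowBound x a) (h : ∀ k, x k = y k) :
    RowBound y a := by
  rwa [← funext h]

/-- Telescoping termwise: `x*Ty - x'*Ty' = x*T(y - y') + (x - x')*Ty'`. It controls the values of a
functional when both representing sequences are replaced by approximations. -/
theorem norm_tsum_sub_tsum_le {x x' y y' : ι → X →L[ℂ] Y} (T : Y →L[ℂ] Y) {a b r r' : ℝ}
    (ha : 0 ≤ a) (hb : 0 ≤ b) (hr : 0 ≤ r) (hr' : 0 ≤ r') (hx : RowBound x a) (hy : RowBound y' b)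
    (hys : SqSmall y) (hys' : SqSmall y')
    (hd : RowBound (fun k => x k - x' k) r) (hd' : RowBound (fun k => y k - y' k) r') :
    ‖∑' k, (x k)† ∘L T ∘L y k - ∑' k, (x' k)† ∘L T ∘L y' k‖ ≤ (a * r' + r * b) * ‖T‖ := by
  have h1 := (summable_adjoint_comp T ha hx (hys.sub hys')).hasSum
  have h2 := (summable_adjoint_comp T hr hd hys').hasSum
  have h0 := (summable_adjoint_comp T ha hx hys).hasSum
  have h3 := h0.sub (h1.add h2)
  have e : (fun k => (x k)† ∘L T ∘L y k - ((x k)† ∘L T ∘L (y k - y' k) +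
      (x k - x' k)† ∘L T ∘L y' k)) = fun k => (x' k)† ∘L T ∘L y' k := by
    funext k
    simp only [map_sub, ContinuousLinearMap.comp_sub, ContinuousLinearMap.sub_comp]
    abel
  rw [e] at h3
  rw [h3.tsum_eq, sub_sub_cancel]
  refine (norm_add_le _ _).trans ?_
  have b1 := norm_tsum_adjoint_comp_le T ha hr' hx hd' (hys.sub hys')
  have b2 := norm_tsum_adjoint_comp_le T hr hb hd hy hys'
  linarith

end RowAlgebra

/-! ### Passing from algebraic spans to closed spans. -/

section Push
variable {K : Type u} [NormedAddCommGroup K] [InnerProductSpace ℂ K] [CompleteSpace K]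
variable {H : Type v} [NormedAddCommGroup H] [InnerProductSpace ℂ H] [CompleteSpace H]
variable {Y : Type w} [NormedAddCommGroup Y] [InnerProductSpace ℂ Y] [CompleteSpace Y]
variable {ι : Type*}

/-- Differences in `E^∞`. -/
def SeqInf.sub {E : Submodule ℂ (K →L[ℂ] H)} (η ζ : SeqInf E) : SeqInf E :=
  ⟨fun k => η.seq k - ζ.seq k, fun k => sub_mem (η.mem k) (ζ.mem k),
    (η.sqSmall.sub ζ.sqSmall).summable_sq⟩

/-- The `k`-th entry is approximated to within `ε 2^{-(k+1)}`. The squares of these errors add up to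
at most `ε²`, so the operator norms of the entries already bound the row. -/
theorem SeqInf.exists_approx {D : Submodule ℂ (K →L[ℂ] Y)} (η : SeqInf D.topologicalClosure)
    {ε : ℝ} (hε : 0 < ε) : ∃ x : SeqInf D, RowBound (fun k => η.seq k - x.seq k) ε := by
  have h1 : ∀ k, ∃ x ∈ D, ‖η.seq k - x‖ ≤ ε * (1 / 2) ^ (k + 1) := fun k => by
    obtain ⟨x, hx, hlt⟩ := Metric.mem_closure_iff.1 (η.mem k) (ε * (1 / 2) ^ (k + 1))
      (by positivity)
    exact ⟨x, hx, by rw [← dist_eq_norm]; exact hlt.le⟩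
  choose x hxD hx using h1
  have hle : ∀ k, ‖η.seq k - x k‖ ^ 2 ≤ ε ^ 2 * ((1 / 2) ^ (k + 1)) := fun k => by
    have h2 : ((1 / 2 : ℝ) ^ (k + 1)) ≤ 1 := pow_le_one₀ (by norm_num) (by norm_num)
    have h3 : (0 : ℝ) ≤ (1 / 2 : ℝ) ^ (k + 1) := by positivity
    calc _ ≤ (ε * (1 / 2) ^ (k + 1)) ^ 2 := by
          gcongr
          exact hx k
      _ = ε ^ 2 * ((1 / 2) ^ (k + 1) * (1 / 2) ^ (k + 1)) := by ring
      _ ≤ ε ^ 2 * ((1 / 2) ^ (k + 1) * 1) := by gcongr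
      _ = _ := by ring
  have hg : HasSum (fun k : ℕ => ε ^ 2 * (1 / 2 : ℝ) ^ (k + 1)) (ε ^ 2) := by
    have : HasSum (fun k : ℕ => ε ^ 2 * ((1 / 2 : ℝ) ^ k * (1 / 2))) (ε ^ 2 * (2 * (1 / 2))) :=
      (hasSum_geometric_two.mul_right _).mul_left _
    simpa [pow_succ] using this
  have hsum : Summable fun k => ‖η.seq k - x k‖ ^ 2 :=
    Summable.of_nonneg_of_le (fun _ => by positivity) hle hg.summable
  have hsq := SqSmall.of_summable_norm_sq hsum
  refine ⟨⟨x, hxD, ((η.sqSmall.sub hsq).congr fun k => by simp).summable_sq⟩, fun s v => ?_⟩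
  refine (sum_norm_sq_apply_le _ s v).trans ?_
  gcongr
  calc ∑ k ∈ s, ‖η.seq k - x k‖ ^ 2 ≤ ∑ k ∈ s, ε ^ 2 * (1 / 2) ^ (k + 1) :=
        Finset.sum_le_sum fun k _ => hle k
    _ ≤ ε ^ 2 := sum_le_hasSum s (fun _ _ => by positivity) hg

/-- A functional `z ↦ ∑ₙ θₙ* Z(z) θ'ₙ`, where `Z(z) k i = k i z` and the entries of `θ`, `θ'` lie
in `[k D]`, `[k D']`, belongs to `Ω_{D,D'}`. -/
theorem exists_omega_push (A : Submodule ℂ (H →L[ℂ] H)) {k : ι → H →L[ℂ] Y}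
    {D D' : Submodule ℂ (K →L[ℂ] H)}
    (hD : IsClosed (D : Set (K →L[ℂ] H))) (hD' : IsClosed (D' : Set (K →L[ℂ] H)))
    (hkD : ∀ i j, ∀ ξ ∈ D, ((k i)† ∘L k j) ∘L ξ ∈ D)
    (hkD' : ∀ i j, ∀ ξ ∈ D', ((k i)† ∘L k j) ∘L ξ ∈ D') (Z : (H →L[ℂ] H) → (Y →L[ℂ] Y))
    (hz : ∀ z ∈ A, ∀ i j, z ∘L ((k i)† ∘L k j) = ((k i)† ∘L k j) ∘L z)
    (hZ : ∀ z ∈ A, ∀ i, Z z ∘L k i = k i ∘L z)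
    (θ : SeqInf (cspan {θ | ∃ i, ∃ ξ ∈ D, θ = k i ∘L ξ}))
    (θ' : SeqInf (cspan {θ | ∃ i, ∃ ξ ∈ D', θ = k i ∘L ξ})) :
    ∃ φ : Omega A D D', ‖φ‖ ≤ ‖θ‖ * ‖θ'‖ ∧
      ∀ z : A, φ.toCLM z = ∑' n, (θ.seq n)† ∘L Z z ∘L θ'.seq n := by
  have hψ : ∀ (x : SeqInf (pushSpan k D)) (y : SeqInf (pushSpan k D')), ∃ φ : Omega A D D',
      ‖φ‖ ≤ ‖x‖ * ‖y‖ ∧ ∀ z : A, φ.toCLM z = ∑' n, (x.seq n)† ∘L Z z ∘L y.seq n := by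
    intro x y
    obtain ⟨c, d, hc, hd, h⟩ := exists_seqInf_of_pushSpan hD hD' hkD hkD' x y
    refine ⟨omega A c d, (norm_omega_le c d).trans ?_, fun z => ?_⟩
    · exact mul_le_mul hc hd d.norm_nonneg x.norm_nonneg
    · rw [omega_toCLM]
      exact h z (Z z) (hz z z.2) (hZ z z.2)
  -- The assignment `ψ` is a mere choice, but an element of `Ω` is determined by its values, so `ψ`
  -- is additive wherever the right-hand side of `hψv` is.
  choose ψ hψn hψv using hψ
  have hhalf : ∀ n : ℕ, (0 : ℝ) < (1 / 2) ^ n := fun n => by positivity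
  -- Both sequences are approximated by sequences in the algebraic spans with error `(1/2)ⁿ`; the
  -- functionals `ψ (x n) (y n)` will form a Cauchy sequence in `Ω`.
  choose x hx using fun n : ℕ => SeqInf.exists_approx (D := pushSpan k D) θ (hhalf n)
  choose y hy using fun n : ℕ => SeqInf.exists_approx (D := pushSpan k D') θ' (hhalf n)
  have hle1 : ∀ n : ℕ, ((1 / 2 : ℝ)) ^ n ≤ 1 := fun n => pow_le_one₀ (by norm_num) (by norm_num)
  have hθ := θ.norm_nonneg
  have hθ' := θ'.norm_nonneg
  have hxn : ∀ n, ‖x n‖ ≤ ‖θ‖ + (1 / 2) ^ n := fun n =>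
    SeqInf.norm_le_of_rowBound _ (add_nonneg hθ (hhalf n).le)
      ((θ.rowBound.sub hθ (hhalf n).le (hx n)).congr fun k => by simp)
  have hyn : ∀ n, ‖y n‖ ≤ ‖θ'‖ + (1 / 2) ^ n := fun n =>
    SeqInf.norm_le_of_rowBound _ (add_nonneg hθ' (hhalf n).le)
      ((θ'.rowBound.sub hθ' (hhalf n).le (hy n)).congr fun k => by simp)
  have hdx : ∀ n, ‖(x n).sub (x (n + 1))‖ ≤ 2 * (1 / 2) ^ n := fun n => by
    refine (SeqInf.norm_le_of_rowBound _ (add_nonneg (hhalf (n + 1)).le (hhalf n).le)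
      (((hx (n + 1)).sub (hhalf (n + 1)).le (hhalf n).le (hx n)).congr fun k => ?_)).trans ?_
    · change _ = (x n).seq k - (x (n + 1)).seq k
      abel
    · rw [pow_succ]
      have := hhalf n
      linarith
  have hdy : ∀ n, ‖(y n).sub (y (n + 1))‖ ≤ 2 * (1 / 2) ^ n := fun n => by
    refine (SeqInf.norm_le_of_rowBound _ (add_nonneg (hhalf (n + 1)).le (hhalf n).le)
      (((hy (n + 1)).sub (hhalf (n + 1)).le (hhalf n).le (hy n)).congr fun k => ?_)).trans ?_
    · change _ = (y n).seq k - (y (n + 1)).seq k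
      abel
    · rw [pow_succ]
      have := hhalf n
      linarith
  -- Changing one argument at a time splits the difference into two functionals, each with one
  -- factor of size `2 (1/2)ⁿ` and the other of norm at most `‖θ‖ + 1` or `‖θ'‖ + 1`.
  have hstep : ∀ n, dist (ψ (x n) (y n)) (ψ (x (n + 1)) (y (n + 1)))
      ≤ (2 * (‖θ‖ + 1) + 2 * (‖θ'‖ + 1)) * (1 / 2) ^ n := by
    intro n
    have e : ψ (x n) (y n) - ψ (x (n + 1)) (y (n + 1))
        = ψ ((x n).sub (x (n + 1))) (y n) + ψ (x (n + 1)) ((y n).sub (y (n + 1))) := by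
      refine Omega.ext fun z => ?_
      rw [← Omega.evalL_apply, ← Omega.evalL_apply, map_sub, map_add]
      simp only [Omega.evalL_apply, hψv]
      have s1 := ((x n).summable (y n) (Z z)).hasSum
      have s2 := ((x (n + 1)).summable (y (n + 1)) (Z z)).hasSum
      have s3 := (((x n).sub (x (n + 1))).summable (y n) (Z z)).hasSum
      have s4 := ((x (n + 1)).summable ((y n).sub (y (n + 1))) (Z z)).hasSum
      refine (s1.sub s2).unique ?_
      refine Eq.mp (congrArg (fun f => HasSum f _) (funext fun m => ?_)) (s3.add s4)
      simp only [SeqInf.sub, map_sub, ContinuousLinearMap.comp_sub, ContinuousLinearMap.sub_comp]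
      abel
    rw [dist_eq_norm, e]
    refine (norm_add_le _ _).trans ?_
    have h1 : ‖ψ ((x n).sub (x (n + 1))) (y n)‖ ≤ 2 * (1 / 2) ^ n * (‖θ'‖ + 1) := by
      refine (hψn _ _).trans (mul_le_mul (hdx n) ?_ (y n).norm_nonneg (by positivity))
      linarith [hyn n, hle1 n]
    have h2 : ‖ψ (x (n + 1)) ((y n).sub (y (n + 1)))‖ ≤ (‖θ‖ + 1) * (2 * (1 / 2) ^ n) := by
      refine (hψn _ _).trans (mul_le_mul ?_ (hdy n) (SeqInf.norm_nonneg _) (by positivity))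
      linarith [hxn (n + 1), hle1 (n + 1)]
    linarith
  obtain ⟨φ, hφ⟩ := cauchySeq_tendsto_of_complete
    (cauchySeq_of_le_geometric (1 / 2) _ (by norm_num) hstep)
  have hlim0 : Filter.Tendsto (fun n : ℕ => (1 / 2 : ℝ) ^ n) Filter.atTop (nhds 0) :=
    tendsto_pow_atTop_nhds_zero_of_lt_one (by norm_num) (by norm_num)
  -- The sharp norm bound survives because `‖x n‖` and `‖y n‖` exceed `‖θ‖` and `‖θ'‖` by at most
  -- `(1/2)ⁿ`. The values converge by `norm_tsum_sub_tsum_le`.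
  refine ⟨φ, ?_, fun z => ?_⟩
  · have h1 : Filter.Tendsto (fun n : ℕ => (‖θ‖ + (1 / 2 : ℝ) ^ n) * (‖θ'‖ + (1 / 2) ^ n))
        Filter.atTop (nhds ((‖θ‖ + 0) * (‖θ'‖ + 0))) :=
      (hlim0.const_add _).mul (hlim0.const_add _)
    rw [add_zero, add_zero] at h1
    refine le_of_tendsto_of_tendsto' hφ.norm h1 fun n => (hψn _ _).trans ?_
    exact mul_le_mul (hxn n) (hyn n) (y n).norm_nonneg (add_nonneg hθ (hhalf n).le)
  · have h1 := ((Omega.evalL (E := D) (F := D') z).continuous.tendsto φ).comp hφ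
    refine tendsto_nhds_unique h1 ?_
    rw [tendsto_iff_norm_sub_tendsto_zero]
    have h2 : Filter.Tendsto (fun n : ℕ => (‖θ‖ * (1 / 2 : ℝ) ^ n + (1 / 2) ^ n * (‖θ'‖ + 1)) *
        ‖Z z‖) Filter.atTop (nhds ((‖θ‖ * 0 + 0 * (‖θ'‖ + 1)) * ‖Z z‖)) :=
      ((hlim0.const_mul _).add (hlim0.mul_const _)).mul_const _
    rw [mul_zero, zero_mul, add_zero, zero_mul] at h2
    refine squeeze_zero (fun _ => norm_nonneg _) (fun n => ?_) h2
    rw [norm_sub_rev]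
    have h3 := norm_tsum_sub_tsum_le (Z z) hθ (add_nonneg hθ' (hhalf n).le) (hhalf n).le
      (hhalf n).le θ.rowBound
      ((θ'.rowBound.sub hθ' (hhalf n).le (hy n)).congr fun k => by simp) θ'.sqSmall
      (y n).sqSmall (hx n) (hy n)
    have h4 : (Omega.evalL (E := D) (F := D') z ∘ fun n => ψ (x n) (y n)) n
        = ∑' m, ((x n).seq m)† ∘L Z z ∘L (y n).seq m := hψv _ _ z
    rw [h4]
    refine h3.trans ?_
    gcongr
    exact hle1 n

end Push

/-! ### Contractions on the projective tensor square. -/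

section ProjExtend
open scoped TensorProduct
variable {E : Type*} [NormedAddCommGroup E] [NormedSpace ℂ E]
variable {G : Type*} [NormedAddCommGroup G] [NormedSpace ℂ G]

/-- A bilinear map as a multilinear map in two variables. -/
def bilinToMultilinear (f : E →ₗ[ℂ] E →ₗ[ℂ] G) : MultilinearMap ℂ (fun _ : Fin 2 => E) G where
  toFun := fun m => f (m 0) (m 1)
  map_update_add' := fun m i x y => by
    fin_cases i <;> simp
  map_update_smul' := fun m i r x => by
    fin_cases i <;> simp

/-- A contractive bilinear map extends to a linear contraction on the projective tensor square. -/
theorem exists_projTensorSq_extension [CompleteSpace G] (f : E →ₗ[ℂ] E →ₗ[ℂ] G)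
    (hf : ∀ x y, ‖f x y‖ ≤ ‖x‖ * ‖y‖) :
    ∃ Φ : ProjTensorSq E →L[ℂ] G, ‖Φ‖ ≤ 1 ∧ ∀ x y, Φ (projTmul x y) = f x y := by
  have hb : ∀ m : Fin 2 → E, ‖bilinToMultilinear f m‖ ≤ 1 * ∏ i, ‖m i‖ := fun m => by
    rw [one_mul, Fin.prod_univ_two]
    exact hf (m 0) (m 1)
  -- The universal property of the projective norm turns the bilinear contraction into a linear one
  -- of the same norm; density of the algebraic tensors then gives the extension to the completion.
  let g := PiTensorProduct.liftIsometry ℂ (fun _ : Fin 2 => E) G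
    ((bilinToMultilinear f).mkContinuous 1 hb)
  have hg : ‖g‖ ≤ 1 := by
    rw [LinearIsometryEquiv.norm_map]
    exact MultilinearMap.mkContinuous_norm_le _ zero_le_one hb
  let e : (⨂[ℂ] _ : Fin 2, E) →ₗ[ℂ] ProjTensorSq E :=
    (UniformSpace.Completion.toComplL (𝕜 := ℂ) (E := ⨂[ℂ] _ : Fin 2, E)).toLinearMap
  have he : DenseRange e := UniformSpace.Completion.denseRange_coe
  have hge : ∀ x, ‖g.toLinearMap x‖ ≤ 1 * ‖e x‖ := fun x => by
    have : ‖e x‖ = ‖x‖ := UniformSpace.Completion.norm_coe x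
    rw [this]
    exact (g.le_opNorm x).trans (mul_le_mul_of_nonneg_right hg (norm_nonneg _))
  refine ⟨g.toLinearMap.extendOfNorm e,
    LinearMap.opNorm_extendOfNorm_le he zero_le_one hge, fun x y => ?_⟩
  refine (LinearMap.extendOfNorm_eq he ⟨1, hge⟩ (PiTensorProduct.tprod ℂ ![x, y])).trans ?_
  change g _ = _
  simp only [g, PiTensorProduct.liftIsometry_apply_apply, PiTensorProduct.lift.tprod]
  rfl

end ProjExtend

/-! ### Slice maps and the product `ω ⊠ ω'`. -/

section Slices
variable {K : Type u} [NormedAddCommGroup K] [InnerProductSpace ℂ K] [CompleteSpace K]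
variable {H : Type v} [NormedAddCommGroup H] [InnerProductSpace ℂ H] [CompleteSpace H]
variable {R : Type w} [NormedAddCommGroup R] [InnerProductSpace ℂ R] [CompleteSpace R]

/-- Two families of creation operators `k1 σ, k2 τ : H → R`, indexed by total spaces `E`, `F` of
operators, such that `B ⊆ ℒ(R)` is mapped to `A ⊆ ℒ(H)` by the slice maps. -/
structure SliceData (A : Submodule ℂ (H →L[ℂ] H)) (E F : Submodule ℂ (K →L[ℂ] H))
    (B : Submodule ℂ (R →L[ℂ] R)) (EE FF : Submodule ℂ (K →L[ℂ] R)) where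
  k1 : E → H →L[ℂ] R
  k2 : F → H →L[ℂ] R
  exch : ∀ (σ : E) (τ : F), k1 σ ∘L (τ : K →L[ℂ] H) = k2 τ ∘L (σ : K →L[ℂ] H)
  rowBound1 : ∀ η : SeqInf E, RowBound (fun n => k1 (η.el n)) ‖η‖
  rowBound2 : ∀ η : SeqInf F, RowBound (fun n => k2 (η.el n)) ‖η‖
  sqSmall1 : ∀ η : SeqInf E, SqSmall (fun n => k1 (η.el n))
  sqSmall2 : ∀ η : SeqInf F, SqSmall (fun n => k2 (η.el n))
  total_left : Total fun σ : E => (σ : K →L[ℂ] H)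
  total_right : Total fun τ : F => (τ : K →L[ℂ] H)
  slice1_mem : ∀ T ∈ B, ∀ σ η : E, (k1 σ)† ∘L T ∘L k1 η ∈ A
  slice2_mem : ∀ T ∈ B, ∀ ξ τ : F, (k2 ξ)† ∘L T ∘L k2 τ ∈ A
  mem1 : ∀ (η : E), ∀ ξ ∈ E, k1 η ∘L ξ ∈ EE
  mem2 : ∀ (η : F), ∀ ξ ∈ F, k2 η ∘L ξ ∈ FF

theorem RowBound.comp_left {X Y Z ι : Type*}
    [NormedAddCommGroup X] [InnerProductSpace ℂ X] [CompleteSpace X]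
    [NormedAddCommGroup Y] [InnerProductSpace ℂ Y] [CompleteSpace Y]
    [NormedAddCommGroup Z] [InnerProductSpace ℂ Z] [CompleteSpace Z]
    {x : ι → X →L[ℂ] Y} {a : ℝ} (hx : RowBound x a) (S : Y →L[ℂ] Z) :
    RowBound (fun k => S ∘L x k) (‖S‖ * a) := fun s v => by
  calc ∑ k ∈ s, ‖(S ∘L x k) v‖ ^ 2 ≤ ∑ k ∈ s, ‖S‖ ^ 2 * ‖x k v‖ ^ 2 := by
        refine Finset.sum_le_sum fun k _ => ?_
        rw [← mul_pow]
        gcongr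
        exact S.le_opNorm _
    _ = ‖S‖ ^ 2 * ∑ k ∈ s, ‖x k v‖ ^ 2 := by rw [Finset.mul_sum]
    _ ≤ ‖S‖ ^ 2 * (a ^ 2 * ‖v‖ ^ 2) := by
        gcongr
        exact hx s v
    _ = _ := by ring

theorem SqSmall.comp_left {X Y Z ι : Type*}
    [NormedAddCommGroup X] [InnerProductSpace ℂ X] [CompleteSpace X]
    [NormedAddCommGroup Y] [InnerProductSpace ℂ Y] [CompleteSpace Y]
    [NormedAddCommGroup Z] [InnerProductSpace ℂ Z] [CompleteSpace Z]
    {x : ι → X →L[ℂ] Y} (hx : SqSmall x) (S : Y →L[ℂ] Z) :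
    SqSmall (fun k => S ∘L x k) := fun ε hε => by
  obtain ⟨δ, hδ, hδε⟩ := exists_pos_mul_lt (norm_nonneg S) hε
  obtain ⟨s, hs⟩ := hx δ hδ
  refine ⟨s, fun t ht v => ?_⟩
  calc ∑ k ∈ t, ‖(S ∘L x k) v‖ ^ 2 ≤ ∑ k ∈ t, ‖S‖ ^ 2 * ‖x k v‖ ^ 2 := by
        refine Finset.sum_le_sum fun k _ => ?_
        rw [← mul_pow]
        gcongr
        exact S.le_opNorm _
    _ = ‖S‖ ^ 2 * ∑ k ∈ t, ‖x k v‖ ^ 2 := by rw [Finset.mul_sum]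
    _ ≤ ‖S‖ ^ 2 * (δ ^ 2 * ‖v‖ ^ 2) := by
        gcongr
        exact hs t ht v
    _ = (‖S‖ * δ) ^ 2 * ‖v‖ ^ 2 := by ring
    _ ≤ _ := by gcongr

namespace SliceData
variable {A : Submodule ℂ (H →L[ℂ] H)} {E F : Submodule ℂ (K →L[ℂ] H)}
  {B : Submodule ℂ (R →L[ℂ] R)} {EE FF : Submodule ℂ (K →L[ℂ] R)} (D : SliceData A E F B EE FF)

/-- The slice `⟨σ|₁ T |η⟩₁`. -/
def slice1 (σ η : E) (T : B) : A := ⟨_, D.slice1_mem T T.2 σ η⟩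

/-- The slice `⟨ξ|₂ T |τ⟩₂`. -/
def slice2 (ξ τ : F) (T : B) : A := ⟨_, D.slice2_mem T T.2 ξ τ⟩

/-- The family `|ξ'ₙ⟩₂ ξₘ`. -/
def famLeft (ξ ξ' : SeqInf F) (p : ℕ × ℕ) : K →L[ℂ] R := D.k2 (ξ'.el p.2) ∘L ξ.seq p.1

/-- The family `|ηₘ⟩₁ η'ₙ`. -/
def famRight (η η' : SeqInf E) (p : ℕ × ℕ) : K →L[ℂ] R := D.k1 (η.el p.1) ∘L η'.seq p.2

theorem rowBound_famLeft (ξ ξ' : SeqInf F) : RowBound (D.famLeft ξ ξ') (‖ξ'‖ * ‖ξ‖) :=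
  RowBound.comp_prod (x := ξ.seq) (k := fun n => D.k2 (ξ'.el n)) (D.rowBound2 ξ') ξ.rowBound

theorem rowBound_famRight (η η' : SeqInf E) : RowBound (D.famRight η η') (‖η‖ * ‖η'‖) :=
  ((RowBound.comp_prod (x := η'.seq) (k := fun n => D.k1 (η.el n)) (D.rowBound1 η)
    η'.rowBound).comp_equiv (Equiv.prodComm ℕ ℕ)).congr fun _ => rfl

theorem sqSmall_famLeft (ξ ξ' : SeqInf F) : SqSmall (D.famLeft ξ ξ') :=
  SqSmall.comp_prod (x := ξ.seq) (k := fun n => D.k2 (ξ'.el n)) ξ.norm_nonneg ξ'.norm_nonneg (D.rowBound2 ξ') ξ.rowBound (D.sqSmall2 ξ')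
    ξ.sqSmall

theorem sqSmall_famRight (η η' : SeqInf E) : SqSmall (D.famRight η η') :=
  (SqSmall.comp_prod (x := η'.seq) (k := fun n => D.k1 (η.el n)) η'.norm_nonneg η.norm_nonneg (D.rowBound1 η) η'.rowBound (D.sqSmall1 η)
    η'.sqSmall).comp_equiv (Equiv.prodComm ℕ ℕ) |>.congr fun _ => rfl

/-- The sequence with entries `|ξ'ₙ⟩₂ ξₘ` in the order given by `i`. -/
def seqLeft (ξ ξ' : SeqInf F) (i : ℕ × ℕ ≃ ℕ) : SeqInf FF :=
  SeqInf.ofFamily (D.famLeft ξ ξ') (fun p => D.mem2 (ξ'.el p.2) _ (ξ.mem p.1)) (D.sqSmall_famLeft ξ ξ') i.symm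

/-- The sequence with entries `|ηₘ⟩₁ η'ₙ` in the order given by `i`. -/
def seqRight (η η' : SeqInf E) (i : ℕ × ℕ ≃ ℕ) : SeqInf EE :=
  SeqInf.ofFamily (D.famRight η η') (fun p => D.mem1 (η.el p.1) _ (η'.mem p.2)) (D.sqSmall_famRight η η') i.symm

theorem norm_seqLeft_le (ξ ξ' : SeqInf F) (i : ℕ × ℕ ≃ ℕ) :
    ‖D.seqLeft ξ ξ' i‖ ≤ ‖ξ'‖ * ‖ξ‖ :=
  SeqInf.norm_ofFamily_le _ _ _ _ (mul_nonneg ξ'.norm_nonneg ξ.norm_nonneg)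
    (D.rowBound_famLeft ξ ξ')

theorem norm_seqRight_le (η η' : SeqInf E) (i : ℕ × ℕ ≃ ℕ) :
    ‖D.seqRight η η' i‖ ≤ ‖η‖ * ‖η'‖ :=
  SeqInf.norm_ofFamily_le _ _ _ _ (mul_nonneg η.norm_nonneg η'.norm_nonneg)
    (D.rowBound_famRight η η')

theorem seqLeft_apply (ξ ξ' : SeqInf F) (i : ℕ × ℕ ≃ ℕ) (m n : ℕ) :
    (D.seqLeft ξ ξ' i).seq (i (m, n)) = D.k2 (ξ'.el n) ∘L ξ.seq m := by
  change D.famLeft ξ ξ' (i.symm (i (m, n))) = _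
  rw [Equiv.symm_apply_apply]
  rfl

theorem seqRight_apply (η η' : SeqInf E) (i : ℕ × ℕ ≃ ℕ) (m n : ℕ) :
    (D.seqRight η η' i).seq (i (m, n)) = D.k1 (η.el m) ∘L η'.seq n := by
  change D.famRight η η' (i.symm (i (m, n))) = _
  rw [Equiv.symm_apply_apply]
  rfl

/-- The value `∑ₘₙ ξₘ* ⟨ξ'ₙ|₂ T |ηₘ⟩₁ η'ₙ`. -/
def val (ξ ξ' : SeqInf F) (η η' : SeqInf E) (T : R →L[ℂ] R) : K →L[ℂ] K :=
  ∑' p, (D.famLeft ξ ξ' p)† ∘L T ∘L D.famRight η η' p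

theorem hasSum_val (ξ ξ' : SeqInf F) (η η' : SeqInf E) (T : R →L[ℂ] R) :
    HasSum (fun p => (D.famLeft ξ ξ' p)† ∘L T ∘L D.famRight η η' p) (D.val ξ ξ' η η' T) :=
  (summable_adjoint_comp T (mul_nonneg ξ'.norm_nonneg ξ.norm_nonneg) (D.rowBound_famLeft ξ ξ')
    (D.sqSmall_famRight η η')).hasSum

theorem omega_seqLeft_seqRight (ξ ξ' : SeqInf F) (η η' : SeqInf E) (i : ℕ × ℕ ≃ ℕ) (T : B) :
    (omega B (D.seqLeft ξ ξ' i) (D.seqRight η η' i)).toCLM T = D.val ξ ξ' η η' T :=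
  omegaMap_ofFamily B (D.famLeft ξ ξ') (D.famRight η η') _ _ _ _ _ T

/-- The operator `∑ₘ ξₘ* ⟨ξ'|₂ T |ηₘ⟩₁`. -/
def sumLeft (ξ : SeqInf F) (η : SeqInf E) (ξ' : F) (T : R →L[ℂ] R) : H →L[ℂ] K :=
  ∑' m, (D.k2 ξ' ∘L ξ.seq m)† ∘L T ∘L D.k1 (η.el m)

theorem hasSum_sumLeft (ξ : SeqInf F) (η : SeqInf E) (ξ' : F) (T : R →L[ℂ] R) :
    HasSum (fun m => (D.k2 ξ' ∘L ξ.seq m)† ∘L T ∘L D.k1 (η.el m)) (D.sumLeft ξ η ξ' T) :=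
  (summable_adjoint_comp T (mul_nonneg (norm_nonneg _) ξ.norm_nonneg)
    (ξ.rowBound.comp_left (D.k2 ξ')) (D.sqSmall1 η)).hasSum

/-- The operator `∑ₙ ⟨ξ'ₙ|₂ T |η⟩₁ η'ₙ`. -/
def sumRight (ξ' : SeqInf F) (η' : SeqInf E) (η : E) (T : R →L[ℂ] R) : K →L[ℂ] H :=
  ∑' n, (D.k2 (ξ'.el n))† ∘L T ∘L (D.k1 η ∘L η'.seq n)

theorem hasSum_sumRight (ξ' : SeqInf F) (η' : SeqInf E) (η : E) (T : R →L[ℂ] R) :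
    HasSum (fun n => (D.k2 (ξ'.el n))† ∘L T ∘L (D.k1 η ∘L η'.seq n)) (D.sumRight ξ' η' η T) :=
  (summable_adjoint_comp T ξ'.norm_nonneg (D.rowBound2 ξ')
    (η'.sqSmall.comp_left (D.k1 η))).hasSum

/-- The exchange relation replaces `k1 ηₘ τ` by `k2 τ ηₘ`, which exposes the slice of `T` along the
second leg between `ξₘ*` and `ηₘ`. As the `τ` are total, the inner sum depends only on the
functional `ω_{ξ,η}`. -/
theorem sumLeft_comp (ξ : SeqInf F) (η : SeqInf E) (ξ' : F) (T : B) (τ : F) :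
    D.sumLeft ξ η ξ' T ∘L (τ : K →L[ℂ] H) = (omega A ξ η).toCLM (D.slice2 ξ' τ T) := by
  have h := (D.hasSum_sumLeft ξ η ξ' T).mapL
    ((ContinuousLinearMap.compL ℂ K H K).flip (τ : K →L[ℂ] H))
  have e : (fun m => (ContinuousLinearMap.compL ℂ K H K).flip (τ : K →L[ℂ] H)
      ((D.k2 ξ' ∘L ξ.seq m)† ∘L (T : R →L[ℂ] R) ∘L D.k1 (η.el m)))
      = fun m => (ξ.seq m)† ∘L (D.slice2 ξ' τ T : H →L[ℂ] H) ∘L η.seq m := by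
    funext m
    have := D.exch (η.el m) τ
    calc _ = ((D.k2 ξ' ∘L ξ.seq m)† ∘L (T : R →L[ℂ] R)) ∘L (D.k1 (η.el m) ∘L (τ : K →L[ℂ] H)) := rfl
      _ = _ := by rw [this, ContinuousLinearMap.adjoint_comp]; rfl
  rw [e] at h
  exact h.tsum_eq.symm

/-- Mirror image of `sumLeft_comp`: the adjoint of the exchange relation is used on the left, and
the slice is taken along the first leg. -/
theorem comp_sumRight (ξ' : SeqInf F) (η' : SeqInf E) (η : E) (T : B) (σ : E) :
    (σ : K →L[ℂ] H)† ∘L D.sumRight ξ' η' η T = (omega A ξ' η').toCLM (D.slice1 σ η T) := by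
  have h := (D.hasSum_sumRight ξ' η' η T).mapL
    (ContinuousLinearMap.compL ℂ K H K ((σ : K →L[ℂ] H)†))
  have e : (fun n => ContinuousLinearMap.compL ℂ K H K ((σ : K →L[ℂ] H)†)
      ((D.k2 (ξ'.el n))† ∘L (T : R →L[ℂ] R) ∘L (D.k1 η ∘L η'.seq n)))
      = fun n => (ξ'.seq n)† ∘L (D.slice1 σ η T : H →L[ℂ] H) ∘L η'.seq n := by
    funext n
    have h1 := congrArg ContinuousLinearMap.adjoint (D.exch σ (ξ'.el n))
    rw [ContinuousLinearMap.adjoint_comp, ContinuousLinearMap.adjoint_comp] at h1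
    calc _ = ((σ : K →L[ℂ] H)† ∘L (D.k2 (ξ'.el n))†) ∘L (T : R →L[ℂ] R) ∘L (D.k1 η ∘L η'.seq n) :=
          rfl
      _ = _ := by rw [← h1]; rfl
  rw [e] at h
  exact h.tsum_eq.symm

/-- The double sum converges unconditionally, so the inner sum over `m` may be carried out
separately; only this inner sum sees `ξ` and `η`. -/
theorem hasSum_val_left (ξ ξ' : SeqInf F) (η η' : SeqInf E) (T : R →L[ℂ] R) :
    HasSum (fun n => D.sumLeft ξ η (ξ'.el n) T ∘L η'.seq n) (D.val ξ ξ' η η' T) := by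
  have h := ((Equiv.prodComm ℕ ℕ).hasSum_iff.2 (D.hasSum_val ξ ξ' η η' T))
  exact h.prod_fiberwise fun n => (D.hasSum_sumLeft ξ η (ξ'.el n) T).mapL
    ((ContinuousLinearMap.compL ℂ K H K).flip (η'.seq n))

theorem hasSum_val_right (ξ ξ' : SeqInf F) (η η' : SeqInf E) (T : R →L[ℂ] R) :
    HasSum (fun m => (ξ.seq m)† ∘L D.sumRight ξ' η' (η.el m) T) (D.val ξ ξ' η η' T) := by
  refine (D.hasSum_val ξ ξ' η η' T).prod_fiberwise fun m => ?_
  have := (D.hasSum_sumRight ξ' η' (η.el m) T).mapL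
    (ContinuousLinearMap.compL ℂ K H K ((ξ.seq m)†))
  refine Eq.mp (congrArg (fun f => HasSum f _) (funext fun n => ?_)) this
  rw [famLeft, ContinuousLinearMap.adjoint_comp]
  rfl

/-- Comparing both sides on the total family `τ` reduces the claim to the values of the functionals.
Stated for a general linear relation, it yields independence of the representation and linearity in
one stroke. -/
theorem sumLeft_linear {ξ ξ₁ ξ₂ : SeqInf F} {η η₁ η₂ : SeqInf E} {r s : ℂ}
    (h : omega A ξ η = r • omega A ξ₁ η₁ + s • omega A ξ₂ η₂) (ξ' : F) (T : B) :
    D.sumLeft ξ η ξ' T = r • D.sumLeft ξ₁ η₁ ξ' T + s • D.sumLeft ξ₂ η₂ ξ' T := by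
  refine D.total_right.ext fun τ => ?_
  rw [ContinuousLinearMap.add_comp, ContinuousLinearMap.smul_comp, ContinuousLinearMap.smul_comp,
    D.sumLeft_comp, D.sumLeft_comp, D.sumLeft_comp, h, ← Omega.evalL_apply, map_add, map_smul,
    map_smul]
  rfl

theorem sumRight_linear {ξ ξ₁ ξ₂ : SeqInf F} {η η₁ η₂ : SeqInf E} {r s : ℂ}
    (h : omega A ξ η = r • omega A ξ₁ η₁ + s • omega A ξ₂ η₂) (η' : E) (T : B) :
    D.sumRight ξ η η' T = r • D.sumRight ξ₁ η₁ η' T + s • D.sumRight ξ₂ η₂ η' T := by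
  apply ContinuousLinearMap.adjoint.injective
  refine D.total_left.ext fun σ => ?_
  apply ContinuousLinearMap.adjoint.injective
  rw [ContinuousLinearMap.adjoint_comp, ContinuousLinearMap.adjoint_comp,
    ContinuousLinearMap.adjoint_adjoint, ContinuousLinearMap.adjoint_adjoint,
    ContinuousLinearMap.comp_add, ContinuousLinearMap.comp_smul, ContinuousLinearMap.comp_smul,
    D.comp_sumRight, D.comp_sumRight, D.comp_sumRight, h, ← Omega.evalL_apply, map_add, map_smul,
    map_smul]
  rfl

theorem val_linear_left {ξ ξ₁ ξ₂ : SeqInf F} {η η₁ η₂ : SeqInf E} {r s : ℂ}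
    (h : omega A ξ η = r • omega A ξ₁ η₁ + s • omega A ξ₂ η₂) (ξ' : SeqInf F) (η' : SeqInf E)
    (T : B) : D.val ξ ξ' η η' T = r • D.val ξ₁ ξ' η₁ η' T + s • D.val ξ₂ ξ' η₂ η' T := by
  refine (D.hasSum_val_left ξ ξ' η η' T).unique ?_
  refine Eq.mp (congrArg (fun f => HasSum f _) (funext fun n => ?_))
    (((D.hasSum_val_left ξ₁ ξ' η₁ η' T).const_smul r).add
      ((D.hasSum_val_left ξ₂ ξ' η₂ η' T).const_smul s))
  rw [D.sumLeft_linear h, ContinuousLinearMap.add_comp, ContinuousLinearMap.smul_comp,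
    ContinuousLinearMap.smul_comp]

theorem val_linear_right {ξ ξ₁ ξ₂ : SeqInf F} {η η₁ η₂ : SeqInf E} {r s : ℂ}
    (h : omega A ξ η = r • omega A ξ₁ η₁ + s • omega A ξ₂ η₂) (ξ' : SeqInf F) (η' : SeqInf E)
    (T : B) : D.val ξ' ξ η' η T = r • D.val ξ' ξ₁ η' η₁ T + s • D.val ξ' ξ₂ η' η₂ T := by
  refine (D.hasSum_val_right ξ' ξ η' η T).unique ?_
  refine Eq.mp (congrArg (fun f => HasSum f _) (funext fun n => ?_))
    (((D.hasSum_val_right ξ' ξ₁ η' η₁ T).const_smul r).add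
      ((D.hasSum_val_right ξ' ξ₂ η' η₂ T).const_smul s))
  rw [D.sumRight_linear h, ContinuousLinearMap.comp_add, ContinuousLinearMap.comp_smul,
    ContinuousLinearMap.comp_smul]

theorem val_congr {ξ₁ ξ₂ ξ₁' ξ₂' : SeqInf F} {η₁ η₂ η₁' η₂' : SeqInf E}
    (h : omega A ξ₁ η₁ = omega A ξ₂ η₂) (h' : omega A ξ₁' η₁' = omega A ξ₂' η₂') (T : B) :
    D.val ξ₁ ξ₁' η₁ η₁' T = D.val ξ₂ ξ₂' η₂ η₂' T := by
  -- Equality of functionals is recast as a linear relation with coefficients `1` and `0`, so that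
  -- the linearity lemmas apply.
  have e1 : omega A ξ₁ η₁ = (1 : ℂ) • omega A ξ₂ η₂ + (0 : ℂ) • omega A ξ₂ η₂ := by
    rw [one_smul, zero_smul, add_zero, h]
  have e2 : omega A ξ₁' η₁' = (1 : ℂ) • omega A ξ₂' η₂' + (0 : ℂ) • omega A ξ₂' η₂' := by
    rw [one_smul, zero_smul, add_zero, h']
  rw [D.val_linear_left e1, D.val_linear_right e2]
  simp

end SliceData

/-- A bound valid for every representation passes to the infimum. The case `M = 0` is separate
because the general argument divides by `M`. -/
theorem Omega.le_mul_norm {A : Submodule ℂ (H →L[ℂ] H)} {E F : Submodule ℂ (K →L[ℂ] H)}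
    (φ : Omega A E F) {c M : ℝ} (hM : 0 ≤ M)
    (h : ∀ η η', φ = omega A η η' → c ≤ M * (‖η‖ * ‖η'‖)) : c ≤ M * ‖φ‖ := by
  rcases hM.eq_or_lt with rfl | hM
  · obtain ⟨η, η', h0⟩ := φ.exists_eq
    have := h η η' h0
    rw [zero_mul] at this ⊢
    exact this
  · rw [← div_le_iff₀' hM]
    refine le_csInf φ.nonempty ?_
    rintro _ ⟨η, η', h0, rfl⟩
    rw [div_le_iff₀' hM]
    exact h η η' h0

namespace SliceData
variable {A : Submodule ℂ (H →L[ℂ] H)} {E F : Submodule ℂ (K →L[ℂ] H)}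
  {B : Submodule ℂ (R →L[ℂ] R)} {EE FF : Submodule ℂ (K →L[ℂ] R)} (D : SliceData A E F B EE FF)

/-- The product `ω ⊠ ω'`. -/
def boxFun (ω ω' : Omega A F E) : Omega B FF EE :=
  omega B (D.seqLeft ω.exists_eq.choose ω'.exists_eq.choose Nat.pairEquiv)
    (D.seqRight ω.exists_eq.choose_spec.choose ω'.exists_eq.choose_spec.choose Nat.pairEquiv)

theorem boxFun_toCLM {ω ω' : Omega A F E} {ξ ξ' : SeqInf F} {η η' : SeqInf E}
    (h : ω = omega A ξ η) (h' : ω' = omega A ξ' η') (T : B) :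
    (D.boxFun ω ω').toCLM T = D.val ξ ξ' η η' T := by
  rw [boxFun, omega_seqLeft_seqRight]
  exact D.val_congr (ω.exists_eq.choose_spec.choose_spec.symm.trans h)
    (ω'.exists_eq.choose_spec.choose_spec.symm.trans h') T

theorem boxFun_omega (ξ ξ' : SeqInf F) (η η' : SeqInf E) (i : ℕ × ℕ ≃ ℕ) :
    D.boxFun (omega A ξ η) (omega A ξ' η') = omega B (D.seqLeft ξ ξ' i) (D.seqRight η η' i) :=
  Omega.ext fun T => by rw [D.boxFun_toCLM rfl rfl, omega_seqLeft_seqRight]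

theorem norm_boxFun_le (ω ω' : Omega A F E) : ‖D.boxFun ω ω'‖ ≤ ‖ω‖ * ‖ω'‖ := by
  -- The infimum is taken over one functional at a time, the other norm serving as the constant.
  refine ω'.le_mul_norm (norm_nonneg _) fun ξ' η' h' => ?_
  rw [mul_comm]
  refine ω.le_mul_norm (mul_nonneg ξ'.norm_nonneg η'.norm_nonneg) fun ξ η h => ?_
  rw [h, h', D.boxFun_omega ξ ξ' η η' Nat.pairEquiv]
  refine (norm_omega_le _ _).trans ((mul_le_mul (D.norm_seqLeft_le ξ ξ' _)
    (D.norm_seqRight_le η η' _) (SeqInf.norm_nonneg _)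
    (mul_nonneg ξ'.norm_nonneg ξ.norm_nonneg)).trans (le_of_eq ?_))
  ring

theorem boxFun_linear_left (r s : ℂ) (ω₁ ω₂ ω' : Omega A F E) :
    D.boxFun (r • ω₁ + s • ω₂) ω' = r • D.boxFun ω₁ ω' + s • D.boxFun ω₂ ω' := by
  obtain ⟨ξ₁, η₁, h₁⟩ := ω₁.exists_eq
  obtain ⟨ξ₂, η₂, h₂⟩ := ω₂.exists_eq
  obtain ⟨ξ', η', h'⟩ := ω'.exists_eq
  obtain ⟨ξ, η, h⟩ := (r • ω₁ + s • ω₂).exists_eq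
  refine Omega.ext fun T => ?_
  rw [← Omega.evalL_apply T (_ + _), map_add, map_smul, map_smul]
  simp only [Omega.evalL_apply]
  rw [D.boxFun_toCLM h h', D.boxFun_toCLM h₁ h', D.boxFun_toCLM h₂ h']
  exact D.val_linear_left (by rw [← h, h₁, h₂]) ξ' η' T

theorem boxFun_linear_right (r s : ℂ) (ω₁ ω₂ ω' : Omega A F E) :
    D.boxFun ω' (r • ω₁ + s • ω₂) = r • D.boxFun ω' ω₁ + s • D.boxFun ω' ω₂ := by
  obtain ⟨ξ₁, η₁, h₁⟩ := ω₁.exists_eq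
  obtain ⟨ξ₂, η₂, h₂⟩ := ω₂.exists_eq
  obtain ⟨ξ', η', h'⟩ := ω'.exists_eq
  obtain ⟨ξ, η, h⟩ := (r • ω₁ + s • ω₂).exists_eq
  refine Omega.ext fun T => ?_
  rw [← Omega.evalL_apply T (_ + _), map_add, map_smul, map_smul]
  simp only [Omega.evalL_apply]
  rw [D.boxFun_toCLM h' h, D.boxFun_toCLM h' h₁, D.boxFun_toCLM h' h₂]
  exact D.val_linear_right (by rw [← h, h₁, h₂]) ξ' η' T

/-- The bilinear map `(ω, ω') ↦ ω ⊠ ω'`. -/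
def box : Omega A F E →ₗ[ℂ] Omega A F E →ₗ[ℂ] Omega B FF EE :=
  LinearMap.mk₂ ℂ D.boxFun
    -- Additivity is the linear relation with coefficients `1, 1`; homogeneity is the one with
    -- second coefficient `0` and an arbitrary second functional.
    (fun x y z => by simpa using D.boxFun_linear_left 1 1 x y z)
    (fun r x z => by simpa using D.boxFun_linear_left r 0 x x z)
    (fun z x y => by simpa using D.boxFun_linear_right 1 1 x y z)
    (fun r z x => by simpa using D.boxFun_linear_right r 0 x x z)

theorem box_apply (ω ω' : Omega A F E) : D.box ω ω' = D.boxFun ω ω' := rfl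

/-- A rank-one right factor leaves exactly one inner sum. Associativity uses this form when the left
factor is itself a product, known only through some representation. -/
theorem box_omega_single_right (ξ : SeqInf F) (η : SeqInf E) (ξ' : F) (η' : E) (T : B) :
    (D.box (omega A ξ η) (omega A (SeqInf.single ξ') (SeqInf.single η'))).toCLM T
      = D.sumLeft ξ η ξ' T ∘L (η' : K →L[ℂ] H) := by
  rw [box_apply, D.boxFun_toCLM rfl rfl]
  refine (D.hasSum_val_left _ _ _ _ T).unique ?_
  refine hasSum_single (f := fun n => D.sumLeft ξ η ((SeqInf.single ξ').el n) T ∘L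
    (SeqInf.single η').seq n) 0 fun n hn => ?_
  rw [SeqInf.single_seq_of_ne _ hn, ContinuousLinearMap.comp_zero]

theorem box_omega_single_left (ξ : SeqInf F) (η : SeqInf E) (ξ' : F) (η' : E) (T : B) :
    (D.box (omega A (SeqInf.single ξ') (SeqInf.single η')) (omega A ξ η)).toCLM T
      = (ξ' : K →L[ℂ] H)† ∘L D.sumRight ξ η η' T := by
  rw [box_apply, D.boxFun_toCLM rfl rfl]
  refine (D.hasSum_val_right _ _ _ _ T).unique ?_
  refine hasSum_single (f := fun n => ((SeqInf.single ξ').seq n)† ∘L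
    D.sumRight ξ η ((SeqInf.single η').el n) T) 0 fun n hn => ?_
  rw [SeqInf.single_seq_of_ne _ hn, map_zero, ContinuousLinearMap.zero_comp]

theorem box_omega_single_single (ξ ξ' : F) (η η' : E) (T : B) :
    (D.box (omega A (SeqInf.single ξ) (SeqInf.single η))
      (omega A (SeqInf.single ξ') (SeqInf.single η'))).toCLM T
      = (D.k2 ξ' ∘L (ξ : K →L[ℂ] H))† ∘L (T : R →L[ℂ] R) ∘L D.k1 η ∘L (η' : K →L[ℂ] H) := by
  rw [box_omega_single_right]
  have h : D.sumLeft (SeqInf.single ξ) (SeqInf.single η) ξ' T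
      = (D.k2 ξ' ∘L (ξ : K →L[ℂ] H))† ∘L (T : R →L[ℂ] R) ∘L D.k1 η := by
    refine (D.hasSum_sumLeft _ _ _ _).unique ?_
    refine hasSum_single (f := fun m => (D.k2 ξ' ∘L (SeqInf.single ξ).seq m)† ∘L
      (T : R →L[ℂ] R) ∘L D.k1 ((SeqInf.single η).el m)) 0 fun n hn => ?_
    rw [SeqInf.single_seq_of_ne _ hn, ContinuousLinearMap.comp_zero, map_zero,
      ContinuousLinearMap.zero_comp]
  rw [h]
  rfl

end SliceData
end Slices

/-! ### Banach algebras and their representations from a coassociative coproduct. -/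

section Fourier
variable {K : Type u} [NormedAddCommGroup K] [InnerProductSpace ℂ K] [CompleteSpace K]
variable {H : Type v} [NormedAddCommGroup H] [InnerProductSpace ℂ H] [CompleteSpace H]
variable {R : Type w} [NormedAddCommGroup R] [InnerProductSpace ℂ R] [CompleteSpace R]

/-- A coassociative coproduct `δ : A → B`, compatible with the slice maps. -/
structure CoproductData (A : Submodule ℂ (H →L[ℂ] H)) (E F : Submodule ℂ (K →L[ℂ] H))
    (B : Submodule ℂ (R →L[ℂ] R)) (EE FF : Submodule ℂ (K →L[ℂ] R))
    (W : Type*) [NormedAddCommGroup W] [InnerProductSpace ℂ W] [CompleteSpace W]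
    extends SliceData A E F B EE FF where
  δ : (H →L[ℂ] H) → (R →L[ℂ] R)
  δ_mem : ∀ z ∈ A, δ z ∈ B
  exists_restrict : ∀ (θ : SeqInf FF) (θ' : SeqInf EE), ∃ ψ : Omega A F E,
    ‖ψ‖ ≤ ‖θ‖ * ‖θ'‖ ∧ ∀ z : A, ψ.toCLM z = ∑' n, (θ.seq n)† ∘L δ z ∘L θ'.seq n
  l1 : E → R →L[ℂ] W
  l3 : F → R →L[ℂ] W
  exch3 : ∀ σ τ, l1 σ ∘L k2 τ = l3 τ ∘L k1 σ
  exists_δδ : ∀ z ∈ A, ∃ S : W →L[ℂ] W,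
    (∀ σ η, δ ((k1 σ)† ∘L δ z ∘L k1 η) = (l1 σ)† ∘L S ∘L l1 η) ∧
    (∀ ξ τ, δ ((k2 ξ)† ∘L δ z ∘L k2 τ) = (l3 ξ)† ∘L S ∘L l3 τ)

namespace CoproductData
variable {A : Submodule ℂ (H →L[ℂ] H)} {E F : Submodule ℂ (K →L[ℂ] H)}
  {B : Submodule ℂ (R →L[ℂ] R)} {EE FF : Submodule ℂ (K →L[ℂ] R)}
  {W : Type*} [NormedAddCommGroup W] [InnerProductSpace ℂ W] [CompleteSpace W]
  (D : CoproductData A E F B EE FF W)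

/-- `δ` as a map `A → B`. -/
def δ' (z : A) : B := ⟨D.δ z, D.δ_mem z z.2⟩

/-- Any two representations of `φ` give the same `ψ`, since `ψ` is determined by its values `φ (δ
z)`. The estimate for each representation therefore descends to the infimum `‖φ‖`. -/
theorem exists_restrict' (φ : Omega B FF EE) : ∃ ψ : Omega A F E,
    ‖ψ‖ ≤ ‖φ‖ ∧ ∀ z : A, ψ.toCLM z = φ.toCLM (D.δ' z) := by
  obtain ⟨θ₀, θ₀', h₀⟩ := φ.exists_eq
  obtain ⟨ψ, -, hψ⟩ := D.exists_restrict θ₀ θ₀'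
  have hψ' : ∀ z : A, ψ.toCLM z = φ.toCLM (D.δ' z) := fun z => by
    rw [hψ, h₀, omega_toCLM]
    rfl
  refine ⟨ψ, ?_, hψ'⟩
  have := φ.le_mul_norm (c := ‖ψ‖) zero_le_one fun θ θ' h => by
    obtain ⟨ψ₁, hn, hψ₁⟩ := D.exists_restrict θ θ'
    have e : ψ = ψ₁ := Omega.ext fun z => by
      rw [hψ', hψ₁, h, omega_toCLM]
      rfl
    rw [e, one_mul]
    exact hn
  rwa [one_mul] at this

/-- The map `φ ↦ φ ∘ δ`. -/
def restrict : Omega B FF EE →ₗ[ℂ] Omega A F E where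
  toFun := fun φ => (D.exists_restrict' φ).choose
  map_add' := fun φ φ' => Omega.ext fun z => by
    have h := fun φ => (D.exists_restrict' φ).choose_spec.2 z
    refine (h (φ + φ')).trans (((Omega.evalL (D.δ' z)).map_add φ φ').trans ?_)
    exact (congrArg₂ (· + ·) (h φ).symm (h φ').symm).trans ((Omega.evalL z).map_add _ _).symm
  map_smul' := fun r φ => Omega.ext fun z => by
    have h := fun φ => (D.exists_restrict' φ).choose_spec.2 z
    refine (h (r • φ)).trans (((Omega.evalL (D.δ' z)).map_smul r φ).trans ?_)
    exact (congrArg (r • ·) (h φ).symm).trans ((Omega.evalL z).map_smul r _).symm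

theorem restrict_toCLM (φ : Omega B FF EE) (z : A) :
    (D.restrict φ).toCLM z = φ.toCLM (D.δ' z) := (D.exists_restrict' φ).choose_spec.2 z

theorem norm_restrict_le (φ : Omega B FF EE) : ‖D.restrict φ‖ ≤ ‖φ‖ :=
  (D.exists_restrict' φ).choose_spec.1

/-- The multiplication `ω * ω' = (ω ⊠ ω') ∘ δ`. -/
def mul : Omega A F E →ₗ[ℂ] Omega A F E →ₗ[ℂ] Omega A F E := D.box.compr₂ D.restrict

theorem mul_toCLM (ω ω' : Omega A F E) (z : A) :
    (D.mul ω ω').toCLM z = (D.box ω ω').toCLM (D.δ' z) := D.restrict_toCLM _ z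

theorem norm_mul_le (ω ω' : Omega A F E) : ‖D.mul ω ω'‖ ≤ ‖ω‖ * ‖ω'‖ :=
  (D.norm_restrict_le _).trans (D.norm_boxFun_le ω ω')

/-- The multiplication as a bounded bilinear map. -/
def mulL : Omega A F E →L[ℂ] Omega A F E →L[ℂ] Omega A F E :=
  LinearMap.mkContinuous₂ D.mul 1 fun x y => by
    rw [one_mul]
    exact D.norm_mul_le x y

theorem mul_single_single (ξ ξ' : F) (η η' : E) (z : A) :
    (D.mul (omega A (SeqInf.single ξ) (SeqInf.single η))
      (omega A (SeqInf.single ξ') (SeqInf.single η'))).toCLM z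
      = (D.k2 ξ' ∘L (ξ : K →L[ℂ] H))† ∘L D.δ z ∘L D.k1 η ∘L (η' : K →L[ℂ] H) := by
  rw [mul_toCLM, D.box_omega_single_single]
  rfl

/-- With `S` the double coproduct of `z`, both bracketings evaluate to the matrix entry of `S`
between `l3 ξ'' k2 ξ' ξ` and `l1 η k1 η' η''`. The left bracketing sees `S` through slices of the
last leg, the right one through slices of the first leg. -/
theorem mul_assoc_single (ξ ξ' ξ'' : F) (η η' η'' : E) :
    D.mul (D.mul (omega A (SeqInf.single ξ) (SeqInf.single η))
        (omega A (SeqInf.single ξ') (SeqInf.single η')))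
        (omega A (SeqInf.single ξ'') (SeqInf.single η''))
      = D.mul (omega A (SeqInf.single ξ) (SeqInf.single η))
        (D.mul (omega A (SeqInf.single ξ') (SeqInf.single η'))
        (omega A (SeqInf.single ξ'') (SeqInf.single η''))) := by
  refine Omega.ext fun z => ?_
  obtain ⟨S, hS1, hS2⟩ := D.exists_δδ z z.2
  -- The inner products are represented by unspecified sequences; only the functionals they define
  -- will enter, through `sumLeft_comp` and `comp_sumRight`.
  obtain ⟨c, d, hcd⟩ := (D.mul (omega A (SeqInf.single ξ) (SeqInf.single η))
        (omega A (SeqInf.single ξ') (SeqInf.single η'))).exists_eq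
  obtain ⟨c', d', hcd'⟩ := (D.mul (omega A (SeqInf.single ξ') (SeqInf.single η'))
        (omega A (SeqInf.single ξ'') (SeqInf.single η''))).exists_eq
  -- Tested on `τ`, the left side becomes the inner product of functionals at a slice of `δ z`. Its
  -- coproduct is a slice of `S`, and the exchange relations carry `τ` to the far right.
  have hl : D.sumLeft c d ξ'' (D.δ' z)
      = (D.l3 ξ'' ∘L D.k2 ξ' ∘L (ξ : K →L[ℂ] H))† ∘L S ∘L D.l1 η ∘L D.k1 η' := by
    refine D.total_right.ext fun τ => ?_
    rw [D.sumLeft_comp, ← hcd, mul_single_single]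
    have h1 : D.δ (D.slice2 ξ'' τ (D.δ' z)) = _ := hS2 ξ'' τ
    have h2 := D.exch3 η τ
    have h3 := D.exch η' τ
    rw [h1]
    calc (D.k2 ξ' ∘L (ξ : K →L[ℂ] H))† ∘L ((D.l3 ξ'')† ∘L S ∘L D.l3 τ) ∘L D.k1 η ∘L
          (η' : K →L[ℂ] H)
        = ((D.k2 ξ' ∘L (ξ : K →L[ℂ] H))† ∘L (D.l3 ξ'')†) ∘L S ∘L (D.l3 τ ∘L D.k1 η) ∘L
          (η' : K →L[ℂ] H) := rfl
      _ = (D.l3 ξ'' ∘L D.k2 ξ' ∘L (ξ : K →L[ℂ] H))† ∘L S ∘L D.l1 η ∘L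
          (D.k2 τ ∘L (η' : K →L[ℂ] H)) := by
        rw [← h2, ContinuousLinearMap.adjoint_comp (D.l3 ξ'')]
        rfl
      _ = _ := by rw [← h3]; rfl
  -- The same argument on the adjoint side, with the test operator `σ` carried to the far left.
  have hr : D.sumRight c' d' η (D.δ' z)
      = (D.l3 ξ'' ∘L D.k2 ξ')† ∘L S ∘L D.l1 η ∘L D.k1 η' ∘L (η'' : K →L[ℂ] H) := by
    apply ContinuousLinearMap.adjoint.injective
    refine D.total_left.ext fun σ => ?_
    apply ContinuousLinearMap.adjoint.injective
    rw [ContinuousLinearMap.adjoint_comp, ContinuousLinearMap.adjoint_comp,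
      ContinuousLinearMap.adjoint_adjoint, ContinuousLinearMap.adjoint_adjoint]
    rw [D.comp_sumRight, ← hcd', mul_single_single]
    have h1 : D.δ (D.slice1 σ η (D.δ' z)) = _ := hS1 σ η
    have h2 := D.exch3 σ ξ''
    have h3 := D.exch σ ξ'
    rw [h1]
    calc (D.k2 ξ'' ∘L (ξ' : K →L[ℂ] H))† ∘L ((D.l1 σ)† ∘L S ∘L D.l1 η) ∘L D.k1 η' ∘L
          (η'' : K →L[ℂ] H)
        = ((D.k2 ξ'' ∘L (ξ' : K →L[ℂ] H))† ∘L (D.l1 σ)†) ∘L S ∘L D.l1 η ∘L D.k1 η' ∘L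
          (η'' : K →L[ℂ] H) := rfl
      _ = ((D.l1 σ ∘L D.k2 ξ'') ∘L (ξ' : K →L[ℂ] H))† ∘L S ∘L D.l1 η ∘L D.k1 η' ∘L
          (η'' : K →L[ℂ] H) := by
        rw [← ContinuousLinearMap.adjoint_comp]
        rfl
      _ = (D.l3 ξ'' ∘L (D.k1 σ ∘L (ξ' : K →L[ℂ] H)))† ∘L S ∘L D.l1 η ∘L D.k1 η' ∘L
          (η'' : K →L[ℂ] H) := by
        rw [h2]
        rfl
      _ = ((D.l3 ξ'' ∘L D.k2 ξ') ∘L (σ : K →L[ℂ] H))† ∘L S ∘L D.l1 η ∘L D.k1 η' ∘L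
          (η'' : K →L[ℂ] H) := by
        rw [h3]
        rfl
      _ = _ := by
        rw [ContinuousLinearMap.adjoint_comp _ (σ : K →L[ℂ] H)]
        rfl
  rw [mul_toCLM, mul_toCLM, hcd, hcd', D.box_omega_single_right, D.box_omega_single_left, hl, hr]
  rw [ContinuousLinearMap.adjoint_comp, ContinuousLinearMap.adjoint_comp (D.k2 ξ'),
    ContinuousLinearMap.adjoint_comp]
  rfl

/-- The identity extends from rank-one functionals to all of `Ω` one variable at a time: each side
is bounded and linear in the variable being freed, so `Omega.clm_ext` applies. -/
theorem mul_assoc (x y z : Omega A F E) : D.mul (D.mul x y) z = D.mul x (D.mul y z) := by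
  have h1 : ∀ (ξ ξ' : F) (η η' : E) (x : Omega A F E),
      D.mul (D.mul x (omega A (SeqInf.single ξ) (SeqInf.single η)))
        (omega A (SeqInf.single ξ') (SeqInf.single η'))
      = D.mul x (D.mul (omega A (SeqInf.single ξ) (SeqInf.single η))
        (omega A (SeqInf.single ξ') (SeqInf.single η'))) := by
    intro ξ ξ' η η' x
    refine DFunLike.congr_fun (Omega.clm_ext
      (f := (D.mulL.flip (omega A (SeqInf.single ξ') (SeqInf.single η'))).comp
        (D.mulL.flip (omega A (SeqInf.single ξ) (SeqInf.single η))))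
      (g := D.mulL.flip (D.mul (omega A (SeqInf.single ξ) (SeqInf.single η))
        (omega A (SeqInf.single ξ') (SeqInf.single η')))) fun ξ₁ η₁ => ?_) x
    exact D.mul_assoc_single ξ₁ ξ ξ' η₁ η η'
  have h2 : ∀ (ξ' : F) (η' : E) (x y : Omega A F E),
      D.mul (D.mul x y) (omega A (SeqInf.single ξ') (SeqInf.single η'))
      = D.mul x (D.mul y (omega A (SeqInf.single ξ') (SeqInf.single η'))) := by
    intro ξ' η' x y
    refine DFunLike.congr_fun (Omega.clm_ext
      (f := (D.mulL.flip (omega A (SeqInf.single ξ') (SeqInf.single η'))).comp (D.mulL x))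
      (g := (D.mulL x).comp (D.mulL.flip (omega A (SeqInf.single ξ') (SeqInf.single η'))))
      fun ξ₁ η₁ => ?_) y
    exact h1 ξ₁ ξ' η₁ η' x
  refine DFunLike.congr_fun (Omega.clm_ext (f := D.mulL (D.mul x y))
      (g := (D.mulL x).comp (D.mulL y)) fun ξ₁ η₁ => ?_) z
  exact h2 ξ₁ η₁ x y

theorem isBanachAlgebra_mul : IsBanachAlgebra (Omega A F E) D.mul :=
  ⟨inferInstance, D.mul_assoc, D.norm_mul_le⟩

end CoproductData

/-- A representation `ω_{ξ,η} ↦ ∑ₙ (a ξₙ)* V b ηₙ` of the functionals, determined by the values of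
the functionals on the operators `s p q`. -/
structure FourierData (A : Submodule ℂ (H →L[ℂ] H)) (E F : Submodule ℂ (K →L[ℂ] H))
    (B : Submodule ℂ (R →L[ℂ] R)) (EE FF : Submodule ℂ (K →L[ℂ] R))
    (W Y Y' : Type*) [NormedAddCommGroup W] [InnerProductSpace ℂ W] [CompleteSpace W]
    [NormedAddCommGroup Y] [InnerProductSpace ℂ Y] [CompleteSpace Y]
    [NormedAddCommGroup Y'] [InnerProductSpace ℂ Y'] [CompleteSpace Y'] (P Q : Type*)
    extends CoproductData A E F B EE FF W where
  a : F → H →L[ℂ] Y'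
  b : E → H →L[ℂ] Y
  V : Y →L[ℂ] Y'
  norm_V : ‖V‖ ≤ 1
  rowBound_a : ∀ η : SeqInf F, RowBound (fun n => a (η.el n)) ‖η‖
  rowBound_b : ∀ η : SeqInf E, RowBound (fun n => b (η.el n)) ‖η‖
  sqSmall_b : ∀ η : SeqInf E, SqSmall (fun n => b (η.el n))
  p : P → K →L[ℂ] H
  q : Q → K →L[ℂ] H
  total_p : Total p
  total_q : Total q
  s : P → Q → A
  slice_eq : ∀ (i : P) (j : Q) (ξ : F) (η : E), (p i)† ∘L ((a ξ)† ∘L V ∘L b η) ∘L q j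
    = (ξ : K →L[ℂ] H)† ∘L (s i j : H →L[ℂ] H) ∘L (η : K →L[ℂ] H)
  δ_slice : ∀ (i : P) (j : Q) (ξ ξ' : F) (η η' : E),
    (k2 ξ' ∘L (ξ : K →L[ℂ] H))† ∘L δ (s i j) ∘L k1 η ∘L (η' : K →L[ℂ] H)
    = (p i)† ∘L ((a ξ)† ∘L V ∘L b η) ∘L ((a ξ')† ∘L V ∘L b η') ∘L q j

namespace FourierData
variable {A : Submodule ℂ (H →L[ℂ] H)} {E F : Submodule ℂ (K →L[ℂ] H)}
  {B : Submodule ℂ (R →L[ℂ] R)} {EE FF : Submodule ℂ (K →L[ℂ] R)}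
  {W Y Y' : Type*} [NormedAddCommGroup W] [InnerProductSpace ℂ W] [CompleteSpace W]
  [NormedAddCommGroup Y] [InnerProductSpace ℂ Y] [CompleteSpace Y]
  [NormedAddCommGroup Y'] [InnerProductSpace ℂ Y'] [CompleteSpace Y'] {P Q : Type*}
  (D : FourierData A E F B EE FF W Y Y' P Q)

/-- The operator `(a ξ)* V b η`. -/
def coeff (ξ : F) (η : E) : H →L[ℂ] H := (D.a ξ)† ∘L D.V ∘L D.b η

/-- The operator `∑ₙ (a ξₙ)* V b ηₙ`. -/
def piSum (ξ : SeqInf F) (η : SeqInf E) : H →L[ℂ] H := ∑' n, D.coeff (ξ.el n) (η.el n)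

theorem hasSum_piSum (ξ : SeqInf F) (η : SeqInf E) :
    HasSum (fun n => D.coeff (ξ.el n) (η.el n)) (D.piSum ξ η) :=
  (summable_adjoint_comp D.V ξ.norm_nonneg (D.rowBound_a ξ) (D.sqSmall_b η)).hasSum

theorem norm_piSum_le (ξ : SeqInf F) (η : SeqInf E) : ‖D.piSum ξ η‖ ≤ ‖ξ‖ * ‖η‖ := by
  refine (norm_tsum_adjoint_comp_le D.V ξ.norm_nonneg η.norm_nonneg (D.rowBound_a ξ)
    (D.rowBound_b η) (D.sqSmall_b η)).trans ?_
  calc _ ≤ ‖ξ‖ * ‖η‖ * 1 := by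
        have := mul_nonneg ξ.norm_nonneg η.norm_nonneg
        gcongr
        exact D.norm_V
    _ = _ := mul_one _

/-- Matrix entries of the sum are values of the functional at the operators `s i j`. Since `p` and
`q` are total, the sum does not depend on the chosen representation. -/
theorem comp_piSum_comp (ξ : SeqInf F) (η : SeqInf E) (i : P) (j : Q) :
    (D.p i)† ∘L D.piSum ξ η ∘L D.q j = (omega A ξ η).toCLM (D.s i j) := by
  have h := ((D.hasSum_piSum ξ η).mapL ((ContinuousLinearMap.compL ℂ K H H).flip (D.q j))).mapL
    (ContinuousLinearMap.compL ℂ K H K ((D.p i)†))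
  have e : (fun n => (ContinuousLinearMap.compL ℂ K H K ((D.p i)†))
      ((ContinuousLinearMap.compL ℂ K H H).flip (D.q j) (D.coeff (ξ.el n) (η.el n))))
      = fun n => (ξ.seq n)† ∘L (D.s i j : H →L[ℂ] H) ∘L η.seq n := by
    funext n
    exact D.slice_eq i j (ξ.el n) (η.el n)
  rw [e] at h
  exact h.tsum_eq.symm

theorem ext_pq {T T' : H →L[ℂ] H}
    (h : ∀ i j, (D.p i)† ∘L T ∘L D.q j = (D.p i)† ∘L T' ∘L D.q j) : T = T' := by
  refine D.total_q.ext fun j => ?_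
  apply ContinuousLinearMap.adjoint.injective
  refine D.total_p.ext fun i => ?_
  apply ContinuousLinearMap.adjoint.injective
  rw [ContinuousLinearMap.adjoint_comp _ (D.p i), ContinuousLinearMap.adjoint_comp _ (D.p i),
    ContinuousLinearMap.adjoint_adjoint, ContinuousLinearMap.adjoint_adjoint]
  exact h i j

/-- The representation on representatives chosen arbitrarily. -/
def piFun (ω : Omega A F E) : H →L[ℂ] H :=
  D.piSum ω.exists_eq.choose ω.exists_eq.choose_spec.choose

theorem comp_piFun_comp (ω : Omega A F E) (i : P) (j : Q) :
    (D.p i)† ∘L D.piFun ω ∘L D.q j = ω.toCLM (D.s i j) := by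
  rw [piFun, comp_piSum_comp, ← ω.exists_eq.choose_spec.choose_spec]

theorem piFun_omega (ξ : SeqInf F) (η : SeqInf E) : D.piFun (omega A ξ η) = D.piSum ξ η :=
  D.ext_pq fun i j => by rw [comp_piFun_comp, comp_piSum_comp]

/-- The representation as a bounded linear map. -/
def rep : Omega A F E →L[ℂ] (H →L[ℂ] H) :=
  LinearMap.mkContinuous
    { toFun := D.piFun
      map_add' := fun ω ω' => D.ext_pq fun i j => by
        rw [ContinuousLinearMap.add_comp, ContinuousLinearMap.comp_add, comp_piFun_comp,
          comp_piFun_comp, comp_piFun_comp, ← Omega.evalL_apply, map_add]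
        rfl
      map_smul' := fun r ω => D.ext_pq fun i j => by
        rw [RingHom.id_apply, ContinuousLinearMap.smul_comp, ContinuousLinearMap.comp_smul,
          comp_piFun_comp, comp_piFun_comp, ← Omega.evalL_apply, map_smul]
        rfl } 1 fun ω => by
    refine ω.le_mul_norm zero_le_one fun ξ η h => ?_
    rw [one_mul]
    change ‖D.piFun ω‖ ≤ _
    rw [h, piFun_omega]
    exact D.norm_piSum_le ξ η

theorem rep_omega (ξ : SeqInf F) (η : SeqInf E) : D.rep (omega A ξ η) = D.piSum ξ η :=
  D.piFun_omega ξ η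

theorem comp_rep_comp (ω : Omega A F E) (i : P) (j : Q) :
    (D.p i)† ∘L D.rep ω ∘L D.q j = ω.toCLM (D.s i j) := D.comp_piFun_comp ω i j

theorem norm_rep_le : ‖D.rep‖ ≤ 1 := LinearMap.mkContinuous_norm_le _ zero_le_one _

theorem rep_single (ξ : F) (η : E) :
    D.rep (omega A (SeqInf.single ξ) (SeqInf.single η)) = D.coeff ξ η := by
  refine D.ext_pq fun i j => ?_
  rw [comp_rep_comp, omega_single]
  exact (D.slice_eq i j ξ η).symm

theorem rep_mul_single (ξ ξ' : F) (η η' : E) :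
    D.rep (D.mul (omega A (SeqInf.single ξ) (SeqInf.single η))
      (omega A (SeqInf.single ξ') (SeqInf.single η')))
      = D.rep (omega A (SeqInf.single ξ) (SeqInf.single η)) *
        D.rep (omega A (SeqInf.single ξ') (SeqInf.single η')) := by
  refine D.ext_pq fun i j => ?_
  rw [comp_rep_comp, D.mul_single_single, rep_single, rep_single]
  exact D.δ_slice i j ξ ξ' η η'

/-- Rank-one functionals are settled by `rep_mul_single`; boundedness of the representation and of
the multiplication frees the two variables in turn. -/
theorem rep_mul (x y : Omega A F E) : D.rep (D.mul x y) = D.rep x * D.rep y := by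
  have h1 : ∀ (ξ : F) (η : E) (x : Omega A F E),
      D.rep (D.mul x (omega A (SeqInf.single ξ) (SeqInf.single η)))
        = D.rep x * D.rep (omega A (SeqInf.single ξ) (SeqInf.single η)) := by
    intro ξ η x
    refine DFunLike.congr_fun (Omega.clm_ext
      (f := D.rep.comp (D.mulL.flip (omega A (SeqInf.single ξ) (SeqInf.single η))))
      (g := ((ContinuousLinearMap.mul ℂ (H →L[ℂ] H)).flip
        (D.rep (omega A (SeqInf.single ξ) (SeqInf.single η)))).comp D.rep) fun ξ₁ η₁ => ?_) x
    exact D.rep_mul_single ξ₁ ξ η₁ η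
  refine DFunLike.congr_fun (Omega.clm_ext (f := D.rep.comp (D.mulL x))
      (g := ((ContinuousLinearMap.mul ℂ (H →L[ℂ] H)) (D.rep x)).comp D.rep) fun ξ₁ η₁ => ?_) y
  exact h1 ξ₁ η₁ x

/-- The range of the representation. -/
def range : Set (H →L[ℂ] H) :=
  {T | ∃ (ξ : SeqInf F) (η : SeqInf E), HasSum (fun n => D.coeff (ξ.el n) (η.el n)) T}

theorem range_rep : Set.range D.rep = D.range := by
  ext T
  constructor
  · rintro ⟨ω, rfl⟩
    obtain ⟨ξ, η, rfl⟩ := ω.exists_eq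
    exact ⟨ξ, η, by rw [rep_omega]; exact D.hasSum_piSum ξ η⟩
  · rintro ⟨ξ, η, h⟩
    exact ⟨omega A ξ η, by rw [rep_omega]; exact (D.hasSum_piSum ξ η).unique h⟩

theorem rep_mem (ω : Omega A F E) : D.rep ω ∈ cspan {T | ∃ ξ η, T = D.coeff ξ η} := by
  obtain ⟨ξ, η, rfl⟩ := ω.exists_eq
  rw [rep_omega]
  refine (isClosed_cspan _).mem_of_tendsto (D.hasSum_piSum ξ η) (Filter.Eventually.of_forall
    fun s => sum_mem fun n _ => mem_cspan ⟨_, _, rfl⟩)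

/-- The range of the representation as a subalgebra. -/
def rangeSubalgebra : NonUnitalSubalgebra ℂ (H →L[ℂ] H) where
  carrier := D.range
  add_mem' := by
    rw [← range_rep]
    rintro _ _ ⟨x, rfl⟩ ⟨y, rfl⟩
    exact ⟨x + y, map_add _ _ _⟩
  zero_mem' := by
    rw [← range_rep]
    exact ⟨0, map_zero _⟩
  smul_mem' := by
    rw [← range_rep]
    rintro r _ ⟨x, rfl⟩
    exact ⟨r • x, map_smul _ _ _⟩
  mul_mem' := by
    rw [← range_rep]
    rintro _ _ ⟨x, rfl⟩ ⟨y, rfl⟩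
    exact ⟨D.mul x y, D.rep_mul x y⟩

/-- Every value of the representation is a limit of finite sums of coefficients. Conversely the
range is a linear subspace, and it contains each coefficient as the image of a rank-one functional.
-/
theorem closure_range :
    closure D.range = (cspan {T | ∃ ξ η, T = D.coeff ξ η} : Set (H →L[ℂ] H)) := by
  apply subset_antisymm
  · refine closure_minimal ?_ (isClosed_cspan _)
    rw [← range_rep]
    rintro _ ⟨ω, rfl⟩
    exact D.rep_mem ω
  · refine closure_mono ?_
    have : Submodule.span ℂ {T | ∃ ξ η, T = D.coeff ξ η} ≤ D.rangeSubalgebra.toSubmodule := by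
      refine Submodule.span_le.2 ?_
      rintro _ ⟨ξ, η, rfl⟩
      change D.coeff ξ η ∈ D.range
      rw [← range_rep, ← D.rep_single]
      exact ⟨_, rfl⟩
    exact this

/-- Common form of the two halves of the theorem; they arise from two choices of the data. -/
theorem main : ∃ Φ : ProjTensorSq (Omega A F E) →L[ℂ] Omega B FF EE,
    ‖Φ‖ ≤ 1 ∧
    (∀ (ξ ξ' : SeqInf F) (η η' : SeqInf E) (i : ℕ × ℕ ≃ ℕ),
      ∃ (θ : SeqInf FF) (θ' : SeqInf EE),
        (∀ m n, θ.seq (i (m, n)) = D.k2 (ξ'.el n) ∘L ξ.seq m) ∧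
        (∀ m n, θ'.seq (i (m, n)) = D.k1 (η.el m) ∘L η'.seq n) ∧
        Φ (projTmul (omega A ξ η) (omega A ξ' η')) = omega B θ θ') ∧
    (∃ hΔ : ∀ z ∈ A, D.δ z ∈ B,
      ∃ mul : Omega A F E →ₗ[ℂ] Omega A F E →ₗ[ℂ] Omega A F E,
        IsBanachAlgebra (Omega A F E) mul ∧
        (∀ (ω ω' : Omega A F E) (z : A),
          (mul ω ω').toCLM z = (Φ (projTmul ω ω')).toCLM ⟨D.δ z, hΔ z z.2⟩) ∧
        ∃ π : Omega A F E →L[ℂ] (H →L[ℂ] H),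
          ‖π‖ ≤ 1 ∧
          (∀ ω, π ω ∈ cspan {T | ∃ ξ η, T = D.coeff ξ η}) ∧
          (∀ ω ω', π (mul ω ω') = π ω * π ω') ∧
          (∀ (ξ : SeqInf F) (η : SeqInf E),
            HasSum (fun n => D.coeff (ξ.el n) (η.el n)) (π (omega A ξ η))) ∧
          Set.range π = D.range ∧
          ∃ S : NonUnitalSubalgebra ℂ (H →L[ℂ] H), (S : Set (H →L[ℂ] H)) = D.range ∧
            closure D.range = (cspan {T | ∃ ξ η, T = D.coeff ξ η} : Set (H →L[ℂ] H))) := by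
  obtain ⟨Φ, hΦ, hΦ'⟩ := exists_projTensorSq_extension D.box D.norm_boxFun_le
  refine ⟨Φ, hΦ, fun ξ ξ' η η' i => ⟨D.seqLeft ξ ξ' i, D.seqRight η η' i,
    D.seqLeft_apply ξ ξ' i, D.seqRight_apply η η' i, ?_⟩, D.δ_mem, D.mul, D.isBanachAlgebra_mul,
    fun ω ω' z => ?_, D.rep, D.norm_rep_le, D.rep_mem, D.rep_mul, fun ξ η => ?_, D.range_rep,
    D.rangeSubalgebra, rfl, D.closure_range⟩
  · rw [hΦ']
    exact D.boxFun_omega ξ ξ' η η' i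
  · rw [hΦ', D.mul_toCLM]
    rfl
  · rw [rep_omega]
    exact D.hasSum_piSum ξ η

end FourierData
end Fourier

/-! ### Totality, adjoints and unitaries given by frames. -/

section Compositions
variable {X Y Z W : Type*}
  [NormedAddCommGroup X] [InnerProductSpace ℂ X] [CompleteSpace X]
  [NormedAddCommGroup Y] [InnerProductSpace ℂ Y] [CompleteSpace Y]
  [NormedAddCommGroup Z] [InnerProductSpace ℂ Z] [CompleteSpace Z]
  [NormedAddCommGroup W] [InnerProductSpace ℂ W] [CompleteSpace W]

theorem comp_reassoc {f : Y →L[ℂ] Z} {g : X →L[ℂ] Y} {h : X →L[ℂ] Z} (e : f ∘L g = h)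
    (k : W →L[ℂ] X) : f ∘L g ∘L k = h ∘L k := by
  rw [← e]
  rfl

theorem adjoint_comp_eq {U : Type*} [NormedAddCommGroup U] [InnerProductSpace ℂ U]
    [CompleteSpace U] {f : Y →L[ℂ] Z} {g : X →L[ℂ] Y} {f' : U →L[ℂ] Z} {g' : X →L[ℂ] U}
    (e : f ∘L g = f' ∘L g') : g† ∘L f† = g'† ∘L f'† := by
  rw [← ContinuousLinearMap.adjoint_comp, ← ContinuousLinearMap.adjoint_comp, e]

theorem Total.ext_adjoint' {ι κ : Type*} {k : ι → X →L[ℂ] Y} (hk : Total k)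
    {l : κ → W →L[ℂ] Z} (hl : Total l) {T T' : Y →L[ℂ] Z}
    (h : ∀ i j, (l i)† ∘L T ∘L k j = (l i)† ∘L T' ∘L k j) : T = T' := by
  refine hk.ext fun j => ?_
  apply ContinuousLinearMap.adjoint.injective
  refine hl.ext fun i => ?_
  apply ContinuousLinearMap.adjoint.injective
  rw [ContinuousLinearMap.adjoint_comp _ (l i), ContinuousLinearMap.adjoint_comp _ (l i),
    ContinuousLinearMap.adjoint_adjoint, ContinuousLinearMap.adjoint_adjoint]
  exact h i j

theorem Total.comp_right_inverse {ι : Type*} {k : ι → X →L[ℂ] Y} (hk : Total k)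
    {U : Y →L[ℂ] Z} {U' : Z →L[ℂ] Y} (hU : U ∘L U' = ContinuousLinearMap.id ℂ Z) :
    Total fun i => U ∘L k i := by
  refine top_le_iff.1 fun z _ => ?_
  have hz : U' z ∈ cspan {y : Y | ∃ i x, k i x = y} := by
    rw [show cspan _ = ⊤ from hk]; trivial
  have h1 := map_mem_of_mem_cspan U (isClosed_cspan {y : Z | ∃ i x, (U ∘L k i) x = y}) (by
    rintro _ ⟨i, x, rfl⟩
    exact mem_cspan ⟨i, x, rfl⟩) hz
  rwa [show U (U' z) = z from DFunLike.congr_fun hU z] at h1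

/-- An operator between the spans of two families with equal Gram matrices is an isometry. -/
theorem adjoint_comp_self_of_frame {ι : Type*} {k : ι → X →L[ℂ] Y} (hk : Total k)
    {l : ι → X →L[ℂ] Z} (hl : ∀ i j, (l i)† ∘L l j = (k i)† ∘L k j) {U : Y →L[ℂ] Z}
    (hU : ∀ i, U ∘L k i = l i) : U† ∘L U = ContinuousLinearMap.id ℂ Y := by
  refine hk.ext_adjoint fun i j => ?_
  calc _ = (U ∘L k i)† ∘L (U ∘L k j) := by
        rw [ContinuousLinearMap.adjoint_comp]; rfl
    _ = (k i)† ∘L k j := by rw [hU, hU, hl]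
    _ = _ := rfl

/-- Mutually inverse operators, one of which is isometric, are adjoint to each other. -/
theorem adjoint_eq_of_inverse {U : Y →L[ℂ] Z} {U' : Z →L[ℂ] Y}
    (h : U† ∘L U = ContinuousLinearMap.id ℂ Y) (h' : U ∘L U' = ContinuousLinearMap.id ℂ Z) :
    U† = U' := by
  calc U† = U† ∘L (U ∘L U') := by rw [h']; rfl
    _ = (U† ∘L U) ∘L U' := rfl
    _ = U' := by rw [h]; rfl

end Compositions

/-! ### Intertwiners and the calculus of kets. -/

section Intertwiners
variable {K : Type u} [NormedAddCommGroup K] [InnerProductSpace ℂ K] [CompleteSpace K]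
variable {H : Type*} [NormedAddCommGroup H] [InnerProductSpace ℂ H] [CompleteSpace H]
variable {H' : Type*} [NormedAddCommGroup H'] [InnerProductSpace ℂ H'] [CompleteSpace H']
variable {H'' : Type*} [NormedAddCommGroup H''] [InnerProductSpace ℂ H''] [CompleteSpace H'']
variable {L : Type*} [NormedAddCommGroup L] [InnerProductSpace ℂ L] [CompleteSpace L]
variable {b c : CBase K}

/-- Tested between elements of `E`, the claim is that the coefficient `ξ*ξ' ∈ 𝔅` commutes with the
adjoint of `x`, which lies in `𝔅†`. -/
theorem CMod.rho_adjoint (E : CMod b H) (x : b.Bd) : (E.rho x)† = E.rho (star x) := by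
  refine E.total.ext_adjoint fun ξ ξ' => ?_
  have hc := (b.commute _ (E.adjoint_comp_mem ξ ξ') _ (star_mem x.2)).eq
  calc (ξ : K →L[ℂ] H)† ∘L (E.rho x)† ∘L (ξ' : K →L[ℂ] H)
      = (E.rho x ∘L (ξ : K →L[ℂ] H))† ∘L (ξ' : K →L[ℂ] H) := by
        rw [ContinuousLinearMap.adjoint_comp]; rfl
    _ = star (x : K →L[ℂ] K) * ((ξ : K →L[ℂ] H)† ∘L (ξ' : K →L[ℂ] H)) := by
        rw [E.rho_comp, ContinuousLinearMap.adjoint_comp]; rfl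
    _ = ((ξ : K →L[ℂ] H)† ∘L (ξ' : K →L[ℂ] H)) * star (x : K →L[ℂ] K) := hc.symm
    _ = (ξ : K →L[ℂ] H)† ∘L E.rho (star x) ∘L (ξ' : K →L[ℂ] H) := by rw [E.rho_comp]; rfl

theorem CMod.rho_mul (E : CMod b H) (x y : b.Bd) : E.rho (x * y) = E.rho x ∘L E.rho y :=
  E.total.ext fun ξ => by
    rw [E.rho_comp, ContinuousLinearMap.comp_assoc, E.rho_comp, ← ContinuousLinearMap.comp_assoc,
      E.rho_comp]
    rfl

theorem CMod.rho_total (E : CMod b H) : Total E.rho := by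
  refine top_le_iff.1 ?_
  rw [← show cspan _ = ⊤ from b.nondegenerate_Bd.comp E.total]
  intro z hz
  refine map_mem_of_mem_cspan (ContinuousLinearMap.id ℂ _) (isClosed_cspan _) ?_ hz
  rintro _ ⟨⟨x, ξ⟩, ζ, rfl⟩
  exact mem_cspan ⟨x, (ξ : K →L[ℂ] H) ζ, DFunLike.congr_fun (E.rho_comp x ξ) ζ⟩

/-- `T` intertwines `ρ_E` and `ρ_E'`. -/
def Intertw (E : CMod b H) (E' : CMod b H') (T : H →L[ℂ] H') : Prop :=
  ∀ x, T ∘L E.rho x = E'.rho x ∘L T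

theorem Intertw.adjoint {E : CMod b H} {E' : CMod b H'} {T : H →L[ℂ] H'} (h : Intertw E E' T) :
    Intertw E' E (T†) := fun x => by
  have := adjoint_comp_eq (h (star x))
  rw [E.rho_adjoint, E'.rho_adjoint, star_star] at this
  exact this.symm

theorem Intertw.comp {E : CMod b H} {E' : CMod b H'} {E'' : CMod b H''} {S : H' →L[ℂ] H''}
    {T : H →L[ℂ] H'} (hS : Intertw E' E'' S) (hT : Intertw E E' T) : Intertw E E'' (S ∘L T) :=
  fun x => by
    calc (S ∘L T) ∘L E.rho x = S ∘L (T ∘L E.rho x) := rfl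
      _ = (S ∘L E'.rho x) ∘L T := by rw [hT]; rfl
      _ = _ := by rw [hS]; rfl

theorem MapsOnto.mem {E : CMod b H} {E' : CMod b H'} {T : H →L[ℂ] H'} (h : MapsOnto T E E')
    {ξ : K →L[ℂ] H} (hξ : ξ ∈ E.space) : T ∘L ξ ∈ E'.space := by
  have : T ∘L ξ ∈ {θ | ∃ θ₀ ∈ E.space, θ = T ∘L θ₀} := ⟨ξ, hξ, rfl⟩
  rw [show _ = _ from h] at this
  exact this

theorem MapsOnto.intertw {E : CMod b H} {E' : CMod b H'} {T : H →L[ℂ] H'} (h : MapsOnto T E E') :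
    Intertw E E' T := E.intertwine E' T fun _ hξ => h.mem hξ

theorem CMod.mem_commutant {E : CMod b H} {T : H →L[ℂ] H} : T ∈ E.commutant ↔ Intertw E E T := by
  constructor
  · intro h x
    exact (h (E.rho x) ⟨x, rfl⟩).symm
  · rintro h _ ⟨x, rfl⟩
    exact (h x).symm

/-- The operators `⟨ηₖ|₂|ηₖ⟩₂` add up to `ρ_E(∑ ηₖ*ηₖ)`, and `ρ_E` is contractive. Square sums of
kets are thus governed by those of the sequence itself. -/
theorem sum_norm_sq_ket2_le (E : CMod b H) (F : CMod b.dagger L) {ι : Type*} (η : ι → F.space)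
    (s : Finset ι) (v : H) :
    ∑ k ∈ s, ‖ket2 E F (η k) v‖ ^ 2
      ≤ ‖∑ k ∈ s, (η k : K →L[ℂ] L)† ∘L (η k : K →L[ℂ] L)‖ * ‖v‖ ^ 2 := by
  refine (sum_norm_sq_le (fun k => ket2 E F (η k)) s v).trans ?_
  gcongr
  simp only [ket2_adjoint_comp]
  have e : ∑ k ∈ s, E.rho ⟨(η k : K →L[ℂ] L)† ∘L (η k : K →L[ℂ] L),
      F.adjoint_comp_mem (η k) (η k)⟩ = E.rho (∑ k ∈ s, ⟨(η k : K →L[ℂ] L)† ∘L (η k : K →L[ℂ] L),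
      F.adjoint_comp_mem (η k) (η k)⟩) := (map_sum E.rhoL _ s).symm
  rw [e]
  refine (E.norm_rho_le _).trans (le_of_eq ?_)
  exact congrArg (fun T : K →L[ℂ] K => ‖T‖) (AddSubmonoidClass.coe_finsetSum _ s)

theorem sum_norm_sq_ket1_le (E : CMod b H) (F : CMod b.dagger L) {ι : Type*} (ξ : ι → E.space)
    (s : Finset ι) (v : L) :
    ∑ k ∈ s, ‖ket1 E F (ξ k) v‖ ^ 2
      ≤ ‖∑ k ∈ s, (ξ k : K →L[ℂ] H)† ∘L (ξ k : K →L[ℂ] H)‖ * ‖v‖ ^ 2 := by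
  refine (sum_norm_sq_le (fun k => ket1 E F (ξ k)) s v).trans ?_
  gcongr
  simp only [ket1_adjoint_comp]
  have e : ∑ k ∈ s, F.rho ⟨(ξ k : K →L[ℂ] H)† ∘L (ξ k : K →L[ℂ] H),
      E.adjoint_comp_mem (ξ k) (ξ k)⟩ = F.rho (∑ k ∈ s, ⟨(ξ k : K →L[ℂ] H)† ∘L (ξ k : K →L[ℂ] H),
      E.adjoint_comp_mem (ξ k) (ξ k)⟩) := (map_sum F.rhoL _ s).symm
  rw [e]
  refine (F.norm_rho_le _).trans (le_of_eq ?_)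
  exact congrArg (fun T : K →L[ℂ] K => ‖T‖) (AddSubmonoidClass.coe_finsetSum _ s)

theorem SeqInf.norm_sum_le {E : Submodule ℂ (K →L[ℂ] H)} (η : SeqInf E) (s : Finset ℕ) :
    ‖∑ k ∈ s, (η.seq k)† ∘L η.seq k‖ ≤ ‖η‖ ^ 2 := by
  have h := norm_sum_adjoint_comp_le η.seq η.seq (ContinuousLinearMap.id ℂ H) s η.norm_nonneg
    η.norm_nonneg (η.rowBound s) (η.rowBound s)
  calc _ ≤ _ := h
    _ ≤ ‖η‖ * ‖η‖ * 1 := by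
      have := mul_nonneg η.norm_nonneg η.norm_nonneg
      gcongr
      exact ContinuousLinearMap.norm_id_le
    _ = _ := by ring

theorem rowBound_ket2 (E : CMod b H) (F : CMod b.dagger L) (η : SeqInf F.space) :
    RowBound (fun n => ket2 E F (η.el n)) ‖η‖ := fun s v =>
  (sum_norm_sq_ket2_le E F η.el s v).trans (by gcongr; exact η.norm_sum_le s)

theorem rowBound_ket1 (E : CMod b H) (F : CMod b.dagger L) (ξ : SeqInf E.space) :
    RowBound (fun n => ket1 E F (ξ.el n)) ‖ξ‖ := fun s v =>
  (sum_norm_sq_ket1_le E F ξ.el s v).trans (by gcongr; exact ξ.norm_sum_le s)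

theorem sqSmall_ket2 (E : CMod b H) (F : CMod b.dagger L) (η : SeqInf F.space) :
    SqSmall (fun n => ket2 E F (η.el n)) := fun ε hε => by
  obtain ⟨s, hs⟩ := summable_iff_vanishing_norm.1 η.summable_sq (ε ^ 2) (by positivity)
  exact ⟨s, fun t ht v => (sum_norm_sq_ket2_le E F η.el t v).trans (by gcongr; exact (hs t ht).le)⟩

theorem sqSmall_ket1 (E : CMod b H) (F : CMod b.dagger L) (ξ : SeqInf E.space) :
    SqSmall (fun n => ket1 E F (ξ.el n)) := fun ε hε => by
  obtain ⟨s, hs⟩ := summable_iff_vanishing_norm.1 ξ.summable_sq (ε ^ 2) (by positivity)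
  exact ⟨s, fun t ht v => (sum_norm_sq_ket1_le E F ξ.el t v).trans (by gcongr; exact (hs t ht).le)⟩

/-- The exchange relation behind all slicing arguments: both sides are `ζ ↦ ξ ⊗ ζ ⊗ η`. -/
theorem ket1_comp_eq (E : CMod b H) (F : CMod b.dagger L) (ξ : E.space) (η : F.space) :
    ket1 E F ξ ∘L (η : K →L[ℂ] L) = ket2 E F η ∘L (ξ : K →L[ℂ] H) := by
  rw [ket1_comp, ket2_comp]

section Tri
variable (E : CMod b H) (F : CMod b.dagger L)

theorem triL_rho_ket2 {E₁ : CMod c H} (h : Compat E E₁) (x : c.Bd) (η : F.space) :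
    (triL E F E₁ h).rho x ∘L ket2 E F η = ket2 E F η ∘L E₁.rho x :=
  CMod.push_rho E₁ (ket2 E F) _ _ η x

theorem triR_rho_ket1 {F₁ : CMod c L} (h : Compat F F₁) (x : c.Bd) (ξ : E.space) :
    (triR E F F₁ h).rho x ∘L ket1 E F ξ = ket1 E F ξ ∘L F₁.rho x :=
  CMod.push_rho F₁ (ket1 E F) _ _ ξ x

theorem triL_rho_ket1 {E₁ : CMod c H} (h : Compat E E₁) (h' : Compat E₁ E) (x : c.Bd)
    (ξ : E.space) :
    (triL E F E₁ h).rho x ∘L ket1 E F ξ = ket1 E F ⟨E₁.rho x ∘L ξ, h'.mem x ξ.2⟩ :=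
  F.total.ext fun η => by
    rw [ket1_comp_eq, ContinuousLinearMap.comp_assoc, ket1_comp_eq,
      ← ContinuousLinearMap.comp_assoc, triL_rho_ket2]
    rfl

theorem triR_rho_ket2 {F₁ : CMod c L} (h : Compat F F₁) (h' : Compat F₁ F) (x : c.Bd)
    (η : F.space) :
    (triR E F F₁ h).rho x ∘L ket2 E F η = ket2 E F ⟨F₁.rho x ∘L η, h'.mem x η.2⟩ :=
  E.total.ext fun ξ => by
    rw [← ket1_comp_eq, ContinuousLinearMap.comp_assoc, ← ket1_comp_eq,
      ← ContinuousLinearMap.comp_assoc, triR_rho_ket1]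
    rfl

/-- Amplified representations are the representations of the module structures `E₁ ◁ F`. Commuting
with them can therefore be treated as an intertwining property. -/
theorem tensL_rho {E₁ : CMod c H} (h : Compat E E₁) (x : c.Bd) :
    tensL E E F (E₁.rho x) = (triL E F E₁ h).rho x :=
  (ket2_total E F).ext fun η => by
    have hx : Intertw E E (E₁.rho x) := fun y => (h.comm y x).symm
    rw [tensL_comp E E F _ hx hx.adjoint, triL_rho_ket2]

theorem tensR_rho {F₁ : CMod c L} (h : Compat F F₁) (x : c.Bd) :
    tensR E F F (F₁.rho x) = (triR E F F₁ h).rho x :=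
  (ket1_total E F).ext fun ξ => by
    have hx : Intertw F F (F₁.rho x) := fun y => (h.comm y x).symm
    rw [tensR_comp E F F _ hx hx.adjoint, triR_rho_ket1]

end Tri

section Tens
variable {E : CMod b H} {E' : CMod b H'} {E'' : CMod b H''} (F : CMod b.dagger L)

theorem Intertw.tensL_ket2 {T : H →L[ℂ] H'} (hT : Intertw E E' T) (η : F.space) :
    tensL E E' F T ∘L ket2 E F η = ket2 E' F η ∘L T := tensL_comp E E' F T hT hT.adjoint η

theorem Intertw.tensL_adjoint {T : H →L[ℂ] H'} (hT : Intertw E E' T) :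
    (tensL E E' F T)† = tensL E' E F (T†) := by
  refine (ket2_total E' F).ext_adjoint' (ket2_total E F) fun η η' => ?_
  rw [hT.adjoint.tensL_ket2]
  calc (ket2 E F η)† ∘L (tensL E E' F T)† ∘L ket2 E' F η'
      = (tensL E E' F T ∘L ket2 E F η)† ∘L ket2 E' F η' := by
        rw [ContinuousLinearMap.adjoint_comp]; rfl
    _ = T† ∘L ((ket2 E' F η)† ∘L ket2 E' F η') := by
        rw [hT.tensL_ket2, ContinuousLinearMap.adjoint_comp]; rfl
    _ = ((ket2 E F η)† ∘L ket2 E F η') ∘L T† := by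
        rw [ket2_adjoint_comp, ket2_adjoint_comp, hT.adjoint]
    _ = _ := rfl

theorem Intertw.bra2_tensL {T : H →L[ℂ] H'} (hT : Intertw E E' T) (η : F.space) :
    (ket2 E' F η)† ∘L tensL E E' F T = T ∘L (ket2 E F η)† := by
  have h := adjoint_comp_eq (hT.adjoint.tensL_ket2 F η)
  rwa [hT.adjoint.tensL_adjoint, ContinuousLinearMap.adjoint_adjoint] at h

theorem Intertw.tensL_comp_tensL {S : H' →L[ℂ] H''} {T : H →L[ℂ] H'} (hS : Intertw E' E'' S)
    (hT : Intertw E E' T) : tensL E' E'' F S ∘L tensL E E' F T = tensL E E'' F (S ∘L T) :=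
  (ket2_total E F).ext fun η => by
    rw [(hS.comp hT).tensL_ket2, ContinuousLinearMap.comp_assoc, hT.tensL_ket2,
      ← ContinuousLinearMap.comp_assoc, hS.tensL_ket2]
    rfl

theorem Intertw.tensL_ket1 {T : H →L[ℂ] H'} (hT : Intertw E E' T)
    (hm : ∀ ξ ∈ E.space, T ∘L ξ ∈ E'.space) (ξ : E.space) :
    tensL E E' F T ∘L ket1 E F ξ = ket1 E' F ⟨T ∘L ξ, hm ξ ξ.2⟩ :=
  F.total.ext fun η => by
    rw [ket1_comp_eq, ContinuousLinearMap.comp_assoc, ket1_comp_eq,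
      ← ContinuousLinearMap.comp_assoc, hT.tensL_ket2]
    rfl

/-- On `|η⟩₂` the representation of `E ▷ F₁` only alters `η`, whereas `T ⊗ Id` acts behind the ket;
the two therefore commute. -/
theorem Intertw.tensL_triR {T : H →L[ℂ] H'} (hT : Intertw E E' T) {F₁ : CMod c L}
    (h : Compat F F₁) (h' : Compat F₁ F) :
    Intertw (triR E F F₁ h) (triR E' F F₁ h) (tensL E E' F T) := fun x =>
  (ket2_total E F).ext fun η => by
    rw [ContinuousLinearMap.comp_assoc, triR_rho_ket2 E F h h', hT.tensL_ket2,
      ContinuousLinearMap.comp_assoc, hT.tensL_ket2, ← ContinuousLinearMap.comp_assoc,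
      triR_rho_ket2 E' F h h']

end Tens

section Tens
variable (E : CMod b L) {F : CMod b.dagger H} {F' : CMod b.dagger H'} {F'' : CMod b.dagger H''}

theorem Intertw.tensR_ket1 {T : H →L[ℂ] H'} (hT : Intertw F F' T) (ξ : E.space) :
    tensR E F F' T ∘L ket1 E F ξ = ket1 E F' ξ ∘L T := tensR_comp E F F' T hT hT.adjoint ξ

theorem Intertw.tensR_adjoint {T : H →L[ℂ] H'} (hT : Intertw F F' T) :
    (tensR E F F' T)† = tensR E F' F (T†) := by
  refine (ket1_total E F').ext_adjoint' (ket1_total E F) fun η η' => ?_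
  rw [hT.adjoint.tensR_ket1]
  calc (ket1 E F η)† ∘L (tensR E F F' T)† ∘L ket1 E F' η'
      = (tensR E F F' T ∘L ket1 E F η)† ∘L ket1 E F' η' := by
        rw [ContinuousLinearMap.adjoint_comp]; rfl
    _ = T† ∘L ((ket1 E F' η)† ∘L ket1 E F' η') := by
        rw [hT.tensR_ket1, ContinuousLinearMap.adjoint_comp]; rfl
    _ = ((ket1 E F η)† ∘L ket1 E F η') ∘L T† := by
        rw [ket1_adjoint_comp, ket1_adjoint_comp, hT.adjoint]
    _ = _ := rfl

theorem Intertw.bra1_tensR {T : H →L[ℂ] H'} (hT : Intertw F F' T) (ξ : E.space) :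
    (ket1 E F' ξ)† ∘L tensR E F F' T = T ∘L (ket1 E F ξ)† := by
  have h := adjoint_comp_eq (hT.adjoint.tensR_ket1 E ξ)
  rwa [hT.adjoint.tensR_adjoint, ContinuousLinearMap.adjoint_adjoint] at h

theorem Intertw.tensR_comp_tensR {S : H' →L[ℂ] H''} {T : H →L[ℂ] H'} (hS : Intertw F' F'' S)
    (hT : Intertw F F' T) : tensR E F' F'' S ∘L tensR E F F' T = tensR E F F'' (S ∘L T) :=
  (ket1_total E F).ext fun ξ => by
    rw [(hS.comp hT).tensR_ket1, ContinuousLinearMap.comp_assoc, hT.tensR_ket1,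
      ← ContinuousLinearMap.comp_assoc, hS.tensR_ket1]
    rfl

theorem Intertw.tensR_ket2 {T : H →L[ℂ] H'} (hT : Intertw F F' T)
    (hm : ∀ η ∈ F.space, T ∘L η ∈ F'.space) (η : F.space) :
    tensR E F F' T ∘L ket2 E F η = ket2 E F' ⟨T ∘L η, hm η η.2⟩ :=
  E.total.ext fun ξ => by
    rw [← ket1_comp_eq, ContinuousLinearMap.comp_assoc, ← ket1_comp_eq,
      ← ContinuousLinearMap.comp_assoc, hT.tensR_ket1]
    rfl

theorem Intertw.tensR_triL {T : H →L[ℂ] H'} (hT : Intertw F F' T) {E₁ : CMod c L}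
    (h : Compat E E₁) (h' : Compat E₁ E) :
    Intertw (triL E F E₁ h) (triL E F' E₁ h) (tensR E F F' T) := fun x =>
  (ket1_total E F).ext fun ξ => by
    rw [ContinuousLinearMap.comp_assoc, triL_rho_ket1 E F h h', hT.tensR_ket1,
      ContinuousLinearMap.comp_assoc, hT.tensR_ket1, ← ContinuousLinearMap.comp_assoc,
      triL_rho_ket1 E F' h h']

end Tens

/-- `(Id ⊗ T)(z ⊗ Id) = (z ⊗ Id)(Id ⊗ T)` if `T` maps `F` into `F'`. -/
theorem Intertw.tensR_tensL {L' : Type*} [NormedAddCommGroup L'] [InnerProductSpace ℂ L']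
    [CompleteSpace L'] {E : CMod b H} {E' : CMod b H'} {F : CMod b.dagger L}
    {F' : CMod b.dagger L'} {z : H →L[ℂ] H'} {T : L →L[ℂ] L'} (hz : Intertw E E' z)
    (hm : ∀ η ∈ F.space, T ∘L η ∈ F'.space) :
    tensR E' F F' T ∘L tensL E E' F z = tensL E E' F' z ∘L tensR E F F' T :=
  (ket2_total E F).ext fun η => by
    have hT : Intertw F F' T := F.intertwine F' T hm
    rw [ContinuousLinearMap.comp_assoc, hz.tensL_ket2, ← ContinuousLinearMap.comp_assoc,
      hT.tensR_ket2 E' hm, ContinuousLinearMap.comp_assoc, hT.tensR_ket2 E hm, hz.tensL_ket2]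

/-- `(Id ⊗ T)(z ⊗ Id) = (z ⊗ Id)(Id ⊗ T)` if `z` maps `E` into `E'`. -/
theorem Intertw.tensL_tensR {L' : Type*} [NormedAddCommGroup L'] [InnerProductSpace ℂ L']
    [CompleteSpace L'] {E : CMod b H} {E' : CMod b H'} {F : CMod b.dagger L}
    {F' : CMod b.dagger L'} {z : H →L[ℂ] H'} {T : L →L[ℂ] L'} (hT : Intertw F F' T)
    (hm : ∀ ξ ∈ E.space, z ∘L ξ ∈ E'.space) :
    tensL E E' F' z ∘L tensR E F F' T = tensR E' F F' T ∘L tensL E E' F z :=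
  (ket1_total E F).ext fun ξ => by
    have hz : Intertw E E' z := E.intertwine E' z hm
    rw [ContinuousLinearMap.comp_assoc, hT.tensR_ket1, ← ContinuousLinearMap.comp_assoc,
      hz.tensL_ket1 F' hm, ContinuousLinearMap.comp_assoc, hz.tensL_ket1 F hm, hT.tensR_ket1]

theorem flip_ket1 (E : CMod b H) (F : CMod b.dagger L) (ξ : E.space) :
    flip E F ∘L ket1 E F ξ = ket2 (b := b.dagger) F E ξ :=
  F.total.ext fun η => by
    rw [ContinuousLinearMap.comp_assoc, ket1_comp, flip_comp]
    exact (ket2_comp (b := b.dagger) F E ξ η).symm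

theorem flip_ket2 (E : CMod b H) (F : CMod b.dagger L) (η : F.space) :
    flip E F ∘L ket2 E F η = ket1 (b := b.dagger) F E η :=
  E.total.ext fun ξ => by
    rw [ContinuousLinearMap.comp_assoc, ket2_comp, flip_comp]
    exact (ket1_comp (b := b.dagger) F E η ξ).symm

theorem flip_flip (E : CMod b H) (F : CMod b.dagger L) :
    flip (b := b.dagger) F E ∘L flip E F = ContinuousLinearMap.id ℂ _ :=
  (ket1_total E F).ext fun ξ => by
    rw [ContinuousLinearMap.comp_assoc, flip_ket1]
    exact flip_ket2 (b := b.dagger) F E ξ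

theorem flip_adjoint (E : CMod b H) (F : CMod b.dagger L) :
    (flip E F)† = flip (b := b.dagger) F E := by
  refine adjoint_eq_of_inverse (adjoint_comp_self_of_frame (ten_total E F)
    (l := fun i => ten (b := b.dagger) F E (i.2, i.1)) (fun i j => ?_) fun i => flip_comp E F i)
    (flip_flip (b := b.dagger) F E)
  rw [ten_adjoint_comp, ten_adjoint_comp]
  exact (rtpKernel_commute E F i.1 j.1 i.2 j.2).symm.eq

end Intertwiners

/-! ### The associativity isomorphism and the exchange `Σ₂₃`. -/

section Assoc
variable {K : Type u} [NormedAddCommGroup K] [InnerProductSpace ℂ K] [CompleteSpace K]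
variable {H : Type*} [NormedAddCommGroup H] [InnerProductSpace ℂ H] [CompleteSpace H]
variable {H' : Type*} [NormedAddCommGroup H'] [InnerProductSpace ℂ H'] [CompleteSpace H']
variable {L : Type*} [NormedAddCommGroup L] [InnerProductSpace ℂ L] [CompleteSpace L]
variable {L' : Type*} [NormedAddCommGroup L'] [InnerProductSpace ℂ L'] [CompleteSpace L']
variable {M : Type*} [NormedAddCommGroup M] [InnerProductSpace ℂ M] [CompleteSpace M]
variable {M' : Type*} [NormedAddCommGroup M'] [InnerProductSpace ℂ M'] [CompleteSpace M']
variable {b c : CBase K}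

section
variable (E : CMod b H) (F : CMod b.dagger L) (F₁ : CMod c L) (G : CMod c.dagger M)
  (h : Compat F F₁) (h' : Compat F₁ F)

theorem assoc_ket (σ : E.space) (τ : G.space) :
    assoc E F F₁ G h h' ∘L ket2 (triR E F F₁ h) G τ ∘L ket1 E F σ
      = ket1 E (triL F₁ G F h') σ ∘L ket2 F₁ G τ := assoc_comp E F F₁ G h h' (σ, τ)

theorem assocSymm_ket (σ : E.space) (τ : G.space) :
    assocSymm E F F₁ G h h' ∘L ket1 E (triL F₁ G F h') σ ∘L ket2 F₁ G τ
      = ket2 (triR E F F₁ h) G τ ∘L ket1 E F σ := assocSymm_comp E F F₁ G h h' (σ, τ)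

theorem total_ket2_ket1 : Total fun i : E.space × G.space =>
    ket2 (triR E F F₁ h) G i.2 ∘L ket1 E F i.1 := (ket1_total E F).comp (ket2_total _ G)

theorem total_ket1_ket2 : Total fun i : E.space × G.space =>
    ket1 E (triL F₁ G F h') i.1 ∘L ket2 F₁ G i.2 :=
  total_swap ((ket2_total F₁ G).comp (ket1_total E _))

theorem assocSymm_assoc :
    assocSymm E F F₁ G h h' ∘L assoc E F F₁ G h h' = ContinuousLinearMap.id ℂ _ :=
  (total_ket2_ket1 E F F₁ G h).ext fun i => by
    rw [ContinuousLinearMap.comp_assoc, assoc_ket, assocSymm_ket]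
    rfl

theorem assoc_assocSymm :
    assoc E F F₁ G h h' ∘L assocSymm E F F₁ G h h' = ContinuousLinearMap.id ℂ _ :=
  (total_ket1_ket2 E F F₁ G h').ext fun i => by
    rw [ContinuousLinearMap.comp_assoc, assocSymm_ket, assoc_ket]
    rfl

theorem assoc_adjoint : (assoc E F F₁ G h h')† = assocSymm E F F₁ G h h' :=
  adjoint_eq_of_inverse (adjoint_comp_self_of_frame (total_ket2_ket1 E F F₁ G h)
    (l := fun i => ket1 E (triL F₁ G F h') i.1 ∘L ket2 F₁ G i.2)
    (fun i j => assoc_aux E F F₁ G h h' i j) fun i => assoc_comp E F F₁ G h h' i)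
    (assoc_assocSymm E F F₁ G h h')

theorem assocSymm_adjoint : (assocSymm E F F₁ G h h')† = assoc E F F₁ G h h' := by
  rw [← assoc_adjoint, ContinuousLinearMap.adjoint_adjoint]

/-- A bra on the first leg and a ket on the last leg commute. On `|σ'⟩₁` both orders produce
`ρ_F(σ*σ')`, which passes through `|τ⟩₂`. -/
theorem bra1_assoc_ket2 (σ : E.space) (τ : G.space) :
    (ket1 E (triL F₁ G F h') σ)† ∘L assoc E F F₁ G h h' ∘L ket2 (triR E F F₁ h) G τ
      = ket2 F₁ G τ ∘L (ket1 E F σ)† :=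
  (ket1_total E F).ext fun σ' => by
    calc _ = (ket1 E (triL F₁ G F h') σ)† ∘L
          (assoc E F F₁ G h h' ∘L ket2 (triR E F F₁ h) G τ ∘L ket1 E F σ') := rfl
      _ = ((ket1 E (triL F₁ G F h') σ)† ∘L ket1 E (triL F₁ G F h') σ') ∘L ket2 F₁ G τ := by
        rw [assoc_ket]; rfl
      _ = ket2 F₁ G τ ∘L ((ket1 E F σ)† ∘L ket1 E F σ') := by
        rw [ket1_adjoint_comp, ket1_adjoint_comp, triL_rho_ket2]
      _ = _ := rfl

theorem bra2_assocSymm_ket1 (σ : E.space) (τ : G.space) :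
    (ket2 (triR E F F₁ h) G τ)† ∘L assocSymm E F F₁ G h h' ∘L ket1 E (triL F₁ G F h') σ
      = ket1 E F σ ∘L (ket2 F₁ G τ)† := by
  have e := congrArg (fun T => T†) (bra1_assoc_ket2 E F F₁ G h h' σ τ)
  simp only [ContinuousLinearMap.adjoint_comp, ContinuousLinearMap.adjoint_adjoint,
    assoc_adjoint] at e
  exact e

theorem assoc_ket2_ket2 (η : F.space) (τ : G.space) :
    assoc E F F₁ G h h' ∘L ket2 (triR E F F₁ h) G τ ∘L ket2 E F η
      = ket2 E (triL F₁ G F h') ⟨ket2 F₁ G τ ∘L η, mem_cspan ⟨τ, η, η.2, rfl⟩⟩ :=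
  E.total.ext fun σ => by
    calc _ = assoc E F F₁ G h h' ∘L ket2 (triR E F F₁ h) G τ ∘L (ket2 E F η ∘L
          (σ : K →L[ℂ] H)) := rfl
      _ = (assoc E F F₁ G h h' ∘L ket2 (triR E F F₁ h) G τ ∘L ket1 E F σ) ∘L
          (η : K →L[ℂ] L) := by rw [← ket1_comp_eq]; rfl
      _ = ket1 E (triL F₁ G F h') σ ∘L (ket2 F₁ G τ ∘L (η : K →L[ℂ] L)) := by
        rw [assoc_ket]; rfl
      _ = _ := ket1_comp_eq E (triL F₁ G F h') σ ⟨ket2 F₁ G τ ∘L η, mem_cspan ⟨τ, η, η.2, rfl⟩⟩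

theorem assoc_ket1 (σ : E.space) (ζ : F₁.space) :
    assoc E F F₁ G h h' ∘L ket1 (triR E F F₁ h) G ⟨ket1 E F σ ∘L ζ, mem_cspan ⟨σ, ζ, ζ.2, rfl⟩⟩
      = ket1 E (triL F₁ G F h') σ ∘L ket1 F₁ G ζ :=
  G.total.ext fun τ => by
    rw [ContinuousLinearMap.comp_assoc, ket1_comp_eq, ContinuousLinearMap.comp_assoc, ket1_comp_eq]
    exact congrArg (fun T => T ∘L (ζ : K →L[ℂ] L)) (assoc_ket E F F₁ G h h' σ τ)

end

/-- `assoc ∘ ((z ⊗ Id) ⊗ Id) = (z ⊗ Id) ∘ assoc`. -/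
theorem assoc_tensL {E : CMod b H} {E' : CMod b H'} (F : CMod b.dagger L) (F₁ : CMod c L)
    (G : CMod c.dagger M) (h : Compat F F₁) (h' : Compat F₁ F) {z : H →L[ℂ] H'}
    (hz : Intertw E E' z) :
    assoc E' F F₁ G h h' ∘L tensL (triR E F F₁ h) (triR E' F F₁ h) G (tensL E E' F z)
      = tensL E E' (triL F₁ G F h') z ∘L assoc E F F₁ G h h' := by
  have hz' : Intertw (triR E F F₁ h) (triR E' F F₁ h) (tensL E E' F z) := hz.tensL_triR F h h'
  refine ((ket2_total E F).comp (ket2_total (triR E F F₁ h) G)).ext fun i => ?_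
  calc _ = assoc E' F F₁ G h h' ∘L (tensL (triR E F F₁ h) (triR E' F F₁ h) G (tensL E E' F z) ∘L
        ket2 (triR E F F₁ h) G i.2) ∘L ket2 E F i.1 := rfl
    _ = assoc E' F F₁ G h h' ∘L ket2 (triR E' F F₁ h) G i.2 ∘L
        (tensL E E' F z ∘L ket2 E F i.1) := by rw [hz'.tensL_ket2]; rfl
    _ = (assoc E' F F₁ G h h' ∘L ket2 (triR E' F F₁ h) G i.2 ∘L ket2 E' F i.1) ∘L z := by
      rw [hz.tensL_ket2]; rfl
    _ = tensL E E' (triL F₁ G F h') z ∘L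
        (assoc E F F₁ G h h' ∘L ket2 (triR E F F₁ h) G i.2 ∘L ket2 E F i.1) := by
      rw [assoc_ket2_ket2, assoc_ket2_ket2, hz.tensL_ket2]
    _ = _ := rfl

/-- `assoc ∘ (Id ⊗ y) = (Id ⊗ (Id ⊗ y)) ∘ assoc`. -/
theorem assoc_tensR (E : CMod b H) (F : CMod b.dagger L) (F₁ : CMod c L)
    {G : CMod c.dagger M} {G' : CMod c.dagger M'} (h : Compat F F₁) (h' : Compat F₁ F)
    {y : M →L[ℂ] M'} (hy : Intertw G G' y) :
    assoc E F F₁ G' h h' ∘L tensR (triR E F F₁ h) G G' y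
      = tensR E (triL F₁ G F h') (triL F₁ G' F h') (tensR F₁ G G' y) ∘L assoc E F F₁ G h h' := by
  have hy' : Intertw (triL F₁ G F h') (triL F₁ G' F h') (tensR F₁ G G' y) := hy.tensR_triL F₁ h' h
  -- The elementary elements of `E ▷ F₁` already give a total family of kets: totality is clear on
  -- the other side of the associativity isomorphism and is carried back by its inverse.
  have ht : Total fun i : E.space × F₁.space => ket1 (triR E F F₁ h) G
      ⟨ket1 E F i.1 ∘L i.2, mem_cspan ⟨i.1, i.2, i.2.2, rfl⟩⟩ := by
    have := (total_swap (k := fun i : E.space × F₁.space => ket1 E (triL F₁ G F h') i.1 ∘L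
      ket1 F₁ G i.2) ((ket1_total F₁ G).comp (ket1_total E _))).comp_right_inverse
      (assocSymm_assoc E F F₁ G h h')
    refine (congrArg Total (funext fun i => ?_)).mp this
    rw [← assoc_ket1 E F F₁ G h h', ← ContinuousLinearMap.comp_assoc, assocSymm_assoc]
    rfl
  refine ht.ext fun i => ?_
  calc _ = assoc E F F₁ G' h h' ∘L (tensR (triR E F F₁ h) G G' y ∘L ket1 (triR E F F₁ h) G
        ⟨ket1 E F i.1 ∘L i.2, mem_cspan ⟨i.1, i.2, i.2.2, rfl⟩⟩) := rfl
    _ = (assoc E F F₁ G' h h' ∘L ket1 (triR E F F₁ h) G'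
        ⟨ket1 E F i.1 ∘L i.2, mem_cspan ⟨i.1, i.2, i.2.2, rfl⟩⟩) ∘L y := by
      rw [hy.tensR_ket1]; rfl
    _ = ket1 E (triL F₁ G' F h') i.1 ∘L (ket1 F₁ G' i.2 ∘L y) := by rw [assoc_ket1]; rfl
    _ = (ket1 E (triL F₁ G' F h') i.1 ∘L tensR F₁ G G' y) ∘L ket1 F₁ G i.2 := by
      rw [← hy.tensR_ket1]; rfl
    _ = tensR E (triL F₁ G F h') (triL F₁ G' F h') (tensR F₁ G G' y) ∘L
        (ket1 E (triL F₁ G F h') i.1 ∘L ket1 F₁ G i.2) := by rw [← hy'.tensR_ket1]; rfl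
    _ = _ := by rw [← assoc_ket1 E F F₁ G h h']; rfl

section Swap
variable (E : CMod b H) (F : CMod b.dagger L) (E₁ : CMod c H) (G : CMod c.dagger M)
  (h : Compat E E₁) (h' : Compat E₁ E)

theorem swap23_ket (η : F.space) (τ : G.space) :
    swap23 E F E₁ G h h' ∘L ket2 (triL E F E₁ h) G τ ∘L ket2 E F η
      = ket2 (triL E₁ G E h') F η ∘L ket2 E₁ G τ := swap23_comp E F E₁ G h h' (η, τ)

theorem total_ket2_ket2 : Total fun i : F.space × G.space =>
    ket2 (triL E F E₁ h) G i.2 ∘L ket2 E F i.1 := (ket2_total E F).comp (ket2_total _ G)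

theorem swap23_swap23 :
    swap23 E₁ G E F h' h ∘L swap23 E F E₁ G h h' = ContinuousLinearMap.id ℂ _ :=
  (total_ket2_ket2 E F E₁ G h).ext fun i => by
    rw [ContinuousLinearMap.comp_assoc, swap23_ket, swap23_ket]
    rfl

theorem swap23_isometry :
    (swap23 E F E₁ G h h')† ∘L swap23 E F E₁ G h h' = ContinuousLinearMap.id ℂ _ := by
  refine adjoint_comp_self_of_frame (total_ket2_ket2 E F E₁ G h)
    (l := fun i => ket2 (triL E₁ G E h') F i.1 ∘L ket2 E₁ G i.2) (fun i j => ?_)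
    fun i => swap23_comp E F E₁ G h h' i
  rw [ContinuousLinearMap.adjoint_comp, ContinuousLinearMap.adjoint_comp]
  calc _ = (ket2 E₁ G i.2)† ∘L ((ket2 (triL E₁ G E h') F i.1)† ∘L ket2 (triL E₁ G E h') F j.1)
          ∘L ket2 E₁ G j.2 := rfl
    _ = ((ket2 E₁ G i.2)† ∘L ket2 E₁ G j.2) ∘L E.rho ⟨_, F.adjoint_comp_mem i.1 j.1⟩ := by
      rw [ket2_adjoint_comp, triL_rho_ket2]; rfl
    _ = E.rho ⟨_, F.adjoint_comp_mem i.1 j.1⟩ ∘L E₁.rho ⟨_, G.adjoint_comp_mem i.2 j.2⟩ := by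
      rw [ket2_adjoint_comp]; exact (h.comm _ _).symm
    _ = ((ket2 E F i.1)† ∘L ket2 E F j.1) ∘L E₁.rho ⟨_, G.adjoint_comp_mem i.2 j.2⟩ := by
      rw [ket2_adjoint_comp]
    _ = (ket2 E F i.1)† ∘L (triL E F E₁ h).rho ⟨_, G.adjoint_comp_mem i.2 j.2⟩ ∘L
        ket2 E F j.1 := by rw [triL_rho_ket2]; rfl
    _ = _ := by rw [← ket2_adjoint_comp]; rfl

theorem swap23_adjoint : (swap23 E F E₁ G h h')† = swap23 E₁ G E F h' h :=
  adjoint_eq_of_inverse (swap23_isometry E F E₁ G h h') (swap23_swap23 E₁ G E F h' h)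

/-- Analogue of `bra1_assoc_ket2` for the exchange of factors: contraction of the `F` leg commutes
with creation on the `G` leg. -/
theorem bra2_swap23_ket2 (ξ : F.space) (η : G.space) :
    (ket2 (triL E₁ G E h') F ξ)† ∘L swap23 E F E₁ G h h' ∘L ket2 (triL E F E₁ h) G η
      = ket2 E₁ G η ∘L (ket2 E F ξ)† :=
  (ket2_total E F).ext fun ξ' => by
    calc _ = (ket2 (triL E₁ G E h') F ξ)† ∘L
          (swap23 E F E₁ G h h' ∘L ket2 (triL E F E₁ h) G η ∘L ket2 E F ξ') := rfl
      _ = ((ket2 (triL E₁ G E h') F ξ)† ∘L ket2 (triL E₁ G E h') F ξ') ∘L ket2 E₁ G η := by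
        rw [swap23_ket]; rfl
      _ = ket2 E₁ G η ∘L ((ket2 E F ξ)† ∘L ket2 E F ξ') := by
        rw [ket2_adjoint_comp, ket2_adjoint_comp, triL_rho_ket2]
      _ = _ := rfl

theorem swap23_ket2_ket1 (σ : E.space) (τ : G.space) :
    swap23 E F E₁ G h h' ∘L ket2 (triL E F E₁ h) G τ ∘L ket1 E F σ
      = ket1 (triL E₁ G E h') F ⟨ket2 E₁ G τ ∘L σ, mem_cspan ⟨τ, σ, σ.2, rfl⟩⟩ :=
  F.total.ext fun η => by
    rw [ket1_comp_eq]
    calc _ = swap23 E F E₁ G h h' ∘L ket2 (triL E F E₁ h) G τ ∘L (ket1 E F σ ∘L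
          (η : K →L[ℂ] L)) := rfl
      _ = (swap23 E F E₁ G h h' ∘L ket2 (triL E F E₁ h) G τ ∘L ket2 E F η) ∘L
          (σ : K →L[ℂ] H) := by rw [ket1_comp_eq]; rfl
      _ = _ := by rw [swap23_ket]; rfl

end Swap

/-- `Σ₂₃ ∘ ((Id ⊗ y) ⊗ Id) = (Id ⊗ y) ∘ Σ₂₃`. -/
theorem swap23_tensL (E : CMod b H) {F : CMod b.dagger L} {F' : CMod b.dagger L'} (E₁ : CMod c H)
    (G : CMod c.dagger M) (h : Compat E E₁) (h' : Compat E₁ E) {y : L →L[ℂ] L'}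
    (hy : Intertw F F' y) :
    swap23 E F' E₁ G h h' ∘L tensL (triL E F E₁ h) (triL E F' E₁ h) G (tensR E F F' y)
      = tensR (triL E₁ G E h') F F' y ∘L swap23 E F E₁ G h h' := by
  have hy' : Intertw (triL E F E₁ h) (triL E F' E₁ h) (tensR E F F' y) := hy.tensR_triL E h h'
  refine ((ket1_total E F).comp (ket2_total (triL E F E₁ h) G)).ext fun i => ?_
  calc _ = swap23 E F' E₁ G h h' ∘L (tensL (triL E F E₁ h) (triL E F' E₁ h) G (tensR E F F' y) ∘L
        ket2 (triL E F E₁ h) G i.2) ∘L ket1 E F i.1 := rfl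
    _ = swap23 E F' E₁ G h h' ∘L ket2 (triL E F' E₁ h) G i.2 ∘L
        (tensR E F F' y ∘L ket1 E F i.1) := by rw [hy'.tensL_ket2]; rfl
    _ = (swap23 E F' E₁ G h h' ∘L ket2 (triL E F' E₁ h) G i.2 ∘L ket1 E F' i.1) ∘L y := by
      rw [hy.tensR_ket1]; rfl
    _ = tensR (triL E₁ G E h') F F' y ∘L
        (swap23 E F E₁ G h h' ∘L ket2 (triL E F E₁ h) G i.2 ∘L ket1 E F i.1) := by
      rw [swap23_ket2_ket1, swap23_ket2_ket1, hy.tensR_ket1]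
    _ = _ := rfl

end Assoc

/-! ### Slices of amplified operators. -/

section Slices
variable {K : Type u} [NormedAddCommGroup K] [InnerProductSpace ℂ K] [CompleteSpace K]
variable {H : Type*} [NormedAddCommGroup H] [InnerProductSpace ℂ H] [CompleteSpace H]
variable {H' : Type*} [NormedAddCommGroup H'] [InnerProductSpace ℂ H'] [CompleteSpace H']
variable {L : Type*} [NormedAddCommGroup L] [InnerProductSpace ℂ L] [CompleteSpace L]
variable {M : Type*} [NormedAddCommGroup M] [InnerProductSpace ℂ M] [CompleteSpace M]
variable {b c : CBase K}

theorem Intertw.tensL_isometry {E : CMod b H} {E' : CMod b H'} (F : CMod b.dagger L)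
    {T : H →L[ℂ] H'} (hT : Intertw E E' T) (h : T† ∘L T = ContinuousLinearMap.id ℂ H) :
    (tensL E E' F T)† ∘L tensL E E' F T = ContinuousLinearMap.id ℂ _ :=
  (ket2_total E F).ext fun η => by
    rw [hT.tensL_adjoint, hT.adjoint.tensL_comp_tensL F hT, h,
      (show Intertw E E (ContinuousLinearMap.id ℂ H) from fun _ => rfl).tensL_ket2]
    rfl

theorem Intertw.tensR_isometry (E : CMod b L) {F : CMod b.dagger H} {F' : CMod b.dagger H'}
    {T : H →L[ℂ] H'} (hT : Intertw F F' T) (h : T† ∘L T = ContinuousLinearMap.id ℂ H) :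
    (tensR E F F' T)† ∘L tensR E F F' T = ContinuousLinearMap.id ℂ _ :=
  (ket1_total E F).ext fun η => by
    rw [hT.tensR_adjoint, hT.adjoint.tensR_comp_tensR E hT, h,
      (show Intertw F F (ContinuousLinearMap.id ℂ H) from fun _ => rfl).tensR_ket1]
    rfl

theorem Intertw.tensL_coisometry {E : CMod b H} {E' : CMod b H'} (F : CMod b.dagger L)
    {T : H →L[ℂ] H'} (hT : Intertw E E' T) (h : T ∘L T† = ContinuousLinearMap.id ℂ H') :
    tensL E E' F T ∘L (tensL E E' F T)† = ContinuousLinearMap.id ℂ _ := by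
  have := hT.adjoint.tensL_isometry F (by rwa [ContinuousLinearMap.adjoint_adjoint])
  rwa [hT.adjoint.tensL_adjoint, ContinuousLinearMap.adjoint_adjoint, ← hT.tensL_adjoint] at this

theorem Intertw.tensR_coisometry (E : CMod b L) {F : CMod b.dagger H} {F' : CMod b.dagger H'}
    {T : H →L[ℂ] H'} (hT : Intertw F F' T) (h : T ∘L T† = ContinuousLinearMap.id ℂ H') :
    tensR E F F' T ∘L (tensR E F F' T)† = ContinuousLinearMap.id ℂ _ := by
  have := hT.adjoint.tensR_isometry E (by rwa [ContinuousLinearMap.adjoint_adjoint])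
  rwa [hT.adjoint.tensR_adjoint, ContinuousLinearMap.adjoint_adjoint, ← hT.tensR_adjoint] at this

/-- Kets intertwine `F₁` with `E ▷ F₁`, bras do the converse, and intertwiners compose. This is what
places slices in a commutant. -/
theorem Intertw.slice1 {E : CMod b H} {F : CMod b.dagger L} {F₁ : CMod c L} {h : Compat F F₁}
    {T : RTP E F →L[ℂ] RTP E F} (hT : Intertw (triR E F F₁ h) (triR E F F₁ h) T)
    (σ η : E.space) : Intertw F₁ F₁ ((ket1 E F σ)† ∘L T ∘L ket1 E F η) := by
  have hk : ∀ η, Intertw F₁ (triR E F F₁ h) (ket1 E F η) := fun η x =>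
    (triR_rho_ket1 E F h x η).symm
  exact (hk σ).adjoint.comp (hT.comp (hk η))

theorem Intertw.slice2 {E : CMod b H} {F : CMod b.dagger L} {E₁ : CMod c H} {h : Compat E E₁}
    {T : RTP E F →L[ℂ] RTP E F} (hT : Intertw (triL E F E₁ h) (triL E F E₁ h) T)
    (ξ τ : F.space) : Intertw E₁ E₁ ((ket2 E F ξ)† ∘L T ∘L ket2 E F τ) := by
  have hk : ∀ η, Intertw E₁ (triL E F E₁ h) (ket2 E F η) := fun η x =>
    (triL_rho_ket2 E F h x η).symm
  exact (hk ξ).adjoint.comp (hT.comp (hk τ))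

/-- Slicing the first leg of `T ⊗ Id` slices `T` and leaves the last leg alone. Coproducts of slices
can thus be read off from operators on three legs. -/
theorem bra1_assoc_tensL_ket1 (E : CMod b H) (F : CMod b.dagger L) (F₁ : CMod c L)
    (G : CMod c.dagger M) (h : Compat F F₁) (h' : Compat F₁ F) {T : RTP E F →L[ℂ] RTP E F}
    (hT : Intertw (triR E F F₁ h) (triR E F F₁ h) T) (σ η : E.space) :
    (ket1 E (triL F₁ G F h') σ)† ∘L
      (assoc E F F₁ G h h' ∘L tensL (triR E F F₁ h) (triR E F F₁ h) G T ∘L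
        (assoc E F F₁ G h h')†) ∘L ket1 E (triL F₁ G F h') η
      = tensL F₁ F₁ G ((ket1 E F σ)† ∘L T ∘L ket1 E F η) := by
  refine (ket2_total F₁ G).ext fun τ => ?_
  rw [assoc_adjoint, (hT.slice1 σ η).tensL_ket2]
  calc _ = (ket1 E (triL F₁ G F h') σ)† ∘L
      (assoc E F F₁ G h h' ∘L tensL (triR E F F₁ h) (triR E F F₁ h) G T) ∘L
        (assocSymm E F F₁ G h h' ∘L ket1 E (triL F₁ G F h') η ∘L ket2 F₁ G τ) := rfl
    _ = (ket1 E (triL F₁ G F h') σ)† ∘L assoc E F F₁ G h h' ∘L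
        (tensL (triR E F F₁ h) (triR E F F₁ h) G T ∘L ket2 (triR E F F₁ h) G τ) ∘L
        ket1 E F η := by rw [assocSymm_ket]; rfl
    _ = ((ket1 E (triL F₁ G F h') σ)† ∘L assoc E F F₁ G h h' ∘L ket2 (triR E F F₁ h) G τ) ∘L T ∘L
        ket1 E F η := by rw [hT.tensL_ket2]; rfl
    _ = _ := by rw [bra1_assoc_ket2]; rfl

theorem bra2_assoc_tensR_ket2 (E : CMod b H) (F : CMod b.dagger L) (F₁ : CMod c L)
    (G : CMod c.dagger M) (h : Compat F F₁) (h' : Compat F₁ F) {T : RTP F₁ G →L[ℂ] RTP F₁ G}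
    (hT : Intertw (triL F₁ G F h') (triL F₁ G F h') T) (ξ τ : G.space) :
    (ket2 (triR E F F₁ h) G ξ)† ∘L
      ((assoc E F F₁ G h h')† ∘L tensR E (triL F₁ G F h') (triL F₁ G F h') T ∘L
        assoc E F F₁ G h h') ∘L ket2 (triR E F F₁ h) G τ
      = tensR E F F ((ket2 F₁ G ξ)† ∘L T ∘L ket2 F₁ G τ) := by
  refine (ket1_total E F).ext fun σ => ?_
  rw [assoc_adjoint, (hT.slice2 ξ τ).tensR_ket1]
  calc _ = (ket2 (triR E F F₁ h) G ξ)† ∘L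
      (assocSymm E F F₁ G h h' ∘L tensR E (triL F₁ G F h') (triL F₁ G F h') T) ∘L
        (assoc E F F₁ G h h' ∘L ket2 (triR E F F₁ h) G τ ∘L ket1 E F σ) := rfl
    _ = (ket2 (triR E F F₁ h) G ξ)† ∘L assocSymm E F F₁ G h h' ∘L
        (tensR E (triL F₁ G F h') (triL F₁ G F h') T ∘L ket1 E (triL F₁ G F h') σ) ∘L
        ket2 F₁ G τ := by rw [assoc_ket]; rfl
    _ = ((ket2 (triR E F F₁ h) G ξ)† ∘L assocSymm E F F₁ G h h' ∘L
        ket1 E (triL F₁ G F h') σ) ∘L T ∘L ket2 F₁ G τ := by rw [hT.tensR_ket1]; rfl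
    _ = _ := by rw [bra2_assocSymm_ket1]; rfl

theorem bra2_swap23_tensL_ket2 (E : CMod b H) (F : CMod b.dagger L) (E₁ : CMod c H)
    (G : CMod c.dagger M) (h : Compat E E₁) (h' : Compat E₁ E) {T : RTP E F →L[ℂ] RTP E F}
    (hT : Intertw (triL E F E₁ h) (triL E F E₁ h) T) (ξ τ : F.space) :
    (ket2 (triL E₁ G E h') F ξ)† ∘L
      (swap23 E F E₁ G h h' ∘L tensL (triL E F E₁ h) (triL E F E₁ h) G T ∘L
        (swap23 E F E₁ G h h')†) ∘L ket2 (triL E₁ G E h') F τ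
      = tensL E₁ E₁ G ((ket2 E F ξ)† ∘L T ∘L ket2 E F τ) := by
  refine (ket2_total E₁ G).ext fun η => ?_
  rw [swap23_adjoint, (hT.slice2 ξ τ).tensL_ket2]
  calc _ = (ket2 (triL E₁ G E h') F ξ)† ∘L
      (swap23 E F E₁ G h h' ∘L tensL (triL E F E₁ h) (triL E F E₁ h) G T) ∘L
        (swap23 E₁ G E F h' h ∘L ket2 (triL E₁ G E h') F τ ∘L ket2 E₁ G η) := rfl
    _ = (ket2 (triL E₁ G E h') F ξ)† ∘L swap23 E F E₁ G h h' ∘L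
        (tensL (triL E F E₁ h) (triL E F E₁ h) G T ∘L ket2 (triL E F E₁ h) G η) ∘L
        ket2 E F τ := by rw [swap23_ket]; rfl
    _ = ((ket2 (triL E₁ G E h') F ξ)† ∘L swap23 E F E₁ G h h' ∘L
        ket2 (triL E F E₁ h) G η) ∘L T ∘L ket2 E F τ := by rw [hT.tensL_ket2]; rfl
    _ = _ := by rw [bra2_swap23_ket2]; rfl

/-- An operator commuting with the products `r i r' j` of two commuting families commutes with
the factors. -/
theorem comm_of_comm_mul {ι κ : Type*} [Mul ι] [Mul κ] {r : ι → H →L[ℂ] H} {r' : κ → H →L[ℂ] H}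
    (hr : ∀ i j, r (i * j) = r i ∘L r j) (hr' : ∀ i j, r' (i * j) = r' i ∘L r' j)
    (ht : Total fun i : κ × ι => r i.2 ∘L r' i.1)
    (hc : ∀ x y, r x ∘L r' y = r' y ∘L r x) {T : H →L[ℂ] H}
    (hT : ∀ x y, (r x ∘L r' y) ∘L T = T ∘L r x ∘L r' y) :
    (∀ x, T ∘L r x = r x ∘L T) ∧ ∀ y, T ∘L r' y = r' y ∘L T := by
  constructor
  · intro x
    -- The index sets need have no unit, so `r x` is tested on the total family of products `r i r'
    -- j`, where it is absorbed into `r (x * i)`.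
    refine ht.ext fun i => ?_
    calc _ = T ∘L (r x ∘L r i.2) ∘L r' i.1 := rfl
      _ = (r (x * i.2) ∘L r' i.1) ∘L T := by rw [hT, hr]
      _ = r x ∘L ((r i.2 ∘L r' i.1) ∘L T) := by rw [hr]; rfl
      _ = _ := by rw [hT]; rfl
  · intro y
    refine ht.ext fun i => ?_
    calc _ = T ∘L (r' y ∘L r i.2) ∘L r' i.1 := rfl
      _ = T ∘L r i.2 ∘L (r' y ∘L r' i.1) := by rw [← hc]; rfl
      _ = (r i.2 ∘L r' (y * i.1)) ∘L T := by rw [hT, hr']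
      _ = (r i.2 ∘L r' y) ∘L r' i.1 ∘L T := by rw [hr']; rfl
      _ = r' y ∘L ((r i.2 ∘L r' i.1) ∘L T) := by rw [hc]; rfl
      _ = _ := by rw [hT]; rfl

theorem intertw_of_comm_mul {E : CMod b H} {E' : CMod c H}
    (hc : ∀ x y, E.rho x ∘L E'.rho y = E'.rho y ∘L E.rho x) {T : H →L[ℂ] H}
    (hT : ∀ x y, (E.rho x ∘L E'.rho y) ∘L T = T ∘L E.rho x ∘L E'.rho y) :
    Intertw E E T ∧ Intertw E' E' T :=
  comm_of_comm_mul E.rho_mul E'.rho_mul (E'.rho_total.comp E.rho_total) hc hT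

end Slices

/-! ### The unitary `V`, the commutants and the coproducts. -/

namespace PMU
variable {K : Type u} [NormedAddCommGroup K] [InnerProductSpace ℂ K] [CompleteSpace K]
variable {H : Type v} [NormedAddCommGroup H] [InnerProductSpace ℂ H] [CompleteSpace H]
variable {b : CBase K} (V : PMU b H)

theorem op_isometry : V.op† ∘L V.op = ContinuousLinearMap.id ℂ _ :=
  (ContinuousLinearMap.norm_map_iff_adjoint_comp_self V.op).1 fun x => V.V.norm_map x

theorem op_adjoint : V.op† = (V.V.symm.toContinuousLinearEquiv : V.Range →L[ℂ] V.Source) :=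
  adjoint_eq_of_inverse V.op_isometry (by
    ext1 x
    exact V.V.apply_symm_apply x)

theorem op_coisometry : V.op ∘L V.op† = ContinuousLinearMap.id ℂ _ := by
  rw [op_adjoint]
  ext1 x
  exact V.V.apply_symm_apply x

theorem norm_op_le : ‖V.op‖ ≤ 1 :=
  ContinuousLinearMap.opNorm_le_bound _ zero_le_one fun x => by
    rw [one_mul]
    exact (V.V.norm_map x).le

theorem op_α : Intertw V.sLα V.rRα V.op := V.map_α.intertw
theorem op_βhβ : Intertw V.sRβ V.rLβh V.op := V.map_βhβ.intertw
theorem op_βh : Intertw V.sRβh V.rRβh V.op := V.map_βh.intertw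
theorem op_β : Intertw V.sLβ V.rLβ V.op := V.map_β.intertw

theorem _root_.CPMU.MapsOnto.adjoint_mem {X Y : Type*} [NormedAddCommGroup X]
    [InnerProductSpace ℂ X] [CompleteSpace X] [NormedAddCommGroup Y] [InnerProductSpace ℂ Y]
    [CompleteSpace Y] {c : CBase K} {E : CMod c X} {E' : CMod c Y} {T : X →L[ℂ] Y}
    (h : MapsOnto T E E') (hT : T† ∘L T = ContinuousLinearMap.id ℂ X) {θ : K →L[ℂ] Y}
    (hθ : θ ∈ E'.space) : T† ∘L θ ∈ E.space := by
  have : θ ∈ {θ | ∃ θ₀ ∈ E.space, θ = T ∘L θ₀} := by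
    rw [show _ = _ from h]
    exact hθ
  obtain ⟨θ₀, h₀, rfl⟩ := this
  rw [comp_reassoc hT]
  exact h₀

/-- The two amplifications of `ρ_β̂` are the representations of `β̂ ◁ β` and `α ▷ β̂`. They commute,
and nondegeneracy separates commutation with their products into commutation with each factor. -/
theorem mem_rangeCommutant {T : V.Range →L[ℂ] V.Range} :
    T ∈ V.rangeCommutant ↔ Intertw V.rLβh V.rLβh T ∧ Intertw V.rRβh V.rRβh T := by
  have hx : ∀ x, tensL V.α V.α V.β (V.βh.rho x) = V.rLβh.rho x := tensL_rho _ _ V.αβh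
  have hy : ∀ y, tensR V.α V.β V.β (V.βh.rho y) = V.rRβh.rho y := tensR_rho _ _ V.ββh
  constructor
  · intro h
    refine intertw_of_comm_mul (fun x y => ?_) fun x y => h _ ⟨x, y, by rw [hx, hy]⟩
    refine (ket2_total V.α V.β).ext fun η => ?_
    rw [ContinuousLinearMap.comp_assoc, triR_rho_ket2 V.α V.β V.ββh V.βhβ, triL_rho_ket2,
      ContinuousLinearMap.comp_assoc, triL_rho_ket2, ← ContinuousLinearMap.comp_assoc,
      triR_rho_ket2 V.α V.β V.ββh V.βhβ]
  · rintro ⟨h1, h2⟩ _ ⟨x, y, rfl⟩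
    change _ ∘L T = T ∘L _
    rw [hx, hy, ← ContinuousLinearMap.comp_assoc, h1, ContinuousLinearMap.comp_assoc,
      ContinuousLinearMap.comp_assoc, h2]

theorem mem_sourceCommutant {T : V.Source →L[ℂ] V.Source} :
    T ∈ V.sourceCommutant ↔ Intertw V.sLβ V.sLβ T ∧ Intertw V.sRβ V.sRβ T := by
  have hx : ∀ x, tensL V.βh V.βh V.α (V.β.rho x) = V.sLβ.rho x := tensL_rho _ _ V.βhβ
  have hy : ∀ y, tensR V.βh V.α V.α (V.β.rho y) = V.sRβ.rho y := tensR_rho V.βh V.α V.αβ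
  constructor
  · intro h
    refine intertw_of_comm_mul (fun x y => ?_) fun x y => h _ ⟨x, y, by rw [hx, hy]⟩
    refine (ket2_total V.βh V.α).ext fun η => ?_
    rw [ContinuousLinearMap.comp_assoc, triR_rho_ket2 V.βh V.α V.αβ V.βα, triL_rho_ket2,
      ContinuousLinearMap.comp_assoc, triL_rho_ket2, ← ContinuousLinearMap.comp_assoc,
      triR_rho_ket2 V.βh V.α V.αβ V.βα]
  · rintro ⟨h1, h2⟩ _ ⟨x, y, rfl⟩
    change _ ∘L T = T ∘L _
    rw [hx, hy, ← ContinuousLinearMap.comp_assoc, h1, ContinuousLinearMap.comp_assoc,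
      ContinuousLinearMap.comp_assoc, h2]

section Coproducts
variable {V} {z y : H →L[ℂ] H}

theorem tensL_sRβh (hz : Intertw V.βh V.βh z) :
    Intertw V.sRβh V.sRβh (tensL V.βh V.βh V.α z) :=
  Intertw.tensL_triR (b := b.dagger) V.α hz V.αβh V.βhα

theorem tensL_sRβ (hz : Intertw V.βh V.βh z) :
    Intertw V.sRβ V.sRβ (tensL V.βh V.βh V.α z) :=
  Intertw.tensL_triR (b := b.dagger) V.α hz V.αβ V.βα

/-- Since `z ⊗ Id` acts on the first leg, it commutes with the representations of `β̂ ▷ β̂` and `β̂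
▷ β`, which act on the second. Conjugation by `V` carries these to `α ▷ β̂` and `β̂ ◁ β`, the two
structures defining the commutant on the range. -/
theorem delta_rRβh (hz : Intertw V.βh V.βh z) : Intertw V.rRβh V.rRβh (V.delta z) := by
  have h1 := tensL_sRβh hz
  have h2 := V.op_βh.adjoint
  exact V.op_βh.comp (h1.comp h2)

theorem delta_rLβh (hz : Intertw V.βh V.βh z) : Intertw V.rLβh V.rLβh (V.delta z) := by
  have h1 := tensL_sRβ hz
  have h2 := V.op_βhβ.adjoint
  exact V.op_βhβ.comp (h1.comp h2)

/-- Here `Id ⊗ y` commutes with the representations of `β ◁ β` and `β̂ ◁ β`, acting on the first leg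
of the range; `V*` carries these to `β ◁ α` and `β̂ ▷ β`. -/
theorem deltaHat_sLβ (hy : Intertw V.β V.β y) : Intertw V.sLβ V.sLβ (V.deltaHat y) :=
  V.op_β.adjoint.comp ((hy.tensR_triL V.α V.αβ V.βα).comp V.op_β)

theorem deltaHat_sRβ (hy : Intertw V.β V.β y) : Intertw V.sRβ V.sRβ (V.deltaHat y) :=
  V.op_βhβ.adjoint.comp ((hy.tensR_triL V.α V.αβh V.βhα).comp V.op_βhβ)

theorem delta_mem (hz : z ∈ V.βh.commutant) : V.delta z ∈ V.rangeCommutant :=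
  V.mem_rangeCommutant.2
    ⟨delta_rLβh (CMod.mem_commutant.1 hz), delta_rRβh (CMod.mem_commutant.1 hz)⟩

theorem deltaHat_mem (hy : y ∈ V.β.commutant) : V.deltaHat y ∈ V.sourceCommutant :=
  V.mem_sourceCommutant.2
    ⟨deltaHat_sLβ (CMod.mem_commutant.1 hy), deltaHat_sRβ (CMod.mem_commutant.1 hy)⟩

end Coproducts

/-- The kets `|ζ⟩₁`, `|σ⟩₁` intertwine `β̂` with `β̂ ▷ β̂` and `α ▷ β̂`, and `V` intertwines the
latter two. -/
theorem slice_mem (σ : V.α.space) (ζ : V.βh.space) : V.slice σ ζ ∈ V.βh.commutant := by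
  refine CMod.mem_commutant.2 ?_
  have h1 : Intertw V.βh V.sRβh (ket1 V.βh V.α ζ) := fun x =>
    (triR_rho_ket1 V.βh V.α V.αβh x ζ).symm
  have h2 : Intertw V.βh V.rRβh (ket1 V.α V.β σ) := fun x =>
    (triR_rho_ket1 V.α V.β V.ββh x σ).symm
  exact h2.adjoint.comp (V.op_βh.comp h1)

theorem sliceHat_mem (σ : V.β.space) (τ : V.α.space) : V.sliceHat σ τ ∈ V.β.commutant := by
  refine CMod.mem_commutant.2 ?_
  have h1 : Intertw V.β V.sLβ (ket2 V.βh V.α τ) := fun x =>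
    (triL_rho_ket2 V.βh V.α V.βhβ x τ).symm
  have h2 : Intertw V.β V.rLβ (ket2 V.α V.β σ) := fun x =>
    (triL_rho_ket2 V.α V.β V.αβ x σ).symm
  exact h2.adjoint.comp (V.op_β.comp h1)

end PMU

/-! ### Composition rules for isometries, coisometries and intertwining relations. -/

section Isometries
variable {X Y Z : Type*}
  [NormedAddCommGroup X] [InnerProductSpace ℂ X] [CompleteSpace X]
  [NormedAddCommGroup Y] [InnerProductSpace ℂ Y] [CompleteSpace Y]
  [NormedAddCommGroup Z] [InnerProductSpace ℂ Z] [CompleteSpace Z]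

theorem isometry_comp {S : Y →L[ℂ] Z} {T : X →L[ℂ] Y}
    (hS : S† ∘L S = ContinuousLinearMap.id ℂ Y) (hT : T† ∘L T = ContinuousLinearMap.id ℂ X) :
    (S ∘L T)† ∘L (S ∘L T) = ContinuousLinearMap.id ℂ X := by
  rw [ContinuousLinearMap.adjoint_comp]
  calc _ = T† ∘L (S† ∘L S) ∘L T := rfl
    _ = T† ∘L T := by rw [hS]; rfl
    _ = _ := hT

theorem coisometry_comp {S : Y →L[ℂ] Z} {T : X →L[ℂ] Y}
    (hS : S ∘L S† = ContinuousLinearMap.id ℂ Z) (hT : T ∘L T† = ContinuousLinearMap.id ℂ Y) :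
    (S ∘L T) ∘L (S ∘L T)† = ContinuousLinearMap.id ℂ Z := by
  rw [ContinuousLinearMap.adjoint_comp]
  calc _ = S ∘L (T ∘L T†) ∘L S† := rfl
    _ = S ∘L S† := by rw [hT]; rfl
    _ = _ := hS

theorem intertwine_comp {S : Y →L[ℂ] Z} {T : X →L[ℂ] Y} {x : X →L[ℂ] X} {y : Y →L[ℂ] Y}
    {z : Z →L[ℂ] Z} (hS : S ∘L y = z ∘L S) (hT : T ∘L x = y ∘L T) :
    (S ∘L T) ∘L x = z ∘L (S ∘L T) := by
  calc _ = S ∘L (T ∘L x) := rfl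
    _ = (S ∘L y) ∘L T := by rw [hT]; rfl
    _ = _ := by rw [hS]; rfl

end Isometries

section
variable {K : Type u} [NormedAddCommGroup K] [InnerProductSpace ℂ K] [CompleteSpace K]
variable {H : Type*} [NormedAddCommGroup H] [InnerProductSpace ℂ H] [CompleteSpace H]
variable {L : Type*} [NormedAddCommGroup L] [InnerProductSpace ℂ L] [CompleteSpace L]
variable {b : CBase K}

theorem flip_tensL_flip (E : CMod b H) (F : CMod b.dagger L) {w : L →L[ℂ] L}
    (hw : Intertw F F w) :
    (flip E F)† ∘L tensL (b := b.dagger) F F E w ∘L flip E F = tensR E F F w := by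
  refine (ket1_total E F).ext fun σ => ?_
  rw [flip_adjoint, hw.tensR_ket1]
  calc _ = flip (b := b.dagger) F E ∘L tensL (b := b.dagger) F F E w ∘L
        (flip E F ∘L ket1 E F σ) := rfl
    _ = flip (b := b.dagger) F E ∘L
        (tensL (b := b.dagger) F F E w ∘L ket2 (b := b.dagger) F E σ) := by rw [flip_ket1]
    _ = (flip (b := b.dagger) F E ∘L ket2 (b := b.dagger) F E σ) ∘L w := by
      rw [Intertw.tensL_ket2 (b := b.dagger) E hw]; rfl
    _ = _ := congrArg (fun T => T ∘L w) (flip_ket2 (b := b.dagger) F E σ)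

end

/-! ### The factors of the pentagon equation. -/

namespace PMU
variable {K : Type u} [NormedAddCommGroup K] [InnerProductSpace ℂ K] [CompleteSpace K]
variable {H : Type v} [NormedAddCommGroup H] [InnerProductSpace ℂ H] [CompleteSpace H]
variable {b : CBase K} (V : PMU b H)

/-- `(H ⊗ H) ⊗ H` with respect to `(β̂, α)`, `(β̂, α)`. -/
abbrev Dom := RTP V.sRβh V.α
/-- `H ⊗ (H ⊗ H)` with respect to `(α, β)`, `(α, β)`. -/
abbrev Cod := RTP V.α V.rLβ

/-- `V₁₂` on the domain of the pentagon. -/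
def opA : V.Dom →L[ℂ] RTP V.rRβh V.α := tensL V.sRβh V.rRβh V.α V.op
/-- The reassociation between `V₁₂` and `V₂₃`. -/
def ascA : RTP V.rRβh V.α →L[ℂ] RTP V.α V.sLβ := assoc V.α V.β V.βh V.α V.ββh V.βhβ
/-- `V₂₃` with values in the codomain of the pentagon. -/
def opB : RTP V.α V.sLβ →L[ℂ] V.Cod := tensR V.α V.sLβ V.rLβ V.op
/-- The reassociation of the domain of the pentagon. -/
def ascB : V.Dom →L[ℂ] RTP V.βh V.sLα := assoc V.βh V.α V.βh V.α V.αβh V.βhα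
/-- `V₂₃` on the domain of the pentagon. -/
def opC : RTP V.βh V.sLα →L[ℂ] RTP V.βh V.rRα := tensR V.βh V.sLα V.rRα V.op
/-- The exchange of the last two factors between `V₂₃` and `V₁₃`. -/
def swA : RTP V.βh V.rRα →L[ℂ] RTP V.sRβ V.α :=
  assocSymm V.βh V.α V.β V.α V.αβ V.βα ∘L
    tensR V.βh V.rRα (triL V.β V.α V.α V.βα) (flip V.α V.β)
/-- `V₁₃` up to exchange of factors. -/
def opD : RTP V.sRβ V.α →L[ℂ] RTP V.rLβh V.α := tensL V.sRβ V.rLβh V.α V.op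
/-- The exchange of the last two factors between `V₁₃` and `V₁₂`. -/
def swB : RTP V.rLβh V.α →L[ℂ] RTP V.sLα V.β := swap23 V.α V.β V.βh V.α V.αβh V.βhα
/-- `V₁₂` after `V₁₃`. -/
def opE : RTP V.sLα V.β →L[ℂ] RTP V.rRα V.β := tensL V.sLα V.rRα V.β V.op
/-- The reassociation of the codomain of the pentagon. -/
def ascC : RTP V.rRα V.β →L[ℂ] V.Cod := assoc V.α V.β V.α V.β V.βα V.αβ

theorem pentagon_eq : V.opB ∘L V.ascA ∘L V.opA
    = V.ascC ∘L V.opE ∘L V.swB ∘L V.opD ∘L V.swA ∘L V.opC ∘L V.ascB := by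
  have h1 : V.toCTriple.pentagonLeft V.op = V.opB ∘L V.ascA ∘L V.opA := by
    unfold CTriple.pentagonLeft opB ascA opA
    rfl
  have h2 : V.toCTriple.pentagonRight V.op
      = V.ascC ∘L V.opE ∘L V.swB ∘L V.opD ∘L V.swA ∘L V.opC ∘L V.ascB := by
    unfold CTriple.pentagonRight opE opD opC ascB ascC swA swB
    rw [ContinuousLinearMap.comp_assoc (assocSymm _ _ _ _ _ _)]
  exact h1.symm.trans (V.pentagon.trans h2)

variable {V}

theorem opA_ket2 (τ : V.α.space) :
    V.opA ∘L ket2 V.sRβh V.α τ = ket2 V.rRβh V.α τ ∘L V.op :=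
  Intertw.tensL_ket2 (b := b.dagger) V.α V.op_βh τ

theorem ascA_ket (σ τ : V.α.space) :
    V.ascA ∘L ket2 V.rRβh V.α τ ∘L ket1 V.α V.β σ = ket1 V.α V.sLβ σ ∘L ket2 V.βh V.α τ :=
  assoc_ket V.α V.β V.βh V.α V.ββh V.βhβ σ τ

theorem opB_ket1 (σ : V.α.space) : V.opB ∘L ket1 V.α V.sLβ σ = ket1 V.α V.rLβ σ ∘L V.op :=
  Intertw.tensR_ket1 V.α V.op_β σ

theorem bra1_opB (σ : V.α.space) :
    (ket1 V.α V.rLβ σ)† ∘L V.opB = V.op ∘L (ket1 V.α V.sLβ σ)† :=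
  Intertw.bra1_tensR V.α V.op_β σ

theorem ascB_ket (ζ : V.βh.space) (τ : V.α.space) :
    V.ascB ∘L ket2 V.sRβh V.α τ ∘L ket1 V.βh V.α ζ = ket1 V.βh V.sLα ζ ∘L ket2 V.βh V.α τ :=
  assoc_ket V.βh V.α V.βh V.α V.αβh V.βhα ζ τ

theorem opC_ket1 (ζ : V.βh.space) :
    V.opC ∘L ket1 V.βh V.sLα ζ = ket1 V.βh V.rRα ζ ∘L V.op :=
  Intertw.tensR_ket1 (b := b.dagger) V.βh V.op_α ζ

theorem intertw_flip : Intertw V.rRα (triL V.β V.α V.α V.βα) (flip V.α V.β) := fun x =>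
  (ket1_total V.α V.β).ext fun σ => by
    have h1 := triL_rho_ket2 (b := b.dagger) V.β V.α V.βα x σ
    calc flip V.α V.β ∘L V.rRα.rho x ∘L ket1 V.α V.β σ
        = (flip V.α V.β ∘L ket1 V.α V.β σ) ∘L V.α.rho x := by rw [triR_rho_ket1]; rfl
      _ = (triL V.β V.α V.α V.βα).rho x ∘L (flip V.α V.β ∘L ket1 V.α V.β σ) := by
        rw [flip_ket1]; exact h1.symm
      _ = _ := rfl

theorem flip_mem {θ : K →L[ℂ] V.Range} (hθ : θ ∈ V.rRα.space) :
    flip V.α V.β ∘L θ ∈ (triL V.β V.α V.α V.βα).space := by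
  refine map_mem_of_mem_cspan (ContinuousLinearMap.compL ℂ K _ _ (flip V.α V.β))
    (isClosed_cspan _) ?_ hθ
  rintro _ ⟨σ, ξ, hξ, rfl⟩
  refine mem_cspan ⟨σ, ξ, hξ, ?_⟩
  rw [← flip_ket1]
  rfl

theorem swA_ket1 (ζ : V.βh.space) :
    V.swA ∘L ket1 V.βh V.rRα ζ = assocSymm V.βh V.α V.β V.α V.αβ V.βα ∘L
      ket1 V.βh (triL V.β V.α V.α V.βα) ζ ∘L flip V.α V.β := by
  unfold swA
  rw [ContinuousLinearMap.comp_assoc, Intertw.tensR_ket1 (b := b.dagger) V.βh intertw_flip ζ]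

theorem swA_ket (ζ : V.βh.space) (η : V.α.space) :
    V.swA ∘L ket1 V.βh V.rRα ζ ∘L ket1 V.α V.β η = ket2 V.sRβ V.α η ∘L ket1 V.βh V.α ζ := by
  rw [← ContinuousLinearMap.comp_assoc, swA_ket1, ContinuousLinearMap.comp_assoc,
    ContinuousLinearMap.comp_assoc, flip_ket1]
  exact assocSymm_ket V.βh V.α V.β V.α V.αβ V.βα ζ η

theorem opD_ket2 (η : V.α.space) : V.opD ∘L ket2 V.sRβ V.α η = ket2 V.rLβh V.α η ∘L V.op :=
  Intertw.tensL_ket2 (b := b.dagger) V.α V.op_βhβ η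

theorem bra2_opD (η : V.α.space) :
    (ket2 V.rLβh V.α η)† ∘L V.opD = V.op ∘L (ket2 V.sRβ V.α η)† :=
  Intertw.bra2_tensL (b := b.dagger) V.α V.op_βhβ η

theorem swB_ket (ξ : V.β.space) (η : V.α.space) :
    V.swB ∘L ket2 V.rLβh V.α η ∘L ket2 V.α V.β ξ = ket2 V.sLα V.β ξ ∘L ket2 V.βh V.α η :=
  swap23_ket V.α V.β V.βh V.α V.αβh V.βhα ξ η

theorem bra2_swB_ket2 (ξ : V.β.space) (η : V.α.space) :
    (ket2 V.sLα V.β ξ)† ∘L V.swB ∘L ket2 V.rLβh V.α η = ket2 V.βh V.α η ∘L (ket2 V.α V.β ξ)† :=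
  bra2_swap23_ket2 V.α V.β V.βh V.α V.αβh V.βhα ξ η

theorem bra2_opE (ξ : V.β.space) :
    (ket2 V.rRα V.β ξ)† ∘L V.opE = V.op ∘L (ket2 V.sLα V.β ξ)† :=
  Intertw.bra2_tensL V.β V.op_α ξ

theorem ascC_ket (η : V.α.space) (τ : V.β.space) :
    V.ascC ∘L ket2 V.rRα V.β τ ∘L ket1 V.α V.β η = ket1 V.α V.rLβ η ∘L ket2 V.α V.β τ :=
  assoc_ket V.α V.β V.α V.β V.βα V.αβ η τ

theorem ascB_coisometry : V.ascB ∘L V.ascB† = ContinuousLinearMap.id ℂ _ := by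
  refine Eq.trans (congrArg (fun T => V.ascB ∘L T) ?_)
    (assoc_assocSymm V.βh V.α V.βh V.α V.αβh V.βhα)
  exact assoc_adjoint V.βh V.α V.βh V.α V.αβh V.βhα

theorem opC_coisometry : V.opC ∘L V.opC† = ContinuousLinearMap.id ℂ _ :=
  Intertw.tensR_coisometry (b := b.dagger) V.βh V.op_α V.op_coisometry

theorem swA_coisometry : V.swA ∘L V.swA† = ContinuousLinearMap.id ℂ _ := by
  refine coisometry_comp ?_ (Intertw.tensR_coisometry (b := b.dagger) V.βh intertw_flip ?_)
  · refine Eq.trans (congrArg (fun T => assocSymm V.βh V.α V.β V.α V.αβ V.βα ∘L T) ?_)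
      (assocSymm_assoc V.βh V.α V.β V.α V.αβ V.βα)
    exact assocSymm_adjoint V.βh V.α V.β V.α V.αβ V.βα
  · rw [flip_adjoint]
    exact flip_flip (b := b.dagger) V.β V.α

theorem opD_coisometry : V.opD ∘L V.opD† = ContinuousLinearMap.id ℂ _ :=
  Intertw.tensL_coisometry (b := b.dagger) V.α V.op_βhβ V.op_coisometry

theorem opD_isometry : V.opD† ∘L V.opD = ContinuousLinearMap.id ℂ _ :=
  Intertw.tensL_isometry (b := b.dagger) V.α V.op_βhβ V.op_isometry

theorem swB_isometry : V.swB† ∘L V.swB = ContinuousLinearMap.id ℂ _ :=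
  swap23_isometry V.α V.β V.βh V.α V.αβh V.βhα

theorem opE_isometry : V.opE† ∘L V.opE = ContinuousLinearMap.id ℂ _ :=
  Intertw.tensL_isometry V.β V.op_α V.op_isometry

theorem ascC_isometry : V.ascC† ∘L V.ascC = ContinuousLinearMap.id ℂ _ := by
  refine Eq.trans (congrArg (fun T => T ∘L V.ascC) ?_)
    (assocSymm_assoc V.α V.β V.α V.β V.βα V.αβ)
  exact assoc_adjoint V.α V.β V.α V.β V.βα V.αβ

end PMU

/-! ### Conjugation by factorised operators. -/

section Conjugation
variable {X Y Z W : Type*}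
  [NormedAddCommGroup X] [InnerProductSpace ℂ X] [CompleteSpace X]
  [NormedAddCommGroup Y] [InnerProductSpace ℂ Y] [CompleteSpace Y]
  [NormedAddCommGroup Z] [InnerProductSpace ℂ Z] [CompleteSpace Z]
  [NormedAddCommGroup W] [InnerProductSpace ℂ W] [CompleteSpace W]

/-- If `P` factors through a coisometry `R` carrying `x` to `w`, conjugation by `P` forgets `R`.
This removes from the pentagon the part of a path that commutes with the operator being conjugated.
-/
theorem conj_of_factor {P : X →L[ℂ] Z} {R : X →L[ℂ] Y} {T : Y →L[ℂ] Z} {x : X →L[ℂ] X}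
    {w : Y →L[ℂ] Y} (hP : P = T ∘L R) (hR : R ∘L x = w ∘L R)
    (hR' : R ∘L R† = ContinuousLinearMap.id ℂ Y) : P ∘L x ∘L P† = T ∘L w ∘L T† := by
  rw [hP, ContinuousLinearMap.adjoint_comp]
  calc _ = T ∘L (R ∘L x) ∘L R† ∘L T† := rfl
    _ = T ∘L w ∘L (R ∘L R†) ∘L T† := by rw [hR]; rfl
    _ = _ := by rw [hR']; rfl

theorem conj_of_factor' {P : X →L[ℂ] Z} {R : X →L[ℂ] Y} {T : Y →L[ℂ] Z} {z : Z →L[ℂ] Z}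
    {w : Y →L[ℂ] Y} (hP : P = T ∘L R) (hT : T ∘L w = z ∘L T)
    (hT' : T† ∘L T = ContinuousLinearMap.id ℂ Y) : P† ∘L z ∘L P = R† ∘L w ∘L R := by
  rw [hP, ContinuousLinearMap.adjoint_comp]
  calc _ = R† ∘L T† ∘L (z ∘L T) ∘L R := rfl
    _ = R† ∘L (T† ∘L T) ∘L w ∘L R := by rw [← hT]; rfl
    _ = _ := by rw [hT']; rfl

theorem symm_intertwine {S : X →L[ℂ] Y} {S' : Y →L[ℂ] X} {x : X →L[ℂ] X} {y : Y →L[ℂ] Y}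
    (h : S ∘L S' = ContinuousLinearMap.id ℂ Y) (h' : S' ∘L S = ContinuousLinearMap.id ℂ X)
    (hS : S ∘L x = y ∘L S) : S' ∘L y = x ∘L S' := by
  calc S' ∘L y = S' ∘L y ∘L (S ∘L S') := by rw [h]; rfl
    _ = S' ∘L (y ∘L S) ∘L S' := rfl
    _ = (S' ∘L S) ∘L x ∘L S' := by rw [← hS]; rfl
    _ = _ := by rw [h']; rfl

theorem comp_reassoc₃ {X Y Z W U : Type*}
    [NormedAddCommGroup X] [InnerProductSpace ℂ X] [CompleteSpace X]
    [NormedAddCommGroup Y] [InnerProductSpace ℂ Y] [CompleteSpace Y]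
    [NormedAddCommGroup Z] [InnerProductSpace ℂ Z] [CompleteSpace Z]
    [NormedAddCommGroup W] [InnerProductSpace ℂ W] [CompleteSpace W]
    [NormedAddCommGroup U] [InnerProductSpace ℂ U] [CompleteSpace U]
    {U' : Type*} [NormedAddCommGroup U'] [InnerProductSpace ℂ U'] [CompleteSpace U']
    {f : Z →L[ℂ] W} {g : Y →L[ℂ] Z} {h : X →L[ℂ] Y} {p : U' →L[ℂ] W} {q : X →L[ℂ] U'}
    (e : f ∘L g ∘L h = p ∘L q) (k : U →L[ℂ] X) : f ∘L g ∘L h ∘L k = p ∘L q ∘L k := by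
  calc _ = (f ∘L g ∘L h) ∘L k := rfl
    _ = _ := by rw [e]; rfl

theorem comp_reassoc₂ {X Y Z W : Type*}
    [NormedAddCommGroup X] [InnerProductSpace ℂ X] [CompleteSpace X]
    [NormedAddCommGroup Y] [InnerProductSpace ℂ Y] [CompleteSpace Y]
    [NormedAddCommGroup Z] [InnerProductSpace ℂ Z] [CompleteSpace Z]
    [NormedAddCommGroup W] [InnerProductSpace ℂ W] [CompleteSpace W]
    {U' : Type*} [NormedAddCommGroup U'] [InnerProductSpace ℂ U'] [CompleteSpace U']
    {f : Y →L[ℂ] Z} {g : X →L[ℂ] Y} {p : U' →L[ℂ] Z} {q : X →L[ℂ] U'}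
    (e : f ∘L g = p ∘L q) (k : W →L[ℂ] X) : f ∘L g ∘L k = p ∘L q ∘L k := by
  calc _ = (f ∘L g) ∘L k := rfl
    _ = _ := by rw [e]; rfl

theorem conj_comp₃ (A : Z →L[ℂ] W) (B : Y →L[ℂ] Z) (C : X →L[ℂ] Y) (x : X →L[ℂ] X) :
    (A ∘L B ∘L C) ∘L x ∘L (A ∘L B ∘L C)† = A ∘L (B ∘L (C ∘L x ∘L C†) ∘L B†) ∘L A† := by
  rw [ContinuousLinearMap.adjoint_comp, ContinuousLinearMap.adjoint_comp]
  rfl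

theorem conj_comp₃' (A : Z →L[ℂ] W) (B : Y →L[ℂ] Z) (C : X →L[ℂ] Y) (x : W →L[ℂ] W) :
    (A ∘L B ∘L C)† ∘L x ∘L (A ∘L B ∘L C) = C† ∘L (B† ∘L (A† ∘L x ∘L A) ∘L B) ∘L C := by
  rw [ContinuousLinearMap.adjoint_comp, ContinuousLinearMap.adjoint_comp]
  rfl

theorem bracket_conj {X X' U U' : Type*}
    [NormedAddCommGroup X] [InnerProductSpace ℂ X] [CompleteSpace X]
    [NormedAddCommGroup X'] [InnerProductSpace ℂ X'] [CompleteSpace X']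
    [NormedAddCommGroup U] [InnerProductSpace ℂ U] [CompleteSpace U]
    [NormedAddCommGroup U'] [InnerProductSpace ℂ U'] [CompleteSpace U']
    {f : Z →L[ℂ] X'} {B : Y →L[ℂ] Z} {M : Y →L[ℂ] Y} {B' : Z →L[ℂ] Y} {g : X →L[ℂ] Z}
    {p : U →L[ℂ] X'} {q : Y →L[ℂ] U} {q' : U' →L[ℂ] Y} {p' : X →L[ℂ] U'} {w : U' →L[ℂ] U}
    (hf : f ∘L B = p ∘L q) (hg : B' ∘L g = q' ∘L p') (h : q ∘L M ∘L q' = w) :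
    f ∘L (B ∘L M ∘L B') ∘L g = p ∘L w ∘L p' := by
  calc _ = (f ∘L B) ∘L M ∘L (B' ∘L g) := rfl
    _ = p ∘L (q ∘L M ∘L q') ∘L p' := by rw [hf, hg]; rfl
    _ = _ := by rw [h]

theorem isometry_bracket {X U X' U' T : Type*}
    [NormedAddCommGroup X] [InnerProductSpace ℂ X] [CompleteSpace X]
    [NormedAddCommGroup X'] [InnerProductSpace ℂ X'] [CompleteSpace X']
    [NormedAddCommGroup U] [InnerProductSpace ℂ U] [CompleteSpace U]
    [NormedAddCommGroup U'] [InnerProductSpace ℂ U'] [CompleteSpace U']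
    [NormedAddCommGroup T] [InnerProductSpace ℂ T] [CompleteSpace T]
    {C : Y →L[ℂ] Z} {k : X →L[ℂ] Y} {k' : X' →L[ℂ] Y} {E : W →L[ℂ] Y} {s : T →L[ℂ] W}
    {M : T →L[ℂ] T} {p : U →L[ℂ] X} {q : W →L[ℂ] U} {q' : U' →L[ℂ] W} {p' : X' →L[ℂ] U'}
    {w : U' →L[ℂ] U} (hC : C† ∘L C = ContinuousLinearMap.id ℂ Y)
    (hf : k† ∘L E = p ∘L q) (hg : E† ∘L k' = q' ∘L p')
    (h : q ∘L (s ∘L M ∘L s†) ∘L q' = w) :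
    (C ∘L k)† ∘L ((C ∘L E ∘L s) ∘L M ∘L (C ∘L E ∘L s)†) ∘L C ∘L k' = p ∘L w ∘L p' := by
  simp only [ContinuousLinearMap.adjoint_comp]
  calc _ = k† ∘L (C† ∘L C) ∘L E ∘L (s ∘L M ∘L s†) ∘L E† ∘L (C† ∘L C) ∘L k' := rfl
    _ = k† ∘L E ∘L (s ∘L M ∘L s†) ∘L E† ∘L k' := by rw [hC]; rfl
    _ = _ := bracket_conj (B := E) (B' := E†) hf hg h

/-- The identity `BB* = Id` removes the inner `B`, after which the kets can be moved through `C`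
before the slice `h` is taken. -/
theorem coisometry_bracket {X U X' U' T : Type*}
    [NormedAddCommGroup X] [InnerProductSpace ℂ X] [CompleteSpace X]
    [NormedAddCommGroup X'] [InnerProductSpace ℂ X'] [CompleteSpace X']
    [NormedAddCommGroup U] [InnerProductSpace ℂ U] [CompleteSpace U]
    [NormedAddCommGroup U'] [InnerProductSpace ℂ U'] [CompleteSpace U']
    [NormedAddCommGroup T] [InnerProductSpace ℂ T] [CompleteSpace T]
    {B : Y →L[ℂ] Z} {k : X →L[ℂ] Z} {k' : X' →L[ℂ] Z} {C : Z →L[ℂ] W} {A : W →L[ℂ] T}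
    {M : T →L[ℂ] T} {r : U →L[ℂ] W} {p : X →L[ℂ] U} {r' : U' →L[ℂ] W} {p' : X' →L[ℂ] U'}
    {w : U' →L[ℂ] U} (hB : B ∘L B† = ContinuousLinearMap.id ℂ Z)
    (hk : C ∘L k = r ∘L p) (hk' : C ∘L k' = r' ∘L p')
    (h : (A ∘L r)† ∘L M ∘L A ∘L r' = w) :
    (B† ∘L k)† ∘L ((A ∘L C ∘L B)† ∘L M ∘L (A ∘L C ∘L B)) ∘L B† ∘L k' = p† ∘L w ∘L p' := by
  have e : (A ∘L C ∘L B) ∘L B† ∘L k = (A ∘L r) ∘L p := by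
    calc _ = A ∘L C ∘L (B ∘L B†) ∘L k := rfl
      _ = A ∘L C ∘L k := by rw [hB]; rfl
      _ = _ := by rw [hk]; rfl
  have e' : (A ∘L C ∘L B) ∘L B† ∘L k' = (A ∘L r') ∘L p' := by
    calc _ = A ∘L C ∘L (B ∘L B†) ∘L k' := rfl
      _ = A ∘L C ∘L k' := by rw [hB]; rfl
      _ = _ := by rw [hk']; rfl
  calc _ = ((A ∘L C ∘L B) ∘L B† ∘L k)† ∘L M ∘L ((A ∘L C ∘L B) ∘L B† ∘L k') := by
        rw [ContinuousLinearMap.adjoint_comp (A ∘L C ∘L B)]; rfl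
    _ = p† ∘L ((A ∘L r)† ∘L M ∘L A ∘L r') ∘L p' := by
        rw [e, e', ContinuousLinearMap.adjoint_comp (A ∘L r) p]; rfl
    _ = _ := by rw [h]

theorem comp_assoc₃ (A : Z →L[ℂ] W) (B : Y →L[ℂ] Z) (C : X →L[ℂ] Y) {U : Type*}
    [NormedAddCommGroup U] [InnerProductSpace ℂ U] [CompleteSpace U] (k : U →L[ℂ] X) :
    A ∘L B ∘L C ∘L k = (A ∘L B ∘L C) ∘L k := rfl

end Conjugation

/-! ### Coproducts of slices of `V`. -/

namespace PMU
variable {K : Type u} [NormedAddCommGroup K] [InnerProductSpace ℂ K] [CompleteSpace K]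
variable {H : Type v} [NormedAddCommGroup H] [InnerProductSpace ℂ H] [CompleteSpace H]
variable {b : CBase K} {V : PMU b H}

theorem opB_adjoint_ket1 (η : V.α.space) :
    V.opB† ∘L ket1 V.α V.rLβ η = ket1 V.α V.sLβ η ∘L V.op† := by
  have h := adjoint_comp_eq (bra1_opB η)
  rwa [ContinuousLinearMap.adjoint_adjoint, ContinuousLinearMap.adjoint_adjoint] at h

theorem opC_adjoint_ket1 (ζ : V.βh.space) :
    V.opC† ∘L ket1 V.βh V.rRα ζ = ket1 V.βh V.sLα ζ ∘L V.op† := by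
  have h := adjoint_comp_eq (Intertw.bra1_tensR (b := b.dagger) V.βh V.op_α ζ)
  rwa [ContinuousLinearMap.adjoint_adjoint, ContinuousLinearMap.adjoint_adjoint] at h

theorem opE_adjoint_ket2 (ξ : V.β.space) :
    V.opE† ∘L ket2 V.rRα V.β ξ = ket2 V.sLα V.β ξ ∘L V.op† := by
  have h := adjoint_comp_eq (bra2_opE ξ)
  rwa [ContinuousLinearMap.adjoint_adjoint, ContinuousLinearMap.adjoint_adjoint] at h

theorem ascB_adjoint_ket (ζ : V.βh.space) (τ : V.α.space) :
    V.ascB† ∘L ket1 V.βh V.sLα ζ ∘L ket2 V.βh V.α τ = ket2 V.sRβh V.α τ ∘L ket1 V.βh V.α ζ := by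
  unfold ascB
  rw [assoc_adjoint]
  exact assocSymm_ket V.βh V.α V.βh V.α V.αβh V.βhα ζ τ

theorem bra1_ascA_ket2 (σ τ : V.α.space) :
    (ket1 V.α V.sLβ σ)† ∘L V.ascA ∘L ket2 V.rRβh V.α τ = ket2 V.βh V.α τ ∘L (ket1 V.α V.β σ)† :=
  bra1_assoc_ket2 V.α V.β V.βh V.α V.ββh V.βhβ σ τ

theorem bra2_ascC_adjoint_ket1 (x : V.α.space) (σ : V.β.space) :
    (ket2 V.rRα V.β σ)† ∘L V.ascC† ∘L ket1 V.α V.rLβ x = ket1 V.α V.β x ∘L (ket2 V.α V.β σ)† := by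
  unfold ascC
  rw [assoc_adjoint]
  exact bra2_assocSymm_ket1 V.α V.β V.α V.β V.βα V.αβ x σ

theorem ket_adjoint_ascC (σ : V.α.space) (ξ : V.β.space) :
    (ket2 V.α V.β ξ)† ∘L (ket1 V.α V.rLβ σ)† ∘L V.ascC
      = (ket1 V.α V.β σ)† ∘L (ket2 V.rRα V.β ξ)† := by
  rw [← ContinuousLinearMap.comp_assoc, ← ContinuousLinearMap.adjoint_comp, ← ascC_ket,
    ContinuousLinearMap.adjoint_comp, ContinuousLinearMap.adjoint_comp,
    ContinuousLinearMap.comp_assoc, ascC_isometry, ContinuousLinearMap.comp_id]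

theorem ket_adjoint_swB (σ : V.β.space) (ξ : V.α.space) :
    (ket2 V.βh V.α ξ)† ∘L (ket2 V.sLα V.β σ)† ∘L V.swB
      = (ket2 V.α V.β σ)† ∘L (ket2 V.rLβh V.α ξ)† := by
  rw [← ContinuousLinearMap.comp_assoc, ← ContinuousLinearMap.adjoint_comp, ← swB_ket,
    ContinuousLinearMap.adjoint_comp, ContinuousLinearMap.adjoint_comp,
    ContinuousLinearMap.comp_assoc, swB_isometry, ContinuousLinearMap.comp_id]

theorem bra2_swA_ket1 (ξ : V.α.space) (η : V.βh.space) :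
    (ket2 V.sRβ V.α ξ)† ∘L V.swA ∘L ket1 V.βh V.rRα η
      = ket1 V.βh V.α η ∘L (ket1 V.α V.β ξ)† :=
  (ket1_total V.α V.β).ext fun x => by
    rw [ContinuousLinearMap.comp_assoc, ContinuousLinearMap.comp_assoc, swA_ket,
      ← ContinuousLinearMap.comp_assoc, ContinuousLinearMap.comp_assoc _ _ (ket1 V.α V.β x),
      ket1_adjoint_comp]
    have h := ket2_adjoint_comp (b := b.dagger) V.sRβ V.α ξ x
    rw [h]
    exact triR_rho_ket1 (b := b.dagger) V.βh V.α V.αβ _ η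

/-- Amplifying a slice of `V` on the right amounts to slicing `V₁₂` along its first leg, which makes
the pentagon equation applicable. -/
theorem tensL_slice (σ : V.α.space) (ζ : V.βh.space) :
    tensL V.βh V.βh V.α (V.slice σ ζ)
      = (ket1 V.α V.sLβ σ)† ∘L V.ascA ∘L V.opA ∘L V.ascB† ∘L ket1 V.βh V.sLα ζ :=
  (ket2_total V.βh V.α).ext fun τ => by
    have h := Intertw.tensL_ket2 (b := b.dagger) V.α (CMod.mem_commutant.1 (V.slice_mem σ ζ)) τ
    rw [h]
    simp only [ContinuousLinearMap.comp_assoc]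
    rw [ascB_adjoint_ket, comp_reassoc₂ (opA_ket2 τ), comp_reassoc₃ (bra1_ascA_ket2 σ τ)]
    rfl

/-- The outer factors `V` and `V*` of the coproduct become `V₂₃` and `V₂₃*` inside the slice. By the
pentagon equation `V₂₃V₁₂V₂₃* = V₁₂V₁₃`, so the coproduct is the slice of `V₁₂V₁₃`. -/
theorem delta_slice (σ : V.α.space) (ζ : V.βh.space) :
    V.delta (V.slice σ ζ) = (ket1 V.α V.rLβ σ)† ∘L V.ascC ∘L V.opE ∘L V.swB ∘L V.opD ∘L V.swA ∘L
      ket1 V.βh V.rRα ζ := by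
  unfold delta
  rw [tensL_slice]
  simp only [ContinuousLinearMap.comp_assoc]
  rw [← opC_adjoint_ket1, comp_reassoc₂ (bra1_opB σ).symm]
  have h := congrArg (fun T => (ket1 V.α V.rLβ σ)† ∘L T ∘L V.ascB† ∘L V.opC† ∘L
    ket1 V.βh V.rRα ζ) V.pentagon_eq
  simp only [ContinuousLinearMap.comp_assoc] at h
  rw [h, comp_reassoc ascB_coisometry, ContinuousLinearMap.id_comp, comp_reassoc opC_coisometry,
    ContinuousLinearMap.id_comp]

theorem bra2_core (ξ : V.β.space) (ζ : V.βh.space) (η : V.α.space) {X : Type*}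
    [NormedAddCommGroup X] [InnerProductSpace ℂ X] [CompleteSpace X] (k : X →L[ℂ] H) :
    (ket2 V.rRα V.β ξ)† ∘L V.opE ∘L V.swB ∘L V.opD ∘L V.swA ∘L ket1 V.βh V.rRα ζ ∘L
        ket1 V.α V.β η ∘L k
      = V.op ∘L ket2 V.βh V.α η ∘L (ket2 V.α V.β ξ)† ∘L V.op ∘L ket1 V.βh V.α ζ ∘L k := by
  rw [comp_reassoc₃ (swA_ket ζ η), comp_reassoc₂ (opD_ket2 η), comp_reassoc₂ (bra2_opE ξ),
    comp_reassoc₃ (bra2_swB_ket2 ξ η)]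

/-- The remaining brackets on the last two legs turn `V₁₂` and `V₁₃` into `⟨ξ|₂V|η⟩₂` and
`⟨ξ'|₂V|η'⟩₂`, composed on the first leg. This is multiplicativity of the representation on rank-one
functionals. -/
theorem delta_slice_apply (σ : V.α.space) (ζ : V.βh.space) (ξ ξ' : V.β.space) (η η' : V.α.space) :
    (ket2 V.α V.β ξ' ∘L (ξ : K →L[ℂ] H))† ∘L V.delta (V.slice σ ζ) ∘L ket1 V.α V.β η ∘L
        (η' : K →L[ℂ] H)
      = (σ : K →L[ℂ] H)† ∘L V.sliceHat ξ η ∘L V.sliceHat ξ' η' ∘L (ζ : K →L[ℂ] H) := by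
  rw [delta_slice, ContinuousLinearMap.adjoint_comp]
  simp only [ContinuousLinearMap.comp_assoc]
  rw [comp_reassoc₃ (ket_adjoint_ascC σ ξ'), bra2_core, ket1_comp_eq (b := b.dagger) V.βh V.α ζ η',
    comp_reassoc₂ (adjoint_comp_eq (ket1_comp_eq V.α V.β σ ξ))]
  simp only [sliceHat, ContinuousLinearMap.comp_assoc]

theorem tensR_sliceHat (σ : V.β.space) (τ : V.α.space) :
    tensR V.α V.β V.β (V.sliceHat σ τ)
      = (ket2 V.rRα V.β σ)† ∘L V.ascC† ∘L V.opB ∘L V.ascA ∘L ket2 V.rRβh V.α τ :=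
  (ket1_total V.α V.β).ext fun x => by
    rw [Intertw.tensR_ket1 V.α (CMod.mem_commutant.1 (V.sliceHat_mem σ τ)) x]
    simp only [ContinuousLinearMap.comp_assoc]
    rw [ascA_ket, comp_reassoc₂ (opB_ket1 x), comp_reassoc₃ (bra2_ascC_adjoint_ket1 x σ)]
    rfl

/-- Dual form: here the pentagon equation is used as `V₁₂*V₂₃V₁₂ = V₁₃V₂₃`, and the slice is taken
along the last leg. -/
theorem deltaHat_sliceHat (σ : V.β.space) (τ : V.α.space) :
    V.deltaHat (V.sliceHat σ τ) = (ket2 V.sLα V.β σ)† ∘L V.swB ∘L V.opD ∘L V.swA ∘L V.opC ∘L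
      V.ascB ∘L ket2 V.sRβh V.α τ := by
  unfold deltaHat
  rw [tensR_sliceHat]
  simp only [ContinuousLinearMap.comp_assoc]
  rw [← opA_ket2]
  have h := congrArg (fun T => V.op† ∘L (ket2 V.rRα V.β σ)† ∘L V.ascC† ∘L T ∘L
    ket2 V.sRβh V.α τ) V.pentagon_eq
  simp only [ContinuousLinearMap.comp_assoc] at h
  rw [h, comp_reassoc ascC_isometry, ContinuousLinearMap.id_comp, comp_reassoc₂ (bra2_opE σ),
    comp_reassoc V.op_isometry, ContinuousLinearMap.id_comp]

theorem deltaHat_sliceHat_apply (σ : V.β.space) (τ : V.α.space) (ξ ξ' : V.α.space)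
    (η η' : V.βh.space) :
    (ket2 V.βh V.α ξ' ∘L (ξ : K →L[ℂ] H))† ∘L V.deltaHat (V.sliceHat σ τ) ∘L ket1 V.βh V.α η ∘L
        (η' : K →L[ℂ] H)
      = (σ : K →L[ℂ] H)† ∘L V.slice ξ η ∘L V.slice ξ' η' ∘L (τ : K →L[ℂ] H) := by
  rw [deltaHat_sliceHat, ContinuousLinearMap.adjoint_comp]
  simp only [ContinuousLinearMap.comp_assoc]
  rw [comp_reassoc₃ (ascB_ket η τ), ← ket1_comp_eq (b := b.dagger) V.βh V.α η' τ,
    comp_reassoc₂ (opC_ket1 η), comp_reassoc₃ (ket_adjoint_swB σ ξ'), comp_reassoc₂ (bra2_opD ξ'),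
    comp_reassoc₃ (bra2_swA_ket1 ξ' η),
    comp_reassoc₂ (adjoint_comp_eq (ket1_comp_eq V.α V.β ξ σ).symm)]
  simp only [slice, ContinuousLinearMap.comp_assoc]

end PMU

/-! ### Coassociativity from the pentagon equation. -/

namespace PMU
variable {K : Type u} [NormedAddCommGroup K] [InnerProductSpace ℂ K] [CompleteSpace K]
variable {H : Type v} [NormedAddCommGroup H] [InnerProductSpace ℂ H] [CompleteSpace H]
variable {b : CBase K} {V : PMU b H} {z y : H →L[ℂ] H}

theorem delta_comp_op (z : H →L[ℂ] H) : V.delta z ∘L V.op = V.op ∘L tensL V.βh V.βh V.α z := by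
  unfold delta
  rw [ContinuousLinearMap.comp_assoc, ContinuousLinearMap.comp_assoc, op_isometry,
    ContinuousLinearMap.comp_id]

theorem op_comp_deltaHat (y : H →L[ℂ] H) :
    V.op ∘L V.deltaHat y = tensR V.α V.β V.β y ∘L V.op := by
  unfold deltaHat
  rw [comp_reassoc V.op_coisometry, ContinuousLinearMap.id_comp]

theorem tensL_delta (hz : Intertw V.βh V.βh z) :
    tensL V.rRβh V.rRβh V.α (V.delta z)
      = V.opA ∘L tensL V.sRβh V.sRβh V.α (tensL V.βh V.βh V.α z) ∘L V.opA† := by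
  have h1 : V.opA† = tensL V.rRβh V.sRβh V.α (V.op†) :=
    Intertw.tensL_adjoint (b := b.dagger) V.α V.op_βh
  have h2 := Intertw.tensL_comp_tensL (b := b.dagger) V.α (tensL_sRβh hz) V.op_βh.adjoint
  have h3 := Intertw.tensL_comp_tensL (b := b.dagger) V.α V.op_βh
    ((tensL_sRβh hz).comp V.op_βh.adjoint)
  rw [h1, h2]
  exact h3.symm

theorem swA_tensL (hz : Intertw V.βh V.βh z) :
    V.swA ∘L tensL V.βh V.βh V.rRα z
      = tensL V.sRβ V.sRβ V.α (tensL V.βh V.βh V.α z) ∘L V.swA :=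
  intertwine_comp
    (symm_intertwine (assoc_assocSymm V.βh V.α V.β V.α V.αβ V.βα)
      (assocSymm_assoc V.βh V.α V.β V.α V.αβ V.βα)
      (assoc_tensL (b := b.dagger) V.α V.β V.α V.αβ V.βα hz))
    (Intertw.tensR_tensL (b := b.dagger) hz fun _ => flip_mem)

theorem opD_tensL (hz : Intertw V.βh V.βh z) :
    V.opD ∘L tensL V.sRβ V.sRβ V.α (tensL V.βh V.βh V.α z)
      = tensL V.rLβh V.rLβh V.α (V.delta z) ∘L V.opD := by
  have h1 := Intertw.tensL_comp_tensL (b := b.dagger) V.α V.op_βhβ (tensL_sRβ hz)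
  have h2 := Intertw.tensL_comp_tensL (b := b.dagger) V.α (delta_rLβh hz) V.op_βhβ
  rw [delta_comp_op] at h2
  exact h1.trans h2.symm

theorem ascB_tensL (hz : Intertw V.βh V.βh z) :
    V.ascB ∘L tensL V.sRβh V.sRβh V.α (tensL V.βh V.βh V.α z)
      = tensL V.βh V.βh V.sLα z ∘L V.ascB :=
  assoc_tensL (b := b.dagger) V.α V.βh V.α V.αβh V.βhα hz

theorem opC_tensL (hz : Intertw V.βh V.βh z) :
    V.opC ∘L tensL V.βh V.βh V.sLα z = tensL V.βh V.βh V.rRα z ∘L V.opC :=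
  Intertw.tensR_tensL (b := b.dagger) hz fun _ => V.map_α.mem

theorem pentagon_eq_comp : V.opB ∘L V.ascA ∘L V.opA
    = (V.ascC ∘L V.opE ∘L V.swB) ∘L (V.opD ∘L V.swA ∘L V.opC ∘L V.ascB) :=
  V.pentagon_eq.trans (comp_assoc₃ _ _ _ _)

theorem pentagon_eq_comp' : V.opB ∘L V.ascA ∘L V.opA
    = (V.ascC ∘L V.opE ∘L V.swB ∘L V.opD) ∘L (V.swA ∘L V.opC ∘L V.ascB) := by
  rw [pentagon_eq]
  simp only [ContinuousLinearMap.comp_assoc]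

theorem opDCB_tensL (hz : Intertw V.βh V.βh z) :
    (V.opD ∘L V.swA ∘L V.opC ∘L V.ascB) ∘L tensL V.sRβh V.sRβh V.α (tensL V.βh V.βh V.α z)
      = tensL V.rLβh V.rLβh V.α (V.delta z) ∘L (V.opD ∘L V.swA ∘L V.opC ∘L V.ascB) :=
  intertwine_comp (opD_tensL hz) (intertwine_comp (swA_tensL hz)
    (intertwine_comp (opC_tensL hz) (ascB_tensL hz)))

theorem opDCB_coisometry : (V.opD ∘L V.swA ∘L V.opC ∘L V.ascB) ∘L
    (V.opD ∘L V.swA ∘L V.opC ∘L V.ascB)† = ContinuousLinearMap.id ℂ _ :=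
  coisometry_comp opD_coisometry (coisometry_comp swA_coisometry
      (coisometry_comp opC_coisometry ascB_coisometry))

/-- The left side conjugates `z ⊗ Id ⊗ Id` by `V₂₃V₁₂`, that is by `V₁₂V₁₃V₂₃`. The factor `V₂₃`
does not affect `z ⊗ Id ⊗ Id` and drops out, leaving the iterated coproduct formed in the other
order. -/
theorem conj_tensL_delta (hz : Intertw V.βh V.βh z) :
    V.opB ∘L (V.ascA ∘L tensL V.rRβh V.rRβh V.α (V.delta z) ∘L V.ascA†) ∘L V.opB†
      = (V.ascC ∘L V.opE ∘L V.swB) ∘L tensL V.rLβh V.rLβh V.α (V.delta z) ∘L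
        (V.ascC ∘L V.opE ∘L V.swB)† := by
  rw [tensL_delta hz]
  exact (conj_comp₃ _ _ _ _).symm.trans
    (conj_of_factor pentagon_eq_comp (opDCB_tensL hz) opDCB_coisometry)

theorem delta_bra1_delta (hz : Intertw V.βh V.βh z) (σ η : V.α.space) :
    V.delta ((ket1 V.α V.β σ)† ∘L V.delta z ∘L ket1 V.α V.β η)
      = (ket1 V.α V.rLβ σ)† ∘L (V.opB ∘L (V.ascA ∘L tensL V.rRβh V.rRβh V.α (V.delta z) ∘L
          V.ascA†) ∘L V.opB†) ∘L ket1 V.α V.rLβ η :=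
  (bracket_conj (bra1_opB σ) (opB_adjoint_ket1 η)
    (bra1_assoc_tensL_ket1 V.α V.β V.βh V.α V.ββh V.βhβ (delta_rRβh hz) σ η)).symm

theorem delta_bra2_delta (hz : Intertw V.βh V.βh z) (ξ τ : V.β.space) :
    V.delta ((ket2 V.α V.β ξ)† ∘L V.delta z ∘L ket2 V.α V.β τ)
      = (V.ascC ∘L ket2 V.rRα V.β ξ)† ∘L ((V.ascC ∘L V.opE ∘L V.swB) ∘L
          tensL V.rLβh V.rLβh V.α (V.delta z) ∘L (V.ascC ∘L V.opE ∘L V.swB)†) ∘L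
          V.ascC ∘L ket2 V.rRα V.β τ :=
  (isometry_bracket ascC_isometry (bra2_opE ξ) (opE_adjoint_ket2 τ)
    (bra2_swap23_tensL_ket2 V.α V.β V.βh V.α V.αβh V.βhα (delta_rLβh hz) ξ τ)).symm

/-- Slicing the first leg of the double coproduct gives the coproduct of a first-leg slice, and
slicing the last leg gives that of a second-leg slice. One `S` serves both because the two iterated
coproducts coincide. -/
theorem exists_delta_delta (hz : Intertw V.βh V.βh z) : ∃ S : V.Cod →L[ℂ] V.Cod,
    (∀ σ η : V.α.space, V.delta ((ket1 V.α V.β σ)† ∘L V.delta z ∘L ket1 V.α V.β η)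
      = (ket1 V.α V.rLβ σ)† ∘L S ∘L ket1 V.α V.rLβ η) ∧
    ∀ ξ τ : V.β.space, V.delta ((ket2 V.α V.β ξ)† ∘L V.delta z ∘L ket2 V.α V.β τ)
      = (V.ascC ∘L ket2 V.rRα V.β ξ)† ∘L S ∘L V.ascC ∘L ket2 V.rRα V.β τ :=
  ⟨_, delta_bra1_delta hz, fun ξ τ => by rw [delta_bra2_delta hz, conj_tensL_delta hz]⟩

theorem opD_deltaHat (hy : Intertw V.β V.β y) :
    V.opD ∘L tensL V.sRβ V.sRβ V.α (V.deltaHat y)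
      = tensL V.rLβh V.rLβh V.α (tensR V.α V.β V.β y) ∘L V.opD := by
  have h0 : Intertw V.rLβh V.rLβh (tensR V.α V.β V.β y) := hy.tensR_triL V.α V.αβh V.βhα
  have h1 := Intertw.tensL_comp_tensL (b := b.dagger) V.α V.op_βhβ (deltaHat_sRβ hy)
  have h2 := Intertw.tensL_comp_tensL (b := b.dagger) V.α h0 V.op_βhβ
  rw [← op_comp_deltaHat] at h2
  exact h1.trans h2.symm

theorem tensR_deltaHat (hy : Intertw V.β V.β y) :
    tensR V.α V.sLβ V.sLβ (V.deltaHat y)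
      = V.opB† ∘L tensR V.α V.rLβ V.rLβ (tensR V.α V.β V.β y) ∘L V.opB := by
  have h0 : Intertw V.rLβ V.rLβ (tensR V.α V.β V.β y) := hy.tensR_triL V.α V.αβ V.βα
  have h1 : V.opB† = tensR V.α V.rLβ V.sLβ (V.op†) := Intertw.tensR_adjoint V.α V.op_β
  have h2 := Intertw.tensR_comp_tensR V.α h0 V.op_β
  have h3 := Intertw.tensR_comp_tensR V.α V.op_β.adjoint (h0.comp V.op_β)
  rw [h1]
  unfold opB
  rw [h2]
  exact h3.symm

theorem ascC_tensR (hy : Intertw V.β V.β y) : V.ascC ∘L tensR V.rRα V.β V.β y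
    = tensR V.α V.rLβ V.rLβ (tensR V.α V.β V.β y) ∘L V.ascC :=
  assoc_tensR V.α V.β V.α V.βα V.αβ hy

theorem opE_tensR (hy : Intertw V.β V.β y) :
    V.opE ∘L tensR V.sLα V.β V.β y = tensR V.rRα V.β V.β y ∘L V.opE :=
  hy.tensL_tensR fun _ => V.map_α.mem

theorem swB_tensL (hy : Intertw V.β V.β y) :
    V.swB ∘L tensL V.rLβh V.rLβh V.α (tensR V.α V.β V.β y) = tensR V.sLα V.β V.β y ∘L V.swB :=
  swap23_tensL V.α V.βh V.α V.αβh V.βhα hy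

theorem ascCED_tensL (hy : Intertw V.β V.β y) :
    (V.ascC ∘L V.opE ∘L V.swB ∘L V.opD) ∘L tensL V.sRβ V.sRβ V.α (V.deltaHat y)
      = tensR V.α V.rLβ V.rLβ (tensR V.α V.β V.β y) ∘L (V.ascC ∘L V.opE ∘L V.swB ∘L V.opD) :=
  intertwine_comp (ascC_tensR hy) (intertwine_comp (opE_tensR hy)
    (intertwine_comp (swB_tensL hy) (opD_deltaHat hy)))

theorem ascCED_isometry : (V.ascC ∘L V.opE ∘L V.swB ∘L V.opD)† ∘L
    (V.ascC ∘L V.opE ∘L V.swB ∘L V.opD) = ContinuousLinearMap.id ℂ _ :=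
  isometry_comp ascC_isometry (isometry_comp opE_isometry (isometry_comp swB_isometry opD_isometry))

/-- Dual of `conj_tensL_delta`: the operator is `y` on the last leg, and it is `V₁₂` that commutes
with it and drops out of the pentagon. -/
theorem conj_tensR_deltaHat (hy : Intertw V.β V.β y) :
    V.opA† ∘L (V.ascA† ∘L tensR V.α V.sLβ V.sLβ (V.deltaHat y) ∘L V.ascA) ∘L V.opA
      = (V.swA ∘L V.opC ∘L V.ascB)† ∘L tensL V.sRβ V.sRβ V.α (V.deltaHat y) ∘L
        (V.swA ∘L V.opC ∘L V.ascB) := by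
  rw [tensR_deltaHat hy]
  exact (conj_comp₃' _ _ _ _).symm.trans
    (conj_of_factor' pentagon_eq_comp' (ascCED_tensL hy) ascCED_isometry)

/-- Up to the exchange of factors, `Δ̂_V(y)` acts on legs one and three; slicing leg one leaves an
operator on leg three only. The flips return that leg to its place. -/
theorem bra1_swA_conj_ket1 (hy : Intertw V.β V.β y) (σ η : V.βh.space) :
    (V.swA ∘L ket1 V.βh V.rRα σ)† ∘L tensL V.sRβ V.sRβ V.α (V.deltaHat y) ∘L
        V.swA ∘L ket1 V.βh V.rRα η
      = tensR V.α V.β V.β ((ket1 V.βh V.α σ)† ∘L V.deltaHat y ∘L ket1 V.βh V.α η) := by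
  have h := bra1_assoc_tensL_ket1 (b := b.dagger) V.βh V.α V.β V.α V.αβ V.βα (deltaHat_sRβ hy) σ η
  have hw : Intertw V.β V.β ((ket1 V.βh V.α σ)† ∘L V.deltaHat y ∘L ket1 V.βh V.α η) :=
    Intertw.slice1 (b := b.dagger) (deltaHat_sRβ hy) σ η
  rw [swA_ket1, swA_ket1, ← flip_tensL_flip V.α V.β hw]
  rw [ContinuousLinearMap.adjoint_comp, ContinuousLinearMap.adjoint_comp, assocSymm_adjoint]
  rw [assoc_adjoint] at h
  refine Eq.trans ?_ (congrArg (fun T => (flip V.α V.β)† ∘L T ∘L flip V.α V.β) h)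
  simp only [ContinuousLinearMap.comp_assoc]

theorem deltaHat_bra1_deltaHat (hy : Intertw V.β V.β y) (σ η : V.βh.space) :
    V.deltaHat ((ket1 V.βh V.α σ)† ∘L V.deltaHat y ∘L ket1 V.βh V.α η)
      = (V.ascB† ∘L ket1 V.βh V.sLα σ)† ∘L ((V.swA ∘L V.opC ∘L V.ascB)† ∘L
          tensL V.sRβ V.sRβ V.α (V.deltaHat y) ∘L (V.swA ∘L V.opC ∘L V.ascB)) ∘L
          V.ascB† ∘L ket1 V.βh V.sLα η :=
  (coisometry_bracket ascB_coisometry (opC_ket1 σ) (opC_ket1 η)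
    (bra1_swA_conj_ket1 hy σ η)).symm

theorem deltaHat_bra2_deltaHat (hy : Intertw V.β V.β y) (ξ τ : V.α.space) :
    V.deltaHat ((ket2 V.βh V.α ξ)† ∘L V.deltaHat y ∘L ket2 V.βh V.α τ)
      = (ket2 V.sRβh V.α ξ)† ∘L (V.opA† ∘L (V.ascA† ∘L tensR V.α V.sLβ V.sLβ (V.deltaHat y) ∘L
          V.ascA) ∘L V.opA) ∘L ket2 V.sRβh V.α τ :=
  (bracket_conj (adjoint_comp_eq (opA_ket2 ξ)) (opA_ket2 τ)
    (bra2_assoc_tensR_ket2 V.α V.β V.βh V.α V.ββh V.βhβ (deltaHat_sLβ hy) ξ τ)).symm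

theorem exists_deltaHat_deltaHat (hy : Intertw V.β V.β y) : ∃ S : V.Dom →L[ℂ] V.Dom,
    (∀ σ η : V.βh.space, V.deltaHat ((ket1 V.βh V.α σ)† ∘L V.deltaHat y ∘L ket1 V.βh V.α η)
      = (V.ascB† ∘L ket1 V.βh V.sLα σ)† ∘L S ∘L V.ascB† ∘L ket1 V.βh V.sLα η) ∧
    ∀ ξ τ : V.α.space, V.deltaHat ((ket2 V.βh V.α ξ)† ∘L V.deltaHat y ∘L ket2 V.βh V.α τ)
      = (ket2 V.sRβh V.α ξ)† ∘L S ∘L ket2 V.sRβh V.α τ :=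
  ⟨_, fun σ η => by rw [deltaHat_bra1_deltaHat hy, conj_tensR_deltaHat hy],
    deltaHat_bra2_deltaHat hy⟩

end PMU

/-! ### Transport of square-summable sequences along isometries. -/

section Transport
variable {K X Y H : Type*}
  [NormedAddCommGroup K] [InnerProductSpace ℂ K] [CompleteSpace K]
  [NormedAddCommGroup X] [InnerProductSpace ℂ X] [CompleteSpace X]
  [NormedAddCommGroup Y] [InnerProductSpace ℂ Y] [CompleteSpace Y]
  [NormedAddCommGroup H] [InnerProductSpace ℂ H] [CompleteSpace H]
variable {S : X →L[ℂ] Y}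

theorem adjoint_comp_of_isometry (hS : S† ∘L S = ContinuousLinearMap.id ℂ X) (x y : K →L[ℂ] X) :
    (S ∘L x)† ∘L (S ∘L y) = x† ∘L y := by
  rw [ContinuousLinearMap.adjoint_comp]
  calc _ = x† ∘L (S† ∘L S) ∘L y := rfl
    _ = _ := by rw [hS]; rfl

/-- The image of a sequence under an isometry. -/
def SeqInf.mapIsometry {G : Submodule ℂ (K →L[ℂ] X)} {G' : Submodule ℂ (K →L[ℂ] Y)}
    (θ : SeqInf G) (hS : S† ∘L S = ContinuousLinearMap.id ℂ X)
    (hG : ∀ x ∈ G, S ∘L x ∈ G') : SeqInf G' where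
  seq := fun n => S ∘L θ.seq n
  mem := fun n => hG _ (θ.mem n)
  summable_sq := by
    simp only [adjoint_comp_of_isometry hS]
    exact θ.summable_sq

theorem SeqInf.norm_mapIsometry {G : Submodule ℂ (K →L[ℂ] X)} {G' : Submodule ℂ (K →L[ℂ] Y)}
    (θ : SeqInf G) (hS : S† ∘L S = ContinuousLinearMap.id ℂ X) (hG : ∀ x ∈ G, S ∘L x ∈ G') :
    ‖θ.mapIsometry hS hG‖ = ‖θ‖ := by
  refine congrArg (fun T : K →L[ℂ] K => √‖T‖) (tsum_congr fun n => ?_)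
  exact adjoint_comp_of_isometry hS _ _

theorem exists_omega_push_isometry {ι : Type*} (A : Submodule ℂ (H →L[ℂ] H)) {k : ι → H →L[ℂ] Y}
    {D D' : Submodule ℂ (K →L[ℂ] H)}
    (hD : IsClosed (D : Set (K →L[ℂ] H))) (hD' : IsClosed (D' : Set (K →L[ℂ] H)))
    (hkD : ∀ i j, ∀ ξ ∈ D, ((k i)† ∘L k j) ∘L ξ ∈ D)
    (hkD' : ∀ i j, ∀ ξ ∈ D', ((k i)† ∘L k j) ∘L ξ ∈ D') (Z : (H →L[ℂ] H) → (Y →L[ℂ] Y))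
    (hz : ∀ z ∈ A, ∀ i j, z ∘L ((k i)† ∘L k j) = ((k i)† ∘L k j) ∘L z)
    (hZ : ∀ z ∈ A, ∀ i, Z z ∘L k i = k i ∘L z) {G G' : Submodule ℂ (K →L[ℂ] X)}
    (hS : S† ∘L S = ContinuousLinearMap.id ℂ X)
    (hG : ∀ x ∈ G, S ∘L x ∈ cspan {θ | ∃ i, ∃ ξ ∈ D, θ = k i ∘L ξ})
    (hG' : ∀ x ∈ G', S ∘L x ∈ cspan {θ | ∃ i, ∃ ξ ∈ D', θ = k i ∘L ξ})
    (θ : SeqInf G) (θ' : SeqInf G') :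
    ∃ φ : Omega A D D', ‖φ‖ ≤ ‖θ‖ * ‖θ'‖ ∧
      ∀ z : A, φ.toCLM z = ∑' n, (θ.seq n)† ∘L (S† ∘L Z z ∘L S) ∘L θ'.seq n := by
  obtain ⟨φ, hφ, h⟩ := exists_omega_push A hD hD' hkD hkD' Z hz hZ (θ.mapIsometry hS hG)
    (θ'.mapIsometry hS hG')
  rw [SeqInf.norm_mapIsometry, SeqInf.norm_mapIsometry] at hφ
  refine ⟨φ, hφ, fun z => (h z).trans (tsum_congr fun n => ?_)⟩
  change (S ∘L θ.seq n)† ∘L Z z ∘L S ∘L θ'.seq n = _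
  rw [ContinuousLinearMap.adjoint_comp]
  rfl

end Transport

/-! ### The data for `Δ_V` and `Δ̂_V`. -/

namespace PMU
variable {K : Type u} [NormedAddCommGroup K] [InnerProductSpace ℂ K] [CompleteSpace K]
variable {H : Type v} [NormedAddCommGroup H] [InnerProductSpace ℂ H] [CompleteSpace H]
variable {b : CBase K} (V : PMU b H)

/-- The adjoint of `V` carries `β ◁ β` and `α ▷ α` to `β ◁ α = [|α⟩₂ β]` and `α ◁ α = [|α⟩₂ α]`.
There `z ⊗ Id` passes through `|α⟩₂`, which is the situation of `exists_omega_push`. -/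
theorem exists_comp_delta (θ : SeqInf V.rLβ.space) (θ' : SeqInf V.rRα.space) :
    ∃ ψ : V.OmegaHat, ‖ψ‖ ≤ ‖θ‖ * ‖θ'‖ ∧
      ∀ z : V.βh.commutant, ψ.toCLM z = ∑' n, (θ.seq n)† ∘L V.delta z ∘L θ'.seq n := by
  have hk := ket2_adjoint_comp V.βh V.α
  have hS : (V.op†)† ∘L V.op† = ContinuousLinearMap.id ℂ _ := by
    rw [ContinuousLinearMap.adjoint_adjoint]
    exact V.op_coisometry
  obtain ⟨ψ, hn, h⟩ := exists_omega_push_isometry V.βh.commutant (k := ket2 V.βh V.α)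
    V.β.isClosed V.α.isClosed (fun i j ξ hξ => by rw [hk]; exact V.βhβ.mem _ hξ)
    (fun i j ξ hξ => by rw [hk]; exact V.βhα.mem _ hξ) (tensL V.βh V.βh V.α)
    (fun z hz i j => by rw [hk]; exact CMod.mem_commutant.1 hz _)
    (fun z hz i => Intertw.tensL_ket2 (b := b.dagger) V.α (CMod.mem_commutant.1 hz) i) hS
    (fun x hx => V.map_β.adjoint_mem V.op_isometry hx)
    (fun x hx => V.map_α.adjoint_mem V.op_isometry hx) θ θ'
  refine ⟨ψ, hn, fun z => (h z).trans ?_⟩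
  rw [ContinuousLinearMap.adjoint_adjoint]
  rfl

/-- Now `V` itself carries `α ◁ α` and `β̂ ▷ β̂` to `[|α⟩₁ α]` and `[|α⟩₁ β̂]`, and `Id ⊗ y` passes
through `|α⟩₁`. -/
theorem exists_comp_deltaHat (θ : SeqInf V.sLα.space) (θ' : SeqInf V.sRβh.space) :
    ∃ ψ : V.OmegaDual, ‖ψ‖ ≤ ‖θ‖ * ‖θ'‖ ∧
      ∀ y : V.β.commutant, ψ.toCLM y = ∑' n, (θ.seq n)† ∘L V.deltaHat y ∘L θ'.seq n := by
  have hk := ket1_adjoint_comp V.α V.β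
  exact exists_omega_push_isometry V.β.commutant (k := ket1 V.α V.β)
    V.α.isClosed V.βh.isClosed (fun i j ξ hξ => by rw [hk]; exact V.βα.mem _ hξ)
    (fun i j ξ hξ => by rw [hk]; exact V.ββh.mem _ hξ) (tensR V.α V.β V.β)
    (fun z hz i j => by rw [hk]; exact CMod.mem_commutant.1 hz _)
    (fun z hz i => (CMod.mem_commutant.1 hz).tensR_ket1 V.α i) V.op_isometry
    (fun x hx => V.map_α.mem hx) (fun x hx => V.map_βh.mem hx) θ θ'

/-- The slice maps on the range of `V`. -/
def rangeSliceData : SliceData V.βh.commutant V.α.space V.β.space V.rangeCommutant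
    V.rRα.space V.rLβ.space where
  k1 := ket1 V.α V.β
  k2 := ket2 V.α V.β
  exch := ket1_comp_eq V.α V.β
  rowBound1 := rowBound_ket1 V.α V.β
  rowBound2 := rowBound_ket2 V.α V.β
  sqSmall1 := sqSmall_ket1 V.α V.β
  sqSmall2 := sqSmall_ket2 V.α V.β
  total_left := V.α.total
  total_right := V.β.total
  slice1_mem := fun _ hT σ η => CMod.mem_commutant.2 ((V.mem_rangeCommutant.1 hT).2.slice1 σ η)
  slice2_mem := fun _ hT ξ τ => CMod.mem_commutant.2 ((V.mem_rangeCommutant.1 hT).1.slice2 ξ τ)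
  mem1 := fun η ξ hξ => mem_cspan ⟨η, ξ, hξ, rfl⟩
  mem2 := fun η ξ hξ => mem_cspan ⟨η, ξ, hξ, rfl⟩

/-- The slice maps on the source of `V`. -/
def sourceSliceData : SliceData V.β.commutant V.βh.space V.α.space V.sourceCommutant
    V.sRβh.space V.sLα.space where
  k1 := ket1 V.βh V.α
  k2 := ket2 V.βh V.α
  exch := ket1_comp_eq (b := b.dagger) V.βh V.α
  rowBound1 := rowBound_ket1 (b := b.dagger) V.βh V.α
  rowBound2 := rowBound_ket2 (b := b.dagger) V.βh V.α
  sqSmall1 := sqSmall_ket1 (b := b.dagger) V.βh V.α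
  sqSmall2 := sqSmall_ket2 (b := b.dagger) V.βh V.α
  total_left := V.βh.total
  total_right := V.α.total
  slice1_mem := fun _ hT σ η => CMod.mem_commutant.2
    (Intertw.slice1 (b := b.dagger) (V.mem_sourceCommutant.1 hT).2 σ η)
  slice2_mem := fun _ hT ξ τ => CMod.mem_commutant.2
    (Intertw.slice2 (b := b.dagger) (V.mem_sourceCommutant.1 hT).1 ξ τ)
  mem1 := fun η ξ hξ => mem_cspan ⟨η, ξ, hξ, rfl⟩
  mem2 := fun η ξ hξ => mem_cspan ⟨η, ξ, hξ, rfl⟩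

/-- The comultiplication `Δ_V`. -/
def deltaData : CoproductData V.βh.commutant V.α.space V.β.space V.rangeCommutant
    V.rRα.space V.rLβ.space V.Cod where
  toSliceData := V.rangeSliceData
  δ := V.delta
  δ_mem := fun _ hz => V.delta_mem hz
  exists_restrict := V.exists_comp_delta
  l1 := ket1 V.α V.rLβ
  l3 := fun τ => V.ascC ∘L ket2 V.rRα V.β τ
  exch3 := fun σ τ => (ascC_ket σ τ).symm
  exists_δδ := fun _ hz => exists_delta_delta (CMod.mem_commutant.1 hz)

/-- The comultiplication `Δ̂_V`. -/
def deltaHatData : CoproductData V.β.commutant V.βh.space V.α.space V.sourceCommutant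
    V.sRβh.space V.sLα.space V.Dom where
  toSliceData := V.sourceSliceData
  δ := V.deltaHat
  δ_mem := fun _ hy => V.deltaHat_mem hy
  exists_restrict := V.exists_comp_deltaHat
  l1 := fun ζ => V.ascB† ∘L ket1 V.βh V.sLα ζ
  l3 := ket2 V.sRβh V.α
  exch3 := ascB_adjoint_ket
  exists_δδ := fun _ hy => exists_deltaHat_deltaHat (CMod.mem_commutant.1 hy)

/-- Both sides are the coefficient of `V` between `ζ ⊗ · ⊗ η` and `σ ⊗ · ⊗ ξ`. Slices along one leg
thus act as test operators for the representation along the other. -/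
theorem slice_eq_sliceHat (σ : V.α.space) (ζ : V.βh.space) (ξ : V.β.space) (η : V.α.space) :
    (σ : K →L[ℂ] H)† ∘L V.sliceHat ξ η ∘L (ζ : K →L[ℂ] H)
      = (ξ : K →L[ℂ] H)† ∘L V.slice σ ζ ∘L (η : K →L[ℂ] H) := by
  simp only [slice, sliceHat, ContinuousLinearMap.comp_assoc]
  rw [← ket1_comp_eq (b := b.dagger) V.βh V.α ζ η,
    comp_reassoc₂ (adjoint_comp_eq (ket1_comp_eq V.α V.β σ ξ))]

/-- The data defining the Fourier algebra. -/
def fourierData : FourierData V.βh.commutant V.α.space V.β.space V.rangeCommutant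
    V.rRα.space V.rLβ.space V.Cod V.Source V.Range V.α.space V.βh.space where
  toCoproductData := V.deltaData
  a := ket2 V.α V.β
  b := ket2 V.βh V.α
  V := V.op
  norm_V := V.norm_op_le
  rowBound_a := rowBound_ket2 V.α V.β
  rowBound_b := rowBound_ket2 (b := b.dagger) V.βh V.α
  sqSmall_b := sqSmall_ket2 (b := b.dagger) V.βh V.α
  p := fun σ => σ
  q := fun ζ => ζ
  total_p := V.α.total
  total_q := V.βh.total
  s := fun σ ζ => ⟨V.slice σ ζ, V.slice_mem σ ζ⟩
  slice_eq := V.slice_eq_sliceHat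
  δ_slice := delta_slice_apply

/-- The data defining the dual Fourier algebra. -/
def dualFourierData : FourierData V.β.commutant V.βh.space V.α.space V.sourceCommutant
    V.sRβh.space V.sLα.space V.Dom V.Source V.Range V.β.space V.α.space where
  toCoproductData := V.deltaHatData
  a := ket1 V.α V.β
  b := ket1 V.βh V.α
  V := V.op
  norm_V := V.norm_op_le
  rowBound_a := rowBound_ket1 V.α V.β
  rowBound_b := rowBound_ket1 (b := b.dagger) V.βh V.α
  sqSmall_b := sqSmall_ket1 (b := b.dagger) V.βh V.α
  p := fun ξ => ξ
  q := fun η => η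
  total_p := V.β.total
  total_q := V.α.total
  s := fun ξ η => ⟨V.sliceHat ξ η, V.sliceHat_mem ξ η⟩
  slice_eq := fun ξ η σ ζ => (V.slice_eq_sliceHat σ ζ ξ η).symm
  δ_slice := deltaHat_sliceHat_apply

end PMU
end CPMU
end
theorem mainTheorem4 {K : Type*} [NormedAddCommGroup K] [InnerProductSpace ℂ K] [CompleteSpace K]
    {H : Type*} [NormedAddCommGroup H] [InnerProductSpace ℂ H] [CompleteSpace H]
    (b : CPMU.CBase K) (V : CPMU.PMU b H) :
    (∃ Φ : CPMU.ProjTensorSq V.OmegaHat →L[ℂ]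
        CPMU.Omega V.rangeCommutant V.rLβ.space V.rRα.space,
      ‖Φ‖ ≤ 1 ∧
      (∀ (ξ ξ' : CPMU.SeqInf V.β.space) (η η' : CPMU.SeqInf V.α.space) (i : ℕ × ℕ ≃ ℕ),
        ∃ (θ : CPMU.SeqInf V.rLβ.space) (θ' : CPMU.SeqInf V.rRα.space),
          (∀ m n, θ.seq (i (m, n)) = CPMU.ket2 V.α V.β (ξ'.el n) ∘L ξ.seq m) ∧
          (∀ m n, θ'.seq (i (m, n)) = CPMU.ket1 V.α V.β (η.el m) ∘L η'.seq n) ∧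
          Φ (CPMU.projTmul (CPMU.omega V.βh.commutant ξ η) (CPMU.omega V.βh.commutant ξ' η'))
            = CPMU.omega V.rangeCommutant θ θ') ∧
      (∃ hΔ : ∀ z ∈ V.βh.commutant, V.delta z ∈ V.rangeCommutant,
        ∃ mul : V.OmegaHat →ₗ[ℂ] V.OmegaHat →ₗ[ℂ] V.OmegaHat,
          CPMU.IsBanachAlgebra V.OmegaHat mul ∧
          (∀ (ω ω' : V.OmegaHat) (z : V.βh.commutant),
            (mul ω ω').toCLM z = (Φ (CPMU.projTmul ω ω')).toCLM ⟨V.delta z, hΔ z z.2⟩) ∧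
          ∃ π : V.OmegaHat →L[ℂ] (H →L[ℂ] H),
            ‖π‖ ≤ 1 ∧
            (∀ ω, π ω ∈ V.legHat) ∧
            (∀ ω ω', π (mul ω ω') = π ω * π ω') ∧
            (∀ (ξ : CPMU.SeqInf V.β.space) (η : CPMU.SeqInf V.α.space),
              HasSum (fun n => V.sliceHat (ξ.el n) (η.el n)) (π (CPMU.omega V.βh.commutant ξ η))) ∧
            Set.range π = V.fourier ∧
            ∃ S : NonUnitalSubalgebra ℂ (H →L[ℂ] H), (S : Set (H →L[ℂ] H)) = V.fourier ∧
              closure V.fourier = (V.legHat : Set (H →L[ℂ] H)))) ∧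
    (∃ Φ : CPMU.ProjTensorSq V.OmegaDual →L[ℂ]
        CPMU.Omega V.sourceCommutant V.sLα.space V.sRβh.space,
      ‖Φ‖ ≤ 1 ∧
      (∀ (η η' : CPMU.SeqInf V.α.space) (ζ ζ' : CPMU.SeqInf V.βh.space) (i : ℕ × ℕ ≃ ℕ),
        ∃ (κ : CPMU.SeqInf V.sLα.space) (κ' : CPMU.SeqInf V.sRβh.space),
          (∀ m n, κ.seq (i (m, n)) = CPMU.ket2 V.βh V.α (η'.el n) ∘L η.seq m) ∧
          (∀ m n, κ'.seq (i (m, n)) = CPMU.ket1 V.βh V.α (ζ.el m) ∘L ζ'.seq n) ∧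
          Φ (CPMU.projTmul (CPMU.omega V.β.commutant η ζ) (CPMU.omega V.β.commutant η' ζ'))
            = CPMU.omega V.sourceCommutant κ κ') ∧
      (∃ hΔ : ∀ y ∈ V.β.commutant, V.deltaHat y ∈ V.sourceCommutant,
        ∃ mul : V.OmegaDual →ₗ[ℂ] V.OmegaDual →ₗ[ℂ] V.OmegaDual,
          CPMU.IsBanachAlgebra V.OmegaDual mul ∧
          (∀ (ω ω' : V.OmegaDual) (y : V.β.commutant),
            (mul ω ω').toCLM y = (Φ (CPMU.projTmul ω ω')).toCLM ⟨V.deltaHat y, hΔ y y.2⟩) ∧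
          ∃ π : V.OmegaDual →L[ℂ] (H →L[ℂ] H),
            ‖π‖ ≤ 1 ∧
            (∀ ω, π ω ∈ V.leg) ∧
            (∀ ω ω', π (mul ω ω') = π ω * π ω') ∧
            (∀ (η : CPMU.SeqInf V.α.space) (ζ : CPMU.SeqInf V.βh.space),
              HasSum (fun n => V.slice (η.el n) (ζ.el n)) (π (CPMU.omega V.β.commutant η ζ))) ∧
            Set.range π = V.dualFourier ∧
            ∃ S : NonUnitalSubalgebra ℂ (H →L[ℂ] H), (S : Set (H →L[ℂ] H)) = V.dualFourier ∧
              closure V.dualFourier = (V.leg : Set (H →L[ℂ] H)))) :=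
  -- Both halves agree with the abstract statement by unfolding: the coefficients of the two data
  -- are `sliceHat` and `slice`, and the kets are those of the range and of the source of `V`.
  ⟨V.fourierData.main, V.dualFourierData.main⟩
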